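/- Let $d\ge 1$, $\Omega=[0,1]^d$ (Lebesgue measure), $p\in\,]1,+\infty[$ and $\Psi(x)=|x|^{p-2}x$. Let $K:\Omega^2\to\mathbb R$ be measurable, nonnegative, symmetric, with $\|K\|_{L^{\infty,2}(\Omega^2)}<+\infty$, where $\|F\|_{L^{\infty,2}(\Omega^2)}=\operatorname{ess\,sup}_{x\in\Omega}\|F(x,\cdot)\|_{L^2(\Omega)}$. For $w\in L^1(\Omega)$ with $(x,y)\mapsto K(x,y)\Psi(w(y)-w(x))\in L^1(\Omega^2)$ (this is the domain of $\Delta_p^K$) let $\Delta_p^{K}w(x)=-\int_\Omega K(x,y)\Psi(w(y)-w(x))\,dy$. For $T>0$, a solution of $$(\mathcal P)\qquad \partial_t u=-\Delta_p^{K}u+f,\qquad u(\cdot,0)=g,$$ is a function $u\in C([0,T];L^1(\Omega))\cap W^{1,1}(]0,T[;L^1(\Omega))$ with $u(\cdot,0)=g$ a.e. such that for a.e. $t\in\,]0,T[$, $u(\cdot,t)$ lies in the domain of $\Delta_p^K$ and the equation holds a.e. in $\Omega$. Assume that $f:\Omega\times[0,T]\to\mathbb R$ is measurable, that $f\in BV([0,T];L^2(\Omega))$,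 i.e. $\|f\|_{BV}:=\|f(\cdot,0)\|_{L^2(\Omega)}+\operatorname{Var}_{[0,T]}(t\mapsto f(\cdot,t)\in L^2(\Omega))<+\infty$, and that one of the following holds: (a) $p<2$, $g\in L^2(\Omega)$, $f\in L^1([0,T];L^2(\Omega))$ (put $q=2$); (b) $p\ge2$, $g\in L^{2(p-1)}(\Omega)$, $f\in L^1([0,T];L^{2(p-1)}(\Omega))$ (put $q=2(p-1)$); (c) $g\in L^\infty(\Omega)$, $f\in L^1([0,T];L^\infty(\Omega))$ (put $q=\infty$). For a partition of $[0,1]$ into $n$ intervals in each coordinate direction let $\Omega_i$, $i\in[n]^d$, be the resulting product cells (products of half-open intervals $]\cdot,\cdot]$), $h_i=|\Omega_i|$, and $\delta_n$ the largest side length. Let $P$ take averages, $(Pw)_i=h_i^{-1}\int_{\Omega_i}w$ and $(PF)_{ij}=(h_ih_j)^{-1}\int_{\Omega_i\times\Omega_j}F$, and let $I$ be the piecewise constant extension of vectors in $\mathbb R^{n^d}$ to $\Omega$ (of matrices to $\Omega^2$). For a partition $0=t_0<\dots<t_N=T$ put $\tau_k=t_k-t_{k-1}$, $\tau=\max_k\tau_k$,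 $\mathbf f^k=\tau_k^{-1}\int_{t_{k-1}}^{t_k}Pf(\cdot,t)\,dt$ and $\bar f_n(\cdot,t)=I\mathbf f^k$ for $t\in\,]t_{k-1},t_k]$. The backward Euler scheme is $\mathbf u^0=Pg$ and $$\frac{\mathbf u^k_i-\mathbf u^{k-1}_i}{\tau_k}=\sum_{j\in[n]^d}h_j(PK)_{ij}\Psi(\mathbf u^k_j-\mathbf u^k_i)+\mathbf f^k_i,\qquad i\in[n]^d,\ 1\le k\le N.$$ Then the following hold. (i) $(\mathcal P)$ has a unique solution $u$; for all meshes and time partitions the sequence $(\mathbf u^k)_k$ is uniquely defined, and $\|I\mathbf u^k\|_{L^2(\Omega)}$ is bounded uniformly in $k$, in $n$ and in the meshes and time partitions. (ii) For $\tau$ sufficiently small (the threshold not depending on the meshes and the time partition), $$\sup_{1\le k\le N,\ t\in]t_{k-1},t_k]}\|I\mathbf u^k-u(\cdot,t)\|_{L^2(\Omega)}\le e^{T/2}\Big(\|IPg-g\|_{L^2(\Omega)}+\|\bar f_n-f\|_{L^1([0,T];L^2(\Omega))}+C\,T^{1/2}\big(\tau^{r}+\|IPK-K\|_*\big)\Big),$$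 where $r=\frac1{3-p}$ in case (a), $r=\frac p{2p-1}$ in case (b), $r=\frac1{3-p}$ in case (c) with $p\le 2$, $r=1$ in case (c) with $p\ge2$, and $\|\cdot\|_*$ is the norm of $L^{\infty,2}(\Omega^2)$ in cases (a), (b) and of $L^2(\Omega^2)$ in case (c). (iii) Let $s\in\,]0,1]$. For $S\subset\mathbb R^m$ let $\mathrm{Lip}(s,L^2(S))$ be the set of $F\in L^2(S)$ with $$|F|_{\mathrm{Lip}}=\sup_{h>0}h^{-s}\sup_{|z|<h}\Big(\int_{x,x+z\in S}|F(x+z)-F(x)|^2dx\Big)^{1/2}<+\infty ,$$ with norm $\|F\|_{L^2(S)}+|F|_{\mathrm{Lip}}$. If $g\in L^\infty(\Omega)\cap \mathrm{Lip}(s,L^2(\Omega))$, $K\in \mathrm{Lip}(s,L^2(\Omega^2))$ and $f\in L^1([0,T];L^\infty(\Omega))\cap \mathrm{Lip}(s,L^2(\Omega\times[0,T]))$, then, for $\tau$ sufficiently small, $$\sup_{1\le k\le N,\ t\in]t_{k-1},t_k]}\|I\mathbf u^k-u(\cdot,t)\|_{L^2(\Omega)}\le C e^{T/2}\Big((1+T^{1/2})\delta_n^{s}+T^{1/2}\tau^{\rho}\Big),$$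 with $\rho=\min(s,\frac1{3-p})$ if $p\le2$ and $\rho=s$ if $p\ge2$. If $f$ does not depend on time, the same holds with $\rho=\frac1{3-p}$ if $p\le2$ and $\rho=1$ if $p\ge2$. The constant $C>0$ in (ii) depends only on $d$, $p$, $g$, $K$ and on an upper bound for $\|f\|_{L^1([0,T];L^q(\Omega))}$ and $\|f\|_{BV}$; in (iii) it depends only on these (with $q=\infty$), on $s$ and on an upper bound for $\|f\|_{\mathrm{Lip}(s,L^2(\Omega\times[0,T]))}$. In particular it depends neither on the meshes, nor on the time partition, nor on $T$, except that when the exponent of $\tau$ in the bound equals $1$ it may also depend on a positive lower bound $T_0\le T$. -/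

import Mathlib

open MeasureTheory Set
open scoped ENNReal NNReal

noncomputable section

namespace NonlocalPLap

/-- Points of `ℝ^d`. -/
abbrev Pt (d : ℕ) : Type := Fin d → ℝ

/-- The domain `Ω = [0,1]^d`. -/
def Om (d : ℕ) : Set (Pt d) := Set.Icc 0 1

/-- Lebesgue measure on `Ω`. -/
def mu (d : ℕ) : Measure (Pt d) := volume.restrict (Om d)

/-! ### Norms -/

/-- The norm of `L^{∞,q}(Ω²)`: the (essential) supremum over `x` of `‖F(x,·)‖_{L^q(Ω)}`. -/
def supLqNorm {d : ℕ} (q : ℝ≥0∞) (F : Pt d → Pt d → ℝ) : ℝ≥0∞ :=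
  essSup (fun x => eLpNorm (F x) q (mu d)) (mu d)

/-- The norm of `L²(Ω²)`. -/
def l2Norm2 {d : ℕ} (F : Pt d → Pt d → ℝ) : ℝ≥0∞ :=
  eLpNorm (fun z : Pt d × Pt d => F z.1 z.2) 2 ((mu d).prod (mu d))

/-- The norm of `L¹([0,T]; L^q(Ω))`. -/
def l1LqNorm {d : ℕ} (q : ℝ≥0∞) (T : ℝ) (f : Pt d → ℝ → ℝ) : ℝ≥0∞ :=
  ∫⁻ t in Set.Icc 0 T, eLpNorm (fun x => f x t) q (mu d)

/-- The total variation on `[0,T]` of `t ↦ f(·,t) ∈ L^q(Ω)`: the supremum over all finite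
nondecreasing sequences of times in `[0,T]` of the sums of the norms of the increments. -/
def variation {d : ℕ} (q : ℝ≥0∞) (T : ℝ) (f : Pt d → ℝ → ℝ) : ℝ≥0∞ :=
  ⨆ (N : ℕ) (t : ℕ → ℝ) (_ : Monotone t) (_ : ∀ i, t i ∈ Set.Icc 0 T),
    ∑ i ∈ Finset.range N, eLpNorm (fun x => f x (t (i + 1)) - f x (t i)) q (mu d)

/-- The norm of `BV([0,T]; L^q(Ω))`. -/
def bvNorm {d : ℕ} (q : ℝ≥0∞) (T : ℝ) (f : Pt d → ℝ → ℝ) : ℝ≥0∞ :=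
  eLpNorm (fun x => f x 0) q (mu d) + variation q T f

/-! ### Lipschitz spaces

`ν` is the Euclidean norm of the ambient space `V` of `S`; it is passed explicitly because the
default norm of a product type in Mathlib is the maximum norm. -/

/-- The first-order `L^q(S)` modulus of smoothness. -/
def modulus {V : Type*} [AddCommGroup V] [MeasureSpace V] (ν : V → ℝ) (q : ℝ≥0∞) (S : Set V)
    (F : V → ℝ) (h : ℝ) : ℝ≥0∞ :=
  ⨆ (z : V) (_ : ν z < h),
    eLpNorm (fun x => F (x + z) - F x) q (volume.restrict {x | x ∈ S ∧ x + z ∈ S})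

/-- The norm of `Lip(s, L^q(S))`. -/
def lipNorm {V : Type*} [AddCommGroup V] [MeasureSpace V] (ν : V → ℝ) (s : ℝ) (q : ℝ≥0∞)
    (S : Set V) (F : V → ℝ) : ℝ≥0∞ :=
  eLpNorm F q (volume.restrict S) +
    ⨆ (h : ℝ) (_ : 0 < h), ENNReal.ofReal (h ^ (-s)) * modulus ν q S F h

/-- The norm of `Lip(s, L²(Ω))`. -/
def lipNormSpace {d : ℕ} (s : ℝ) (g : Pt d → ℝ) : ℝ≥0∞ :=
  lipNorm (fun z : Pt d => √(∑ i, z i ^ 2)) s 2 (Om d) g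

/-- The norm of `Lip(s, L²(Ω²))`. -/
def lipNormKernel {d : ℕ} (s : ℝ) (K : Pt d → Pt d → ℝ) : ℝ≥0∞ :=
  lipNorm (fun z : Pt d × Pt d => √((∑ i, z.1 i ^ 2) + ∑ i, z.2 i ^ 2)) s 2 (Om d ×ˢ Om d)
    (fun z => K z.1 z.2)

/-- The norm of `Lip(s, L²(Ω × [0,T]))`. -/
def lipNormTime {d : ℕ} (s T : ℝ) (f : Pt d → ℝ → ℝ) : ℝ≥0∞ :=
  lipNorm (fun z : Pt d × ℝ => √((∑ i, z.1 i ^ 2) + z.2 ^ 2)) s 2 (Om d ×ˢ Set.Icc 0 T)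
    (fun z => f z.1 z.2)

/-! ### The evolution problem -/

/-- `Ψ(x) = |x|^{p-2} x`. -/
def Psi (p x : ℝ) : ℝ := |x| ^ (p - 2) * x

/-- The nonlocal `p`-Laplacian with kernel `K`. -/
def plap {d : ℕ} (K : Pt d → Pt d → ℝ) (p : ℝ) (w : Pt d → ℝ) (x : Pt d) : ℝ :=
  -∫ y, K x y * Psi p (w y - w x) ∂(mu d)

/-- The domain of the nonlocal `p`-Laplacian (for functions `w ∈ L¹(Ω)`). -/
def InDom {d : ℕ} (K : Pt d → Pt d → ℝ) (p : ℝ) (w : Pt d → ℝ) : Prop :=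
  Integrable (fun z : Pt d × Pt d => K z.1 z.2 * Psi p (w z.2 - w z.1)) ((mu d).prod (mu d))

/-- Solutions `u ∈ C([0,T]; L¹(Ω)) ∩ W^{1,1}(]0,T[; L¹(Ω))` of
`∂ₜ u = - plap K p u + f`, `u(·,0) = g`.  The function `v` is the derivative `∂ₜ u`. -/
structure IsSolution {d : ℕ} (K : Pt d → Pt d → ℝ) (p T : ℝ) (f : Pt d → ℝ → ℝ) (g : Pt d → ℝ)
    (u : ℝ → Lp ℝ 1 (mu d)) : Prop where
  continuousOn : ContinuousOn u (Set.Icc 0 T)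
  initial : u 0 =ᵐ[mu d] g
  evolution : ∃ v : ℝ → Lp ℝ 1 (mu d),
    IntegrableOn v (Set.Ioo 0 T) ∧
    (∀ t ∈ Set.Icc 0 T, u t = u 0 + ∫ r in (0 : ℝ)..t, v r) ∧
    ∀ᵐ t ∂(volume.restrict (Set.Ioo 0 T)),
      InDom K p (u t) ∧ v t =ᵐ[mu d] fun x => -plap K p (u t) x + f x t

/-- Nonnegative, symmetric, measurable kernels in `L^{∞,2}(Ω²)`. -/
structure IsKernel {d : ℕ} (K : Pt d → Pt d → ℝ) : Prop where
  measurable : Measurable (fun z : Pt d × Pt d => K z.1 z.2)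
  nonneg : ∀ x ∈ Om d, ∀ y ∈ Om d, 0 ≤ K x y
  symm : ∀ x ∈ Om d, ∀ y ∈ Om d, K x y = K y x
  bounded : supLqNorm 2 K < ⊤

/-- Source terms in `L¹([0,T]; L^q(Ω)) ∩ BV([0,T]; L²(Ω))`. -/
structure IsSource {d : ℕ} (q : ℝ≥0∞) (T : ℝ) (f : Pt d → ℝ → ℝ) : Prop where
  measurable : Measurable (fun z : Pt d × ℝ => f z.1 z.2)
  l1Lq : l1LqNorm q T f < ⊤
  bv : bvNorm 2 T f < ⊤

/-- The three alternative integrability assumptions on the data. -/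
inductive DataCase
  | a
  | b
  | c

/-- The range of `p` in each case: `p < 2`, resp. `p ≥ 2`, resp. no restriction. -/
def DataCase.Admissible : DataCase → ℝ → Prop
  | .a, p => p < 2
  | .b, p => 2 ≤ p
  | .c, _ => True

/-- The integrability exponent `q` of the data: `g ∈ L^q(Ω)` and `f ∈ L¹([0,T]; L^q(Ω))`. -/
def DataCase.exponent : DataCase → ℝ → ℝ≥0∞
  | .a, _ => 2
  | .b, p => ENNReal.ofReal (2 * (p - 1))
  | .c, _ => ⊤

/-- The exponent of the time step in the error bound. -/
def DataCase.rate : DataCase → ℝ → ℝ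
  | .a, p => 1 / (3 - p)
  | .b, p => p / (2 * p - 1)
  | .c, p => if p ≤ 2 then 1 / (3 - p) else 1

/-- The norm in which the error on the kernel is measured. -/
def DataCase.kernelNorm {d : ℕ} : DataCase → (Pt d → Pt d → ℝ) → ℝ≥0∞
  | .a, F => supLqNorm 2 F
  | .b, F => supLqNorm 2 F
  | .c, F => l2Norm2 F

/-! ### Meshes, projector and injector -/

/-- A partition `a = pt 0 < pt 1 < ⋯ < pt n = b` (so that `n ≥ 1` when `a < b`). -/
structure Partition (a b : ℝ) (n : ℕ) where
  pt : Fin (n + 1) → ℝ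
  strictMono : StrictMono pt
  first : pt 0 = a
  last : pt (Fin.last n) = b

/-- The length of the `k`-th interval `]pt k, pt (k+1)]`. -/
def Partition.step {a b : ℝ} {n : ℕ} (P : Partition a b n) (k : Fin n) : ℝ :=
  P.pt k.succ - P.pt k.castSucc

/-- The `k`-th interval `]pt k, pt (k+1)]`. -/
def Partition.interval {a b : ℝ} {n : ℕ} (P : Partition a b n) (k : Fin n) : Set ℝ :=
  Set.Ioc (P.pt k.castSucc) (P.pt k.succ)

/-- The maximal length of the intervals. -/
def Partition.size {a b : ℝ} {n : ℕ} (P : Partition a b n) : ℝ := ⨆ k : Fin n, P.step k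

/-- A tensor product mesh of `Ω` with `n` intervals in each direction. -/
abbrev Mesh (d n : ℕ) : Type := Fin d → Partition 0 1 n

/-- The multi-indices `[n]^d`. -/
abbrev Idx (d n : ℕ) : Type := Fin d → Fin n

variable {d n : ℕ}

/-- The cell `Ω_i`. -/
def Mesh.cell (m : Mesh d n) (i : Idx d n) : Set (Pt d) :=
  Set.univ.pi fun k => (m k).interval (i k)

/-- The measure `h_i` of the cell `Ω_i`. -/
def Mesh.vol (m : Mesh d n) (i : Idx d n) : ℝ := volume.real (Mesh.cell m i)

/-- The maximal mesh size `δ`. -/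
def Mesh.size (m : Mesh d n) : ℝ := ⨆ k : Fin d, (m k).size

/-- The projector `P` on functions on `Ω`: averages over the cells. -/
def Mesh.proj (m : Mesh d n) (w : Pt d → ℝ) (i : Idx d n) : ℝ :=
  (Mesh.vol m i)⁻¹ * ∫ x in Mesh.cell m i, w x

/-- The projector `P` on functions on `Ω²`. -/
def Mesh.proj2 (m : Mesh d n) (F : Pt d → Pt d → ℝ) (i j : Idx d n) : ℝ :=
  (Mesh.vol m i * Mesh.vol m j)⁻¹ * ∫ z in Mesh.cell m i ×ˢ Mesh.cell m j, F z.1 z.2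

/-- The piecewise constant injector `I`. -/
def Mesh.inj (m : Mesh d n) (v : Idx d n → ℝ) (x : Pt d) : ℝ :=
  ∑ i, (Mesh.cell m i).indicator (fun _ => v i) x

/-- The piecewise constant injector `I` for kernels. -/
def Mesh.inj2 (m : Mesh d n) (A : Idx d n → Idx d n → ℝ) (x y : Pt d) : ℝ :=
  ∑ i, ∑ j, (Mesh.cell m i).indicator 1 x * (Mesh.cell m j).indicator 1 y * A i j

/-! ### The fully discrete problem -/

/-- The discrete `p`-Laplacian with kernel `A`. -/
def Mesh.discretePlap (m : Mesh d n) (A : Idx d n → Idx d n → ℝ) (p : ℝ) (v : Idx d n → ℝ)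
    (i : Idx d n) : ℝ :=
  -∑ j, Mesh.vol m j * A i j * Psi p (v j - v i)

/-- The discrete source term: the average over the `k`-th time interval of `P f(·,t)`. -/
def discreteSource {T : ℝ} {N : ℕ} (m : Mesh d n) (θ : Partition 0 T N) (f : Pt d → ℝ → ℝ)
    (k : Fin N) (i : Idx d n) : ℝ :=
  (θ.step k)⁻¹ * ∫ t in θ.interval k, Mesh.proj m (fun x => f x t) i

/-- The space-time piecewise constant extension of the discrete source term. -/
def sourceExt {T : ℝ} {N : ℕ} (m : Mesh d n) (θ : Partition 0 T N) (f : Pt d → ℝ → ℝ)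
    (x : Pt d) (t : ℝ) : ℝ :=
  ∑ k, (θ.interval k).indicator (fun _ => Mesh.inj m (discreteSource m θ f k) x) t

/-- `U 0, …, U N` is generated by the backward Euler scheme
`(U k - U (k-1)) / τ_k = - discretePlap (P K) (U k) + f_k`, `U 0 = P g`. -/
def IsBackwardEuler {T : ℝ} {N : ℕ} (m : Mesh d n) (θ : Partition 0 T N) (K : Pt d → Pt d → ℝ)
    (p : ℝ) (f : Pt d → ℝ → ℝ) (g : Pt d → ℝ) (U : Fin (N + 1) → Idx d n → ℝ) : Prop :=
  U 0 = Mesh.proj m g ∧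
  ∀ (k : Fin N) (i : Idx d n),
    (U k.succ i - U k.castSucc i) / θ.step k =
      -Mesh.discretePlap m (Mesh.proj2 m K) p (U k.succ) i + discreteSource m θ f k i

/-- The bound `sup_{k, t ∈ ]t_{k-1}, t_k]} ‖I U^k - u(·,t)‖_{L²(Ω)} ≤ R`. -/
def ErrorLE {T : ℝ} {N : ℕ} (m : Mesh d n) (θ : Partition 0 T N) (U : Fin (N + 1) → Idx d n → ℝ)
    (u : ℝ → Lp ℝ 1 (mu d)) (R : ℝ≥0∞) : Prop :=
  ∀ (k : Fin N), ∀ t ∈ θ.interval k,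
    eLpNorm (fun x => Mesh.inj m (U k.succ) x - u t x) 2 (mu d) ≤ R

/-- The right-hand side of the general error bound. -/
def generalBound (α : DataCase) (p C : ℝ) {T : ℝ} {N : ℕ} (m : Mesh d n) (θ : Partition 0 T N)
    (K : Pt d → Pt d → ℝ) (f : Pt d → ℝ → ℝ) (g : Pt d → ℝ) : ℝ≥0∞ :=
  ENNReal.ofReal (Real.exp (T / 2)) *
    (eLpNorm (fun x => Mesh.inj m (Mesh.proj m g) x - g x) 2 (mu d) +
      l1LqNorm 2 T (fun x t => sourceExt m θ f x t - f x t) +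
      ENNReal.ofReal (C * √T) *
        (ENNReal.ofReal (θ.size ^ α.rate p) +
          α.kernelNorm (fun x y => Mesh.inj2 m (Mesh.proj2 m K) x y - K x y)))

/-- The right-hand side of the error bound under Lipschitz regularity, `r` being the exponent of
the time step. -/
def lipBound (s r C : ℝ) {T : ℝ} {N : ℕ} (m : Mesh d n) (θ : Partition 0 T N) : ℝ≥0∞ :=
  ENNReal.ofReal (C * Real.exp (T / 2) *
    ((1 + √T) * Mesh.size m ^ s + √T * θ.size ^ r))

/-- The exponent of the time step under Lipschitz regularity of order `s`. -/
def lipRate (s p : ℝ) : ℝ := if p ≤ 2 then min s (1 / (3 - p)) else s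

end NonlocalPLap

end

noncomputable section

namespace NonlocalPLap

set_option linter.unusedSectionVars false

/-! ### Absolutely continuous curves -/

section Curves

open Filter Topology

variable {E : Type*} [NormedAddCommGroup E] [NormedSpace ℝ E] {a b : ℝ}

/-! The integrand K(x,y) Ψ(w(y) − w(x)) is antisymmetric, so testing the operator with η gives −½ ∬
K Ψ(w(y) − w(x)) (η(y) − η(x)). Since Ψ is odd and nondecreasing, suitable test functions give this
a sign. The sign of the difference of two solutions yields contraction in L¹, hence uniqueness
(`eq_of_isPrimitive_L1`). The difference itself yields dissipativity in L². An indicator {u > c} and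
|u|^{q−2}u yield bounds in L^∞ and L^q (`ae_le_of_isPrimitive`, `eLpNorm_le_of_isPrimitive`). In all
three cases q ≥ max(2, 2(p−1)), so Ψ(u(y) − u(x)) lies in L²(Ω²), and integration against K ∈
L^{∞,2} leads back to L²(Ω).

Existence (`exists_solution`): Ψ is replaced by bounded Lipschitz odd monotone functions and the
data are truncated, so that Picard–Lindelöf applies. The L^∞ bound keeps the solution where the
replacement is accurate, so the approximations solve the original equation up to a small residual.
Dissipativity makes them Cauchy in L², uniformly in time; the equation passes to the limit in L¹.

The scheme, read on step functions, is exactly implicit Euler in L²(Ω) for the operator with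
averaged kernel, which belongs to the same class with the same bound
(`CellPartition.symmKernel_avgKernel`). One step is solvable because it is the Euler–Lagrange
equation of a strictly convex energy.

Error in time: for c between a' and a, monotonicity alone gives (Φ(a) − Φ(b))(c − b) ≥ −(Φ(a) −
Φ(a'))(a − a') (`neg_le_sub_mul_sub_of_mem_uIcc`). Applied to the linear interpolant of the scheme,
it bounds the defect of each step by the dissipation between consecutive iterates. These
dissipations sum to a quantity controlled by ‖A w₀ + F₀‖ and the variation of the source
(`sum_inner_increment_le`), so the time error is O(τ) for every p (`norm_implicit_euler_sub_le`).
The stated rates r ≤ 1 are weaker: τ ≤ C √T τ^r for small τ (`exists_le_sqrt_mul_rpow`). A constant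
independent of T is obtained for r < 1; for r = 1 a lower bound on T enters.

The remaining errors are the averaging errors of g, f and K. Under L² Lipschitz regularity they are
O(δ^s), and O(δ^s + τ^s) for f. Two points of a cell are compared through a third one ranging over a
window of the size of the mesh (`CellPartition.sq_eLpNorm_sub_le_of_window`), so no regularity of
the mesh is required. -/

lemma absolutelyContinuousOnInterval_of_dist_le {r H : ℝ → ℝ} {C : ℝ}
    (hH : AbsolutelyContinuousOnInterval H a b)
    (h : ∀ s ∈ uIcc a b, ∀ t ∈ uIcc a b, |r s - r t| ≤ C * |H s - H t|) :
    AbsolutelyContinuousOnInterval r a b := by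
  unfold AbsolutelyContinuousOnInterval at hH ⊢
  have h0 := hH.const_mul C
  rw [mul_zero] at h0
  refine squeeze_zero' ?_ ?_ h0
  · exact Eventually.of_forall fun _ => Finset.sum_nonneg fun _ _ => dist_nonneg
  · filter_upwards [(eventually_inf_principal.mpr (by simp) :
      ∀ᶠ I in AbsolutelyContinuousOnInterval.totalLengthFilter ⊓
        𝓟 (AbsolutelyContinuousOnInterval.disjWithin a b),
        I ∈ AbsolutelyContinuousOnInterval.disjWithin a b)] with I hI
    rw [Finset.mul_sum]
    refine Finset.sum_le_sum fun i hi => ?_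
    have := hI.1 i hi
    simpa [Real.dist_eq] using h _ this.1 _ this.2

/-- An absolutely continuous function is differentiable almost everywhere and is the integral of its
derivative. Asking for a bound on whatever derivative happens to exist spares a chain rule for
nonsmooth functionals. -/
lemma le_add_integral_of_deriv_le {r φ : ℝ → ℝ} (hab : a ≤ b)
    (hr : AbsolutelyContinuousOnInterval r a b) (hφ : IntervalIntegrable φ volume a b)
    (h : ∀ᵐ t ∂volume.restrict (Ioo a b), ∀ r', HasDerivAt r r' t → r' ≤ φ t) :
    r b ≤ r a + ∫ t in a..b, φ t := by
  have h1 := hr.integral_deriv_eq_sub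
  have h2 : ∫ t in a..b, deriv r t ≤ ∫ t in a..b, φ t := by
    rw [intervalIntegral.integral_of_le hab, intervalIntegral.integral_of_le hab,
      integral_Ioc_eq_integral_Ioo, integral_Ioc_eq_integral_Ioo]
    refine integral_mono_ae ?_ ?_ ?_
    · exact ((intervalIntegrable_iff_integrableOn_Ioo_of_le hab).1 hr.intervalIntegrable_deriv)
    · exact ((intervalIntegrable_iff_integrableOn_Ioo_of_le hab).1 hφ)
    · filter_upwards [h, ae_restrict_of_ae hr.ae_differentiableAt,
        ae_restrict_mem measurableSet_Ioo] with t ht hd hm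
      exact ht _ (hd (by rw [uIcc_of_le hab]; exact Ioo_subset_Icc_self hm)).hasDerivAt
  linarith

/-- `e` is an absolutely continuous curve on `[a,b]` with derivative `w`. -/
structure IsPrimitive (e w : ℝ → E) (a b : ℝ) : Prop where
  integrable : IntervalIntegrable w volume a b
  eq : ∀ t ∈ Icc a b, e t = e a + ∫ s in a..t, w s

namespace IsPrimitive

variable {e w e' w' : ℝ → E}

lemma sub_eq (h : IsPrimitive e w a b) {s t : ℝ} (hs : s ∈ Icc a b) (ht : t ∈ Icc a b) :
    e t - e s = ∫ r in s..t, w r := by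
  have hab : a ≤ b := hs.1.trans hs.2
  rw [h.eq t ht, h.eq s hs, add_sub_add_left_eq_sub, intervalIntegral.integral_interval_sub_left]
  · exact h.integrable.mono_set (by
      rw [uIcc_of_le ht.1, uIcc_of_le hab]; exact Icc_subset_Icc le_rfl ht.2)
  · exact h.integrable.mono_set (by
      rw [uIcc_of_le hs.1, uIcc_of_le hab]; exact Icc_subset_Icc le_rfl hs.2)

lemma mono (h : IsPrimitive e w a b) {c d : ℝ} (hac : a ≤ c) (hcd : c ≤ d) (hdb : d ≤ b) :
    IsPrimitive e w c d := by
  refine ⟨h.integrable.mono_set ?_, fun t ht => ?_⟩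
  · rw [uIcc_of_le hcd, uIcc_of_le (hac.trans (hcd.trans hdb))]; exact Icc_subset_Icc hac hdb
  · rw [← h.sub_eq ⟨hac, hcd.trans hdb⟩ ⟨hac.trans ht.1, ht.2.trans hdb⟩]; abel

lemma norm_sub_le (h : IsPrimitive e w a b) {s t : ℝ} (hs : s ∈ Icc a b) (ht : t ∈ Icc a b) :
    ‖e s - e t‖ ≤ |(∫ r in a..s, ‖w r‖) - ∫ r in a..t, ‖w r‖| := by
  have hab : a ≤ b := hs.1.trans hs.2
  have hw := h.integrable.norm
  rw [h.sub_eq ht hs, intervalIntegral.integral_interval_sub_left]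
  · exact intervalIntegral.norm_integral_le_abs_integral_norm
  · exact hw.mono_set (by
      rw [uIcc_of_le hs.1, uIcc_of_le hab]; exact Icc_subset_Icc le_rfl hs.2)
  · exact hw.mono_set (by
      rw [uIcc_of_le ht.1, uIcc_of_le hab]; exact Icc_subset_Icc le_rfl ht.2)

/-- The increments of `e` are dominated by those of the primitive of ‖w‖, which is absolutely
continuous; a functional that is Lipschitz along the curve inherits this. -/
lemma absolutelyContinuous_of_le (h : IsPrimitive e w a b) (hab : a ≤ b) {r : ℝ → ℝ} {C : ℝ}
    (hr : ∀ s ∈ Icc a b, ∀ t ∈ Icc a b, |r s - r t| ≤ C * ‖e s - e t‖) (hC : 0 ≤ C) :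
    AbsolutelyContinuousOnInterval r a b := by
  refine absolutelyContinuousOnInterval_of_dist_le (C := C)
    (h.integrable.norm.absolutelyContinuousOnInterval_intervalIntegral (c := a) left_mem_uIcc) ?_
  rw [uIcc_of_le hab]
  intro s hs t ht
  exact (hr s hs t ht).trans (mul_le_mul_of_nonneg_left (h.norm_sub_le hs ht) hC)

lemma continuousOn (h : IsPrimitive e w a b) : ContinuousOn e (Icc a b) := by
  rcases le_or_gt a b with hab | hab
  · have h1 : ContinuousOn (fun t => e a + ∫ s in a..t, w s) (Icc a b) := by
      have := intervalIntegral.continuousOn_primitive_interval' h.integrable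
        (left_mem_uIcc (a := a) (b := b))
      rw [uIcc_of_le hab] at this
      exact continuousOn_const.add this
    exact h1.congr h.eq
  · simp [Icc_eq_empty (not_le.2 hab)]

lemma ae_hasDerivAt [CompleteSpace E] (h : IsPrimitive e w a b) :
    ∀ᵐ t ∂volume.restrict (Ioo a b), HasDerivAt e (w t) t := by
  filter_upwards [ae_restrict_of_ae h.integrable.ae_hasDerivAt_integral,
    ae_restrict_mem measurableSet_Ioo] with t ht hm
  have hab : a ≤ b := (hm.1.trans hm.2).le
  have h1 := (ht (by rw [uIcc_of_le hab]; exact Ioo_subset_Icc_self hm) a left_mem_uIcc).const_add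
    (e a)
  refine h1.congr_of_eventuallyEq ?_
  filter_upwards [Ioo_mem_nhds hm.1 hm.2] with s hs using h.eq s (Ioo_subset_Icc_self hs)

lemma add (h : IsPrimitive e w a b) (h' : IsPrimitive e' w' a b) :
    IsPrimitive (fun t => e t + e' t) (fun t => w t + w' t) a b := by
  refine ⟨h.integrable.add h'.integrable, fun t ht => ?_⟩
  have hs : uIcc a t ⊆ uIcc a b := by
    rw [uIcc_of_le ht.1, uIcc_of_le (ht.1.trans ht.2)]; exact Icc_subset_Icc le_rfl ht.2
  rw [h.eq t ht, h'.eq t ht, intervalIntegral.integral_add (h.integrable.mono_set hs)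
    (h'.integrable.mono_set hs)]
  abel

lemma map {F : Type*} [NormedAddCommGroup F] [NormedSpace ℝ F] [CompleteSpace E] [CompleteSpace F]
    (h : IsPrimitive e w a b) (L : E →L[ℝ] F) :
    IsPrimitive (fun t => L (e t)) (fun t => L (w t)) a b := by
  refine ⟨⟨L.integrable_comp h.integrable.1, L.integrable_comp h.integrable.2⟩, fun t ht => ?_⟩
  have hs : uIcc a t ⊆ uIcc a b := by
    rw [uIcc_of_le ht.1, uIcc_of_le (ht.1.trans ht.2)]; exact Icc_subset_Icc le_rfl ht.2
  rw [h.eq t ht, map_add, L.intervalIntegral_comp_comm (h.integrable.mono_set hs)]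

lemma neg (h : IsPrimitive e w a b) : IsPrimitive (fun t => -e t) (fun t => -w t) a b := by
  refine ⟨h.integrable.neg, fun t ht => ?_⟩
  rw [h.eq t ht, intervalIntegral.integral_neg]; abel

lemma sub (h : IsPrimitive e w a b) (h' : IsPrimitive e' w' a b) :
    IsPrimitive (fun t => e t - e' t) (fun t => w t - w' t) a b := by
  simpa [sub_eq_add_neg] using h.add h'.neg

lemma congr_deriv (h : IsPrimitive e w a b) (hab : a ≤ b)
    (hw : ∀ᵐ t ∂volume.restrict (Ioo a b), w t = w' t) : IsPrimitive e w' a b := by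
  have hw2 : ∀ᵐ t ∂volume.restrict (Ioc a b), w t = w' t := by
    rwa [← Measure.restrict_congr_set Ioo_ae_eq_Ioc]
  have hint : IntervalIntegrable w' volume a b := by
    rw [intervalIntegrable_iff_integrableOn_Ioc_of_le hab] at *
    exact (((intervalIntegrable_iff_integrableOn_Ioc_of_le hab).1 h.integrable).congr hw2)
  refine ⟨hint, fun t ht => ?_⟩
  rw [h.eq t ht]
  congr 1
  refine intervalIntegral.integral_congr_ae ?_
  rw [ae_restrict_iff' measurableSet_Ioc] at hw2
  filter_upwards [hw2] with s hs hs2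
  rw [uIoc_of_le ht.1] at hs2
  exact hs ⟨hs2.1, hs2.2.trans ht.2⟩

/-- The function s ↦ ℓ(e t − e s) − (r t − r s) is nonnegative near t and vanishes at t, so its
derivative is zero there. This replaces the chain rule for convex functionals that need not be
differentiable. -/
lemma deriv_le_of_subgradient {e : ℝ → E} {w : E} {r : ℝ → ℝ} {r' t : ℝ} {ℓ : E →L[ℝ] ℝ}
    (hd : HasDerivAt e w t) (hm : t ∈ Ioo a b)
    (hsub : ∀ s ∈ Icc a b, r t - r s ≤ ℓ (e t - e s)) (hr' : HasDerivAt r r' t) : r' ≤ ℓ w := by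
  have hl : HasDerivAt (fun s => ℓ (e t - e s)) (-ℓ w) t := by
    have := ℓ.hasFDerivAt.comp_hasDerivAt t (hd.const_sub (e t))
    simpa [Function.comp_def] using this
  have hmin : IsLocalMin (fun s => ℓ (e t - e s) - (r t - r s)) t := by
    filter_upwards [Ioo_mem_nhds hm.1 hm.2] with s hs
    simpa using hsub s (Ioo_subset_Icc_self hs)
  have := hmin.hasDerivAt_eq_zero (hl.sub (hr'.const_sub (r t)))
  linarith

/-- A functional with subgradients along the curve grows at most as the subgradients tell. -/
lemma le_add_integral_of_subgradient [CompleteSpace E] (h : IsPrimitive e w a b) (hab : a ≤ b)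
    {r φ : ℝ → ℝ} {C : ℝ} (hC : 0 ≤ C)
    (hr : ∀ s ∈ Icc a b, ∀ t ∈ Icc a b, |r s - r t| ≤ C * ‖e s - e t‖)
    (hφ : IntervalIntegrable φ volume a b)
    (hsub : ∀ᵐ t ∂volume.restrict (Ioo a b), ∃ ℓ : E →L[ℝ] ℝ,
      (∀ s ∈ Icc a b, r t - r s ≤ ℓ (e t - e s)) ∧ ℓ (w t) ≤ φ t) :
    r b ≤ r a + ∫ t in a..b, φ t := by
  refine le_add_integral_of_deriv_le hab (h.absolutelyContinuous_of_le hab hr hC) hφ ?_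
  filter_upwards [hsub, h.ae_hasDerivAt, ae_restrict_mem measurableSet_Ioo] with t ht hd hm r' hr'
  obtain ⟨ℓ, h1, h2⟩ := ht
  exact (deriv_le_of_subgradient hd hm h1 hr').trans h2

/-- A quadratic Gronwall estimate with sharp constants. -/
lemma norm_le_sqrt_add_integral {H : Type*} [NormedAddCommGroup H] [InnerProductSpace ℝ H]
    [CompleteSpace H] {e w : ℝ → H} (h : IsPrimitive e w a b) (hab : a ≤ b) {ψ : ℝ → ℝ} {β : ℝ}
    (hβ : 0 ≤ β) (hψ : IntervalIntegrable ψ volume a b)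
    (hin : ∀ᵐ t ∂volume.restrict (Ioo a b), 0 ≤ ψ t ∧ inner ℝ (e t) (w t) ≤ ψ t * ‖e t‖ + β) :
    ‖e b‖ ≤ √(‖e a‖ ^ 2 + 2 * β * (b - a)) + ∫ t in a..b, ψ t := by
  have key : ∀ ε > 0, ‖e b‖ ≤ √(‖e a‖ ^ 2 + 2 * β * (b - a) + ε) + ∫ t in a..b, ψ t := by
    intro ε hε
    -- The reserve 2β(b − t) is consumed at the rate 2β and thus cancels the β in the hypothesis,
    -- leaving S' ≤ 2ψ‖e‖ ≤ 2ψ√S and (√S)' ≤ ψ. The shift ε keeps S away from 0, where the square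
    -- root is not Lipschitz.
    set S : ℝ → ℝ := fun t => ‖e t‖ ^ 2 + 2 * β * (b - t) + ε with hS
    have hSε : ∀ t ∈ Icc a b, ε ≤ S t := fun t ht => by
      have : 0 ≤ 2 * β * (b - t) := mul_nonneg (by positivity) (by linarith [ht.2])
      simp only [hS]; nlinarith [sq_nonneg ‖e t‖]
    obtain ⟨M, hM⟩ : ∃ M, ∀ t ∈ Icc a b, ‖e t‖ ≤ M :=
      isCompact_Icc.exists_bound_of_continuousOn h.continuousOn
    have hM0 : 0 ≤ M := (norm_nonneg _).trans (hM a ⟨le_rfl, hab⟩)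
    have hAC : AbsolutelyContinuousOnInterval (fun t => √(S t)) a b := by
      have h1 : IsPrimitive (fun t => (t : ℝ)) (fun _ => (1 : ℝ)) a b :=
        ⟨intervalIntegrable_const, fun t _ => by simp⟩
      have hA : AbsolutelyContinuousOnInterval S a b := by
        have h2 : AbsolutelyContinuousOnInterval (fun t => ‖e t‖ ^ 2) a b := by
          refine h.absolutelyContinuous_of_le hab (C := 2 * M) (fun s hs t ht => ?_) (by positivity)
          rw [show ‖e s‖ ^ 2 - ‖e t‖ ^ 2 = (‖e s‖ + ‖e t‖) * (‖e s‖ - ‖e t‖) by ring, abs_mul,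
            abs_of_nonneg (by positivity)]
          exact mul_le_mul (by linarith [hM s hs, hM t ht]) (abs_norm_sub_norm_le _ _)
            (abs_nonneg _) (by positivity)
        have h3 : AbsolutelyContinuousOnInterval (fun t => 2 * β * (b - t) + ε) a b := by
          refine h1.absolutelyContinuous_of_le hab (C := 2 * β) (fun s hs t ht => ?_)
            (by positivity)
          rw [show 2 * β * (b - s) + ε - (2 * β * (b - t) + ε) = -(2 * β * (s - t)) by ring,
            abs_neg, abs_mul, abs_of_nonneg (by positivity : 0 ≤ 2 * β), Real.norm_eq_abs]
        have := h2.add h3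
        refine absolutelyContinuousOnInterval_of_dist_le (C := 1) this fun s _ t _ => ?_
        simp only [hS, Pi.add_apply, one_mul]
        apply le_of_eq; ring_nf
      refine absolutelyContinuousOnInterval_of_dist_le (C := 1 / √ε) hA ?_
      rw [uIcc_of_le hab]
      intro s hs t ht
      have hs' := hSε s hs
      have ht' := hSε t ht
      have e1 : S s - S t = (√(S s) + √(S t)) * (√(S s) - √(S t)) := by
        have := Real.sq_sqrt (hε.le.trans hs'); have := Real.sq_sqrt (hε.le.trans ht')
        nlinarith
      have hpos : 0 < √ε := Real.sqrt_pos.2 hε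
      rw [e1, abs_mul, abs_of_nonneg (by positivity : 0 ≤ √(S s) + √(S t)), one_div,
        inv_mul_eq_div, le_div_iff₀ hpos, mul_comm]
      refine mul_le_mul_of_nonneg_right ?_ (abs_nonneg _)
      have := Real.sqrt_le_sqrt hs'
      have := Real.sqrt_nonneg (S t)
      linarith
    have := le_add_integral_of_deriv_le (φ := ψ) hab hAC hψ (by
      filter_upwards [hin, h.ae_hasDerivAt, ae_restrict_mem measurableSet_Ioo] with
        t ht hd hm r' hr'
      have hSpos : 0 < S t := hε.trans_le (hSε t (Ioo_subset_Icc_self hm))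
      have hdS : HasDerivAt S (2 * inner ℝ (e t) (w t) + 2 * β * (-1)) t := by
        have h1 := hd.norm_sq
        have h2 : HasDerivAt (fun t : ℝ => 2 * β * (b - t)) (2 * β * (-1)) t :=
          ((hasDerivAt_id t).const_sub b).const_mul (2 * β)
        exact (h1.add h2).add_const ε
      have hds := hdS.sqrt hSpos.ne'
      rw [hr'.unique hds, div_le_iff₀ (by positivity)]
      have hle : ‖e t‖ ≤ √(S t) := by
        apply Real.le_sqrt_of_sq_le
        have : 0 ≤ 2 * β * (b - t) := mul_nonneg (by positivity) (by linarith [hm.2])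
        simp only [hS]; linarith
      have := mul_le_mul_of_nonneg_left hle ht.1
      linarith [ht.2])
    have e2 : ‖e b‖ ≤ √(S b) := by
      apply Real.le_sqrt_of_sq_le; simp only [hS]; linarith
    exact e2.trans this
  have hlim : Tendsto (fun ε : ℝ => √(‖e a‖ ^ 2 + 2 * β * (b - a) + ε) + ∫ t in a..b, ψ t)
      (𝓝[>] 0) (𝓝 (√(‖e a‖ ^ 2 + 2 * β * (b - a) + 0) + ∫ t in a..b, ψ t)) := by
    apply tendsto_nhdsWithin_of_tendsto_nhds
    apply Continuous.tendsto
    fun_prop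
  rw [add_zero] at hlim
  refine ge_of_tendsto hlim ?_
  filter_upwards [self_mem_nhdsWithin] with ε hε using key ε hε

end IsPrimitive

end Curves

/-! ### Nonlocal integral operators -/

section Operators

variable {Ω : Type*} [MeasurableSpace Ω] {μ : Measure Ω}

lemma sq_eLpNorm_two (f : Ω → ℝ) : eLpNorm f 2 μ ^ 2 = ∫⁻ x, ‖f x‖ₑ ^ 2 ∂μ := by
  rw [eLpNorm_eq_lintegral_rpow_enorm_toReal (by norm_num) (by norm_num)]
  rw [← ENNReal.rpow_natCast, ← ENNReal.rpow_mul]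
  norm_num

lemma lintegral_enorm_mul_le {f g : Ω → ℝ} (hf : AEStronglyMeasurable f μ)
    (hg : AEStronglyMeasurable g μ) :
    ∫⁻ x, ‖f x * g x‖ₑ ∂μ ≤ eLpNorm f 2 μ * eLpNorm g 2 μ := by
  have := eLpNorm_smul_le_mul_eLpNorm (p := 2) (q := 2) (r := 1) hg hf
  rwa [eLpNorm_one_eq_lintegral_enorm] at this

lemma sq_eLpNorm_two_prod [SFinite μ] {G : Ω × Ω → ℝ} (hG : AEStronglyMeasurable G (μ.prod μ)) :
    eLpNorm G 2 (μ.prod μ) ^ 2 = ∫⁻ x, eLpNorm (fun y => G (x, y)) 2 μ ^ 2 ∂μ := by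
  rw [sq_eLpNorm_two, lintegral_prod _ (hG.enorm.pow_const 2)]
  simp_rw [sq_eLpNorm_two]

lemma ae_aestronglyMeasurable_section [SFinite μ] {G : Ω × Ω → ℝ}
    (hG : AEStronglyMeasurable G (μ.prod μ)) :
    ∀ᵐ x ∂μ, AEStronglyMeasurable (fun y => G (x, y)) μ := hG.prodMk_left

lemma pow_two_le_imp {a b : ℝ≥0∞} (h : a ^ 2 ≤ b ^ 2) : a ≤ b :=
  (ENNReal.pow_le_pow_left_iff (by norm_num)).1 h

lemma lintegral_prod_mul_le [SFinite μ] {F G : Ω × Ω → ℝ} {κ : ℝ≥0∞}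
    (hF : AEStronglyMeasurable F (μ.prod μ)) (hG : AEStronglyMeasurable G (μ.prod μ))
    (hκ : ∀ᵐ x ∂μ, eLpNorm (fun y => F (x, y)) 2 μ ≤ κ) :
    ∀ᵐ x ∂μ, ∫⁻ y, ‖F (x, y) * G (x, y)‖ₑ ∂μ ≤ κ * eLpNorm (fun y => G (x, y)) 2 μ := by
  filter_upwards [hκ, ae_aestronglyMeasurable_section hF, ae_aestronglyMeasurable_section hG]
    with x h1 h2 h3
  exact (lintegral_enorm_mul_le h2 h3).trans (mul_le_mul_left h1 _)

/-- Boundedness of `G ↦ ∫ F G dy` from `L²(Ω²)` to `L²(Ω)` for `F ∈ L^{∞,2}(Ω²)`. -/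
lemma eLpNorm_integral_mul_le [SFinite μ] {F G : Ω × Ω → ℝ} {κ : ℝ≥0∞}
    (hF : AEStronglyMeasurable F (μ.prod μ)) (hG : AEStronglyMeasurable G (μ.prod μ))
    (hκ : ∀ᵐ x ∂μ, eLpNorm (fun y => F (x, y)) 2 μ ≤ κ) :
    eLpNorm (fun x => ∫ y, F (x, y) * G (x, y) ∂μ) 2 μ ≤ κ * eLpNorm G 2 (μ.prod μ) := by
  apply pow_two_le_imp
  rw [mul_pow, sq_eLpNorm_two_prod hG, sq_eLpNorm_two]
  calc ∫⁻ x, ‖∫ y, F (x, y) * G (x, y) ∂μ‖ₑ ^ 2 ∂μ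
      ≤ ∫⁻ x, κ ^ 2 * eLpNorm (fun y => G (x, y)) 2 μ ^ 2 ∂μ := by
        refine lintegral_mono_ae ?_
        filter_upwards [lintegral_prod_mul_le hF hG hκ] with x hx
        rw [← mul_pow]
        exact pow_le_pow_left' ((enorm_integral_le_lintegral_enorm _).trans hx) 2
    _ = _ := by
        rw [lintegral_const_mul'']
        simp_rw [sq_eLpNorm_two]
        exact (hG.enorm.pow_const 2).lintegral_prod_right'

/-- The counterpart for bounded G: only the L²(Ω²) norm of F is needed, because L¹ ≤ L² on a
probability space. This is why the kernel error can be measured in L²(Ω²) when the data are in L^∞.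
-/
lemma eLpNorm_integral_mul_le_of_bound [IsProbabilityMeasure μ] {F G : Ω × Ω → ℝ} {R : ℝ≥0∞}
    (hF : AEStronglyMeasurable F (μ.prod μ)) (hR : ∀ᵐ z ∂μ.prod μ, ‖G z‖ₑ ≤ R) :
    eLpNorm (fun x => ∫ y, F (x, y) * G (x, y) ∂μ) 2 μ ≤ R * eLpNorm F 2 (μ.prod μ) := by
  apply pow_two_le_imp
  rw [mul_pow, sq_eLpNorm_two_prod hF, sq_eLpNorm_two]
  calc ∫⁻ x, ‖∫ y, F (x, y) * G (x, y) ∂μ‖ₑ ^ 2 ∂μ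
      ≤ ∫⁻ x, R ^ 2 * eLpNorm (fun y => F (x, y)) 2 μ ^ 2 ∂μ := by
        refine lintegral_mono_ae ?_
        filter_upwards [Measure.ae_ae_of_ae_prod hR, ae_aestronglyMeasurable_section hF]
          with x hx hFx
        rw [← mul_pow]
        refine pow_le_pow_left' ((enorm_integral_le_lintegral_enorm _).trans ?_) 2
        calc ∫⁻ y, ‖F (x, y) * G (x, y)‖ₑ ∂μ ≤ ∫⁻ y, R * ‖F (x, y)‖ₑ ∂μ := by
              refine lintegral_mono_ae ?_
              filter_upwards [hx] with y hy
              rw [enorm_mul, mul_comm]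
              exact mul_le_mul_left hy _
          _ = R * eLpNorm (fun y => F (x, y)) 1 μ := by
              rw [lintegral_const_mul'' _ hFx.enorm, eLpNorm_one_eq_lintegral_enorm]
          _ ≤ _ := mul_le_mul_right
              (eLpNorm_le_eLpNorm_of_exponent_le (by norm_num) hFx) _
    _ = _ := by
        rw [lintegral_const_mul'']
        simp_rw [sq_eLpNorm_two]
        exact (hF.enorm.pow_const 2).lintegral_prod_right'

lemma aestronglyMeasurable_integral_mul [SFinite μ] {F G : Ω × Ω → ℝ}
    (hF : AEStronglyMeasurable F (μ.prod μ)) (hG : AEStronglyMeasurable G (μ.prod μ)) :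
    AEStronglyMeasurable (fun x => ∫ y, F (x, y) * G (x, y) ∂μ) μ :=
  (hF.mul hG).integral_prod_right'

lemma memLp_integral_mul [SFinite μ] {F G : Ω × Ω → ℝ} {κ : ℝ≥0∞} (hκ' : κ ≠ ⊤)
    (hF : AEStronglyMeasurable F (μ.prod μ)) (hG : MemLp G 2 (μ.prod μ))
    (hκ : ∀ᵐ x ∂μ, eLpNorm (fun y => F (x, y)) 2 μ ≤ κ) :
    MemLp (fun x => ∫ y, F (x, y) * G (x, y) ∂μ) 2 μ :=
  ⟨aestronglyMeasurable_integral_mul hF hG.1,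
    (eLpNorm_integral_mul_le hF hG.1 hκ).trans_lt
      (ENNReal.mul_lt_top hκ'.lt_top hG.2)⟩

/-- Cauchy–Schwarz in y, with the bound on the sections of F uniform in x, and then Cauchy–Schwarz
in x. This integrability justifies the exchange of variables in every symmetrization below. -/
lemma integrable_mul_mul [SFinite μ] {F G : Ω × Ω → ℝ} {η : Ω → ℝ} {κ : ℝ≥0∞} (hκ' : κ ≠ ⊤)
    (hF : AEStronglyMeasurable F (μ.prod μ)) (hG : MemLp G 2 (μ.prod μ)) (hη : MemLp η 2 μ)
    (hκ : ∀ᵐ x ∂μ, eLpNorm (fun y => F (x, y)) 2 μ ≤ κ) :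
    Integrable (fun z => F z * G z * η z.1) (μ.prod μ) := by
  have hmeas : AEStronglyMeasurable (fun z => F z * G z * η z.1) (μ.prod μ) :=
    (hF.mul hG.1).mul hη.1.comp_fst
  refine ⟨hmeas, ?_⟩
  rw [hasFiniteIntegral_iff_enorm, lintegral_prod _ hmeas.enorm]
  have hGm : AEMeasurable (fun x => eLpNorm (fun y => G (x, y)) 2 μ) μ := by
    have : AEMeasurable (fun x => (eLpNorm (fun y => G (x, y)) 2 μ ^ 2) ^ (2 : ℝ)⁻¹) μ := by
      simp_rw [sq_eLpNorm_two]
      exact ((hG.1.enorm.pow_const 2).lintegral_prod_right').pow_const _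
    refine this.congr (Filter.Eventually.of_forall fun x => ?_)
    simp only
    rw [← ENNReal.rpow_natCast, ← ENNReal.rpow_mul]; norm_num
  calc ∫⁻ x, ∫⁻ y, ‖F (x, y) * G (x, y) * η x‖ₑ ∂μ ∂μ
      ≤ ∫⁻ x, κ * (eLpNorm (fun y => G (x, y)) 2 μ * ‖η x‖ₑ) ∂μ := by
        refine lintegral_mono_ae ?_
        filter_upwards [lintegral_prod_mul_le hF hG.1 hκ] with x hx
        simp_rw [enorm_mul _ (η x)]
        rw [lintegral_mul_const' _ _ enorm_ne_top, ← mul_assoc]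
        exact mul_le_mul_left hx _
    _ = κ * ∫⁻ x, eLpNorm (fun y => G (x, y)) 2 μ * ‖η x‖ₑ ∂μ :=
        lintegral_const_mul' _ _ hκ'
    _ ≤ κ * (eLpNorm G 2 (μ.prod μ) * eLpNorm η 2 μ) := by
        refine mul_le_mul_right ?_ _
        refine (ENNReal.lintegral_mul_le_Lp_mul_Lq μ Real.HolderConjugate.two_two
          hGm hη.1.enorm).trans (le_of_eq ?_)
        have e1 : ∀ a : ℝ≥0∞, (a ^ 2) ^ (1 / 2 : ℝ) = a := fun a => by
          rw [← ENNReal.rpow_natCast, ← ENNReal.rpow_mul]; norm_num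
        simp_rw [ENNReal.rpow_two]
        rw [← sq_eLpNorm_two_prod hG.1, ← sq_eLpNorm_two, e1, e1]
    _ < ⊤ := ENNReal.mul_lt_top hκ'.lt_top (ENNReal.mul_lt_top hG.2 hη.2)

lemma integrable_mul_of_memLp_two [IsProbabilityMeasure μ] {F G : Ω × Ω → ℝ} {κ : ℝ≥0∞}
    (hκ' : κ ≠ ⊤) (hF : AEStronglyMeasurable F (μ.prod μ)) (hG : MemLp G 2 (μ.prod μ))
    (hκ : ∀ᵐ x ∂μ, eLpNorm (fun y => F (x, y)) 2 μ ≤ κ) :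
    Integrable (fun z => F z * G z) (μ.prod μ) := by
  simpa using integrable_mul_mul (η := fun _ => 1) hκ' hF hG (memLp_const 1) hκ

/-- Symmetrization of an antisymmetric interaction. -/
lemma integral_integral_mul_antisymm [SFinite μ] {H : Ω × Ω → ℝ} {η : Ω → ℝ}
    (hH : ∀ z, H z.swap = -H z) (hint : Integrable (fun z => H z * η z.1) (μ.prod μ)) :
    ∫ x, (∫ y, H (x, y) ∂μ) * η x ∂μ = -(1 / 2) * ∫ z, H z * (η z.2 - η z.1) ∂μ.prod μ := by
  have h2 : Integrable (fun z => H z * η z.2) (μ.prod μ) := by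
    have := hint.swap.neg
    refine this.congr (Filter.Eventually.of_forall fun z => ?_)
    simp [hH]
  have e1 : ∫ x, (∫ y, H (x, y) ∂μ) * η x ∂μ = ∫ z, H z * η z.1 ∂μ.prod μ := by
    rw [integral_prod _ hint]
    simp_rw [integral_mul_const]
  have e2 : ∫ z, H z * η z.2 ∂μ.prod μ = -∫ z, H z * η z.1 ∂μ.prod μ := by
    rw [← integral_prod_swap (fun z => H z * η z.1), ← integral_neg]
    refine integral_congr_ae (Filter.Eventually.of_forall fun z => ?_)
    simp [hH]
  simp_rw [mul_sub]
  rw [integral_sub h2 hint, e2, e1]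
  ring

lemma integral_integral_mul_nonpos [SFinite μ] {H : Ω × Ω → ℝ} {η : Ω → ℝ}
    (hH : ∀ z, H z.swap = -H z) (hint : Integrable (fun z => H z * η z.1) (μ.prod μ))
    (hs : ∀ z, 0 ≤ H z * (η z.2 - η z.1)) :
    ∫ x, (∫ y, H (x, y) ∂μ) * η x ∂μ ≤ 0 := by
  rw [integral_integral_mul_antisymm hH hint]
  have : 0 ≤ ∫ z, H z * (η z.2 - η z.1) ∂μ.prod μ := integral_nonneg fun z => hs z
  linarith

end Operators

/-! ### Kernels and nonlinearities on a probability space -/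

section Kernels

variable {Ω : Type*} [MeasurableSpace Ω]

/-- Symmetric nonnegative kernels whose sections are bounded in `L²` by `κ`. -/
structure SymmKernel (μ : Measure Ω) (K : Ω → Ω → ℝ) (κ : ℝ≥0) : Prop where
  measurable : Measurable fun z : Ω × Ω => K z.1 z.2
  nonneg : ∀ x y, 0 ≤ K x y
  symm : ∀ x y, K x y = K y x
  bounded : ∀ᵐ x ∂μ, eLpNorm (K x) 2 μ ≤ κ

/-- Nondecreasing, odd, continuous nonlinearities. -/
structure OddMono (Φ : ℝ → ℝ) : Prop where
  mono : Monotone Φ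
  odd : ∀ s, Φ (-s) = -Φ s
  continuous : Continuous Φ

/-- The nonlocal operator `w ↦ ∫ K(·,y) Φ(w(y) - w(·)) dy`. -/
def nonlocal (μ : Measure Ω) (K : Ω → Ω → ℝ) (Φ : ℝ → ℝ) (w : Ω → ℝ) (x : Ω) : ℝ :=
  ∫ y, K x y * Φ (w y - w x) ∂μ

variable {μ : Measure Ω} {K : Ω → Ω → ℝ} {κ : ℝ≥0} {Φ : ℝ → ℝ} {w w' : Ω → ℝ}

lemma OddMono.map_sub_swap (hΦ : OddMono Φ) (a b : ℝ) : Φ (a - b) = -Φ (b - a) := by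
  rw [← hΦ.odd, neg_sub]

lemma OddMono.sub_mul_sub_nonneg (hΦ : OddMono Φ) (a b : ℝ) : 0 ≤ (Φ a - Φ b) * (a - b) := by
  rcases le_total a b with h | h
  · exact mul_nonneg_of_nonpos_of_nonpos (sub_nonpos.2 (hΦ.mono h)) (sub_nonpos.2 h)
  · exact mul_nonneg (sub_nonneg.2 (hΦ.mono h)) (sub_nonneg.2 h)

lemma OddMono.map_zero (hΦ : OddMono Φ) : Φ 0 = 0 := by
  have := hΦ.odd 0
  simp at this; linarith

lemma aestronglyMeasurable_diff [SFinite μ] (hw : AEStronglyMeasurable w μ) :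
    AEStronglyMeasurable (fun z : Ω × Ω => w z.2 - w z.1) (μ.prod μ) :=
  hw.comp_snd.sub hw.comp_fst

lemma eLpNorm_diff_le [IsProbabilityMeasure μ] {q : ℝ≥0∞} (hq : 1 ≤ q)
    (hw : AEStronglyMeasurable w μ) :
    eLpNorm (fun z : Ω × Ω => w z.2 - w z.1) q (μ.prod μ) ≤ 2 * eLpNorm w q μ := by
  refine (eLpNorm_sub_le hw.comp_snd hw.comp_fst hq).trans ?_
  have h1 : eLpNorm (fun z : Ω × Ω => w z.2) q (μ.prod μ) = eLpNorm w q μ :=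
    eLpNorm_comp_measurePreserving hw measurePreserving_snd
  have h2 : eLpNorm (fun z : Ω × Ω => w z.1) q (μ.prod μ) = eLpNorm w q μ :=
    eLpNorm_comp_measurePreserving hw measurePreserving_fst
  rw [h1, h2, two_mul]

lemma nonlocal_congr_ae (h : w =ᵐ[μ] w') : nonlocal μ K Φ w =ᵐ[μ] nonlocal μ K Φ w' := by
  filter_upwards [h] with x hx
  refine integral_congr_ae ?_
  filter_upwards [h] with y hy
  rw [hx, hy]

/-- The integrated form of the accretivity of the nonlocal operator. -/
lemma integral_nonlocal_sub_mul_nonpos [SFinite μ] (hK : SymmKernel μ K κ) (hΦ : OddMono Φ)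
    {η : Ω → ℝ}
    (h1 : Integrable (fun z : Ω × Ω => K z.1 z.2 * Φ (w z.2 - w z.1)) (μ.prod μ))
    (h2 : Integrable (fun z : Ω × Ω => K z.1 z.2 * Φ (w' z.2 - w' z.1)) (μ.prod μ))
    (hint : Integrable (fun z : Ω × Ω =>
      (K z.1 z.2 * (Φ (w z.2 - w z.1) - Φ (w' z.2 - w' z.1))) * η z.1) (μ.prod μ))
    (hη : ∀ x y, 0 ≤ (Φ (w y - w x) - Φ (w' y - w' x)) * (η y - η x)) :
    ∫ x, (nonlocal μ K Φ w x - nonlocal μ K Φ w' x) * η x ∂μ ≤ 0 := by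
  have := integral_integral_mul_nonpos (μ := μ)
    (H := fun z => K z.1 z.2 * (Φ (w z.2 - w z.1) - Φ (w' z.2 - w' z.1))) (η := η) ?_ hint ?_
  · refine le_trans (le_of_eq ?_) this
    refine integral_congr_ae ?_
    filter_upwards [h1.prod_right_ae, h2.prod_right_ae] with x hx1 hx2
    simp only [nonlocal, mul_sub]
    rw [integral_sub hx1 hx2]
  · intro z
    simp only [Prod.fst_swap, Prod.snd_swap]
    rw [hK.symm, hΦ.map_sub_swap (w z.1), hΦ.map_sub_swap (w' z.1)]; ring
  · intro z
    rw [mul_assoc]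
    exact mul_nonneg (hK.nonneg _ _) (hη _ _)

end Kernels

/-! ### The `p`-Laplacian nonlinearity and its Lipschitz approximation -/

section Nonlinearity

variable {p : ℝ}

/-- Taken for h(t) = max(t,0)^(p−1) this is Ψ itself, and for a regularized h it is the
approximation of Ψ. -/
lemma oddMono_sub_neg {h : ℝ → ℝ} (hm : Monotone h) (hc : Continuous h) :
    OddMono fun s => h s - h (-s) where
  mono := fun s t hst => sub_le_sub (hm hst) (hm (neg_le_neg hst))
  odd := fun s => by simp
  continuous := hc.sub (hc.comp continuous_neg)

lemma Psi_eq (hp : 1 < p) (s : ℝ) : Psi p s = max s 0 ^ (p - 1) - max (-s) 0 ^ (p - 1) := by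
  have h0 : (0 : ℝ) ^ (p - 1) = 0 := Real.zero_rpow (by linarith)
  have key : ∀ x : ℝ, 0 < x → x ^ (p - 2) * x = x ^ (p - 1) := fun x hx => by
    rw [← Real.rpow_add_one hx.ne']; congr 1; ring
  rcases lt_trichotomy s 0 with h | h | h
  · rw [Psi, abs_of_neg h, max_eq_right h.le, max_eq_left (by linarith), h0,
      ← key (-s) (by linarith)]; ring
  · simp [Psi, h, h0]
  · rw [Psi, abs_of_pos h, max_eq_left h.le, max_eq_right (by linarith), h0, key s h]; ring

lemma abs_Psi (hp : 1 < p) (s : ℝ) : |Psi p s| = |s| ^ (p - 1) := by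
  rcases eq_or_ne s 0 with rfl | h
  · simp [Psi, Real.zero_rpow (by linarith : p - 1 ≠ 0)]
  · rw [Psi, abs_mul, abs_of_nonneg (by positivity), ← Real.rpow_add_one (abs_pos.2 h).ne']
    congr 1; ring

lemma Psi_mul_self (hp : 1 < p) (s : ℝ) : Psi p s * s = |s| ^ p := by
  rcases eq_or_ne s 0 with rfl | h
  · simp [Real.zero_rpow (by linarith : p ≠ 0)]
  · rw [Psi, mul_assoc, ← sq, ← sq_abs, ← Real.rpow_natCast, ← Real.rpow_add (abs_pos.2 h)]
    congr 1; norm_num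

lemma oddMono_Psi (hp : 1 < p) : OddMono (Psi p) := by
  have : Psi p = fun s => (fun t : ℝ => max t 0 ^ (p - 1)) s - (fun t : ℝ => max t 0 ^ (p - 1)) (-s) :=
    funext (Psi_eq hp)
  rw [this]
  apply oddMono_sub_neg
  · intro s t hst
    exact Real.rpow_le_rpow (le_max_right _ _) (max_le_max_right _ hst) (by linarith)
  · exact (continuous_id.max continuous_const).rpow_const fun _ => Or.inr (by linarith)

/-- For p < 2 the slope of Ψ is infinite at 0, and for every p it is unbounded at infinity as a
function value. Clamping the argument to [0,R] and shifting it by ε cures both: t ↦ (clamp t +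
ε)^(p−1) is monotone, bounded and Lipschitz. In h(s) − h(−s) the spurious value ε^(p−1) at the
origin cancels. -/
lemma exists_lipschitz_approx_Psi (hp : 1 < p) {R η : ℝ} (hR : 0 ≤ R) (hη : 0 < η) :
    ∃ Φ : ℝ → ℝ, OddMono Φ ∧ (∃ c, LipschitzWith c Φ) ∧ (∃ B : ℝ≥0, ∀ s, |Φ s| ≤ B) ∧
      ∀ s, |s| ≤ R → |Φ s - Psi p s| ≤ η := by
  have hcont : Continuous fun t : ℝ => max t 0 ^ (p - 1) :=
    (continuous_id.max continuous_const).rpow_const fun _ => Or.inr (by linarith)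
  have huc := isCompact_Icc.uniformContinuousOn_of_continuous
    (s := Icc (0 : ℝ) (R + 1)) hcont.continuousOn
  rw [Metric.uniformContinuousOn_iff] at huc
  obtain ⟨δ, hδ, hδ'⟩ := huc (η / 4) (by positivity)
  -- The shift is smaller than the modulus δ of uniform continuity and at most 1, so that shifted
  -- arguments stay in [0, R+1].
  set ε := min (δ / 2) 1 with hε
  have hε0 : 0 < ε := by positivity
  have hεδ : ε < δ := (min_le_left _ _).trans_lt (by linarith)
  have hε1 : ε ≤ 1 := min_le_right _ _
  have hdiff : ∀ t ∈ Icc 0 R, |(t + ε) ^ (p - 1) - t ^ (p - 1)| ≤ η / 4 := by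
    intro t ht
    have := hδ' (t + ε) ⟨by linarith [ht.1], by linarith [ht.2]⟩ t ⟨ht.1, by linarith [ht.2]⟩
      (by simpa [Real.dist_eq, abs_of_pos hε0] using hεδ)
    rw [Real.dist_eq, max_eq_left (by linarith [ht.1]), max_eq_left ht.1] at this
    exact this.le
  set pr : ℝ → ℝ := fun t => max 0 (min R t) with hpr
  have hprm : ∀ t, pr t ∈ Icc 0 R := fun t => ⟨le_max_left _ _, max_le hR (min_le_left _ _)⟩
  have hprmono : Monotone pr := fun s t hst => max_le_max_left _ (min_le_min_left _ hst)
  have hprlip : LipschitzWith 1 pr := LipschitzWith.id.const_min R |>.const_max 0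
  set h : ℝ → ℝ := fun t => (pr t + ε) ^ (p - 1) with hh
  have hmono : Monotone h := fun s t hst =>
    Real.rpow_le_rpow (by linarith [(hprm s).1]) (by linarith [hprmono hst]) (by linarith)
  obtain ⟨c, hc⟩ : ∃ c, LipschitzOnWith c (fun t : ℝ => (t + ε) ^ (p - 1)) (Icc 0 R) := by
    refine ContDiffOn.exists_lipschitzOnWith (n := 1) ?_ one_ne_zero (convex_Icc _ _)
      isCompact_Icc
    refine ContDiffOn.rpow_const_of_ne (contDiffOn_id.add contDiffOn_const) fun t ht => ?_
    have := ht.1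
    exact (show 0 < t + ε by positivity).ne'
  have hlip : LipschitzWith c h := by
    refine LipschitzWith.of_dist_le_mul fun s t => ?_
    refine (hc.dist_le_mul _ (hprm s) _ (hprm t)).trans ?_
    have := hprlip.dist_le_mul s t
    rw [NNReal.coe_one, one_mul] at this
    gcongr
  refine ⟨fun s => h s - h (-s), oddMono_sub_neg hmono hlip.continuous, ⟨c + c, ?_⟩,
    ⟨⟨2 * (R + ε) ^ (p - 1), by positivity⟩, ?_⟩, ?_⟩
  · have h2 : LipschitzWith c fun s => h (-s) := LipschitzWith.of_dist_le_mul fun s t => by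
      simpa using hlip.dist_le_mul (-s) (-t)
    exact hlip.sub h2
  · intro s
    have hb : ∀ t, |h t| ≤ (R + ε) ^ (p - 1) := fun t => by
      have := (hprm t).1
      rw [abs_of_nonneg (by positivity)]
      exact Real.rpow_le_rpow (by positivity) (by linarith [(hprm t).2]) (by linarith)
    refine (abs_sub _ _).trans ?_
    have h1 := hb s
    have h2 := hb (-s)
    change |h s| + |h (-s)| ≤ 2 * (R + ε) ^ (p - 1)
    linarith
  · intro s hs
    have hpos : ∀ t, |t| ≤ R → |h t - max t 0 ^ (p - 1)| ≤ η / 4 := by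
      intro t ht
      have : pr t = max t 0 := by
        simp only [hpr]; rw [min_eq_right (le_of_abs_le ht), max_comm]
      rw [hh]; simp only
      rw [this]
      exact hdiff _ ⟨le_max_right _ _, max_le (le_of_abs_le ht) hR⟩
    have h1 := hpos s hs
    have h2 := hpos (-s) (by rwa [abs_neg])
    rw [Psi_eq hp]
    have : h s - h (-s) - (max s 0 ^ (p - 1) - max (-s) 0 ^ (p - 1)) =
      (h s - max s 0 ^ (p - 1)) - (h (-s) - max (-s) 0 ^ (p - 1)) := by ring
    rw [this]
    exact (abs_sub _ _).trans (by linarith)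

end Nonlinearity

/-! ### Functions as elements of `L²` -/

section ToL2

variable {Ω : Type*} [MeasurableSpace Ω] {μ : Measure Ω}

open Classical in
/-- The class of `f` in `L²`, or `0` if `f` is not square integrable. -/
def toL2 (μ : Measure Ω) (f : Ω → ℝ) : Lp ℝ 2 μ := if h : MemLp f 2 μ then h.toLp f else 0

lemma coeFn_toL2 {f : Ω → ℝ} (h : MemLp f 2 μ) : toL2 μ f =ᵐ[μ] f := by
  rw [toL2, dif_pos h]; exact h.coeFn_toLp

lemma toL2_congr {f g : Ω → ℝ} (h : f =ᵐ[μ] g) : toL2 μ f = toL2 μ g := by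
  by_cases hf : MemLp f 2 μ
  · rw [toL2, toL2, dif_pos hf, dif_pos (hf.ae_eq h)]
    exact (MemLp.toLp_eq_toLp_iff _ _).2 h
  · rw [toL2, toL2, dif_neg hf, dif_neg fun hg => hf (hg.ae_eq h.symm)]

lemma enorm_toL2 {f : Ω → ℝ} (h : MemLp f 2 μ) : ‖toL2 μ f‖ₑ = eLpNorm f 2 μ := by
  rw [Lp.enorm_def]; exact eLpNorm_congr_ae (coeFn_toL2 h)

lemma norm_toL2 {f : Ω → ℝ} (h : MemLp f 2 μ) : ‖toL2 μ f‖ = (eLpNorm f 2 μ).toReal := by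
  rw [Lp.norm_def, eLpNorm_congr_ae (coeFn_toL2 h)]

lemma toL2_sub {f g : Ω → ℝ} (hf : MemLp f 2 μ) (hg : MemLp g 2 μ) :
    toL2 μ f - toL2 μ g = toL2 μ (fun x => f x - g x) := by
  apply Lp.ext
  filter_upwards [Lp.coeFn_sub (toL2 μ f) (toL2 μ g), coeFn_toL2 hf, coeFn_toL2 hg,
    coeFn_toL2 (hf.sub hg)] with x h1 h2 h3 h4
  have h4' : toL2 μ (fun x => f x - g x) x = f x - g x := h4
  rw [h1, Pi.sub_apply, h2, h3, h4']

lemma inner_eq_integral (f g : Lp ℝ 2 μ) : inner ℝ f g = ∫ x, f x * g x ∂μ := by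
  rw [L2.inner_def]
  refine integral_congr_ae (Filter.Eventually.of_forall fun x => ?_)
  simp [mul_comm]

lemma inner_toL2_left {f : Ω → ℝ} (hf : MemLp f 2 μ) (g : Lp ℝ 2 μ) :
    inner ℝ (toL2 μ f) g = ∫ x, f x * g x ∂μ := by
  rw [inner_eq_integral]
  refine integral_congr_ae ?_
  filter_upwards [coeFn_toL2 hf] with x hx
  rw [hx]

/-- A jointly measurable function with square integrable sections is a measurable curve in `L²`. -/
lemma measurable_toL2_curve [MeasurableSpace.CountablyGenerated Ω] [IsFiniteMeasure μ]
    {f : Ω → ℝ → ℝ} (hf : Measurable fun z : Ω × ℝ => f z.1 z.2)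
    (h2 : ∀ t, MemLp (fun x => f x t) 2 μ) :
    StronglyMeasurable fun t => toL2 μ (fun x => f x t) := by
  let _ : MeasurableSpace (Lp ℝ 2 μ) := borel _
  have _ : BorelSpace (Lp ℝ 2 μ) := ⟨rfl⟩
  have _ : Fact ((2 : ℝ≥0∞) ≠ ⊤) := ⟨by norm_num⟩
  apply Measurable.stronglyMeasurable
  -- L² over a countably generated space is second countable, so measurability need only be tested
  -- on balls. There it reduces to the measurability of t ↦ ‖f(·,t) − c‖, which is Tonelli's
  -- theorem.
  have hbasis : TopologicalSpace.IsTopologicalBasis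
      {s : Set (Lp ℝ 2 μ) | ∃ c r, s = Metric.eball c r} := by
    refine TopologicalSpace.isTopologicalBasis_of_isOpen_of_nhds ?_ ?_
    · rintro _ ⟨c, r, rfl⟩; exact Metric.isOpen_eball
    · intro a u ha hu
      obtain ⟨ε, hε, h⟩ := EMetric.isOpen_iff.1 hu a ha
      exact ⟨_, ⟨a, ε, rfl⟩, Metric.mem_eball_self hε, h⟩
  change @Measurable _ _ _ (borel _) _
  rw [hbasis.borel_eq_generateFrom]
  refine measurable_generateFrom ?_
  rintro _ ⟨c, r, rfl⟩
  have hm : Measurable fun t => eLpNorm (fun x => f x t - c x) 2 μ := by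
    have : Measurable fun t => (∫⁻ x, ‖f x t - c x‖ₑ ^ 2 ∂μ) ^ (2 : ℝ)⁻¹ := by
      refine Measurable.pow_const (Measurable.lintegral_prod_left' (f := fun z : Ω × ℝ =>
        ‖f z.1 z.2 - c z.1‖ₑ ^ 2) ?_) _
      exact ((hf.sub ((Lp.stronglyMeasurable c).measurable.comp measurable_fst)).enorm).pow_const 2
    convert this using 2 with t
    rw [← sq_eLpNorm_two, ← ENNReal.rpow_natCast, ← ENNReal.rpow_mul]; norm_num
  convert hm (measurableSet_Iio (a := r)) using 1
  ext t
  simp only [mem_preimage, Metric.mem_eball, mem_Iio, Lp.edist_def]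
  rw [eLpNorm_congr_ae]
  filter_upwards [coeFn_toL2 (h2 t)] with x hx
  simp [hx]

end ToL2

/-! ### The evolution problem with a bounded Lipschitz nonlinearity -/

section Regularized

variable {Ω : Type*} [MeasurableSpace Ω] {μ : Measure Ω}
  {K : Ω → Ω → ℝ} {κ : ℝ≥0} {Φ : ℝ → ℝ} {w w' : Ω → ℝ}

lemma SymmKernel.aestronglyMeasurable (hK : SymmKernel μ K κ) :
    AEStronglyMeasurable (fun z : Ω × Ω => K z.1 z.2) (μ.prod μ) :=
  hK.measurable.aestronglyMeasurable

variable [IsProbabilityMeasure μ]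

lemma eLpNorm_nonlocal_le (hK : SymmKernel μ K κ)
    (hG : MemLp (fun z : Ω × Ω => Φ (w z.2 - w z.1)) 2 (μ.prod μ)) :
    eLpNorm (nonlocal μ K Φ w) 2 μ ≤
      κ * eLpNorm (fun z : Ω × Ω => Φ (w z.2 - w z.1)) 2 (μ.prod μ) :=
  eLpNorm_integral_mul_le (F := fun z => K z.1 z.2) (G := fun z => Φ (w z.2 - w z.1))
    hK.aestronglyMeasurable hG.1 hK.bounded

lemma memLp_nonlocal (hK : SymmKernel μ K κ)
    (hG : MemLp (fun z : Ω × Ω => Φ (w z.2 - w z.1)) 2 (μ.prod μ)) :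
    MemLp (nonlocal μ K Φ w) 2 μ :=
  memLp_integral_mul (F := fun z => K z.1 z.2) (G := fun z => Φ (w z.2 - w z.1)) ENNReal.coe_ne_top hK.aestronglyMeasurable hG hK.bounded

lemma integrable_kernel_mul (hK : SymmKernel μ K κ)
    (hG : MemLp (fun z : Ω × Ω => Φ (w z.2 - w z.1)) 2 (μ.prod μ)) :
    Integrable (fun z : Ω × Ω => K z.1 z.2 * Φ (w z.2 - w z.1)) (μ.prod μ) :=
  integrable_mul_of_memLp_two ENNReal.coe_ne_top hK.aestronglyMeasurable hG hK.bounded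

lemma memLp_comp_diff_of_bound (hΦ : Continuous Φ) {B : ℝ} (hB : ∀ s, |Φ s| ≤ B)
    (hw : AEStronglyMeasurable w μ) (q : ℝ≥0∞) :
    MemLp (fun z : Ω × Ω => Φ (w z.2 - w z.1)) q (μ.prod μ) :=
  MemLp.of_bound (hΦ.comp_aestronglyMeasurable (aestronglyMeasurable_diff hw)) B
    (Filter.Eventually.of_forall fun _ => hB _)

/-- The increments θ(w(y)) − θ(w(x)) and Φ(w(y) − w(x)) have the same sign. With θ a step function
this yields the L^∞ bound, with θ = q·`Psi q` the L^q bound. -/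
lemma integral_nonlocal_mul_comp_nonpos (hK : SymmKernel μ K κ) (hΦ : OddMono Φ) {θ : ℝ → ℝ}
    (hθ : Monotone θ) (hG : MemLp (fun z : Ω × Ω => Φ (w z.2 - w z.1)) 2 (μ.prod μ))
    (hθw : MemLp (fun x => θ (w x)) 2 μ) :
    ∫ x, nonlocal μ K Φ w x * θ (w x) ∂μ ≤ 0 := by
  refine integral_integral_mul_nonpos (H := fun z => K z.1 z.2 * Φ (w z.2 - w z.1))
    (η := fun x => θ (w x)) ?_ ?_ ?_
  · intro z
    simp only [Prod.fst_swap, Prod.snd_swap]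
    rw [hK.symm, hΦ.map_sub_swap (w z.1)]; ring
  · exact integrable_mul_mul ENNReal.coe_ne_top hK.aestronglyMeasurable hG hθw hK.bounded
  · intro z
    rw [mul_assoc]
    refine mul_nonneg (hK.nonneg _ _) ?_
    rcases le_total (w z.1) (w z.2) with h | h
    · refine mul_nonneg ?_ (sub_nonneg.2 (hθ h))
      have := hΦ.mono (sub_nonneg.2 h)
      rwa [hΦ.map_zero] at this
    · refine mul_nonneg_of_nonpos_of_nonpos ?_ (sub_nonpos.2 (hθ h))
      have := hΦ.mono (sub_nonpos.2 h)
      rwa [hΦ.map_zero] at this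

/-- Monotonicity in `L²`. -/
lemma integral_nonlocal_sub_mul_sub_nonpos (hK : SymmKernel μ K κ) (hΦ : OddMono Φ)
    (hw : MemLp w 2 μ) (hw' : MemLp w' 2 μ)
    (hG : MemLp (fun z : Ω × Ω => Φ (w z.2 - w z.1)) 2 (μ.prod μ))
    (hG' : MemLp (fun z : Ω × Ω => Φ (w' z.2 - w' z.1)) 2 (μ.prod μ)) :
    ∫ x, (nonlocal μ K Φ w x - nonlocal μ K Φ w' x) * (w x - w' x) ∂μ ≤ 0 := by
  refine integral_nonlocal_sub_mul_nonpos hK hΦ (η := fun x => w x - w' x)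
    (integrable_kernel_mul hK hG) (integrable_kernel_mul hK hG') ?_ ?_
  · exact integrable_mul_mul ENNReal.coe_ne_top hK.aestronglyMeasurable (hG.sub hG')
      (hw.sub hw') hK.bounded
  · intro x y
    have := hΦ.sub_mul_sub_nonneg (w y - w x) (w' y - w' x)
    rwa [show w y - w' y - (w x - w' x) = w y - w x - (w' y - w' x) by ring]

lemma norm_toL2_nonlocal_sub_le (hK : SymmKernel μ K κ) {c : ℝ≥0} (hΦ : LipschitzWith c Φ)
    {B : ℝ} (hB : ∀ s, |Φ s| ≤ B) (f g : Lp ℝ 2 μ) :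
    ‖toL2 μ (nonlocal μ K Φ f) - toL2 μ (nonlocal μ K Φ g)‖ ≤ κ * (c * (2 * ‖f - g‖)) := by
  have hf := memLp_comp_diff_of_bound hΦ.continuous hB (Lp.aestronglyMeasurable f) 2
  have hg := memLp_comp_diff_of_bound hΦ.continuous hB (Lp.aestronglyMeasurable g) 2
  have hsub : MemLp (fun x => nonlocal μ K Φ f x - nonlocal μ K Φ g x) 2 μ :=
    (memLp_nonlocal hK hf).sub (memLp_nonlocal hK hg)
  rw [toL2_sub (memLp_nonlocal hK hf) (memLp_nonlocal hK hg), norm_toL2 hsub]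
  have hfg : MemLp (fun x => f x - g x) 2 μ := (Lp.memLp f).sub (Lp.memLp g)
  have e1 : (fun x => nonlocal μ K Φ f x - nonlocal μ K Φ g x) =ᵐ[μ]
      fun x => ∫ y, K x y * (Φ (f y - f x) - Φ (g y - g x)) ∂μ := by
    filter_upwards [(integrable_kernel_mul hK hf).prod_right_ae,
      (integrable_kernel_mul hK hg).prod_right_ae] with x hx1 hx2
    simp only [nonlocal, mul_sub]
    rw [integral_sub hx1 hx2]
  refine ENNReal.toReal_le_of_le_ofReal (by positivity) ?_
  rw [eLpNorm_congr_ae e1]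
  refine (eLpNorm_integral_mul_le (G := fun z => Φ (f z.2 - f z.1) - Φ (g z.2 - g z.1))
    hK.aestronglyMeasurable (hf.sub hg).1 hK.bounded).trans ?_
  have e2 : eLpNorm (fun z : Ω × Ω => Φ (f z.2 - f z.1) - Φ (g z.2 - g z.1)) 2 (μ.prod μ) ≤
      c * eLpNorm (fun z : Ω × Ω => (fun x => f x - g x) z.2 - (fun x => f x - g x) z.1) 2
        (μ.prod μ) := by
    refine eLpNorm_le_nnreal_smul_eLpNorm_of_ae_le_mul (Filter.Eventually.of_forall fun z => ?_) 2
    have := hΦ.dist_le_mul (f z.2 - f z.1) (g z.2 - g z.1)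
    rw [Real.dist_eq, Real.dist_eq] at this
    rw [← NNReal.coe_le_coe]
    simp only [coe_nnnorm, Real.norm_eq_abs, NNReal.coe_mul]
    refine this.trans (le_of_eq ?_)
    congr 2; ring
  have e3 := eLpNorm_diff_le (q := 2) (by norm_num) hfg.1
  have e4 : eLpNorm (fun x => f x - g x) 2 μ = ENNReal.ofReal ‖f - g‖ := by
    rw [ofReal_norm, Lp.enorm_def]
    exact eLpNorm_congr_ae (Lp.coeFn_sub f g).symm
  rw [ENNReal.ofReal_mul (by positivity), ENNReal.ofReal_mul (by positivity),
    ENNReal.ofReal_mul (by positivity), ENNReal.ofReal_coe_nnreal, ENNReal.ofReal_coe_nnreal, ← e4]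
  gcongr
  refine e2.trans ?_
  gcongr
  simpa using e3

lemma norm_toL2_nonlocal_le (hK : SymmKernel μ K κ) (hΦ : Continuous Φ)
    {B : ℝ≥0} (hB : ∀ s, |Φ s| ≤ B) (f : Lp ℝ 2 μ) :
    ‖toL2 μ (nonlocal μ K Φ f)‖ ≤ κ * B := by
  have hf := memLp_comp_diff_of_bound hΦ hB (Lp.aestronglyMeasurable f) 2
  rw [norm_toL2 (memLp_nonlocal hK hf)]
  refine ENNReal.toReal_le_of_le_ofReal (by positivity) ((eLpNorm_nonlocal_le hK hf).trans ?_)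
  rw [ENNReal.ofReal_mul (by positivity), ENNReal.ofReal_coe_nnreal]
  gcongr
  refine (eLpNorm_le_of_ae_bound (C := B) (Filter.Eventually.of_forall fun _ => hB _)).trans ?_
  simp

/-- Subtracting the primitive P of the merely integrable source turns the equation into x' = A(x +
P(t)), whose right-hand side is continuous in time. As A is globally Lipschitz and bounded by κB,
trajectories stay in the ball of radius κBT, and Picard–Lindelöf covers all of [0,T] at once. -/
theorem exists_regularized_solution (hK : SymmKernel μ K κ) {c B : ℝ≥0} (hΦ : LipschitzWith c Φ)
    (hB : ∀ s, |Φ s| ≤ B) {T : ℝ} (hT : 0 ≤ T) (g : Lp ℝ 2 μ) {F : ℝ → Lp ℝ 2 μ}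
    (hF : IntervalIntegrable F volume 0 T) :
    ∃ u : ℝ → Lp ℝ 2 μ, u 0 = g ∧
      IsPrimitive u (fun t => toL2 μ (nonlocal μ K Φ (u t)) + F t) 0 T := by
  set A : Lp ℝ 2 μ → Lp ℝ 2 μ := fun f => toL2 μ (nonlocal μ K Φ f) with hA
  set P : ℝ → Lp ℝ 2 μ := fun t => ∫ s in (0 : ℝ)..t, F s with hP
  have hAlip : LipschitzWith (κ * (c * 2)) A := by
    refine LipschitzWith.of_dist_le_mul fun f g => ?_
    rw [dist_eq_norm, dist_eq_norm]
    refine (norm_toL2_nonlocal_sub_le hK hΦ hB f g).trans (le_of_eq ?_)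
    push_cast; ring
  have hPc : ContinuousOn P (Icc 0 T) := by
    have := intervalIntegral.continuousOn_primitive_interval' hF left_mem_uIcc
    rwa [uIcc_of_le hT] at this
  have hpl : IsPicardLindelof (fun t x => A (x + P t)) (tmin := 0) (tmax := T) ⟨0, le_rfl, hT⟩ g
      (κ * B * ⟨T, hT⟩) 0 (κ * B) (κ * (c * 2)) := by
    refine ⟨fun t _ => ?_, fun x _ => ?_, fun t _ x _ => ?_, ?_⟩
    · refine LipschitzWith.lipschitzOnWith (LipschitzWith.of_dist_le_mul fun f g => ?_)
      simpa using hAlip.dist_le_mul (f + P t) (g + P t)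
    · exact hAlip.continuous.comp_continuousOn (continuousOn_const.add hPc)
    · exact norm_toL2_nonlocal_le hK hΦ.continuous hB (x + P t)
    · simp [hT]
      exact le_of_eq rfl
  obtain ⟨α, h0, hα⟩ := hpl.exists_eq_forall_mem_Icc_hasDerivWithinAt₀
  have hαc : ContinuousOn α (Icc 0 T) := fun t ht => (hα t ht).continuousWithinAt
  have hd : ContinuousOn (fun t => A (α t + P t)) (Icc 0 T) :=
    hAlip.continuous.comp_continuousOn (hαc.add hPc)
  have hdi : IntervalIntegrable (fun t => A (α t + P t)) volume 0 T := by
    apply ContinuousOn.intervalIntegrable; rwa [uIcc_of_le hT]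
  refine ⟨fun t => α t + P t, ?_, hdi.add hF, fun t ht => ?_⟩
  · simp only [hP, intervalIntegral.integral_same, add_zero]; exact h0
  · have hsub : uIcc 0 t ⊆ uIcc 0 T := by
      rw [uIcc_of_le ht.1, uIcc_of_le hT]; exact Icc_subset_Icc le_rfl ht.2
    rw [intervalIntegral.integral_add (hdi.mono_set hsub) (hF.mono_set hsub)]
    have := intervalIntegral.integral_eq_sub_of_hasDerivAt_of_le ht.1
      (hαc.mono (Icc_subset_Icc le_rfl ht.2)) (fun s hs =>
        (hα s ⟨hs.1.le, hs.2.le.trans ht.2⟩).hasDerivAt (Icc_mem_nhds hs.1 (hs.2.trans_le ht.2)))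
      (hdi.mono_set hsub)
    rw [this]
    simp only [hP, intervalIntegral.integral_same, add_zero]
    abel

end Regularized

/-! ### A priori bounds in `L^q` -/

section Bounds

variable {Ω : Type*} [MeasurableSpace Ω] {μ : Measure Ω} [IsProbabilityMeasure μ]
  {K : Ω → Ω → ℝ} {κ : ℝ≥0} {Φ : ℝ → ℝ} {a b : ℝ} {u v F : ℝ → Lp ℝ 2 μ}

lemma abs_integral_le_norm (f : Lp ℝ 2 μ) : ∫ x, |f x| ∂μ ≤ ‖f‖ := by
  have h1 : ∫ x, |f x| ∂μ = (eLpNorm f 1 μ).toReal := by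
    rw [eLpNorm_one_eq_lintegral_enorm, ← integral_norm_eq_lintegral_enorm
      (Lp.aestronglyMeasurable f)]
    rfl
  rw [h1, Lp.norm_def]
  exact ENNReal.toReal_mono (Lp.eLpNorm_ne_top f)
    (eLpNorm_le_eLpNorm_of_exponent_le (by norm_num) (Lp.aestronglyMeasurable f))

lemma integrable_coe (f : Lp ℝ 2 μ) : Integrable f μ := (Lp.memLp f).integrable (by norm_num)

/-- Comparison with the spatially constant supersolution c(t) = m + ∫ρ: the integral of (u − c)⁺
starts at 0 and does not increase. Its subgradient is the indicator of {u > c(t)}, a nondecreasing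
function of u, so the nonlocal term contributes with the good sign. -/
theorem ae_le_of_isPrimitive (hK : SymmKernel μ K κ) (hΦ : OddMono Φ) {B : ℝ}
    (hB : ∀ s, |Φ s| ≤ B) (hab : a ≤ b) (hu : IsPrimitive u v a b)
    (hv : ∀ᵐ t ∂volume.restrict (Ioo a b), v t =ᵐ[μ] fun x => nonlocal μ K Φ (u t) x + F t x)
    {ρ : ℝ → ℝ} (hρ : IntervalIntegrable ρ volume a b)
    (hF : ∀ᵐ t ∂volume.restrict (Ioo a b), ∀ᵐ x ∂μ, F t x ≤ ρ t) {m : ℝ}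
    (h0 : ∀ᵐ x ∂μ, u a x ≤ m) : ∀ᵐ x ∂μ, u b x ≤ m + ∫ t in a..b, ρ t := by
  have hone : MemLp (fun _ : Ω => (1 : ℝ)) 2 μ := memLp_const 1
  set one : Lp ℝ 2 μ := toL2 μ fun _ => 1 with hone'
  set c : ℝ → ℝ := fun t => m + ∫ s in a..t, ρ s with hc
  have hca : c a = m := by simp [hc]
  have hcp : IsPrimitive c ρ a b := ⟨hρ, fun t _ => by simp [hc]⟩
  have hep := hu.sub (hcp.map (ContinuousLinearMap.toSpanSingleton ℝ one))
  simp only [ContinuousLinearMap.toSpanSingleton_apply] at hep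
  have hsm : ∀ (f : Lp ℝ 2 μ) (k : ℝ), (f - k • one : Lp ℝ 2 μ) =ᵐ[μ] fun x => f x - k := by
    intro f k
    filter_upwards [Lp.coeFn_sub f (k • one), Lp.coeFn_smul k one, coeFn_toL2 hone]
      with x h1 h2 h3
    rw [h1, Pi.sub_apply, h2, Pi.smul_apply, hone', h3]; simp
  set J : Lp ℝ 2 μ → ℝ := fun f => ∫ x, max (f x) 0 ∂μ with hJ
  have hJi : ∀ f : Lp ℝ 2 μ, Integrable (fun x => max (f x) 0) μ := fun f =>
    (integrable_coe f).pos_part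
  have hmain := hep.le_add_integral_of_subgradient hab (r := fun t => J (u t - c t • one))
    (φ := fun _ => 0) (C := 1) zero_le_one ?_ intervalIntegrable_const ?_
  · have hJ0 : J (u a - c a • one) = 0 := by
      change ∫ x, max ((u a - c a • one : Lp ℝ 2 μ) x) 0 ∂μ = 0
      refine integral_eq_zero_of_ae ?_
      filter_upwards [hsm (u a) (c a), h0] with x h1 h2
      rw [h1, Pi.zero_apply, max_eq_right]
      rw [hca]; linarith
    simp only [hJ0, intervalIntegral.integral_zero, add_zero] at hmain
    have hnn : 0 ≤ᵐ[μ] fun x => max ((u b - c b • one : Lp ℝ 2 μ) x) 0 :=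
      Filter.Eventually.of_forall fun x => le_max_right _ _
    have hz := (integral_eq_zero_iff_of_nonneg_ae hnn (hJi _)).1
      (le_antisymm hmain (integral_nonneg_of_ae hnn))
    filter_upwards [hz, hsm (u b) (c b)] with x h1 h2
    have h3 : max ((u b - c b • one : Lp ℝ 2 μ) x) 0 = 0 := h1
    have := le_max_left ((u b - c b • one : Lp ℝ 2 μ) x) 0
    rw [h3, h2] at this
    simp only [hc] at this; linarith
  · intro s _ t _
    simp only [hJ]
    rw [← integral_sub (hJi _) (hJi _), one_mul]
    refine (abs_integral_le_integral_abs).trans (le_trans ?_ (abs_integral_le_norm _))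
    refine integral_mono_ae ((hJi _).sub (hJi _)).abs (integrable_coe _).abs ?_
    filter_upwards [Lp.coeFn_sub (u s - c s • one) (u t - c t • one)] with x hx
    rw [hx]
    exact abs_max_sub_max_le_abs _ _ _
  · filter_upwards [hv, hF] with t hvt hFt
    set θ : ℝ → ℝ := fun s => if c t < s then 1 else 0 with hθ
    have hθm : Monotone θ := fun x y hxy => by
      simp only [hθ]; split_ifs with h1 h2 <;> first | exact absurd (h1.trans_le hxy) h2 | norm_num
    have hη : MemLp (fun x => θ (u t x)) 2 μ := by
      refine MemLp.of_bound (hθm.measurable.comp_aemeasurable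
        (Lp.aestronglyMeasurable (u t)).aemeasurable).aestronglyMeasurable 1
        (Filter.Eventually.of_forall fun x => ?_)
      simp only [hθ]; split_ifs <;> simp
    refine ⟨innerSL ℝ (toL2 μ fun x => θ (u t x)), fun s _ => ?_, ?_⟩
    · rw [innerSL_apply_apply, inner_toL2_left hη]
      simp only [hJ]
      rw [← integral_sub (hJi _) (hJi _)]
      refine integral_mono_ae ((hJi _).sub (hJi _)) ?_ ?_
      · exact hη.integrable_mul (Lp.memLp _)
      filter_upwards [Lp.coeFn_sub (u t - c t • one) (u s - c s • one), hsm (u t) (c t)]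
        with x h1 h2
      rw [h1, Pi.sub_apply, h2]
      simp only [hθ]
      split_ifs with h
      · rw [max_eq_left (by linarith)]
        have := le_max_left ((u s - c s • one : Lp ℝ 2 μ) x) 0
        linarith
      · rw [max_eq_right (by linarith)]
        have := le_max_right ((u s - c s • one : Lp ℝ 2 μ) x) 0
        linarith
    · rw [innerSL_apply_apply, inner_toL2_left hη]
      have hG := memLp_comp_diff_of_bound hΦ.continuous hB (Lp.aestronglyMeasurable (u t)) 2
      have hn := memLp_nonlocal hK hG
      have e1 : ∫ x, θ (u t x) * (v t - ρ t • one : Lp ℝ 2 μ) x ∂μ =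
          ∫ x, nonlocal μ K Φ (u t) x * θ (u t x) ∂μ + ∫ x, θ (u t x) * (F t x - ρ t) ∂μ := by
        have hi : Integrable (fun x => nonlocal μ K Φ (u t) x * θ (u t x)) μ :=
          hn.integrable_mul hη
        rw [← integral_add hi]
        · refine integral_congr_ae ?_
          filter_upwards [hvt, hsm (v t) (ρ t)] with x h1 h2
          rw [h2, h1]; ring
        · exact hη.integrable_mul ((Lp.memLp (F t)).sub (memLp_const _))
      rw [e1]
      have h2 : ∫ x, θ (u t x) * (F t x - ρ t) ∂μ ≤ 0 := by
        refine integral_nonpos_of_ae ?_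
        filter_upwards [hFt] with x hx
        refine mul_nonpos_of_nonneg_of_nonpos ?_ (by linarith)
        simp only [hθ]; split_ifs <;> norm_num
      have h3 := integral_nonlocal_mul_comp_nonpos hK hΦ hθm hG hη
      linarith

theorem ae_abs_le_of_isPrimitive (hK : SymmKernel μ K κ) (hΦ : OddMono Φ) {B : ℝ}
    (hB : ∀ s, |Φ s| ≤ B) (hab : a ≤ b) (hu : IsPrimitive u v a b)
    (hv : ∀ᵐ t ∂volume.restrict (Ioo a b), v t =ᵐ[μ] fun x => nonlocal μ K Φ (u t) x + F t x)
    {ρ : ℝ → ℝ} (hρ : IntervalIntegrable ρ volume a b)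
    (hF : ∀ᵐ t ∂volume.restrict (Ioo a b), ∀ᵐ x ∂μ, |F t x| ≤ ρ t) {m : ℝ}
    (h0 : ∀ᵐ x ∂μ, |u a x| ≤ m) : ∀ᵐ x ∂μ, |u b x| ≤ m + ∫ t in a..b, ρ t := by
  have h1 := ae_le_of_isPrimitive hK hΦ hB hab hu hv hρ
    (by filter_upwards [hF] with t ht; filter_upwards [ht] with x hx using le_of_abs_le hx)
    (by filter_upwards [h0] with x hx using le_of_abs_le hx)
  have h2 := ae_le_of_isPrimitive (F := fun t => -F t) hK hΦ hB hab hu.neg ?_ hρ ?_ (m := m) ?_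
  · filter_upwards [h1, h2, Lp.coeFn_neg (u b)] with x h3 h4 h5
    rw [h5, Pi.neg_apply] at h4
    exact abs_le.2 ⟨by linarith, h3⟩
  · filter_upwards [hv] with t ht
    have e : nonlocal μ K Φ (-u t : Lp ℝ 2 μ) =ᵐ[μ] fun x => -nonlocal μ K Φ (u t) x := by
      refine (nonlocal_congr_ae (Lp.coeFn_neg (u t))).trans
        (Filter.Eventually.of_forall fun x => ?_)
      simp only [nonlocal, Pi.neg_apply]
      rw [← integral_neg]
      congr 1; ext y
      rw [← mul_neg, ← hΦ.odd]; congr 2; ring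
    filter_upwards [ht, e, Lp.coeFn_neg (v t), Lp.coeFn_neg (F t)] with x h3 h4 h5 h6
    rw [h5, h6, h4, Pi.neg_apply, Pi.neg_apply, h3]; ring
  · filter_upwards [hF] with t ht
    filter_upwards [ht, Lp.coeFn_neg (F t)] with x hx h5
    rw [h5, Pi.neg_apply]; linarith [(abs_le.1 hx).1]
  · filter_upwards [h0, Lp.coeFn_neg (u a)] with x hx h5
    rw [h5, Pi.neg_apply]; linarith [(abs_le.1 hx).1]

/-- Convexity of |·|^q, obtained from Young's inequality for the product t·`Psi q s` with the
conjugate exponents q and q/(q−1). -/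
lemma abs_rpow_sub_le {q : ℝ} (hq : 1 < q) (s t : ℝ) :
    |s| ^ q - |t| ^ q ≤ q * Psi q s * (s - t) := by
  have hc : q.HolderConjugate (q / (q - 1)) := Real.HolderConjugate.conjExponent hq
  have h1 := Real.young_inequality t (Psi q s) hc
  have h2 : |Psi q s| ^ (q / (q - 1)) = |s| ^ q := by
    rw [abs_Psi hq, ← Real.rpow_mul (abs_nonneg _)]
    congr 1; field_simp [show q - 1 ≠ 0 by linarith]
  rw [h2] at h1
  have h3 := Psi_mul_self hq s
  have h4 : q * (|t| ^ q / q + |s| ^ q / (q / (q - 1))) = |t| ^ q + (q - 1) * |s| ^ q := by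
    have : q ≠ 0 := by linarith
    have : q - 1 ≠ 0 := by linarith
    field_simp
  have h5 : q * Psi q s * (s - t) = q * (Psi q s * s) - q * (t * Psi q s) := by ring
  have h6 := mul_le_mul_of_nonneg_left h1 (by linarith : 0 ≤ q)
  rw [h5, h3]
  linarith

lemma abs_abs_rpow_sub_le {q : ℝ} (hq : 1 < q) {R s t : ℝ} (hs : |s| ≤ R) (ht : |t| ≤ R) :
    |(|s| ^ q - |t| ^ q)| ≤ q * R ^ (q - 1) * |s - t| := by
  have key : ∀ s t : ℝ, |s| ≤ R → |s| ^ q - |t| ^ q ≤ q * R ^ (q - 1) * |s - t| := by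
    intro s t hs
    refine (abs_rpow_sub_le hq s t).trans ((le_abs_self _).trans ?_)
    rw [abs_mul, abs_mul, abs_Psi hq, abs_of_pos (by linarith : 0 < q)]
    gcongr
  refine abs_le.2 ⟨?_, key s t hs⟩
  have := key t s ht
  rw [abs_sub_comm] at this
  linarith

lemma rpow_sub_rpow_le {α ε x y : ℝ} (hα : α ≤ 1) (hε : 0 < ε) (hy : ε ≤ y)
    (hxy : y ≤ x) : x ^ α - y ^ α ≤ ε ^ (α - 1) * (x - y) := by
  have hy0 : 0 < y := hε.trans_le hy
  have h1 : x ^ α = y ^ α * (x / y) ^ α := by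
    rw [← Real.mul_rpow hy0.le (div_nonneg (by linarith) hy0.le)]; congr 1; field_simp
  have h2 : (x / y) ^ α ≤ x / y := by
    have : 1 ≤ x / y := (one_le_div hy0).2 hxy
    simpa using Real.rpow_le_rpow_of_exponent_le this hα
  have h3 : y ^ α * (x / y) - y ^ α = y ^ (α - 1) * (x - y) := by
    rw [Real.rpow_sub_one hy0.ne']; field_simp
  have h4 : y ^ (α - 1) ≤ ε ^ (α - 1) := Real.rpow_le_rpow_of_nonpos hε hy (by linarith)
  have h5 : 0 < y ^ α := by positivity
  nlinarith [mul_le_mul_of_nonneg_left h2 h5.le, mul_le_mul_of_nonneg_right h4 (sub_nonneg.2 hxy)]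

/-- For J = ∫|u|^q the nonlocal term drops out and Hölder's inequality gives J' ≤ q J^((q−1)/q) ρ,
that is (J^(1/q))' ≤ ρ. The pointwise bound R serves to make J finite and absolutely continuous; it
does not enter the conclusion. -/
theorem eLpNorm_le_of_isPrimitive (hK : SymmKernel μ K κ) (hΦ : OddMono Φ) {B : ℝ}
    (hB : ∀ s, |Φ s| ≤ B) (hab : a ≤ b) (hu : IsPrimitive u v a b)
    (hv : ∀ᵐ t ∂volume.restrict (Ioo a b), v t =ᵐ[μ] fun x => nonlocal μ K Φ (u t) x + F t x)
    {q : ℝ} (hq : 1 < q) {R : ℝ} (hR : ∀ t ∈ Icc a b, ∀ᵐ x ∂μ, |u t x| ≤ R)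
    {ρ : ℝ → ℝ} (hρ : IntervalIntegrable ρ volume a b)
    (hF : ∀ᵐ t ∂volume.restrict (Ioo a b),
      0 ≤ ρ t ∧ eLpNorm (F t) (ENNReal.ofReal q) μ ≤ ENNReal.ofReal (ρ t)) :
    eLpNorm (u b) (ENNReal.ofReal q) μ ≤
      eLpNorm (u a) (ENNReal.ofReal q) μ + ENNReal.ofReal (∫ t in a..b, ρ t) := by
  have hq0 : 0 < q := by linarith
  have hqne : ENNReal.ofReal q ≠ 0 := by simpa using hq0
  have hR0 : 0 ≤ R := by
    obtain ⟨x, hx⟩ := (hR a ⟨le_rfl, hab⟩).exists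
    exact (abs_nonneg _).trans hx
  have hbd : ∀ {f : Ω → ℝ}, AEStronglyMeasurable f μ → (∀ᵐ x ∂μ, |f x| ≤ R) → ∀ {α : ℝ}, 0 ≤ α →
      ∀ s : ℝ≥0∞, MemLp (fun x => |f x| ^ α) s μ := by
    intro f hf hfR α hα s
    refine MemLp.of_bound ((Real.continuous_rpow_const hα).comp_aestronglyMeasurable
      hf.norm) (R ^ α) ?_
    filter_upwards [hfR] with x hx
    rw [Real.norm_of_nonneg (by positivity)]
    exact Real.rpow_le_rpow (abs_nonneg _) hx hα
  set J : ℝ → ℝ := fun t => ∫ x, |u t x| ^ q ∂μ with hJ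
  have hJ0 : ∀ t, 0 ≤ J t := fun t => integral_nonneg fun x => by positivity
  have hJi : ∀ t ∈ Icc a b, Integrable (fun x => |u t x| ^ q) μ := fun t ht =>
    memLp_one_iff_integrable.1 (hbd (Lp.aestronglyMeasurable _) (hR t ht) hq0.le 1)
  have hnorm : ∀ t ∈ Icc a b,
      eLpNorm (u t) (ENNReal.ofReal q) μ = ENNReal.ofReal (J t ^ q⁻¹) := by
    intro t ht
    have hm : MemLp (u t) (ENNReal.ofReal q) μ :=
      MemLp.of_bound (Lp.aestronglyMeasurable _) R (hR t ht)
    rw [hm.eLpNorm_eq_integral_rpow_norm hqne (by simp), ENNReal.toReal_ofReal hq0.le]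
    rfl
  have hJlip : ∀ s ∈ Icc a b, ∀ t ∈ Icc a b, |J s - J t| ≤ q * R ^ (q - 1) * ‖u s - u t‖ := by
    intro s hs t ht
    simp only [hJ]
    rw [← integral_sub (hJi s hs) (hJi t ht)]
    refine (abs_integral_le_integral_abs).trans (le_trans ?_
      (mul_le_mul_of_nonneg_left (abs_integral_le_norm _) (by positivity)))
    rw [← integral_const_mul]
    refine integral_mono_ae ((hJi s hs).sub (hJi t ht)).abs
      ((integrable_coe _).abs.const_mul _) ?_
    filter_upwards [Lp.coeFn_sub (u s) (u t), hR s hs, hR t ht] with x h1 h2 h3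
    rw [h1]
    exact abs_abs_rpow_sub_le hq h2 h3
  have hder : ∀ᵐ t ∂volume.restrict (Ioo a b), ∀ r', HasDerivAt J r' t →
      r' ≤ q * (J t ^ ((q - 1) / q) * ρ t) := by
    filter_upwards [hu.ae_hasDerivAt, hv, hF, ae_restrict_mem measurableSet_Ioo] with
      t hd hvt hFt hm r' hr'
    have htm := Ioo_subset_Icc_self hm
    have hθ : Continuous fun s => q * Psi q s :=
      continuous_const.mul (oddMono_Psi hq).continuous
    have hθm : Monotone fun s => q * Psi q s := fun s t hst =>
      mul_le_mul_of_nonneg_left ((oddMono_Psi hq).mono hst) hq0.le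
    have hη : MemLp (fun x => q * Psi q (u t x)) 2 μ := by
      refine MemLp.of_bound (hθ.comp_aestronglyMeasurable (Lp.aestronglyMeasurable _))
        (q * R ^ (q - 1)) ?_
      filter_upwards [hR t htm] with x hx
      rw [Real.norm_eq_abs, abs_mul, abs_Psi hq, abs_of_pos hq0]
      gcongr
    have hle := IsPrimitive.deriv_le_of_subgradient (r := J)
      (ℓ := innerSL ℝ (toL2 μ fun x => q * Psi q (u t x))) hd hm ?_ hr'
    · refine hle.trans ?_
      rw [innerSL_apply_apply, inner_toL2_left hη]
      have hG := memLp_comp_diff_of_bound hΦ.continuous hB (Lp.aestronglyMeasurable (u t)) 2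
      have hn := memLp_nonlocal hK hG
      have hi : Integrable (fun x => nonlocal μ K Φ (u t) x * (q * Psi q (u t x))) μ :=
        hn.integrable_mul hη
      have hi2 : Integrable (fun x => q * Psi q (u t x) * F t x) μ :=
        hη.integrable_mul (Lp.memLp _)
      have e1 : ∫ x, q * Psi q (u t x) * v t x ∂μ =
          ∫ x, nonlocal μ K Φ (u t) x * (q * Psi q (u t x)) ∂μ +
            ∫ x, q * Psi q (u t x) * F t x ∂μ := by
        rw [← integral_add hi hi2]
        refine integral_congr_ae ?_
        filter_upwards [hvt] with x h1
        rw [h1]; ring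
      rw [e1]
      have h3 := integral_nonlocal_mul_comp_nonpos hK hΦ hθm hG hη
      have hc : (q / (q - 1)).HolderConjugate q :=
        (Real.HolderConjugate.conjExponent hq).symm
      have hFm : MemLp (F t) (ENNReal.ofReal q) μ :=
        ⟨Lp.aestronglyMeasurable _, hFt.2.trans_lt ENNReal.ofReal_lt_top⟩
      have hum : MemLp (fun x => |u t x| ^ (q - 1)) (ENNReal.ofReal (q / (q - 1))) μ :=
        hbd (Lp.aestronglyMeasurable _) (hR t htm) (by linarith) _
      have h4 : ∫ x, |u t x| ^ (q - 1) * |F t x| ∂μ ≤ J t ^ ((q - 1) / q) * ρ t := by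
        have := integral_mul_le_Lp_mul_Lq_of_nonneg hc
          (Filter.Eventually.of_forall fun x => by positivity)
          (Filter.Eventually.of_forall fun x => abs_nonneg (F t x)) hum hFm.abs
        refine this.trans (mul_le_mul ?_ ?_ (by positivity) (Real.rpow_nonneg (hJ0 t) _))
        · rw [one_div_div]
          refine le_of_eq ?_
          congr 1
          refine integral_congr_ae (Filter.Eventually.of_forall fun x => ?_)
          simp only
          rw [← Real.rpow_mul (abs_nonneg _)]
          congr 1
          have : q - 1 ≠ 0 := by linarith
          field_simp
        · have h5 := hFt.2
          rw [hFm.eLpNorm_eq_integral_rpow_norm hqne (by simp), ENNReal.toReal_ofReal hq0.le,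
            ENNReal.ofReal_le_ofReal_iff hFt.1] at h5
          rw [one_div]
          exact h5
      have h6 : ∫ x, q * Psi q (u t x) * F t x ∂μ ≤
          q * ∫ x, |u t x| ^ (q - 1) * |F t x| ∂μ := by
        rw [← integral_const_mul]
        refine integral_mono_ae hi2 ?_ (Filter.Eventually.of_forall fun x => ?_)
        · have := hi2.abs
          refine this.congr (Filter.Eventually.of_forall fun x => ?_)
          simp only
          rw [abs_mul, abs_mul, abs_Psi hq, abs_of_pos hq0]; ring
        · refine (le_abs_self _).trans (le_of_eq ?_)
          simp only
          rw [abs_mul, abs_mul, abs_Psi hq, abs_of_pos hq0]; ring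
      have h7 := mul_le_mul_of_nonneg_left h4 hq0.le
      linarith
    · intro s hs
      rw [innerSL_apply_apply, inner_toL2_left hη]
      simp only [hJ]
      rw [← integral_sub (hJi t htm) (hJi s hs)]
      refine integral_mono_ae ((hJi t htm).sub (hJi s hs)) (hη.integrable_mul (Lp.memLp _)) ?_
      filter_upwards [Lp.coeFn_sub (u t) (u s)] with x h1
      rw [h1]
      exact abs_rpow_sub_le hq _ _
  -- The root x ↦ x^(1/q) is not Lipschitz at 0; it is on [ε, ∞), and ε tends to 0 at the end.
  have hkey : ∀ ε > 0, J b ^ q⁻¹ ≤ (J a + ε) ^ q⁻¹ + ∫ t in a..b, ρ t := by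
    intro ε hε
    have hq1 : q⁻¹ ≤ 1 := inv_le_one_of_one_le₀ hq.le
    set r : ℝ → ℝ := fun t => (J t + ε) ^ q⁻¹ with hr
    have hlip : ∀ s ∈ Icc a b, ∀ t ∈ Icc a b,
        |r s - r t| ≤ (ε ^ (q⁻¹ - 1) * (q * R ^ (q - 1))) * ‖u s - u t‖ := by
      have key : ∀ s ∈ Icc a b, ∀ t ∈ Icc a b, J t ≤ J s →
          |r s - r t| ≤ (ε ^ (q⁻¹ - 1) * (q * R ^ (q - 1))) * ‖u s - u t‖ := by
        intro s hs t ht hst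
        have h1 := rpow_sub_rpow_le hq1 hε (show ε ≤ J t + ε by linarith [hJ0 t])
          (show J t + ε ≤ J s + ε by linarith)
        have h2 : 0 ≤ r s - r t := sub_nonneg.2
          (Real.rpow_le_rpow (by linarith [hJ0 t]) (by linarith) (by positivity))
        rw [abs_of_nonneg h2, mul_assoc]
        refine h1.trans ?_
        gcongr
        refine le_trans ?_ (hJlip s hs t ht)
        refine le_trans (le_of_eq ?_) (le_abs_self _)
        ring
      intro s hs t ht
      rcases le_total (J t) (J s) with h | h
      · exact key s hs t ht h
      · rw [abs_sub_comm, norm_sub_rev]; exact key t ht s hs h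
    have hAC := hu.absolutelyContinuous_of_le hab hlip (by positivity)
    have hfin := le_add_integral_of_deriv_le hab hAC hρ (by
      filter_upwards [hder, hF] with t ht hFt r' hr'
      have hpos : 0 < J t + ε := by linarith [hJ0 t]
      have hrpos : 0 < r t := Real.rpow_pos_of_pos hpos _
      have hrq : ∀ s, r s ^ q = J s + ε := fun s => by
        simp only [hr]
        rw [← Real.rpow_mul (by linarith [hJ0 s]), inv_mul_cancel₀ hq0.ne', Real.rpow_one]
      -- J is recovered as r^q − ε, so a derivative of r determines one of J, to which the bound
      -- `hder` applies; no separate differentiability statement for J is required.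
      have h1 : HasDerivAt J (r' * q * r t ^ (q - 1)) t := by
        have := (hr'.rpow_const (p := q) (Or.inl hrpos.ne')).sub_const ε
        refine this.congr_of_eventuallyEq (Filter.Eventually.of_forall fun s => ?_)
        simp only
        rw [hrq]; ring
      have h2 := ht _ h1
      have h3 : J t ^ ((q - 1) / q) ≤ r t ^ (q - 1) := by
        simp only [hr]
        rw [← Real.rpow_mul hpos.le, show q⁻¹ * (q - 1) = (q - 1) / q by ring]
        exact Real.rpow_le_rpow (hJ0 t) (by linarith) (div_nonneg (by linarith) hq0.le)
      have h4 : q * r t ^ (q - 1) * r' ≤ q * r t ^ (q - 1) * ρ t := by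
        have := mul_le_mul_of_nonneg_left (mul_le_mul_of_nonneg_right h3 hFt.1) hq0.le
        linarith
      exact le_of_mul_le_mul_left h4 (by positivity))
    refine le_trans ?_ hfin
    exact Real.rpow_le_rpow (hJ0 b) (by linarith) (by positivity)
  have hlim : Filter.Tendsto (fun ε : ℝ => (J a + ε) ^ q⁻¹ + ∫ t in a..b, ρ t)
      (nhdsWithin 0 (Ioi 0)) (nhds ((J a + 0) ^ q⁻¹ + ∫ t in a..b, ρ t)) := by
    apply tendsto_nhdsWithin_of_tendsto_nhds
    apply Continuous.tendsto
    exact ((continuous_const.add continuous_id).rpow_const fun _ =>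
      Or.inr (by positivity)).add continuous_const
  rw [add_zero] at hlim
  have hfinal : J b ^ q⁻¹ ≤ J a ^ q⁻¹ + ∫ t in a..b, ρ t := by
    refine ge_of_tendsto hlim ?_
    filter_upwards [self_mem_nhdsWithin] with ε hε using hkey ε hε
  rw [hnorm b ⟨hab, le_rfl⟩, hnorm a ⟨le_rfl, hab⟩]
  refine (ENNReal.ofReal_le_ofReal hfinal).trans ENNReal.ofReal_add_le

end Bounds

/-! ### Convergence lemmas -/

section Convergence

open Filter Topology

variable {Ω : Type*} [MeasurableSpace Ω] {μ : Measure Ω} [IsProbabilityMeasure μ]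
  {K : Ω → Ω → ℝ} {κ : ℝ≥0} {Φ Ψ : ℝ → ℝ} {p : ℝ}

/-- The inclusion `L² → L¹`. -/
def toL1 (μ : Measure Ω) [IsProbabilityMeasure μ] : Lp ℝ 2 μ →L[ℝ] Lp ℝ 1 μ :=
  LinearMap.mkContinuous
    { toFun := fun f => ⟨f.1, Lp.antitone (by norm_num) f.2⟩
      map_add' := fun _ _ => rfl
      map_smul' := fun _ _ => rfl } 1 (fun f => by
    rw [one_mul, Lp.norm_def, Lp.norm_def]
    exact ENNReal.toReal_mono (Lp.eLpNorm_ne_top f)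
      (eLpNorm_le_eLpNorm_of_exponent_le (by norm_num) (Lp.aestronglyMeasurable f)))

lemma coeFn_toL1 (f : Lp ℝ 2 μ) : (toL1 μ f : Ω → ℝ) = f := rfl

lemma toL1_injective : Function.Injective (toL1 μ) := fun f g h => by
  apply Lp.ext
  rw [← coeFn_toL1 f, ← coeFn_toL1 g, h]

lemma norm_toL1_le (f : Lp ℝ 2 μ) : ‖toL1 μ f‖ ≤ ‖f‖ := by
  rw [Lp.norm_def, Lp.norm_def]
  exact ENNReal.toReal_mono (Lp.eLpNorm_ne_top f)
      (eLpNorm_le_eLpNorm_of_exponent_le (by norm_num) (Lp.aestronglyMeasurable f))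

/-- A continuous injection between Polish spaces is a measurable embedding (Lusin–Souslin), so
measurability can be pulled back from L¹ to L². -/
lemma aestronglyMeasurable_of_toL1 [MeasurableSpace.CountablyGenerated Ω] {v : ℝ → Lp ℝ 2 μ}
    {ν : Measure ℝ} (hv : AEStronglyMeasurable (fun t => toL1 μ (v t)) ν) :
    AEStronglyMeasurable v ν := by
  have _ : Fact ((2 : ℝ≥0∞) ≠ ⊤) := ⟨by norm_num⟩
  have _ : Fact ((1 : ℝ≥0∞) ≠ ⊤) := ⟨by norm_num⟩
  let _ : MeasurableSpace (Lp ℝ 2 μ) := borel _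
  have _ : BorelSpace (Lp ℝ 2 μ) := ⟨rfl⟩
  let _ : MeasurableSpace (Lp ℝ 1 μ) := borel _
  have _ : BorelSpace (Lp ℝ 1 μ) := ⟨rfl⟩
  have hemb : MeasurableEmbedding (toL1 μ) :=
    (toL1 μ).continuous.measurableEmbedding toL1_injective
  exact (hemb.aemeasurable_comp_iff.1 hv.aemeasurable).aestronglyMeasurable

/-- Truncation at level `k` in `L²`. -/
def clampL2 (μ : Measure Ω) (k : ℕ) : Lp ℝ 2 μ → Lp ℝ 2 μ :=
  ((LipschitzWith.id.const_min (k : ℝ)).const_max (-(k : ℝ))).compLp (by simp)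

lemma coeFn_clampL2 (k : ℕ) (f : Lp ℝ 2 μ) :
    clampL2 μ k f =ᵐ[μ] fun x => max (-(k : ℝ)) (min k (f x)) :=
  LipschitzWith.coeFn_compLp _ _ _

lemma continuous_clampL2 (k : ℕ) : Continuous (clampL2 μ k) := LipschitzWith.continuous_compLp _ _

lemma abs_clamp_le (k : ℕ) (s : ℝ) : |max (-(k : ℝ)) (min k s)| ≤ k := by
  have : (0 : ℝ) ≤ k := k.cast_nonneg
  rw [abs_le]; exact ⟨le_max_left _ _, max_le (by linarith) (min_le_left _ _)⟩

lemma abs_clamp_le_abs (k : ℕ) (s : ℝ) : |max (-(k : ℝ)) (min k s)| ≤ |s| := by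
  have : (0 : ℝ) ≤ k := k.cast_nonneg
  have h1 := le_abs_self s
  have h2 := neg_abs_le s
  have h3 := abs_nonneg s
  rw [abs_le]
  refine ⟨?_, max_le (by linarith) ((min_le_right _ _).trans h1)⟩
  rcases le_total (k : ℝ) s with h | h
  · rw [min_eq_left h, max_eq_right (by linarith)]; linarith
  · rw [min_eq_right h]; exact h2.trans (le_max_right _ _)

lemma norm_clampL2_le (k : ℕ) (f : Lp ℝ 2 μ) : ‖clampL2 μ k f‖ ≤ ‖f‖ := by
  refine Lp.norm_le_norm_of_ae_le ?_
  filter_upwards [coeFn_clampL2 k f] with x hx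
  rw [hx]; exact abs_clamp_le_abs k _

lemma eLpNorm_clampL2_le (k : ℕ) (f : Lp ℝ 2 μ) (q : ℝ≥0∞) :
    eLpNorm (clampL2 μ k f) q μ ≤ eLpNorm f q μ := by
  refine eLpNorm_mono_ae ?_
  filter_upwards [coeFn_clampL2 k f] with x hx
  rw [hx]; exact abs_clamp_le_abs k _

lemma tendsto_clampL2 (f : Lp ℝ 2 μ) : Tendsto (fun k => clampL2 μ k f) atTop (𝓝 f) := by
  rw [Lp.tendsto_Lp_iff_tendsto_eLpNorm']
  have h1 : Tendsto (fun k : ℕ => ∫⁻ x, ‖max (-(k : ℝ)) (min k (f x)) - f x‖ₑ ^ 2 ∂μ) atTop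
      (𝓝 (∫⁻ _, 0 ∂μ)) := by
    refine tendsto_lintegral_of_dominated_convergence' (fun x => (2 * ‖f x‖ₑ) ^ 2) ?_ ?_ ?_ ?_
    · intro k
      have hf := (Lp.aestronglyMeasurable f).aemeasurable
      exact ((aemeasurable_const.max (aemeasurable_const.min hf)).sub hf).enorm.pow_const 2
    · intro k
      refine Eventually.of_forall fun x => ?_
      refine pow_le_pow_left' ((enorm_sub_le).trans ?_) 2
      rw [two_mul]
      gcongr
      exact enorm_le_iff_norm_le.2 (abs_clamp_le_abs k (f x))
    · simp_rw [mul_pow]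
      rw [lintegral_const_mul' _ _ (by norm_num), ← sq_eLpNorm_two]
      exact ENNReal.mul_ne_top (by norm_num) (ENNReal.pow_ne_top (Lp.eLpNorm_ne_top f))
    · refine Eventually.of_forall fun x => ?_
      refine tendsto_const_nhds.congr' ?_
      filter_upwards [eventually_ge_atTop ⌈|f x|⌉₊] with k hk
      have hk' : |f x| ≤ k := (Nat.le_ceil _).trans (by exact_mod_cast hk)
      rw [min_eq_right ((le_abs_self _).trans hk'), max_eq_right (by linarith [neg_abs_le (f x)])]
      simp
  rw [lintegral_zero] at h1
  have h2 : Tendsto (fun k => eLpNorm (fun x => clampL2 μ k f x - f x) 2 μ ^ 2) atTop (𝓝 0) := by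
    refine h1.congr fun k => ?_
    rw [sq_eLpNorm_two]
    refine lintegral_congr_ae ?_
    filter_upwards [coeFn_clampL2 k f] with x hx
    rw [hx]
  have h3 := (ENNReal.continuous_rpow_const (y := (2 : ℝ)⁻¹)).continuousAt.tendsto.comp h2
  simp only [ENNReal.zero_rpow_of_pos (by norm_num : (0 : ℝ) < 2⁻¹)] at h3
  refine h3.congr fun k => ?_
  simp only [Function.comp]
  rw [← ENNReal.rpow_natCast, ← ENNReal.rpow_mul]; norm_num; rfl

lemma eLpNorm_le_of_tendsto_L2 {w : ℕ → Lp ℝ 2 μ} {w' : Lp ℝ 2 μ}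
    (h : Tendsto w atTop (𝓝 w')) {q C : ℝ≥0∞} (hb : ∀ k, eLpNorm (w k) q μ ≤ C) :
    eLpNorm w' q μ ≤ C :=
  eLpNorm_le_of_tendstoInMeasure (Eventually.of_forall hb) (tendstoInMeasure_of_tendsto_Lp h)
    fun k => Lp.aestronglyMeasurable (w k)

lemma SymmKernel.memLp_two (hK : SymmKernel μ K κ) :
    MemLp (fun z : Ω × Ω => K z.1 z.2) 2 (μ.prod μ) := by
  refine ⟨hK.aestronglyMeasurable, ?_⟩
  have : eLpNorm (fun z : Ω × Ω => K z.1 z.2) 2 (μ.prod μ) ^ 2 ≤ (κ : ℝ≥0∞) ^ 2 := by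
    rw [sq_eLpNorm_two_prod hK.aestronglyMeasurable]
    refine (lintegral_mono_ae (g := fun _ => (κ : ℝ≥0∞) ^ 2) ?_).trans (by simp)
    filter_upwards [hK.bounded] with x hx
    exact pow_le_pow_left' hx 2
  exact (pow_two_le_imp this).trans_lt ENNReal.coe_lt_top

/-- The factors Ψ(w_k(y) − w_k(x)) are only known to be bounded in L². Since K ∈ L²(Ω²), the
integral of the product over a set s is at most ‖K 1_s‖ D, which makes the products uniformly
integrable. Vitali's theorem along almost everywhere convergent subsequences then gives convergence
in L¹. -/
lemma tendsto_eLpNorm_kernel_mul (hK : SymmKernel μ K κ) (hΨ : Continuous Ψ)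
    {w : ℕ → Lp ℝ 2 μ} {w' : Lp ℝ 2 μ} (h : Tendsto w atTop (𝓝 w')) {D : ℝ≥0}
    (hD : ∀ k, eLpNorm (fun z : Ω × Ω => Ψ (w k z.2 - w k z.1)) 2 (μ.prod μ) ≤ D)
    (hD' : eLpNorm (fun z : Ω × Ω => Ψ (w' z.2 - w' z.1)) 2 (μ.prod μ) ≤ D) :
    Tendsto (fun k => eLpNorm (fun z : Ω × Ω => K z.1 z.2 * Ψ (w k z.2 - w k z.1) -
      K z.1 z.2 * Ψ (w' z.2 - w' z.1)) 1 (μ.prod μ)) atTop (𝓝 0) := by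
  have hmeas : ∀ f : Lp ℝ 2 μ, AEStronglyMeasurable (fun z : Ω × Ω => Ψ (f z.2 - f z.1))
      (μ.prod μ) := fun f =>
    hΨ.comp_aestronglyMeasurable (aestronglyMeasurable_diff (Lp.aestronglyMeasurable f))
  refine tendsto_of_subseq_tendsto fun ns hns => ?_
  obtain ⟨ms, -, hms⟩ := (tendstoInMeasure_of_tendsto_Lp (h.comp hns)).exists_seq_tendsto_ae
  refine ⟨ms, ?_⟩
  refine tendsto_Lp_finite_of_tendsto_ae le_rfl (by norm_num)
    (f := fun k (z : Ω × Ω) => K z.1 z.2 * Ψ (w (ns (ms k)) z.2 - w (ns (ms k)) z.1))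
    (g := fun z => K z.1 z.2 * Ψ (w' z.2 - w' z.1))
    (fun k => hK.aestronglyMeasurable.mul (hmeas _)) ?_ ?_ ?_
  · exact memLp_one_iff_integrable.2 (integrable_kernel_mul hK
      ⟨hmeas _, hD'.trans_lt ENNReal.coe_lt_top⟩)
  · intro ε hε
    obtain ⟨δ, hδ, hδ'⟩ := hK.memLp_two.eLpNorm_indicator_le (by norm_num) (by norm_num)
      (show 0 < ε / (D + 1) by positivity)
    refine ⟨δ, hδ, fun k s hs hμs => ?_⟩
    have h1 := hδ' s hs hμs
    have h2 : (s.indicator fun z : Ω × Ω =>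
        K z.1 z.2 * Ψ (w (ns (ms k)) z.2 - w (ns (ms k)) z.1)) =
        fun z => s.indicator (fun z : Ω × Ω => K z.1 z.2) z *
          Ψ (w (ns (ms k)) z.2 - w (ns (ms k)) z.1) := by
      ext z; by_cases hz : z ∈ s <;> simp [hz]
    rw [eLpNorm_one_eq_lintegral_enorm, h2]
    refine (lintegral_enorm_mul_le (hK.aestronglyMeasurable.indicator hs) (hmeas _)).trans ?_
    refine (mul_le_mul' h1 (hD _)).trans ?_
    rw [← ENNReal.ofReal_coe_nnreal, ← ENNReal.ofReal_mul (by positivity)]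
    apply ENNReal.ofReal_le_ofReal
    rw [div_mul_eq_mul_div, div_le_iff₀ (by positivity)]
    nlinarith [D.coe_nonneg]
  · have h1 := Measure.quasiMeasurePreserving_snd (μ := μ) (ν := μ).ae hms
    have h2 := Measure.quasiMeasurePreserving_fst (μ := μ) (ν := μ).ae hms
    filter_upwards [h1, h2] with z hz1 hz2
    exact ((hΨ.tendsto _).comp (hz1.sub hz2)).const_mul _

/-- Because |Ψ(s)| = |s|^(p−1), square integrability of Ψ(w(y) − w(x)) asks for w ∈ L^(2(p−1)). This
is where the exponent q of the data comes from. -/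
lemma eLpNorm_Psi_diff_le (hp : 1 < p) {q : ℝ≥0∞} (hq1 : 1 ≤ q)
    (hq : 2 * ENNReal.ofReal (p - 1) ≤ q) {w : Ω → ℝ} (hw : AEStronglyMeasurable w μ) :
    eLpNorm (fun z : Ω × Ω => Psi p (w z.2 - w z.1)) 2 (μ.prod μ) ≤
      (2 * eLpNorm w q μ) ^ (p - 1) := by
  have h1 : eLpNorm (fun z : Ω × Ω => Psi p (w z.2 - w z.1)) 2 (μ.prod μ) =
      eLpNorm (fun z : Ω × Ω => ‖w z.2 - w z.1‖ ^ (p - 1)) 2 (μ.prod μ) := by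
    refine eLpNorm_congr_norm_ae (Eventually.of_forall fun z => ?_)
    simp only [Real.norm_eq_abs, abs_Psi hp]
    exact (abs_of_nonneg (Real.rpow_nonneg (abs_nonneg _) _)).symm
  rw [h1, eLpNorm_norm_rpow _ (by linarith)]
  refine ENNReal.rpow_le_rpow ?_ (by linarith)
  exact (eLpNorm_le_eLpNorm_of_exponent_le hq (aestronglyMeasurable_diff hw)).trans
    (eLpNorm_diff_le hq1 hw)

lemma memLp_Psi_diff (hp : 1 < p) {q : ℝ≥0∞} (hq1 : 1 ≤ q)
    (hq : 2 * ENNReal.ofReal (p - 1) ≤ q) {w : Ω → ℝ} (hw : MemLp w q μ) :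
    MemLp (fun z : Ω × Ω => Psi p (w z.2 - w z.1)) 2 (μ.prod μ) :=
  ⟨(oddMono_Psi hp).continuous.comp_aestronglyMeasurable (aestronglyMeasurable_diff hw.1),
    (eLpNorm_Psi_diff_le hp hq1 hq hw.1).trans_lt (ENNReal.rpow_lt_top_of_nonneg (by linarith)
      (ENNReal.mul_ne_top (by norm_num) hw.2.ne))⟩

lemma norm_toL2_nonlocal_sub_le_of_approx (hK : SymmKernel μ K κ) {R η : ℝ} (hη : 0 ≤ η)
    (happ : ∀ s, |s| ≤ 2 * R → |Φ s - Ψ s| ≤ η) {w : Lp ℝ 2 μ} (hw : ∀ᵐ x ∂μ, |w x| ≤ R)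
    (hG : MemLp (fun z : Ω × Ω => Φ (w z.2 - w z.1)) 2 (μ.prod μ))
    (hG' : MemLp (fun z : Ω × Ω => Ψ (w z.2 - w z.1)) 2 (μ.prod μ)) :
    ‖toL2 μ (nonlocal μ K Φ w) - toL2 μ (nonlocal μ K Ψ w)‖ ≤ κ * η := by
  have hsub : MemLp (fun x => nonlocal μ K Φ w x - nonlocal μ K Ψ w x) 2 μ :=
    (memLp_nonlocal hK hG).sub (memLp_nonlocal hK hG')
  rw [toL2_sub (memLp_nonlocal hK hG) (memLp_nonlocal hK hG'), norm_toL2 hsub]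
  have e1 : (fun x => nonlocal μ K Φ w x - nonlocal μ K Ψ w x) =ᵐ[μ]
      fun x => ∫ y, K x y * (Φ (w y - w x) - Ψ (w y - w x)) ∂μ := by
    filter_upwards [(integrable_kernel_mul hK hG).prod_right_ae,
      (integrable_kernel_mul hK hG').prod_right_ae] with x hx1 hx2
    simp only [nonlocal, mul_sub]
    rw [integral_sub hx1 hx2]
  refine ENNReal.toReal_le_of_le_ofReal (by positivity) ?_
  rw [eLpNorm_congr_ae e1]
  refine (eLpNorm_integral_mul_le (F := fun z => K z.1 z.2)
    (G := fun z => Φ (w z.2 - w z.1) - Ψ (w z.2 - w z.1))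
    hK.aestronglyMeasurable (hG.sub hG').1 hK.bounded).trans ?_
  rw [ENNReal.ofReal_mul (by positivity), ENNReal.ofReal_coe_nnreal]
  gcongr
  refine (eLpNorm_le_of_ae_bound (C := η) ?_).trans (by simp)
  have h1 := Measure.quasiMeasurePreserving_snd (μ := μ) (ν := μ).ae hw
  have h2 := Measure.quasiMeasurePreserving_fst (μ := μ) (ν := μ).ae hw
  filter_upwards [h1, h2] with z hz1 hz2
  refine happ _ ((abs_sub _ _).trans ?_)
  linarith

end Convergence

/-! ### Existence of solutions -/

section Existence

open Filter Topology

variable {Ω : Type*} [MeasurableSpace Ω] {μ : Measure Ω} [IsProbabilityMeasure μ]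
  {K : Ω → Ω → ℝ} {κ : ℝ≥0} {p T : ℝ} {g : Lp ℝ 2 μ} {F : ℝ → Lp ℝ 2 μ} {Q : ℝ≥0∞}

lemma eLpNorm_top_le_iff {w : Ω → ℝ} {m : ℝ} (hm : 0 ≤ m) :
    eLpNorm w ⊤ μ ≤ ENNReal.ofReal m ↔ ∀ᵐ x ∂μ, |w x| ≤ m := by
  constructor
  · intro h
    rw [eLpNorm_exponent_top] at h
    filter_upwards [enorm_ae_le_eLpNormEssSup w μ] with x hx
    have := hx.trans h
    rw [Real.enorm_eq_ofReal_abs, ENNReal.ofReal_le_ofReal_iff hm] at this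
    exact this
  · intro h
    rw [eLpNorm_exponent_top]
    exact eLpNormEssSup_le_of_ae_bound h

lemma intervalIntegrable_clampL2 (hF : IntervalIntegrable F volume 0 T) (k : ℕ) :
    IntervalIntegrable (fun t => clampL2 μ k (F t)) volume 0 T :=
  hF.mono_fun ((continuous_clampL2 k).comp_aestronglyMeasurable hF.aestronglyMeasurable_restrict_uIoc)
    (Eventually.of_forall fun _ => norm_clampL2_le k _)

lemma norm_toL2_nonlocal_Psi_le (hp : 1 < p) (hK : SymmKernel μ K κ) (hQ1 : 1 ≤ Q)
    (hQp : 2 * ENNReal.ofReal (p - 1) ≤ Q) {w : Lp ℝ 2 μ} {M : ℝ} (hM : 0 ≤ M)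
    (hw : eLpNorm w Q μ ≤ ENNReal.ofReal M) :
    ‖toL2 μ (nonlocal μ K (Psi p) w)‖ ≤ κ * (2 * M) ^ (p - 1) := by
  have hm : MemLp w Q μ := ⟨Lp.aestronglyMeasurable w, hw.trans_lt ENNReal.ofReal_lt_top⟩
  have hG := memLp_Psi_diff hp hQ1 hQp hm
  rw [norm_toL2 (memLp_nonlocal hK hG)]
  refine ENNReal.toReal_le_of_le_ofReal (by positivity) ((eLpNorm_nonlocal_le hK hG).trans ?_)
  rw [ENNReal.ofReal_mul (by positivity), ENNReal.ofReal_coe_nnreal]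
  gcongr
  refine (eLpNorm_Psi_diff_le hp hQ1 hQp hm.1).trans ?_
  rw [← ENNReal.ofReal_rpow_of_nonneg (by positivity) (by linarith),
    ENNReal.ofReal_mul (by norm_num), ENNReal.ofReal_ofNat]
  gcongr

/-- Data truncated at level k force |u| ≤ k + kT, so Φ has to be close to Ψ only on the differences
of modulus at most 2(k + kT). Exchanging Φ for Ψ in the equation then costs a residual r of norm at
most κ/(k+1). Truncation does not increase norms, so the bound in L^Q does not see k. -/
lemma exists_approximate_solution (hp : 1 < p) (hK : SymmKernel μ K κ) (hT : 0 ≤ T)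
    (hF : IntervalIntegrable F volume 0 T) (hQ2 : 2 ≤ Q)
    (hQp : 2 * ENNReal.ofReal (p - 1) ≤ Q) {M₀ : ℝ≥0} (hg : eLpNorm g Q μ ≤ M₀) {ρ : ℝ → ℝ}
    (hρ : IntervalIntegrable ρ volume 0 T)
    (hFQ : ∀ᵐ t ∂volume.restrict (Ioo 0 T), 0 ≤ ρ t ∧ eLpNorm (F t) Q μ ≤ ENNReal.ofReal (ρ t))
    (k : ℕ) :
    ∃ u r : ℝ → Lp ℝ 2 μ, u 0 = clampL2 μ k g ∧
      IsPrimitive u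
        (fun t => toL2 μ (nonlocal μ K (Psi p) (u t)) + clampL2 μ k (F t) + r t) 0 T ∧
      (∀ t ∈ Icc 0 T, ‖r t‖ ≤ κ * (1 / (k + 1))) ∧
      ∀ t ∈ Icc 0 T, eLpNorm (u t) Q μ ≤ M₀ + ENNReal.ofReal (∫ s in (0 : ℝ)..t, ρ s) := by
  have hk0 : (0 : ℝ) ≤ k := k.cast_nonneg
  obtain ⟨Φ, hΦ, ⟨c, hc⟩, ⟨B, hB⟩, happ⟩ := exists_lipschitz_approx_Psi hp
    (R := 2 * (k + k * T)) (by positivity) (show (0 : ℝ) < 1 / (k + 1) by positivity)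
  obtain ⟨u, hu0, hu⟩ := exists_regularized_solution hK hc hB hT (clampL2 μ k g)
    (intervalIntegrable_clampL2 hF k)
  have hv : ∀ t, (toL2 μ (nonlocal μ K Φ (u t)) + clampL2 μ k (F t) : Lp ℝ 2 μ) =ᵐ[μ]
      fun x => nonlocal μ K Φ (u t) x + clampL2 μ k (F t) x := by
    intro t
    have hG := memLp_comp_diff_of_bound hΦ.continuous hB (Lp.aestronglyMeasurable (u t)) 2
    filter_upwards [Lp.coeFn_add (toL2 μ (nonlocal μ K Φ (u t))) (clampL2 μ k (F t)),
      coeFn_toL2 (memLp_nonlocal hK hG)] with x h1 h2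
    rw [h1, Pi.add_apply, h2]
  have hbound : ∀ t ∈ Icc 0 T, ∀ᵐ x ∂μ, |u t x| ≤ k + k * T := by
    intro t ht
    have := ae_abs_le_of_isPrimitive (F := fun t => clampL2 μ k (F t)) (ρ := fun _ => k) (m := k)
      hK hΦ hB ht.1 (hu.mono le_rfl ht.1 ht.2) (Eventually.of_forall hv) intervalIntegrable_const
      ?_ ?_
    · filter_upwards [this] with x hx
      refine hx.trans ?_
      rw [intervalIntegral.integral_const, smul_eq_mul, sub_zero]
      nlinarith [ht.2]
    · refine Eventually.of_forall fun s => ?_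
      filter_upwards [coeFn_clampL2 k (F s)] with x hx
      rw [hx]; exact abs_clamp_le k _
    · rw [hu0]
      filter_upwards [coeFn_clampL2 k g] with x hx
      rw [hx]; exact abs_clamp_le k _
  have hQb : ∀ t ∈ Icc 0 T,
      eLpNorm (u t) Q μ ≤ M₀ + ENNReal.ofReal (∫ s in (0 : ℝ)..t, ρ s) := by
    intro t ht
    have hsub : Ioo 0 t ⊆ Ioo 0 T := Ioo_subset_Ioo le_rfl ht.2
    have hρt : IntervalIntegrable ρ volume 0 t := hρ.mono_set (by
      rw [uIcc_of_le ht.1, uIcc_of_le hT]; exact Icc_subset_Icc le_rfl ht.2)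
    have hFQt := ae_restrict_of_ae_restrict_of_subset hsub hFQ
    have hg' : eLpNorm (u 0) Q μ ≤ M₀ := by
      rw [hu0]; exact (eLpNorm_clampL2_le k g Q).trans hg
    have hI : 0 ≤ ∫ s in (0 : ℝ)..t, ρ s := by
      rw [intervalIntegral.integral_of_le ht.1, integral_Ioc_eq_integral_Ioo]
      exact integral_nonneg_of_ae (by filter_upwards [hFQt] with s hs using hs.1)
    rcases eq_or_ne Q ⊤ with rfl | hQt
    · rw [← ENNReal.ofReal_coe_nnreal, ← ENNReal.ofReal_add (by positivity) hI,
        eLpNorm_top_le_iff (by positivity)]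
      refine ae_abs_le_of_isPrimitive (F := fun t => clampL2 μ k (F t)) hK hΦ hB ht.1
        (hu.mono le_rfl ht.1 ht.2) (Eventually.of_forall hv) hρt ?_ ?_
      · filter_upwards [hFQt] with s hs
        rw [← eLpNorm_top_le_iff hs.1]
        exact (eLpNorm_clampL2_le k _ _).trans hs.2
      · rw [← eLpNorm_top_le_iff M₀.coe_nonneg, ENNReal.ofReal_coe_nnreal]
        exact hg'
    · have hQr : Q = ENNReal.ofReal Q.toReal := (ENNReal.ofReal_toReal hQt).symm
      have hq1 : 1 < Q.toReal := by
        have := ENNReal.toReal_mono hQt hQ2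
        simp only [ENNReal.toReal_ofNat] at this
        linarith
      rw [hQr] at hg' ⊢
      refine (eLpNorm_le_of_isPrimitive (F := fun t => clampL2 μ k (F t)) hK hΦ hB ht.1
        (hu.mono le_rfl ht.1 ht.2) (Eventually.of_forall hv) hq1 (R := k + k * T)
        (fun s hs => hbound s ⟨hs.1, hs.2.trans ht.2⟩) hρt ?_).trans (by gcongr)
      filter_upwards [hFQt] with s hs
      rw [← hQr]
      exact ⟨hs.1, (eLpNorm_clampL2_le k _ _).trans hs.2⟩
  refine ⟨u, fun t => toL2 μ (nonlocal μ K Φ (u t)) - toL2 μ (nonlocal μ K (Psi p) (u t)), hu0,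
    ?_, fun t ht => ?_, hQb⟩
  · refine hu.congr_deriv hT (Eventually.of_forall fun t => ?_)
    have : ∀ a b c : Lp ℝ 2 μ, a + c = b + c + (a - b) := fun a b c => by abel
    exact this _ _ _
  · refine norm_toL2_nonlocal_sub_le_of_approx hK (by positivity) happ (hbound t ht)
      (memLp_comp_diff_of_bound hΦ.continuous hB (Lp.aestronglyMeasurable (u t)) 2)
      (memLp_Psi_diff hp (le_trans (by norm_num) hQ2) hQp
        ⟨Lp.aestronglyMeasurable _, (hQb t ht).trans_lt ?_⟩)
    exact ENNReal.add_lt_top.2 ⟨ENNReal.coe_lt_top, ENNReal.ofReal_lt_top⟩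

lemma inner_toL2_nonlocal_sub_nonpos (hK : SymmKernel μ K κ) {Φ : ℝ → ℝ} (hΦ : OddMono Φ)
    {w w' : Lp ℝ 2 μ} (hG : MemLp (fun z : Ω × Ω => Φ (w z.2 - w z.1)) 2 (μ.prod μ))
    (hG' : MemLp (fun z : Ω × Ω => Φ (w' z.2 - w' z.1)) 2 (μ.prod μ)) :
    inner ℝ (w - w') (toL2 μ (nonlocal μ K Φ w) - toL2 μ (nonlocal μ K Φ w')) ≤ 0 := by
  refine le_trans (le_of_eq ?_)
    (integral_nonlocal_sub_mul_sub_nonpos hK hΦ (Lp.memLp w) (Lp.memLp w') hG hG')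
  rw [inner_eq_integral]
  refine integral_congr_ae ?_
  filter_upwards [Lp.coeFn_sub w w', coeFn_toL2 (memLp_nonlocal hK hG),
    coeFn_toL2 (memLp_nonlocal hK hG'), Lp.coeFn_sub (toL2 μ (nonlocal μ K Φ w))
      (toL2 μ (nonlocal μ K Φ w'))] with x h1 h2 h3 h4
  rw [h1, h4, Pi.sub_apply, Pi.sub_apply, h2, h3, mul_comm]

/-- Solutions of perturbed equations depend continuously on the data. -/
lemma norm_sub_le_of_isPrimitive (hK : SymmKernel μ K κ) {Φ : ℝ → ℝ} (hΦ : OddMono Φ) (hT : 0 ≤ T)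
    {u u' F F' : ℝ → Lp ℝ 2 μ}
    (hu : IsPrimitive u (fun t => toL2 μ (nonlocal μ K Φ (u t)) + F t) 0 T)
    (hu' : IsPrimitive u' (fun t => toL2 μ (nonlocal μ K Φ (u' t)) + F' t) 0 T)
    (hG : ∀ t ∈ Icc 0 T, MemLp (fun z : Ω × Ω => Φ (u t z.2 - u t z.1)) 2 (μ.prod μ))
    (hG' : ∀ t ∈ Icc 0 T, MemLp (fun z : Ω × Ω => Φ (u' t z.2 - u' t z.1)) 2 (μ.prod μ))
    {ψ : ℝ → ℝ} (hψ : IntervalIntegrable ψ volume 0 T)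
    (hψF : ∀ t ∈ Icc 0 T, ‖F t - F' t‖ ≤ ψ t) :
    ‖u T - u' T‖ ≤ ‖u 0 - u' 0‖ + ∫ t in (0 : ℝ)..T, ψ t := by
  have h := (hu.sub hu').norm_le_sqrt_add_integral hT (β := 0) le_rfl hψ (by
    filter_upwards [ae_restrict_mem measurableSet_Ioo] with t ht
    have htm := Ioo_subset_Icc_self ht
    refine ⟨(norm_nonneg _).trans (hψF t htm), ?_⟩
    rw [show toL2 μ (nonlocal μ K Φ (u t)) + F t - (toL2 μ (nonlocal μ K Φ (u' t)) + F' t) =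
      (toL2 μ (nonlocal μ K Φ (u t)) - toL2 μ (nonlocal μ K Φ (u' t))) + (F t - F' t) by abel,
      inner_add_right]
    have h1 := inner_toL2_nonlocal_sub_nonpos hK hΦ (hG t htm) (hG' t htm)
    have h2 := real_inner_le_norm (u t - u' t) (F t - F' t)
    have h3 := mul_le_mul_of_nonneg_left (hψF t htm) (norm_nonneg (u t - u' t))
    linarith)
  simpa [Real.sqrt_sq (norm_nonneg _)] using h

/-- Dissipativity makes the approximate solutions Cauchy in L², uniformly in time, with defects
given by the truncation errors and the residuals. At the critical exponent Q = 2(p−1) the nonlinear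
term is merely bounded in L², so the limit in the equation is taken in L¹ and brought back by
injectivity of the inclusion. The L^Q bound survives because norms are lower semicontinuous. -/
theorem exists_solution [MeasurableSpace.CountablyGenerated Ω] (hp : 1 < p)
    (hK : SymmKernel μ K κ) (hT : 0 ≤ T) (g : Lp ℝ 2 μ)
    (hF : IntervalIntegrable F volume 0 T) (hQ2 : 2 ≤ Q)
    (hQp : 2 * ENNReal.ofReal (p - 1) ≤ Q) {M₀ : ℝ≥0} (hg : eLpNorm g Q μ ≤ M₀) {ρ : ℝ → ℝ}
    (hρ : IntervalIntegrable ρ volume 0 T)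
    (hFQ : ∀ᵐ t ∂volume.restrict (Ioo 0 T),
      0 ≤ ρ t ∧ eLpNorm (F t) Q μ ≤ ENNReal.ofReal (ρ t)) :
    ∃ u : ℝ → Lp ℝ 2 μ, u 0 = g ∧
      IsPrimitive u (fun t => toL2 μ (nonlocal μ K (Psi p) (u t)) + F t) 0 T ∧
      ∀ t ∈ Icc 0 T, eLpNorm (u t) Q μ ≤ M₀ + ENNReal.ofReal (∫ s in (0 : ℝ)..T, ρ s) := by
  choose u r hu0 hu hr hQb' using exists_approximate_solution hp hK hT hF hQ2 hQp hg hρ hFQ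
  have hQ1 : 1 ≤ Q := le_trans (by norm_num) hQ2
  have hsubT : ∀ {t}, t ∈ Icc 0 T → uIcc 0 t ⊆ uIcc 0 T := fun {t} ht => by
    rw [uIcc_of_le ht.1, uIcc_of_le hT]; exact Icc_subset_Icc le_rfl ht.2
  have hρ0 : ∀ᵐ t ∂volume.restrict (Ioc 0 T), 0 ≤ ρ t := by
    rw [← Measure.restrict_congr_set Ioo_ae_eq_Ioc]
    filter_upwards [hFQ] with s hs using hs.1
  have hIρ0 : 0 ≤ ∫ s in (0 : ℝ)..T, ρ s := by
    rw [intervalIntegral.integral_of_le hT]; exact integral_nonneg_of_ae hρ0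
  have hIρ : ∀ t ∈ Icc 0 T, ∫ s in (0 : ℝ)..t, ρ s ≤ ∫ s in (0 : ℝ)..T, ρ s := fun t ht =>
    intervalIntegral.integral_mono_interval le_rfl ht.1 ht.2 hρ0 hρ
  set M : ℝ := M₀ + ∫ s in (0 : ℝ)..T, ρ s with hM
  have hM0 : 0 ≤ M := by positivity
  have hMe : (M₀ : ℝ≥0∞) + ENNReal.ofReal (∫ s in (0 : ℝ)..T, ρ s) = ENNReal.ofReal M := by
    rw [hM, ENNReal.ofReal_add (by positivity) hIρ0, ENNReal.ofReal_coe_nnreal]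
  have hQb : ∀ k, ∀ t ∈ Icc 0 T, eLpNorm (u k t) Q μ ≤ ENNReal.ofReal M := fun k t ht =>
    (hQb' k t ht).trans (by rw [← hMe]; gcongr; exact hIρ t ht)
  have hmem : ∀ k, ∀ t ∈ Icc 0 T, MemLp (u k t) Q μ := fun k t ht =>
    ⟨Lp.aestronglyMeasurable _, (hQb k t ht).trans_lt ENNReal.ofReal_lt_top⟩
  -- the approximations form a Cauchy sequence
  set e : ℕ → ℝ := fun k => ‖clampL2 μ k g - g‖ + (∫ t in (0 : ℝ)..T, ‖clampL2 μ k (F t) - F t‖) +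
    T * (κ * (1 / (k + 1))) with he
  have hdist : ∀ k l, ∀ t ∈ Icc 0 T, ‖u k t - u l t‖ ≤ e k + e l := by
    intro k l t ht
    have hFi : ∀ k, IntervalIntegrable (fun t => ‖clampL2 μ k (F t) - F t‖) volume 0 T :=
      fun k => ((intervalIntegrable_clampL2 hF k).sub hF).norm
    set ψ : ℝ → ℝ := fun t => (‖clampL2 μ k (F t) - F t‖ + κ * (1 / (k + 1))) +
      (‖clampL2 μ l (F t) - F t‖ + κ * (1 / (l + 1))) with hψ
    have hψi : IntervalIntegrable ψ volume 0 T :=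
      ((hFi k).add intervalIntegrable_const).add ((hFi l).add intervalIntegrable_const)
    have h1 := norm_sub_le_of_isPrimitive (F := fun t => clampL2 μ k (F t) + r k t)
      (F' := fun t => clampL2 μ l (F t) + r l t) (ψ := ψ) hK (oddMono_Psi hp) ht.1
      (by simpa only [add_assoc] using (hu k).mono le_rfl ht.1 ht.2)
      (by simpa only [add_assoc] using (hu l).mono le_rfl ht.1 ht.2)
      (fun s hs => memLp_Psi_diff hp hQ1 hQp (hmem k s ⟨hs.1, hs.2.trans ht.2⟩))
      (fun s hs => memLp_Psi_diff hp hQ1 hQp (hmem l s ⟨hs.1, hs.2.trans ht.2⟩))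
      (hψi.mono_set (hsubT ht)) (fun s hs => by
        have hsT : s ∈ Icc 0 T := ⟨hs.1, hs.2.trans ht.2⟩
        have e1 : clampL2 μ k (F s) + r k s - (clampL2 μ l (F s) + r l s) =
          ((clampL2 μ k (F s) - F s) + r k s) - ((clampL2 μ l (F s) - F s) + r l s) := by abel
        rw [e1]
        refine (norm_sub_le _ _).trans (add_le_add ?_ ?_)
        · exact (norm_add_le _ _).trans (add_le_add le_rfl (hr k s hsT))
        · exact (norm_add_le _ _).trans (add_le_add le_rfl (hr l s hsT)))
    have h2 : ∫ s in (0 : ℝ)..t, ψ s ≤ ∫ s in (0 : ℝ)..T, ψ s :=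
      intervalIntegral.integral_mono_interval le_rfl ht.1 ht.2
        (Eventually.of_forall fun s => by simp only [hψ, Pi.zero_apply]; positivity) hψi
    have h3 : ∫ s in (0 : ℝ)..T, ψ s =
        ((∫ t in (0 : ℝ)..T, ‖clampL2 μ k (F t) - F t‖) + T * (κ * (1 / (k + 1)))) +
        ((∫ t in (0 : ℝ)..T, ‖clampL2 μ l (F t) - F t‖) + T * (κ * (1 / (l + 1)))) := by
      simp only [hψ]
      rw [intervalIntegral.integral_add ((hFi k).add intervalIntegrable_const)
        ((hFi l).add intervalIntegrable_const), intervalIntegral.integral_add (hFi k)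
        intervalIntegrable_const, intervalIntegral.integral_add (hFi l) intervalIntegrable_const]
      simp only [intervalIntegral.integral_const, smul_eq_mul, sub_zero]
    have h4 : ‖u k 0 - u l 0‖ ≤ ‖clampL2 μ k g - g‖ + ‖clampL2 μ l g - g‖ := by
      rw [hu0, hu0, show clampL2 μ k g - clampL2 μ l g =
        (clampL2 μ k g - g) - (clampL2 μ l g - g) by abel]
      exact norm_sub_le _ _
    simp only [he]
    linarith
  have hinv : Tendsto (fun k : ℕ => κ * (1 / ((k : ℝ) + 1))) atTop (𝓝 0) := by
    simpa using tendsto_one_div_add_atTop_nhds_zero_nat.const_mul (κ : ℝ)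
  have he0 : Tendsto e atTop (𝓝 0) := by
    have h1 : Tendsto (fun k => ‖clampL2 μ k g - g‖) atTop (𝓝 0) :=
      tendsto_iff_norm_sub_tendsto_zero.1 (tendsto_clampL2 g)
    have h2 : Tendsto (fun k => ∫ t in (0 : ℝ)..T, ‖clampL2 μ k (F t) - F t‖) atTop
        (𝓝 (∫ t in (0 : ℝ)..T, (0 : ℝ))) := by
      refine intervalIntegral.tendsto_integral_filter_of_dominated_convergence
        (fun t => 2 * ‖F t‖) (Eventually.of_forall fun k => ?_) (Eventually.of_forall fun k => ?_)
        (hF.norm.const_mul 2) ?_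
      · exact ((intervalIntegrable_clampL2 hF k).sub hF).norm.aestronglyMeasurable_restrict_uIoc
      · refine Eventually.of_forall fun t _ => ?_
        rw [norm_norm]
        refine (norm_sub_le _ _).trans ?_
        have := norm_clampL2_le k (F t)
        linarith
      · exact Eventually.of_forall fun t _ =>
          tendsto_iff_norm_sub_tendsto_zero.1 (tendsto_clampL2 (F t))
    rw [intervalIntegral.integral_zero] at h2
    have h3 : Tendsto (fun k : ℕ => T * (κ * (1 / ((k : ℝ) + 1)))) atTop (𝓝 0) := by
      simpa using hinv.const_mul T
    have := (h1.add h2).add h3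
    simp only [add_zero] at this
    exact this
  -- Membership in [0,T] sits inside the existential, so that the choice yields a curve on all of ℝ.
  have hlim : ∀ t, ∃ y, t ∈ Icc 0 T → Tendsto (fun k => u k t) atTop (𝓝 y) := by
    intro t
    by_cases ht : t ∈ Icc 0 T
    · have hc : CauchySeq fun k => u k t := by
        refine Metric.cauchySeq_iff.2 fun ε hε => ?_
        obtain ⟨N, hN⟩ := (he0.eventually (gt_mem_nhds (half_pos hε))).exists_forall_of_atTop
        refine ⟨N, fun m hm n hn => ?_⟩
        rw [dist_eq_norm]
        exact (hdist m n t ht).trans_lt (by linarith [hN m hm, hN n hn])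
      obtain ⟨y, hy⟩ := cauchySeq_tendsto_of_complete hc
      exact ⟨y, fun _ => hy⟩
    · exact ⟨0, fun h => absurd h ht⟩
  choose U hU using hlim
  have hUQ : ∀ t ∈ Icc 0 T, eLpNorm (U t) Q μ ≤ ENNReal.ofReal M := fun t ht =>
    eLpNorm_le_of_tendsto_L2 (hU t ht) fun k => hQb k t ht
  have h0m : (0 : ℝ) ∈ Icc 0 T := ⟨le_rfl, hT⟩
  have hU0 : U 0 = g := by
    refine tendsto_nhds_unique (hU 0 h0m) ?_
    simp_rw [hu0]
    exact tendsto_clampL2 g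
  have hGb : ∀ {w : Lp ℝ 2 μ}, eLpNorm w Q μ ≤ ENNReal.ofReal M →
      eLpNorm (fun z : Ω × Ω => Psi p (w z.2 - w z.1)) 2 (μ.prod μ) ≤
        (((2 * M) ^ (p - 1)).toNNReal : ℝ≥0) := by
    intro w hw
    refine (eLpNorm_Psi_diff_le hp hQ1 hQp (Lp.aestronglyMeasurable w)).trans ?_
    change _ ≤ ENNReal.ofReal _
    rw [← ENNReal.ofReal_rpow_of_nonneg (by positivity) (by linarith),
      ENNReal.ofReal_mul (by norm_num), ENNReal.ofReal_ofNat]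
    gcongr
  set vk : ℕ → ℝ → Lp ℝ 2 μ := fun k t =>
    toL2 μ (nonlocal μ K (Psi p) (u k t)) + clampL2 μ k (F t) + r k t with hvk
  set V : ℝ → Lp ℝ 2 μ := fun t => toL2 μ (nonlocal μ K (Psi p) (U t)) + F t with hV
  have hconv : ∀ t ∈ Icc 0 T, Tendsto (fun k => toL1 μ (vk k t)) atTop (𝓝 (toL1 μ (V t))) := by
    intro t ht
    have h1 : Tendsto (fun k => toL1 μ (toL2 μ (nonlocal μ K (Psi p) (u k t)))) atTop
        (𝓝 (toL1 μ (toL2 μ (nonlocal μ K (Psi p) (U t))))) := by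
      rw [Lp.tendsto_Lp_iff_tendsto_eLpNorm']
      have hG' := memLp_Psi_diff hp hQ1 hQp
        ⟨Lp.aestronglyMeasurable _, (hUQ t ht).trans_lt ENNReal.ofReal_lt_top⟩
      have hlim := tendsto_eLpNorm_kernel_mul hK (oddMono_Psi hp).continuous (hU t ht)
        (fun k => hGb (hQb k t ht)) (hGb (hUQ t ht))
      refine tendsto_of_tendsto_of_tendsto_of_le_of_le tendsto_const_nhds hlim
        (fun _ => zero_le) fun k => ?_
      have hG := memLp_Psi_diff hp hQ1 hQp (hmem k t ht)
      rw [coeFn_toL1, coeFn_toL1]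
      have e1 : (fun x => toL2 μ (nonlocal μ K (Psi p) (u k t)) x -
          toL2 μ (nonlocal μ K (Psi p) (U t)) x) =ᵐ[μ]
          fun x => ∫ y, (K x y * Psi p (u k t y - u k t x) - K x y * Psi p (U t y - U t x)) ∂μ := by
        filter_upwards [coeFn_toL2 (memLp_nonlocal hK hG), coeFn_toL2 (memLp_nonlocal hK hG'),
          (integrable_kernel_mul hK hG).prod_right_ae,
          (integrable_kernel_mul hK hG').prod_right_ae] with x h2 h3 hx1 hx2
        rw [h2, h3]
        exact (integral_sub hx1 hx2).symm
      refine (eLpNorm_congr_ae e1).le.trans ?_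
      rw [eLpNorm_one_eq_lintegral_enorm, eLpNorm_one_eq_lintegral_enorm, lintegral_prod]
      · exact lintegral_mono fun x => enorm_integral_le_lintegral_enorm _
      · exact ((integrable_kernel_mul hK hG).sub (integrable_kernel_mul hK hG')).1.enorm
    have h2 : Tendsto (fun k => toL1 μ (clampL2 μ k (F t))) atTop (𝓝 (toL1 μ (F t))) :=
      ((toL1 μ).continuous.tendsto _).comp (tendsto_clampL2 (F t))
    have h3 : Tendsto (fun k => r k t) atTop (𝓝 0) :=
      squeeze_zero_norm (fun k => hr k t ht) hinv
    have h4 : Tendsto (fun k => toL1 μ (r k t)) atTop (𝓝 0) := by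
      have := ((toL1 μ).continuous.tendsto 0).comp h3
      rwa [map_zero] at this
    have := (h1.add h2).add h4
    rw [add_zero] at this
    simpa [hvk, hV, map_add] using this
  have hbd : ∀ k, ∀ t ∈ Icc 0 T, ‖toL1 μ (vk k t)‖ ≤ κ * (2 * M) ^ (p - 1) + ‖F t‖ + κ := by
    intro k t ht
    refine (norm_toL1_le _).trans ((norm_add₃_le).trans ?_)
    gcongr
    · exact norm_toL2_nonlocal_Psi_le hp hK hQ1 hQp hM0 (hQb k t ht)
    · exact norm_clampL2_le k _
    · refine (hr k t ht).trans ?_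
      refine mul_le_of_le_one_right κ.coe_nonneg ?_
      rw [div_le_one (by positivity)]
      have : (0 : ℝ) ≤ k := k.cast_nonneg
      linarith
  have hbi : IntervalIntegrable (fun t => κ * (2 * M) ^ (p - 1) + ‖F t‖ + κ) volume 0 T :=
    (intervalIntegrable_const.add hF.norm).add intervalIntegrable_const
  have hVm : AEStronglyMeasurable (fun t => toL1 μ (V t)) (volume.restrict (Ioc 0 T)) := by
    refine aestronglyMeasurable_of_tendsto_ae atTop (f := fun k t => toL1 μ (vk k t))
      (fun k => ?_) ?_
    · exact (toL1 μ).continuous.comp_aestronglyMeasurable (hu k).integrable.1.1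
    · filter_upwards [ae_restrict_mem measurableSet_Ioc] with t ht
      exact hconv t (Ioc_subset_Icc_self ht)
  -- Convergence of the right-hand sides is available in L¹ only; measurability of V in L² comes
  -- from the measurable embedding.
  have hVm2 : AEStronglyMeasurable V (volume.restrict (Ioc 0 T)) := aestronglyMeasurable_of_toL1 hVm
  have hVi : IntervalIntegrable V volume 0 T := by
    rw [intervalIntegrable_iff_integrableOn_Ioc_of_le hT]
    refine ((intervalIntegrable_iff_integrableOn_Ioc_of_le hT).1 hbi).mono' hVm2 ?_
    filter_upwards [ae_restrict_mem measurableSet_Ioc] with t ht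
    refine (norm_add_le _ _).trans ?_
    have := norm_toL2_nonlocal_Psi_le hp hK hQ1 hQp hM0 (hUQ t (Ioc_subset_Icc_self ht))
    linarith [κ.coe_nonneg]
  refine ⟨U, hU0, ⟨hVi, fun t ht => ?_⟩, fun t ht => (hUQ t ht).trans hMe.ge⟩
  apply toL1_injective
  have h1 : Tendsto (fun k => toL1 μ (u k t)) atTop (𝓝 (toL1 μ (U t))) :=
    ((toL1 μ).continuous.tendsto _).comp (hU t ht)
  have h2 : Tendsto (fun k => toL1 μ (u k t)) atTop
      (𝓝 (toL1 μ (U 0) + ∫ s in (0 : ℝ)..t, toL1 μ (V s))) := by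
    have h3 : ∀ k, toL1 μ (u k t) = toL1 μ (u k 0) + ∫ s in (0 : ℝ)..t, toL1 μ (vk k s) :=
      fun k => ((hu k).map (toL1 μ)).eq t ht
    simp_rw [h3]
    refine (((toL1 μ).continuous.tendsto _).comp (hU 0 h0m)).add ?_
    refine intervalIntegral.tendsto_integral_filter_of_dominated_convergence
      (fun t => κ * (2 * M) ^ (p - 1) + ‖F t‖ + κ) (Eventually.of_forall fun k => ?_)
      (Eventually.of_forall fun k => ?_) (hbi.mono_set (hsubT ht)) ?_
    · exact ((((hu k).mono le_rfl ht.1 ht.2).map (toL1 μ)).integrable).aestronglyMeasurable_restrict_uIoc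
    · refine Eventually.of_forall fun s hs => hbd k s ?_
      rw [uIoc_of_le ht.1] at hs
      exact ⟨hs.1.le, hs.2.trans ht.2⟩
    · refine Eventually.of_forall fun s hs => hconv s ?_
      rw [uIoc_of_le ht.1] at hs
      exact ⟨hs.1.le, hs.2.trans ht.2⟩
  rw [tendsto_nhds_unique h1 h2, map_add, (toL1 μ).intervalIntegral_comp_comm
    (hVi.mono_set (hsubT ht))]

end Existence

/-! ### Uniqueness of solutions in `L¹` -/

section Uniqueness

variable {Ω : Type*} [MeasurableSpace Ω] {μ : Measure Ω} {K : Ω → Ω → ℝ} {κ : ℝ≥0} {Φ : ℝ → ℝ}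

/-- Integration against a bounded function, as a functional on `L¹`. -/
lemma exists_integral_mul_clm {η : Ω → ℝ} (hη : AEStronglyMeasurable η μ) (hb : ∀ x, |η x| ≤ 1) :
    ∃ ℓ : Lp ℝ 1 μ →L[ℝ] ℝ, ∀ f : Lp ℝ 1 μ, ℓ f = ∫ x, η x * f x ∂μ := by
  have hint : ∀ f : Lp ℝ 1 μ, Integrable (fun x => η x * f x) μ := fun f =>
    (L1.integrable_coeFn f).bdd_mul (c := 1) hη (Filter.Eventually.of_forall hb)
  refine ⟨LinearMap.mkContinuous
    { toFun := fun f => ∫ x, η x * f x ∂μ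
      map_add' := fun f g => ?_
      map_smul' := fun c f => ?_ } 1 fun f => ?_, fun f => rfl⟩
  · rw [← integral_add (hint f) (hint g)]
    refine integral_congr_ae ?_
    filter_upwards [Lp.coeFn_add f g] with x hx
    rw [hx, Pi.add_apply, mul_add]
  · rw [RingHom.id_apply, smul_eq_mul, ← integral_const_mul]
    refine integral_congr_ae ?_
    filter_upwards [Lp.coeFn_smul c f] with x hx
    rw [hx, Pi.smul_apply, smul_eq_mul]
    ring
  · rw [one_mul, L1.norm_eq_integral_norm]
    refine (norm_integral_le_integral_norm _).trans
      (integral_mono (hint f).norm (L1.integrable_coeFn f).norm fun x => ?_)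
    simp only [norm_mul]
    exact mul_le_of_le_one_left (norm_nonneg _) (hb x)

/-- The nonlocal operator is accretive in `L¹`, so that two solutions with the same data agree. -/
theorem eq_of_isPrimitive_L1 [SFinite μ] (hK : SymmKernel μ K κ) (hΦ : OddMono Φ) {T : ℝ}
    {u u' v v' : ℝ → Lp ℝ 1 μ} {f : Ω → ℝ → ℝ} (hu : IsPrimitive u v 0 T)
    (hu' : IsPrimitive u' v' 0 T) (h0 : u 0 = u' 0)
    (hv : ∀ᵐ t ∂volume.restrict (Ioo 0 T),
      Integrable (fun z : Ω × Ω => K z.1 z.2 * Φ (u t z.2 - u t z.1)) (μ.prod μ) ∧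
      v t =ᵐ[μ] fun x => nonlocal μ K Φ (u t) x + f x t)
    (hv' : ∀ᵐ t ∂volume.restrict (Ioo 0 T),
      Integrable (fun z : Ω × Ω => K z.1 z.2 * Φ (u' t z.2 - u' t z.1)) (μ.prod μ) ∧
      v' t =ᵐ[μ] fun x => nonlocal μ K Φ (u' t) x + f x t) :
    ∀ t ∈ Icc 0 T, u t = u' t := by
  intro t ht
  have hsub : Ioo 0 t ⊆ Ioo 0 T := Ioo_subset_Ioo le_rfl ht.2
  have key := ((hu.sub hu').mono le_rfl ht.1 ht.2).le_add_integral_of_subgradient ht.1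
    (r := fun s => ‖u s - u' s‖) (φ := fun _ => 0) (C := 1) zero_le_one
    (fun s _ s' _ => by rw [one_mul]; exact abs_norm_sub_norm_le _ _) intervalIntegrable_const (by
      filter_upwards [ae_restrict_of_ae_restrict_of_subset hsub hv,
        ae_restrict_of_ae_restrict_of_subset hsub hv'] with s hs hs'
      set w : Ω → ℝ := ⇑(u s)
      set w' : Ω → ℝ := ⇑(u' s)
      have hw : StronglyMeasurable w := Lp.stronglyMeasurable (u s)
      have hw' : StronglyMeasurable w' := Lp.stronglyMeasurable (u' s)
      -- The sign function with value 0 at 0 gives a subgradient of the L¹ norm. Being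
      -- nondecreasing, it makes η(y) − η(x) follow the sign of (w − w')(y) − (w − w')(x), which is
      -- also the sign of the increment of Φ; and as it is bounded, integrability of K Φ suffices.
      set σ : ℝ → ℝ := fun c => if 0 < c then 1 else if c < 0 then -1 else 0 with hσ
      have hσm : Measurable σ := Measurable.ite measurableSet_Ioi measurable_const
        (Measurable.ite measurableSet_Iio measurable_const measurable_const)
      have hσb : ∀ c, |σ c| ≤ 1 := fun c => by
        simp only [hσ]; split_ifs <;> simp
      have hσmono : Monotone σ := fun a b hab => by
        simp only [hσ]; split_ifs <;> linarith
      have hσabs : ∀ c, σ c * c = |c| := fun c => by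
        rcases lt_trichotomy c 0 with h | h | h
        · simp [hσ, h, h.le.not_gt, abs_of_neg h]
        · simp [hσ, h]
        · simp [hσ, h, abs_of_pos h]
      set η : Ω → ℝ := fun x => σ (w x - w' x) with hη
      have hηm : Measurable η := hσm.comp (hw.measurable.sub hw'.measurable)
      obtain ⟨ℓ, hℓ⟩ := exists_integral_mul_clm (μ := μ) hηm.aestronglyMeasurable fun x => hσb _
      refine ⟨ℓ, fun r _ => ?_, ?_⟩
      · rw [map_sub, hℓ, hℓ, L1.norm_eq_integral_norm, L1.norm_eq_integral_norm]
        have e1 : ∫ x, ‖(u s - u' s) x‖ ∂μ = ∫ x, η x * (u s - u' s) x ∂μ := by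
          refine integral_congr_ae ?_
          filter_upwards [Lp.coeFn_sub (u s) (u' s)] with x hx
          rw [hx, Pi.sub_apply, Real.norm_eq_abs, ← hσabs]
        rw [e1, sub_le_sub_iff_left]
        refine integral_mono ((L1.integrable_coeFn _).bdd_mul (c := 1)
          hηm.aestronglyMeasurable (Filter.Eventually.of_forall fun x => hσb _))
          (L1.integrable_coeFn _).norm fun x => ?_
        refine (le_abs_self _).trans ?_
        rw [abs_mul]
        exact mul_le_of_le_one_left (abs_nonneg _) (hσb _)
      · rw [hℓ]
        refine le_trans (le_of_eq ?_) (integral_nonlocal_sub_mul_nonpos hK hΦ (η := η) hs.1 hs'.1 ?_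
          fun x y => ?_)
        · refine integral_congr_ae ?_
          filter_upwards [Lp.coeFn_sub (v s) (v' s), hs.2, hs'.2] with x h1 h2 h3
          rw [h1, Pi.sub_apply, h2, h3]
          ring
        · have h1 := (hs.1.sub hs'.1).mul_bdd (g := fun z => η z.1) (c := 1)
            (hηm.comp measurable_fst).aestronglyMeasurable
            (Filter.Eventually.of_forall fun z => hσb _)
          refine h1.congr (Filter.Eventually.of_forall fun z => ?_)
          simp only [Pi.sub_apply]
          ring
        · rcases le_total (w x - w' x) (w y - w' y) with h | h
          · exact mul_nonneg (sub_nonneg.2 (hΦ.mono (by linarith))) (sub_nonneg.2 (hσmono h))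
          · exact mul_nonneg_of_nonpos_of_nonpos (sub_nonpos.2 (hΦ.mono (by linarith)))
              (sub_nonpos.2 (hσmono h)))
  simp only [h0, sub_self, norm_zero, intervalIntegral.integral_zero, add_zero] at key
  exact sub_eq_zero.1 (norm_le_zero_iff.1 key)

end Uniqueness

/-! ### The backward Euler method in a Hilbert space: stability of the increments -/

section Increments

variable {H : Type*} [NormedAddCommGroup H] [InnerProductSpace ℝ H] [CompleteSpace H] {δ D : ℕ → H} {N : ℕ}

/-- In the application δ is the discrete time derivative and D the increment of the source. The
hypothesis is dissipativity between consecutive iterates, as D k − (δ (k+1) − δ k) is minus the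
increment of the operator. It gives ‖δ (k+1)‖² ≤ ⟨D k + δ k, δ (k+1)⟩. -/
lemma norm_increment_le (h : ∀ k < N, 0 ≤ inner ℝ (D k - (δ (k + 1) - δ k)) (δ (k + 1))) :
    ∀ k ≤ N, ‖δ k‖ ≤ ‖δ 0‖ + ∑ j ∈ Finset.range k, ‖D j‖ := by
  intro k
  induction k with
  | zero => simp
  | succ k ih =>
    intro hk
    have h1 := h k hk
    rw [show D k - (δ (k + 1) - δ k) = D k + δ k - δ (k + 1) by abel, inner_sub_left,
      real_inner_self_eq_norm_sq] at h1
    have h2 := (real_inner_le_norm (D k + δ k) (δ (k + 1))).trans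
      (mul_le_mul_of_nonneg_right (norm_add_le (D k) (δ k)) (norm_nonneg _))
    have h3 : ‖δ (k + 1)‖ ≤ ‖D k‖ + ‖δ k‖ := by
      by_contra! hc
      have := norm_nonneg (D k)
      have := norm_nonneg (δ k)
      nlinarith
    rw [Finset.sum_range_succ]
    linarith [ih (by omega)]

/-- The term −⟨δ (k+1) − δ k, δ (k+1)⟩ is at most ½‖δ k‖² − ½‖δ (k+1)‖² and telescopes. The total
dissipation is therefore bounded independently of the number of steps, which is what makes the
scheme first order. -/
lemma sum_inner_increment_le (h : ∀ k < N, 0 ≤ inner ℝ (D k - (δ (k + 1) - δ k)) (δ (k + 1))) :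
    ∑ k ∈ Finset.range N, inner ℝ (D k - (δ (k + 1) - δ k)) (δ (k + 1)) ≤
      (‖δ 0‖ + ∑ j ∈ Finset.range N, ‖D j‖) ^ 2 := by
  set L := ‖δ 0‖ + ∑ j ∈ Finset.range N, ‖D j‖ with hL
  have hLb : ∀ k ≤ N, ‖δ k‖ ≤ L := fun k hk => (norm_increment_le h k hk).trans (by
    rw [hL]; gcongr)
  have hterm : ∀ k ∈ Finset.range N, inner ℝ (D k - (δ (k + 1) - δ k)) (δ (k + 1)) ≤
      L * ‖D k‖ + (‖δ k‖ ^ 2 / 2 - ‖δ (k + 1)‖ ^ 2 / 2) := by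
    intro k hk
    have hk' := Finset.mem_range.1 hk
    rw [inner_sub_left, inner_sub_left, real_inner_self_eq_norm_sq]
    have h1 := real_inner_le_norm (D k) (δ (k + 1))
    have h2 := mul_le_mul_of_nonneg_left (hLb (k + 1) hk') (norm_nonneg (D k))
    have h3 := real_inner_le_norm (δ k) (δ (k + 1))
    nlinarith [sq_nonneg (‖δ k‖ - ‖δ (k + 1)‖)]
  refine (Finset.sum_le_sum hterm).trans ?_
  rw [Finset.sum_add_distrib, ← Finset.mul_sum,
    Finset.sum_range_sub' (fun k => ‖δ k‖ ^ 2 / 2)]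
  have h0 : ‖δ 0‖ ≤ L := hLb 0 (Nat.zero_le _)
  have hS : ∑ j ∈ Finset.range N, ‖D j‖ = L - ‖δ 0‖ := by rw [hL]; ring
  rw [hS]
  nlinarith [sq_nonneg ‖δ N‖, norm_nonneg (δ 0)]

/-- The triangle inequality in the plane for the vectors (X, √c) and (Y, 0). -/
lemma sqrt_add_sq_add_le {X Y c : ℝ} (hY : 0 ≤ Y) (hc : 0 ≤ c) :
    √((X + Y) ^ 2 + c) ≤ √(X ^ 2 + c) + Y := by
  have h1 : X ≤ √(X ^ 2 + c) := Real.le_sqrt_of_sq_le (by linarith)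
  rw [Real.sqrt_le_left (by positivity)]
  have := Real.sq_sqrt (show 0 ≤ X ^ 2 + c by positivity)
  nlinarith

/-- A recursion of quadratic type. -/
lemma le_sqrt_add_sum {E q ψ : ℕ → ℝ} (hE : ∀ k, 0 ≤ E k) (hq : ∀ k < N, 0 ≤ q k)
    (hψ : ∀ k < N, 0 ≤ ψ k) (h : ∀ k < N, E (k + 1) ≤ √(E k ^ 2 + q k) + ψ k) :
    ∀ k ≤ N, E k ≤ √(E 0 ^ 2 + ∑ j ∈ Finset.range k, q j) + ∑ j ∈ Finset.range k, ψ j := by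
  intro k
  induction k with
  | zero => simp [Real.sqrt_sq (hE 0)]
  | succ k ih =>
    intro hk
    have hQ : 0 ≤ ∑ j ∈ Finset.range k, q j := Finset.sum_nonneg fun j hj => hq j (by
      have := Finset.mem_range.1 hj; omega)
    have hP : 0 ≤ ∑ j ∈ Finset.range k, ψ j := Finset.sum_nonneg fun j hj => hψ j (by
      have := Finset.mem_range.1 hj; omega)
    rw [Finset.sum_range_succ, Finset.sum_range_succ, ← add_assoc, ← add_assoc]
    refine (h k hk).trans (add_le_add_left ?_ _)
    refine (Real.sqrt_le_sqrt (add_le_add_left (pow_le_pow_left₀ (hE k) (ih (by omega)) 2) _)).trans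
      ?_
    refine (sqrt_add_sq_add_le hP (hq k hk)).trans ?_
    rw [Real.sq_sqrt (by positivity)]

/-- The error of the implicit Euler method for a dissipative operator satisfying a three-point
inequality, including the consistency error of the operator. -/
theorem norm_implicit_euler_sub_le {A : H → H} {t : ℕ → ℝ} {N : ℕ}
    (ht : ∀ k < N, t k < t (k + 1)) {τ : ℝ} (hτ : ∀ k < N, t (k + 1) - t k ≤ τ)
    {u V : ℝ → H} (hu : IsPrimitive u V (t 0) (t N)) {w F : ℕ → H}
    (hw : ∀ k < N, w (k + 1) - w k =
      (t (k + 1) - t k) • (A (w (k + 1)) + F k))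
    (hA : ∀ k < N, inner ℝ (w (k + 1) - w k) (A (w (k + 1)) - A (w k)) ≤ 0)
    (hAu : ∀ k < N, ∀ s ∈ Icc (t 0) (t N), ∀ θ : ℝ, 0 ≤ θ → θ ≤ 1 →
      inner ℝ (w k + θ • (w (k + 1) - w k) - u s) (A (w (k + 1)) - A (u s)) ≤
        -inner ℝ (w (k + 1) - w k) (A (w (k + 1)) - A (w k)))
    {ψ : ℝ → ℝ} (hψ : IntervalIntegrable ψ volume (t 0) (t N)) (hψ0 : ∀ s, 0 ≤ ψ s)
    (hψF : ∀ k < N, ∀ᵐ s ∂volume.restrict (Ioo (t k) (t (k + 1))),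
      ‖A (u s) + F k - V s‖ ≤ ψ s) :
    ∀ k < N, ∀ s ∈ Icc (t k) (t (k + 1)), ‖w (k + 1) - u s‖ ≤ ‖w 0 - u (t 0)‖ +
      3 * τ * (‖A (w 0) + F 0‖ +
        ∑ j ∈ Finset.range N, ‖F j - F (j - 1)‖) + ∫ s in (t 0)..(t N), ψ s := by
  -- For k ≥ 1 this is the discrete derivative. At k = 0 truncated subtraction makes it A(w 0) + F
  -- 0, and likewise D 0 = 0, so the initial layer costs only ‖A(w 0) + F 0‖.
  set δ : ℕ → H := fun k => A (w k) + F (k - 1) with hδ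
  set D : ℕ → H := fun k => F k - F (k - 1) with hD
  set q : ℕ → ℝ := fun k => inner ℝ (D k - (δ (k + 1) - δ k)) (δ (k + 1)) with hq
  set L : ℝ := ‖δ 0‖ + ∑ j ∈ Finset.range N, ‖D j‖ with hL
  have hmono : ∀ j k, j ≤ k → k ≤ N → t j ≤ t k := by
    intro j k hjk
    induction k, hjk using Nat.le_induction with
    | base => exact fun _ => le_rfl
    | succ k _ ih => exact fun hk => (ih (by omega)).trans (ht k hk).le
  have hstep : ∀ k < N, w (k + 1) - w k = (t (k + 1) - t k) • δ (k + 1) := hw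
  have hqe : ∀ k < N, -inner ℝ (w (k + 1) - w k) (A (w (k + 1)) - A (w k)) =
      (t (k + 1) - t k) * q k := by
    intro k hk
    have e1 : D k - (δ (k + 1) - δ k) = -(A (w (k + 1)) - A (w k)) := by
      simp only [hD, hδ, Nat.add_sub_cancel]; abel
    rw [hstep k hk, inner_smul_left, hq]
    simp only
    rw [e1, inner_neg_left, real_inner_comm]
    simp
  have hq0 : ∀ k < N, 0 ≤ q k := by
    intro k hk
    have h1 := hA k hk
    have h2 := hqe k hk
    have h3 : 0 ≤ (t (k + 1) - t k) * q k := by rw [← h2]; exact neg_nonneg.2 h1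
    exact nonneg_of_mul_nonneg_right h3 (sub_pos.2 (ht k hk))
  have hδL : ∀ k ≤ N, ‖δ k‖ ≤ L := fun k hk => (norm_increment_le hq0 k hk).trans (by
    rw [hL]; gcongr)
  have hqL : ∑ k ∈ Finset.range N, q k ≤ L ^ 2 := sum_inner_increment_le hq0
  have hL0 : 0 ≤ L := by positivity
  have hψi : ∀ {a b : ℝ}, a ∈ Icc (t 0) (t N) → b ∈ Icc (t 0) (t N) →
      IntervalIntegrable ψ volume a b := fun {a b} ha hb => hψ.mono_set (by
    rw [uIcc_of_le (ha.1.trans ha.2)]; exact uIcc_subset_Icc ha hb)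
  -- one time step
  have hone : ∀ k < N, ∀ s ∈ Icc (t k) (t (k + 1)), ‖w k + (s - t k) • δ (k + 1) - u s‖ ≤
      √(‖w k - u (t k)‖ ^ 2 + 2 * τ ^ 2 * q k) + ∫ r in (t k)..s, ψ r := by
    intro k hk s hs
    have hτk : 0 < t (k + 1) - t k := sub_pos.2 (ht k hk)
    have hk0 : t 0 ≤ t k := hmono 0 k (Nat.zero_le _) hk.le
    have hkN : t (k + 1) ≤ t N := hmono (k + 1) N hk le_rfl
    have hlin : IsPrimitive (fun r => w k + (r - t k) • δ (k + 1)) (fun _ => δ (k + 1)) (t k) s := by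
      refine ⟨intervalIntegrable_const, fun r _ => ?_⟩
      simp
    have hprim := hlin.sub (hu.mono hk0 hs.1 (hs.2.trans hkN))
    -- The interpolant w k + (r − t k) δ (k+1) is compared with u. By the three-point inequality the
    -- operator contributes at most β = (t (k+1) − t k) q k, which over an interval of length at
    -- most τ adds 2τ² q k under the root.
    have := hprim.norm_le_sqrt_add_integral hs.1 (β := (t (k + 1) - t k) * q k)
      (mul_nonneg hτk.le (hq0 k hk)) (hψi ⟨hk0, (ht k hk).le.trans hkN⟩
        ⟨hk0.trans hs.1, hs.2.trans hkN⟩) (by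
      filter_upwards [ae_restrict_of_ae_restrict_of_subset (Ioo_subset_Ioo le_rfl hs.2)
        (hψF k hk), ae_restrict_mem measurableSet_Ioo] with r hr hrm
      refine ⟨hψ0 r, ?_⟩
      have hrN : r ∈ Icc (t 0) (t N) := ⟨hk0.trans hrm.1.le, hrm.2.le.trans (hs.2.trans hkN)⟩
      have hθ : (r - t k) • δ (k + 1) = ((r - t k) / (t (k + 1) - t k)) • (w (k + 1) - w k) := by
        rw [hstep k hk, smul_smul, div_mul_cancel₀ _ hτk.ne']
      have h1 := hAu k hk r hrN ((r - t k) / (t (k + 1) - t k))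
        (div_nonneg (by linarith [hrm.1]) hτk.le)
        ((div_le_one hτk).2 (by linarith [hrm.2, hs.2]))
      rw [← hθ] at h1
      have h2 := hqe k hk
      have e1 : δ (k + 1) - V r = (A (w (k + 1)) - A (u r)) + (A (u r) + F k - V r) := by
        simp only [hδ, Nat.add_sub_cancel]; abel
      rw [e1, inner_add_right]
      have h3 := (real_inner_le_norm (w k + (r - t k) • δ (k + 1) - u r)
        (A (u r) + F k - V r)).trans (mul_le_mul_of_nonneg_left hr (norm_nonneg _))
      have h4 := h1.trans h2.le
      linarith)
    refine this.trans (add_le_add_left (Real.sqrt_le_sqrt ?_) _)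
    simp only [sub_self, zero_smul, add_zero]
    have e2 : (t (k + 1) - t k) * (s - t k) ≤ τ ^ 2 := by
      have := hτ k hk
      have := hs.2
      have := hs.1
      nlinarith
    have := mul_le_mul_of_nonneg_right e2 (hq0 k hk)
    linarith
  set E : ℕ → ℝ := fun k => ‖w k - u (t k)‖ with hE
  have hrec : ∀ k < N, E (k + 1) ≤ √(E k ^ 2 + 2 * τ ^ 2 * q k) +
      ∫ r in (t k)..(t (k + 1)), ψ r := by
    intro k hk
    have := hone k hk (t (k + 1)) ⟨(ht k hk).le, le_rfl⟩
    rwa [← hstep k hk, add_sub_cancel] at this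
  have hI0 : ∀ k < N, 0 ≤ ∫ r in (t k)..(t (k + 1)), ψ r := fun k hk =>
    intervalIntegral.integral_nonneg (ht k hk).le fun _ _ => hψ0 _
  have hq0' : ∀ k < N, 0 ≤ 2 * τ ^ 2 * q k := fun k hk => mul_nonneg (by positivity) (hq0 k hk)
  have hsum := le_sqrt_add_sum (fun k => norm_nonneg (w k - u (t k))) hq0' hI0 hrec
  intro k hk s hs
  have hk0 : t 0 ≤ t k := hmono 0 k (Nat.zero_le _) hk.le
  have hkN : t (k + 1) ≤ t N := hmono (k + 1) N hk le_rfl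
  have hτ0 : 0 ≤ τ := (sub_pos.2 (ht k hk)).le.trans (hτ k hk)
  have hadj : ∑ j ∈ Finset.range k, ∫ r in (t j)..(t (j + 1)), ψ r = ∫ r in (t 0)..(t k), ψ r :=
    intervalIntegral.sum_integral_adjacent_intervals fun j hj =>
      hψi ⟨hmono 0 j (Nat.zero_le _) (by omega), hmono j N (by omega) le_rfl⟩
        ⟨hmono 0 (j + 1) (Nat.zero_le _) (by omega), hmono (j + 1) N (by omega) le_rfl⟩
  have h1 : ‖w k + (s - t k) • δ (k + 1) - u s‖ ≤
      √(E 0 ^ 2 + ∑ j ∈ Finset.range (k + 1), 2 * τ ^ 2 * q j) + ∫ r in (t 0)..(t N), ψ r := by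
    refine (hone k hk s hs).trans ?_
    have hP : 0 ≤ ∫ r in (t 0)..(t k), ψ r := intervalIntegral.integral_nonneg hk0 fun _ _ => hψ0 _
    have hQ : 0 ≤ ∑ j ∈ Finset.range k, 2 * τ ^ 2 * q j := Finset.sum_nonneg fun j hj => hq0' j (by
      have := Finset.mem_range.1 hj; omega)
    have h2 := hsum k hk.le
    rw [hadj] at h2
    have h3 : √(‖w k - u (t k)‖ ^ 2 + 2 * τ ^ 2 * q k) ≤
        √(E 0 ^ 2 + ∑ j ∈ Finset.range (k + 1), 2 * τ ^ 2 * q j) + ∫ r in (t 0)..(t k), ψ r := by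
      refine (Real.sqrt_le_sqrt (add_le_add_left (pow_le_pow_left₀ (norm_nonneg _) h2 2) _)).trans ?_
      refine (sqrt_add_sq_add_le hP (hq0' k hk)).trans ?_
      rw [Real.sq_sqrt (by positivity), Finset.sum_range_succ, add_assoc (E 0 ^ 2)]
    have h4 : (∫ r in (t 0)..(t k), ψ r) + ∫ r in (t k)..s, ψ r = ∫ r in (t 0)..s, ψ r :=
      intervalIntegral.integral_add_adjacent_intervals
        (hψi ⟨le_rfl, hk0.trans (hs.1.trans (hs.2.trans hkN))⟩ ⟨hk0, hs.1.trans (hs.2.trans hkN)⟩)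
        (hψi ⟨hk0, hs.1.trans (hs.2.trans hkN)⟩ ⟨hk0.trans hs.1, hs.2.trans hkN⟩)
    have h5 : ∫ r in (t 0)..s, ψ r ≤ ∫ r in (t 0)..(t N), ψ r :=
      intervalIntegral.integral_mono_interval le_rfl (hk0.trans hs.1) (hs.2.trans hkN)
        (Filter.Eventually.of_forall fun r => hψ0 r) hψ
    linarith
  -- The sum of the q j is at most L², so the root is at most √(E 0² + 2τ²L²) ≤ E 0 + 2τL.
  have h2 : √(E 0 ^ 2 + ∑ j ∈ Finset.range (k + 1), 2 * τ ^ 2 * q j) ≤ E 0 + 2 * τ * L := by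
    have hE0 : 0 ≤ E 0 := norm_nonneg _
    rw [Real.sqrt_le_left (by positivity), ← Finset.mul_sum]
    have h3 : ∑ j ∈ Finset.range (k + 1), q j ≤ L ^ 2 := by
      refine (Finset.sum_le_sum_of_subset_of_nonneg (Finset.range_subset_range.2 hk) ?_).trans hqL
      exact fun j hj _ => hq0 j (Finset.mem_range.1 hj)
    have h4 := mul_le_mul_of_nonneg_left h3 (show 0 ≤ 2 * τ ^ 2 by positivity)
    have h5 : 0 ≤ E 0 * (τ * L) := by positivity
    nlinarith [sq_nonneg (τ * L)]
  -- Passing from the interpolant at time s to the endpoint value w (k+1) costs one more τL, whence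
  -- the factor 3.
  have h3 : ‖w (k + 1) - u s‖ ≤ ‖w k + (s - t k) • δ (k + 1) - u s‖ + τ * L := by
    have e1 : w (k + 1) - u s = (w k + (s - t k) • δ (k + 1) - u s) +
        (t (k + 1) - s) • δ (k + 1) := by
      have := hstep k hk
      rw [sub_eq_iff_eq_add] at this
      rw [this, show t (k + 1) - t k = (t (k + 1) - s) + (s - t k) by ring, add_smul]
      abel
    rw [e1]
    refine (norm_add_le _ _).trans (add_le_add_right ?_ _)
    rw [norm_smul, Real.norm_eq_abs, abs_of_nonneg (by linarith [hs.2])]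
    exact mul_le_mul (by linarith [hs.1, hτ k hk]) (hδL (k + 1) hk) (norm_nonneg _) hτ0
  have h4 : E 0 = ‖w 0 - u (t 0)‖ := rfl
  have h5 : 3 * τ * L = 2 * τ * L + τ * L := by ring
  rw [h4] at h1 h2
  change _ ≤ _ + 3 * τ * L + _
  linarith

end Increments

/-! ### The error of the backward Euler method -/

section Euler

variable {Ω : Type*} [MeasurableSpace Ω] {μ : Measure Ω} [IsProbabilityMeasure μ]
  {K : Ω → Ω → ℝ} {κ : ℝ≥0} {Φ : ℝ → ℝ}

/-- The right-hand side can be negative only if b lies between c and a. Then a', c, b, a are in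
monotone order, so |Φ a − Φ b| ≤ |Φ a − Φ a'| and |c − b| ≤ |a − a'|. Monotonicity alone is used, so
no rate depending on p arises from this inequality. -/
lemma neg_le_sub_mul_sub_of_mem_uIcc (hΦ : Monotone Φ) {a a' b c : ℝ} (hc : c ∈ uIcc a' a) :
    -((Φ a - Φ a') * (a - a')) ≤ (Φ a - Φ b) * (c - b) := by
  rw [mem_uIcc] at hc
  rcases hc with ⟨h1, h2⟩ | ⟨h1, h2⟩
  · have hm := hΦ (h1.trans h2)
    rcases le_total b c with h | h
    · have := hΦ (h.trans h2)
      nlinarith [mul_nonneg (sub_nonneg.2 this) (sub_nonneg.2 h),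
        mul_nonneg (sub_nonneg.2 hm) (sub_nonneg.2 (h1.trans h2))]
    · rcases le_total a b with h' | h'
      · have := hΦ h'
        nlinarith [mul_nonneg (sub_nonneg.2 this) (sub_nonneg.2 h),
          mul_nonneg (sub_nonneg.2 hm) (sub_nonneg.2 (h1.trans h2))]
      · have e1 := hΦ h'
        have e2 := hΦ (h1.trans h)
        have : (Φ a - Φ b) * (b - c) ≤ (Φ a - Φ a') * (a - a') :=
          mul_le_mul (by linarith) (by linarith) (by linarith) (by linarith)
        linarith
  · have hm := hΦ (h1.trans h2)
    rcases le_total c b with h | h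
    · have := hΦ (h1.trans h)
      nlinarith [mul_nonneg (sub_nonneg.2 this) (sub_nonneg.2 h),
        mul_nonneg (sub_nonneg.2 hm) (sub_nonneg.2 (h1.trans h2))]
    · rcases le_total b a with h' | h'
      · have := hΦ h'
        nlinarith [mul_nonneg (sub_nonneg.2 this) (sub_nonneg.2 h),
          mul_nonneg (sub_nonneg.2 hm) (sub_nonneg.2 (h1.trans h2))]
      · have e1 := hΦ h'
        have e2 := hΦ (h.trans h2)
        have : (Φ b - Φ a) * (c - b) ≤ (Φ a' - Φ a) * (a' - a) :=
          mul_le_mul (by linarith) (by linarith) (by linarith) (by linarith)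
        linarith

lemma integrable_kernel_mul_diff (hK : SymmKernel μ K κ) (hΦ : OddMono Φ) {w η : Ω → ℝ}
    (hG : MemLp (fun z : Ω × Ω => Φ (w z.2 - w z.1)) 2 (μ.prod μ)) (hη : MemLp η 2 μ) :
    Integrable (fun z : Ω × Ω => K z.1 z.2 * Φ (w z.2 - w z.1) * (η z.2 - η z.1)) (μ.prod μ) := by
  have h1 := integrable_mul_mul ENNReal.coe_ne_top hK.aestronglyMeasurable hG hη hK.bounded
  refine (h1.swap.add h1).neg.congr (Filter.Eventually.of_forall fun z => ?_)
  simp only [Pi.neg_apply, Pi.add_apply, Function.comp_apply, Prod.fst_swap, Prod.snd_swap]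
  rw [hK.symm z.2, hΦ.map_sub_swap (w z.1)]
  ring

/-- The weak form of the nonlocal operator. -/
lemma inner_toL2_nonlocal (hK : SymmKernel μ K κ) (hΦ : OddMono Φ) {w : Ω → ℝ} {η : Lp ℝ 2 μ}
    (hG : MemLp (fun z : Ω × Ω => Φ (w z.2 - w z.1)) 2 (μ.prod μ)) :
    inner ℝ η (toL2 μ (nonlocal μ K Φ w)) =
      -(1 / 2) * ∫ z, K z.1 z.2 * Φ (w z.2 - w z.1) * (η z.2 - η z.1) ∂μ.prod μ := by
  rw [inner_eq_integral, ← integral_integral_mul_antisymm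
    (H := fun z => K z.1 z.2 * Φ (w z.2 - w z.1))]
  · refine integral_congr_ae ?_
    filter_upwards [coeFn_toL2 (memLp_nonlocal hK hG)] with x hx
    rw [hx, mul_comm]
    rfl
  · intro z
    simp only [Prod.fst_swap, Prod.snd_swap]
    rw [hK.symm, hΦ.map_sub_swap (w z.1)]; ring
  · exact integrable_mul_mul ENNReal.coe_ne_top hK.aestronglyMeasurable hG (Lp.memLp η) hK.bounded

/-- The fundamental inequality for the error of the backward Euler method. -/
lemma inner_sub_nonlocal_sub_le (hK : SymmKernel μ K κ) (hΦ : OddMono Φ) {w w' u : Lp ℝ 2 μ}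
    (hw : MemLp (fun z : Ω × Ω => Φ (w z.2 - w z.1)) 2 (μ.prod μ))
    (hw' : MemLp (fun z : Ω × Ω => Φ (w' z.2 - w' z.1)) 2 (μ.prod μ))
    (hu : MemLp (fun z : Ω × Ω => Φ (u z.2 - u z.1)) 2 (μ.prod μ)) {θ : ℝ} (h0 : 0 ≤ θ)
    (h1 : θ ≤ 1) :
    inner ℝ (w' + θ • (w - w') - u) (toL2 μ (nonlocal μ K Φ w) - toL2 μ (nonlocal μ K Φ u)) ≤
      -inner ℝ (w - w') (toL2 μ (nonlocal μ K Φ w) - toL2 μ (nonlocal μ K Φ w')) := by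
  set η₁ : Lp ℝ 2 μ := w' + θ • (w - w') - u with hη₁
  set η₂ : Lp ℝ 2 μ := w - w' with hη₂
  have i1 := integrable_kernel_mul_diff hK hΦ hw (Lp.memLp η₁)
  have i2 := integrable_kernel_mul_diff hK hΦ hu (Lp.memLp η₁)
  have i3 := integrable_kernel_mul_diff hK hΦ hw (Lp.memLp η₂)
  have i4 := integrable_kernel_mul_diff hK hΦ hw' (Lp.memLp η₂)
  rw [inner_sub_right, inner_sub_right, inner_toL2_nonlocal hK hΦ hw,
    inner_toL2_nonlocal hK hΦ hu, inner_toL2_nonlocal hK hΦ hw, inner_toL2_nonlocal hK hΦ hw']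
  have key : 0 ≤ ∫ z, ((K z.1 z.2 * Φ (w z.2 - w z.1) * (η₁ z.2 - η₁ z.1) -
      K z.1 z.2 * Φ (u z.2 - u z.1) * (η₁ z.2 - η₁ z.1)) +
      (K z.1 z.2 * Φ (w z.2 - w z.1) * (η₂ z.2 - η₂ z.1) -
      K z.1 z.2 * Φ (w' z.2 - w' z.1) * (η₂ z.2 - η₂ z.1))) ∂μ.prod μ := by
    refine integral_nonneg_of_ae ?_
    have e1 : ∀ᵐ x ∂μ, η₁ x = w' x + θ * (w x - w' x) - u x ∧ η₂ x = w x - w' x := by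
      filter_upwards [Lp.coeFn_sub (w' + θ • (w - w')) u, Lp.coeFn_add w' (θ • (w - w')),
        Lp.coeFn_smul θ (w - w'), Lp.coeFn_sub w w'] with x a1 a2 a3 a4
      constructor
      · rw [hη₁, a1, Pi.sub_apply, a2, Pi.add_apply, a3, Pi.smul_apply, a4, Pi.sub_apply,
          smul_eq_mul]
      · rw [hη₂, a4, Pi.sub_apply]
    filter_upwards [Measure.quasiMeasurePreserving_fst.ae e1,
      Measure.quasiMeasurePreserving_snd.ae e1] with z hz1 hz2
    rw [Pi.zero_apply, hz1.1, hz1.2, hz2.1, hz2.2]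
    -- The differences of the interpolant interpolate between the differences of w' and of w, so the
    -- scalar inequality applies at almost every pair of points.
    have hc : (w' z.2 - w' z.1) + θ * ((w z.2 - w z.1) - (w' z.2 - w' z.1)) ∈
        uIcc (w' z.2 - w' z.1) (w z.2 - w z.1) := by
      rw [← segment_eq_uIcc, segment_eq_image']
      exact ⟨θ, ⟨h0, h1⟩, by simp⟩
    have := neg_le_sub_mul_sub_of_mem_uIcc hΦ.mono (b := u z.2 - u z.1) hc
    have := mul_nonneg (hK.nonneg z.1 z.2) (sub_nonneg.2 this)
    refine this.trans (le_of_eq ?_)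
    ring
  have e := integral_add (i1.sub i2) (i3.sub i4)
  simp only [Pi.sub_apply] at e
  rw [e, integral_sub i1 i2, integral_sub i3 i4] at key
  linarith

/-- Stability of an implicit Euler step. -/
lemma norm_le_of_implicit_step (hK : SymmKernel μ K κ) (hΦ : OddMono Φ) {w w' F : Lp ℝ 2 μ}
    {τ : ℝ} (hτ : 0 ≤ τ) (hG : MemLp (fun z : Ω × Ω => Φ (w z.2 - w z.1)) 2 (μ.prod μ))
    (h : w - w' = τ • (toL2 μ (nonlocal μ K Φ w) + F)) : ‖w‖ ≤ ‖w'‖ + τ * ‖F‖ := by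
  have h1 : inner ℝ w (toL2 μ (nonlocal μ K Φ w)) ≤ 0 := by
    rw [inner_toL2_nonlocal hK hΦ hG]
    have : 0 ≤ ∫ z, K z.1 z.2 * Φ (w z.2 - w z.1) * (w z.2 - w z.1) ∂μ.prod μ :=
      integral_nonneg fun z => by
        have := hΦ.sub_mul_sub_nonneg (w z.2 - w z.1) 0
        rw [hΦ.map_zero, sub_zero, sub_zero] at this
        simp only [Pi.zero_apply]
        rw [mul_assoc]
        exact mul_nonneg (hK.nonneg _ _) this
    linarith
  have h2 : inner ℝ w w = inner ℝ w w' + τ * inner ℝ w (toL2 μ (nonlocal μ K Φ w)) +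
      τ * inner ℝ w F := by
    conv_lhs => rw [show inner ℝ w w = inner ℝ w (w' + (w - w')) by rw [add_sub_cancel]]
    rw [h, inner_add_right, inner_smul_right, inner_add_right]
    ring
  rw [real_inner_self_eq_norm_sq] at h2
  have h3 := real_inner_le_norm w w'
  have h4 := mul_le_mul_of_nonneg_left (real_inner_le_norm w F) hτ
  have h5 := mul_nonpos_of_nonneg_of_nonpos hτ h1
  by_contra! hc
  have : 0 ≤ τ * ‖F‖ := by positivity
  nlinarith [norm_nonneg w', norm_nonneg w]

/-- The error of the backward Euler method, including the consistency error of the operator. -/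
theorem norm_backwardEuler_sub_le (hK : SymmKernel μ K κ) (hΦ : OddMono Φ) {t : ℕ → ℝ} {N : ℕ}
    (ht : ∀ k < N, t k < t (k + 1)) {τ : ℝ} (hτ : ∀ k < N, t (k + 1) - t k ≤ τ)
    {u V : ℝ → Lp ℝ 2 μ} (hu : IsPrimitive u V (t 0) (t N)) {w F : ℕ → Lp ℝ 2 μ}
    (hw : ∀ k < N, w (k + 1) - w k =
      (t (k + 1) - t k) • (toL2 μ (nonlocal μ K Φ (w (k + 1))) + F k))
    (hwG : ∀ k ≤ N, MemLp (fun z : Ω × Ω => Φ (w k z.2 - w k z.1)) 2 (μ.prod μ))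
    (huG : ∀ s ∈ Icc (t 0) (t N), MemLp (fun z : Ω × Ω => Φ (u s z.2 - u s z.1)) 2 (μ.prod μ))
    {ψ : ℝ → ℝ} (hψ : IntervalIntegrable ψ volume (t 0) (t N)) (hψ0 : ∀ s, 0 ≤ ψ s)
    (hψF : ∀ k < N, ∀ᵐ s ∂volume.restrict (Ioo (t k) (t (k + 1))),
      ‖toL2 μ (nonlocal μ K Φ (u s)) + F k - V s‖ ≤ ψ s) :
    ∀ k < N, ∀ s ∈ Icc (t k) (t (k + 1)), ‖w (k + 1) - u s‖ ≤ ‖w 0 - u (t 0)‖ +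
      3 * τ * (‖toL2 μ (nonlocal μ K Φ (w 0)) + F 0‖ +
        ∑ j ∈ Finset.range N, ‖F j - F (j - 1)‖) + ∫ s in (t 0)..(t N), ψ s := by
  exact norm_implicit_euler_sub_le (A := fun v => toL2 μ (nonlocal μ K Φ v)) ht hτ hu hw
    (fun k hk => inner_toL2_nonlocal_sub_nonpos hK hΦ (hwG (k + 1) hk) (hwG k hk.le))
    (fun k hk s hs θ h0 h1 => inner_sub_nonlocal_sub_le hK hΦ (hwG (k + 1) hk) (hwG k hk.le)
      (huG s hs) h0 h1) hψ hψ0 hψF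

end Euler

/-! ### Solvability of one step of the discrete scheme -/

section DiscreteStep

variable {ι : Type*} [Fintype ι] {h : ι → ℝ} {A : ι → ι → ℝ} {b : ι → ℝ} {τ p : ℝ}

lemma sum_sum_antisymm {H : ι → ι → ℝ} (hH : ∀ i j, H j i = -H i j) (η : ι → ℝ) :
    ∑ i, ∑ j, H i j * (η j - η i) = -2 * ∑ i, (∑ j, H i j) * η i := by
  have h1 : ∑ i, ∑ j, H i j * η j = -∑ i, ∑ j, H i j * η i := by
    rw [Finset.sum_comm, ← Finset.sum_neg_distrib]
    refine Finset.sum_congr rfl fun i _ => ?_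
    rw [← Finset.sum_neg_distrib]
    refine Finset.sum_congr rfl fun j _ => ?_
    rw [hH]; ring
  simp only [mul_sub, Finset.sum_sub_distrib, Finset.sum_mul]
  rw [h1]; ring

lemma exists_isMinOn_discreteEnergy (hh : ∀ i, 0 < h i) {W : (ι → ℝ) → ℝ} (hW : Continuous W)
    (hW0 : ∀ v, 0 ≤ W v) (b : ι → ℝ) :
    ∃ v, ∀ v', (∑ i, h i * (v i - b i) ^ 2) / 2 + W v ≤ (∑ i, h i * (v' i - b i) ^ 2) / 2 + W v' := by
  set J : (ι → ℝ) → ℝ := fun v => (∑ i, h i * (v i - b i) ^ 2) / 2 + W v with hJ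
  have hJc : Continuous J := by fun_prop
  have hJb : J b = W b := by simp [hJ]
  -- Outside the cube of half-width R about b, some coordinate contributes at least h i · R² / 2 ≥ h
  -- i · R / 2 ≥ W b = J b to the energy. The summand 1 ensures R² ≥ R.
  set R : ℝ := 1 + ∑ i, 2 * W b / h i with hR
  have hRi : ∀ i, 2 * W b / h i ≤ R := fun i => by
    have := Finset.single_le_sum (f := fun i => 2 * W b / h i)
      (fun j _ => div_nonneg (mul_nonneg zero_le_two (hW0 b)) (hh j).le) (Finset.mem_univ i)
    linarith
  have hR1 : 1 ≤ R := by
    have : 0 ≤ ∑ i, 2 * W b / h i :=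
      Finset.sum_nonneg fun j _ => div_nonneg (mul_nonneg zero_le_two (hW0 b)) (hh j).le
    linarith
  obtain ⟨v, hv, hmin⟩ := (isCompact_univ_pi fun i => isCompact_Icc (a := b i - R)
    (b := b i + R)).exists_isMinOn (f := J) ⟨b, fun i _ => ⟨by linarith, by linarith⟩⟩
      hJc.continuousOn
  have hbv : J v ≤ J b := hmin (a := b) fun i _ => ⟨by linarith, by linarith⟩
  refine ⟨v, fun v' => ?_⟩
  by_cases hv' : v' ∈ univ.pi fun i => Icc (b i - R) (b i + R)
  · exact hmin hv'
  · simp only [mem_univ_pi, not_forall] at hv'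
    obtain ⟨i, hi⟩ := hv'
    refine hbv.trans ?_
    rw [hJb]
    have h1 : R ^ 2 ≤ (v' i - b i) ^ 2 := by
      rw [mem_Icc, not_and_or, not_le, not_le] at hi
      rcases hi with hi | hi <;> nlinarith
    have h2 : h i * (v' i - b i) ^ 2 ≤ ∑ i, h i * (v' i - b i) ^ 2 :=
      Finset.single_le_sum (f := fun i => h i * (v' i - b i) ^ 2)
        (fun j _ => mul_nonneg (hh j).le (sq_nonneg _)) (Finset.mem_univ i)
    have h3 : 2 * W b ≤ R * h i := (div_le_iff₀ (hh i)).1 (hRi i)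
    have h4 : R * h i ≤ h i * (v' i - b i) ^ 2 := by
      rw [mul_comm]
      exact mul_le_mul_of_nonneg_left (by nlinarith) (hh i).le
    have := hW0 v'
    linarith

/-- The equations say that v is a critical point of ½ ∑ h_i (v_i − b_i)² + τ/(2p) ∑∑ h_i h_j A_ij
|v_j − v_i|^p; the p is removed by differentiation and the 2 by symmetrization. A minimizer gives
existence. For uniqueness, the difference of two solutions is tested with itself and monotonicity of
Ψ is used. -/
theorem existsUnique_discrete_step (hp : 1 < p) (hh : ∀ i, 0 < h i) (hA : ∀ i j, 0 ≤ A i j)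
    (hs : ∀ i j, A i j = A j i) (hτ : 0 ≤ τ) (b : ι → ℝ) :
    ∃! v : ι → ℝ, ∀ i, v i - b i = τ * ∑ j, h j * A i j * Psi p (v j - v i) := by
  have hanti : ∀ (v : ι → ℝ) i j, h j * h i * A j i * Psi p (v i - v j) =
      -(h i * h j * A i j * Psi p (v j - v i)) := fun v i j => by
    rw [hs, (oddMono_Psi hp).map_sub_swap (v i)]; ring
  obtain ⟨v, hv⟩ := exists_isMinOn_discreteEnergy hh (b := b)
    (W := fun v => τ / (2 * p) * ∑ i, ∑ j, h i * h j * A i j * |v j - v i| ^ p)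
    (by
      have := zero_le_one.trans hp.le
      refine continuous_const.mul (continuous_finsetSum _ fun i _ => continuous_finsetSum _ fun j _ =>
        continuous_const.mul (Continuous.rpow_const (by fun_prop) fun _ => Or.inr this)))
    (fun v => mul_nonneg (by positivity) (Finset.sum_nonneg fun i _ => Finset.sum_nonneg fun j _ =>
      mul_nonneg (mul_nonneg (mul_nonneg (hh i).le (hh j).le) (hA i j)) (by positivity)))
  refine existsUnique_of_exists_of_unique ⟨v, fun i => ?_⟩ fun v' v hv' hv0 => ?_
  · classical
    set η : ι → ℝ := Pi.single i 1 with hη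
    have hlin : ∀ c c' : ℝ, HasDerivAt (fun s : ℝ => c + s * c') c' 0 := fun c c' => by
      simpa using ((hasDerivAt_id (0 : ℝ)).mul_const c').const_add c
    have hd : HasDerivAt (fun s : ℝ => (∑ k, h k * ((v k - b k) + s * η k) ^ 2) / 2 +
        τ / (2 * p) * ∑ k, ∑ j, h k * h j * A k j * |(v j - v k) + s * (η j - η k)| ^ p)
        ((∑ k, h k * (2 * (v k - b k) * η k)) / 2 + τ / (2 * p) * ∑ k, ∑ j, h k * h j * A k j *
          (p * |v j - v k| ^ (p - 2) * (v j - v k) * (η j - η k))) 0 := by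
      refine HasDerivAt.add (HasDerivAt.div_const (HasDerivAt.fun_sum fun k _ => ?_) 2)
        (HasDerivAt.const_mul _ (HasDerivAt.fun_sum fun k _ => HasDerivAt.fun_sum fun j _ => ?_))
      · have := (hlin (v k - b k) (η k)).pow 2
        simpa using this.const_mul (h k)
      · have h0 : (v j - v k) + 0 * (η j - η k) = v j - v k := by ring
        have := HasDerivAt.comp (0 : ℝ) (h₂ := fun x : ℝ => |x| ^ p) (hasDerivAt_abs_rpow _ hp)
          (hlin (v j - v k) (η j - η k))
        rw [h0] at this
        exact this.const_mul _
    have hmin : IsLocalMin (fun s : ℝ => (∑ k, h k * ((v k - b k) + s * η k) ^ 2) / 2 +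
        τ / (2 * p) * ∑ k, ∑ j, h k * h j * A k j * |(v j - v k) + s * (η j - η k)| ^ p) 0 := by
      refine Filter.Eventually.of_forall fun s => ?_
      have := hv fun k => v k + s * η k
      simp only [zero_mul, add_zero]
      refine this.trans (le_of_eq ?_)
      congr 3
      · ext k; ring
      · ext k; congr 1; ext j; congr 3; ring
    have h0 := hmin.hasDerivAt_eq_zero hd
    have e1 : ∑ k, h k * (2 * (v k - b k) * η k) = 2 * (h i * (v i - b i)) := by
      rw [Finset.sum_eq_single i]
      · simp [hη]; ring
      · intro k _ hk; simp [hη, hk]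
      · simp
    have e2 : ∑ k, ∑ j, h k * h j * A k j * (p * |v j - v k| ^ (p - 2) * (v j - v k) *
        (η j - η k)) = p * (-2 * (h i * ∑ j, h j * A i j * Psi p (v j - v i))) := by
      have := sum_sum_antisymm (H := fun i j => h i * h j * A i j * Psi p (v j - v i)) (hanti v) η
      have e3 : ∑ k, (∑ j, h k * h j * A k j * Psi p (v j - v k)) * η k =
          h i * ∑ j, h j * A i j * Psi p (v j - v i) := by
        rw [Finset.sum_eq_single i]
        · simp only [hη, Pi.single_eq_same, mul_one, Finset.mul_sum]
          refine Finset.sum_congr rfl fun j _ => by ring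
        · intro k _ hk; simp [hη, hk]
        · simp
      rw [← e3, ← this, Finset.mul_sum]
      refine Finset.sum_congr rfl fun k _ => ?_
      rw [Finset.mul_sum]
      refine Finset.sum_congr rfl fun j _ => ?_
      rw [Psi]; ring
    rw [e1, e2] at h0
    have hp0 : p ≠ 0 := by positivity
    have h1 : h i * (v i - b i - τ * ∑ j, h j * A i j * Psi p (v j - v i)) = 0 := by
      rw [← h0]; field_simp; ring
    have := (mul_eq_zero.1 h1).resolve_left (hh i).ne'
    linarith
  · set D : ι → ι → ℝ := fun i j => h i * h j * A i j * Psi p (v' j - v' i) -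
      h i * h j * A i j * Psi p (v j - v i) with hD
    have h1 := sum_sum_antisymm (H := D)
      (fun i j => by simp only [hD, hanti v' i j, hanti v i j]; ring) (fun i => v' i - v i)
    have h2 : ∑ i, h i * (v' i - v i) ^ 2 = τ * ∑ i, (∑ j, D i j) * (v' i - v i) := by
      rw [Finset.mul_sum]
      refine Finset.sum_congr rfl fun i _ => ?_
      have e1 : v' i - v i = τ * (∑ j, h j * A i j * Psi p (v' j - v' i)) -
          τ * ∑ j, h j * A i j * Psi p (v j - v i) := by
        rw [← hv' i, ← hv0 i]; ring
      have e2 : ∑ j, D i j = h i * ((∑ j, h j * A i j * Psi p (v' j - v' i)) -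
          ∑ j, h j * A i j * Psi p (v j - v i)) := by
        simp only [hD, Finset.sum_sub_distrib, mul_sub, Finset.mul_sum, mul_assoc]
      rw [e2, sq]
      nth_rewrite 1 [e1]
      ring
    have h3 : 0 ≤ ∑ i, ∑ j, D i j * ((v' j - v j) - (v' i - v i)) :=
      Finset.sum_nonneg fun i _ => Finset.sum_nonneg fun j _ => by
        have := mul_nonneg (mul_nonneg (mul_nonneg (hh i).le (hh j).le) (hA i j))
          ((oddMono_Psi hp).sub_mul_sub_nonneg (v' j - v' i) (v j - v i))
        refine this.trans (le_of_eq ?_)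
        simp only [hD]; ring
    have h4 : ∑ i, h i * (v' i - v i) ^ 2 = 0 := by
      refine le_antisymm ?_ (Finset.sum_nonneg fun i _ => mul_nonneg (hh i).le (sq_nonneg _))
      rw [h2]
      exact mul_nonpos_of_nonneg_of_nonpos hτ (by linarith)
    rw [Finset.sum_eq_zero_iff_of_nonneg fun i _ => mul_nonneg (hh i).le (sq_nonneg _)] at h4
    ext i
    have := h4 i (Finset.mem_univ i)
    have := pow_eq_zero_iff (two_ne_zero) |>.1 ((mul_eq_zero.1 this).resolve_left (hh i).ne')
    linarith

end DiscreteStep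

/-! ### Finite partitions into cells, averages and step functions -/

section Cells

open ProbabilityTheory

variable {Ω ι : Type*} [MeasurableSpace Ω] [Fintype ι] {μ : Measure Ω} {c : ι → Set Ω}

/-- A finite partition of a measure space, up to a null set, into sets of positive measure. -/
structure CellPartition (μ : Measure Ω) (c : ι → Set Ω) : Prop where
  measurableSet : ∀ i, MeasurableSet (c i)
  disjoint : ∀ i j, i ≠ j → Disjoint (c i) (c j)
  pos : ∀ i, μ (c i) ≠ 0
  cover : ∀ᵐ x ∂μ, ∃ i, x ∈ c i

/-- The function equal to `v i` on the `i`-th cell. -/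
def stepFun (c : ι → Set Ω) (v : ι → ℝ) (x : Ω) : ℝ := ∑ i, (c i).indicator (fun _ => v i) x

/-- The average of `w` over the `i`-th cell. -/
def cellAvg (μ : Measure Ω) (c : ι → Set Ω) (w : Ω → ℝ) (i : ι) : ℝ := ∫ x, w x ∂μ[|c i]

variable (hc : CellPartition μ c)

include hc

lemma CellPartition.stepFun_eq (v : ι → ℝ) {i : ι} {x : Ω} (hx : x ∈ c i) :
    stepFun c v x = v i := by
  rw [stepFun, Finset.sum_eq_single i]
  · exact indicator_of_mem hx _
  · exact fun j _ hj => indicator_of_notMem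
      (fun h => Set.disjoint_left.1 (hc.disjoint j i hj) h hx) _
  · simp

lemma CellPartition.measurable_stepFun (v : ι → ℝ) : Measurable (stepFun c v) :=
  Finset.measurable_fun_sum _ fun i _ => measurable_const.indicator (hc.measurableSet i)

variable [IsFiniteMeasure μ]

lemma CellPartition.isProbabilityMeasure (i : ι) : IsProbabilityMeasure (μ[|c i]) :=
  cond_isProbabilityMeasure (hc.pos i)

lemma CellPartition.cond_le (i : ι) {P : Ω → Prop} (h : ∀ᵐ x ∂μ, P x) : ∀ᵐ x ∂μ[|c i], P x :=
  cond_absolutelyContinuous.ae_le h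

lemma CellPartition.ae_cond_mem (i : ι) : ∀ᵐ x ∂μ[|c i], x ∈ c i :=
  ProbabilityTheory.ae_cond_mem (hc.measurableSet i)

lemma CellPartition.mul_lintegral_cond (i : ι) (f : Ω → ℝ≥0∞) :
    μ (c i) * ∫⁻ x, f x ∂μ[|c i] = ∫⁻ x in c i, f x ∂μ := by
  rw [ProbabilityTheory.cond, lintegral_smul_measure, smul_eq_mul, ← mul_assoc,
    ENNReal.mul_inv_cancel (hc.pos i) (measure_ne_top _ _), one_mul]

/-- Integration cell by cell. -/
lemma CellPartition.lintegral_eq_sum (f : Ω → ℝ≥0∞) :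
    ∫⁻ x, f x ∂μ = ∑ i, μ (c i) * ∫⁻ x, f x ∂μ[|c i] := by
  have h1 : μ.restrict (⋃ i, c i) = μ := by
    rw [Measure.restrict_eq_self_of_ae_mem]
    filter_upwards [hc.cover] with x hx using mem_iUnion.2 hx
  conv_lhs => rw [← h1]
  rw [lintegral_iUnion hc.measurableSet (fun i j hij => hc.disjoint i j hij), tsum_fintype]
  exact Finset.sum_congr rfl fun i _ => (hc.mul_lintegral_cond i f).symm

lemma CellPartition.lintegral_stepFun_comp (v : ι → ℝ) (φ : ℝ → ℝ≥0∞) :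
    ∫⁻ x, φ (stepFun c v x) ∂μ = ∑ i, μ (c i) * φ (v i) := by
  rw [hc.lintegral_eq_sum]
  refine Finset.sum_congr rfl fun i _ => ?_
  congr 1
  have := hc.isProbabilityMeasure i
  have : ∀ᵐ x ∂μ[|c i], φ (stepFun c v x) = φ (v i) := by
    filter_upwards [hc.ae_cond_mem i] with x hx
    rw [hc.stepFun_eq v hx]
  rw [lintegral_congr_ae this, lintegral_const, measure_univ, mul_one]

lemma CellPartition.integral_stepFun_comp (v : ι → ℝ) (φ : ℝ → ℝ) :
    ∫ x, φ (stepFun c v x) ∂μ = ∑ i, μ.real (c i) * φ (v i) := by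
  have h1 : μ.restrict (⋃ i, c i) = μ := by
    rw [Measure.restrict_eq_self_of_ae_mem]
    filter_upwards [hc.cover] with x hx using mem_iUnion.2 hx
  have he : ∀ i, EqOn (fun x => φ (stepFun c v x)) (fun _ => φ (v i)) (c i) := fun i x hx => by
    simp only [hc.stepFun_eq v hx]
  conv_lhs => rw [← h1]
  rw [integral_iUnion_fintype hc.measurableSet (fun i j hij => hc.disjoint i j hij)]
  · refine Finset.sum_congr rfl fun i _ => ?_
    rw [setIntegral_congr_fun (hc.measurableSet i) (he i), setIntegral_const, smul_eq_mul]
  · intro i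
    exact (integrableOn_const (measure_ne_top _ _)).congr_fun (he i).symm (hc.measurableSet i)

lemma CellPartition.cellAvg_eq (w : Ω → ℝ) (i : ι) :
    cellAvg μ c w i = (μ.real (c i))⁻¹ * ∫ x in c i, w x ∂μ := by
  rw [cellAvg, ProbabilityTheory.cond, integral_smul_measure, ENNReal.toReal_inv, smul_eq_mul]
  rfl

lemma CellPartition.enorm_cellAvg_le {q : ℝ≥0∞} (hq : 1 ≤ q) {w : Ω → ℝ}
    (hw : AEStronglyMeasurable w μ) (i : ι) : ‖cellAvg μ c w i‖ₑ ≤ eLpNorm w q (μ[|c i]) := by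
  have := hc.isProbabilityMeasure i
  refine (enorm_integral_le_lintegral_enorm _).trans ?_
  rw [← eLpNorm_one_eq_lintegral_enorm]
  exact eLpNorm_le_eLpNorm_of_exponent_le hq (hw.mono_ac cond_absolutelyContinuous)

/-- Averaging is a contraction in all `L^q`. -/
lemma CellPartition.eLpNorm_stepFun_cellAvg_le {q : ℝ≥0∞} (hq : 1 ≤ q) {w : Ω → ℝ}
    (hw : AEStronglyMeasurable w μ) : eLpNorm (stepFun c (cellAvg μ c w)) q μ ≤ eLpNorm w q μ := by
  rcases eq_or_ne q ⊤ with rfl | hqt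
  · rw [eLpNorm_exponent_top, eLpNorm_exponent_top]
    refine essSup_le_of_ae_le _ ?_
    filter_upwards [hc.cover] with x ⟨i, hx⟩
    rw [hc.stepFun_eq _ hx]
    refine (hc.enorm_cellAvg_le hq hw i).trans ?_
    rw [eLpNorm_exponent_top]
    exact eLpNormEssSup_mono_measure _ cond_absolutelyContinuous
  · have hq0 : q ≠ 0 := (zero_lt_one.trans_le hq).ne'
    have hqr : 0 < q.toReal := ENNReal.toReal_pos hq0 hqt
    rw [eLpNorm_eq_lintegral_rpow_enorm_toReal hq0 hqt,
      eLpNorm_eq_lintegral_rpow_enorm_toReal hq0 hqt]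
    refine ENNReal.rpow_le_rpow ?_ (by positivity)
    rw [hc.lintegral_stepFun_comp _ (fun a => ‖a‖ₑ ^ q.toReal), hc.lintegral_eq_sum]
    refine Finset.sum_le_sum fun i _ => mul_le_mul_right ?_ _
    refine (ENNReal.rpow_le_rpow (hc.enorm_cellAvg_le hq hw i) hqr.le).trans (le_of_eq ?_)
    rw [eLpNorm_eq_lintegral_rpow_enorm_toReal hq0 hqt, ← ENNReal.rpow_mul, one_div,
      inv_mul_cancel₀ hqr.ne', ENNReal.rpow_one]

/-- The error of the averages in terms of the oscillation inside the cells. -/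
lemma CellPartition.sq_eLpNorm_stepFun_cellAvg_sub_le {w : Ω → ℝ} (hw : MemLp w 2 μ) :
    eLpNorm (fun x => stepFun c (cellAvg μ c w) x - w x) 2 μ ^ 2 ≤
      ∑ i, μ (c i) * ∫⁻ x, ∫⁻ y, ‖w y - w x‖ₑ ^ 2 ∂μ[|c i] ∂μ[|c i] := by
  rw [sq_eLpNorm_two, hc.lintegral_eq_sum]
  refine Finset.sum_le_sum fun i _ => mul_le_mul_right (lintegral_mono_ae ?_) _
  have := hc.isProbabilityMeasure i
  have hwi : MemLp w 2 (μ[|c i]) :=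
    (hw.restrict (c i)).smul_measure (ENNReal.inv_ne_top.2 (hc.pos i))
  have hint : Integrable w (μ[|c i]) := hwi.integrable one_le_two
  filter_upwards [hc.ae_cond_mem i] with x hx
  have e1 : stepFun c (cellAvg μ c w) x - w x = ∫ y, (w y - w x) ∂μ[|c i] := by
    rw [hc.stepFun_eq _ hx, integral_sub hint (integrable_const _), integral_const,
      probReal_univ, one_smul, cellAvg]
  rw [e1, ← sq_eLpNorm_two]
  refine pow_le_pow_left' ((enorm_integral_le_lintegral_enorm _).trans ?_) 2
  rw [← eLpNorm_one_eq_lintegral_enorm]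
  exact eLpNorm_le_eLpNorm_of_exponent_le one_le_two (hwi.1.sub aestronglyMeasurable_const)

/-- Serves space × space, for kernels, and space × time, for source terms. -/
lemma CellPartition.prod {Ω' ι' : Type*} [MeasurableSpace Ω'] [Fintype ι'] {μ' : Measure Ω'}
    [IsFiniteMeasure μ'] {c' : ι' → Set Ω'} (hc' : CellPartition μ' c') :
    CellPartition (μ.prod μ') fun k : ι × ι' => c k.1 ×ˢ c' k.2 := by
  refine ⟨fun k => (hc.measurableSet _).prod (hc'.measurableSet _), fun k l hkl => ?_, fun k => ?_,
    ?_⟩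
  · rw [Set.disjoint_prod]
    by_cases h : k.1 = l.1
    · exact Or.inr (hc'.disjoint _ _ fun h' => hkl (Prod.ext h h'))
    · exact Or.inl (hc.disjoint _ _ h)
  · rw [Measure.prod_prod]
    exact mul_ne_zero (hc.pos _) (hc'.pos _)
  · filter_upwards [Measure.quasiMeasurePreserving_fst.ae hc.cover,
      Measure.quasiMeasurePreserving_snd.ae hc'.cover] with z ⟨i, hi⟩ ⟨j, hj⟩
    exact ⟨(i, j), hi, hj⟩

omit hc [IsFiniteMeasure μ] in
lemma cond_prod_cond [SFinite μ] {Ω' : Type*} [MeasurableSpace Ω'] {μ' : Measure Ω'} [SFinite μ']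
    {s : Set Ω} {s' : Set Ω'} (h : μ s ≠ 0) (h' : μ' s' ≠ 0) :
    (μ.prod μ')[|s ×ˢ s'] = (μ[|s]).prod (μ'[|s']) := by
  simp only [ProbabilityTheory.cond]
  rw [Measure.prod_smul_left, Measure.prod_smul_right, Measure.prod_restrict, Measure.prod_prod,
    smul_smul, ENNReal.mul_inv (Or.inl h) (Or.inr h')]

/-! Averages of kernels -/

/-- The step kernel with the averages of `K` over the products of cells. -/
def avgKernel (μ : Measure Ω) (c : ι → Set Ω) (K : Ω → Ω → ℝ) (x y : Ω) : ℝ :=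
  stepFun (fun k : ι × ι => c k.1 ×ˢ c k.2)
    (cellAvg (μ.prod μ) (fun k : ι × ι => c k.1 ×ˢ c k.2) fun z => K z.1 z.2) (x, y)

/-- The average of the kernel `K` over the product of two cells. -/
def cellAvg₂ (μ : Measure Ω) (c : ι → Set Ω) (K : Ω → Ω → ℝ) (i j : ι) : ℝ :=
  cellAvg (μ.prod μ) (fun k : ι × ι => c k.1 ×ˢ c k.2) (fun z => K z.1 z.2) (i, j)

lemma CellPartition.avgKernel_eq (K : Ω → Ω → ℝ) {i j : ι} {x y : Ω} (hx : x ∈ c i)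
    (hy : y ∈ c j) : avgKernel μ c K x y = cellAvg₂ μ c K i j :=
  (hc.prod hc).stepFun_eq _ (i := (i, j)) ⟨hx, hy⟩

lemma CellPartition.cellAvg₂_eq_integral (K : Ω → Ω → ℝ) (i j : ι) :
    cellAvg₂ μ c K i j = ∫ z, K z.1 z.2 ∂(μ[|c i]).prod (μ[|c j]) := by
  rw [cellAvg₂, cellAvg, cond_prod_cond (hc.pos i) (hc.pos j)]

lemma CellPartition.cellAvg₂_symm {K : Ω → Ω → ℝ} (hK : ∀ x y, K x y = K y x) (i j : ι) :
    cellAvg₂ μ c K i j = cellAvg₂ μ c K j i := by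
  have := hc.isProbabilityMeasure i
  have := hc.isProbabilityMeasure j
  rw [hc.cellAvg₂_eq_integral, hc.cellAvg₂_eq_integral, ← integral_prod_swap]
  simp only [Prod.fst_swap, Prod.snd_swap]
  exact integral_congr_ae (Filter.Eventually.of_forall fun z => hK _ _)

lemma CellPartition.cellAvg₂_nonneg {K : Ω → Ω → ℝ} (hK : ∀ x y, 0 ≤ K x y) (i j : ι) :
    0 ≤ cellAvg₂ μ c K i j := integral_nonneg fun _ => hK _ _

/-- The bound κ is preserved by Jensen's inequality: for x ∈ c i the squared norm of the averaged
section is at most the mean of ‖K(x',·)‖² over x' ∈ c i. All estimates for the continuous operator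
thus hold for the discrete one, uniformly in the mesh. -/
lemma CellPartition.symmKernel_avgKernel {K : Ω → Ω → ℝ} {κ : ℝ≥0} (hK : SymmKernel μ K κ) :
    SymmKernel μ (avgKernel μ c K) κ := by
  refine ⟨(hc.prod hc).measurable_stepFun _, fun x y => ?_, fun x y => ?_, ?_⟩
  · exact Finset.sum_nonneg fun k _ => indicator_nonneg
      (fun _ _ => hc.cellAvg₂_nonneg hK.nonneg _ _) _
  · rw [avgKernel, avgKernel, stepFun, stepFun, ← (Equiv.prodComm ι ι).sum_comp]
    refine Finset.sum_congr rfl fun k _ => ?_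
    have h := hc.cellAvg₂_symm hK.symm k.1 k.2
    change (c k.2 ×ˢ c k.1).indicator (fun _ => cellAvg₂ μ c K k.2 k.1) (x, y) =
      (c k.1 ×ˢ c k.2).indicator (fun _ => cellAvg₂ μ c K k.1 k.2) (y, x)
    by_cases hk : (x, y) ∈ c k.2 ×ˢ c k.1
    · rw [indicator_of_mem hk, indicator_of_mem (show (y, x) ∈ c k.1 ×ˢ c k.2 from ⟨hk.2, hk.1⟩)]
      exact h.symm
    · rw [indicator_of_notMem hk, indicator_of_notMem fun h' => hk ⟨h'.2, h'.1⟩]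
  · filter_upwards [hc.cover] with x ⟨i, hx⟩
    have := hc.isProbabilityMeasure i
    refine pow_two_le_imp ?_
    have e1 : (avgKernel μ c K x) =ᵐ[μ] stepFun c (cellAvg₂ μ c K i) := by
      filter_upwards [hc.cover] with y ⟨j, hy⟩
      rw [hc.avgKernel_eq K hx hy, hc.stepFun_eq _ hy]
    rw [eLpNorm_congr_ae e1, sq_eLpNorm_two, hc.lintegral_stepFun_comp _ fun a => ‖a‖ₑ ^ 2]
    have hm : Measurable fun z : Ω × Ω => ‖K z.1 z.2‖ₑ ^ 2 := hK.measurable.enorm.pow_const 2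
    calc ∑ j, μ (c j) * ‖cellAvg₂ μ c K i j‖ₑ ^ 2
        ≤ ∑ j, μ (c j) * ∫⁻ x', ∫⁻ y, ‖K x' y‖ₑ ^ 2 ∂μ[|c j] ∂μ[|c i] := by
          refine Finset.sum_le_sum fun j _ => mul_le_mul_right ?_ _
          have := hc.isProbabilityMeasure j
          rw [← lintegral_prod _ hm.aemeasurable, ← sq_eLpNorm_two, hc.cellAvg₂_eq_integral]
          refine pow_le_pow_left' ((enorm_integral_le_lintegral_enorm _).trans ?_) 2
          rw [← eLpNorm_one_eq_lintegral_enorm]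
          exact eLpNorm_le_eLpNorm_of_exponent_le one_le_two hK.measurable.aestronglyMeasurable
      _ = ∫⁻ x', eLpNorm (K x') 2 μ ^ 2 ∂μ[|c i] := by
          have hmj : ∀ j, Measurable fun x' => ∫⁻ y, ‖K x' y‖ₑ ^ 2 ∂μ[|c j] := fun j => by
            have := hc.isProbabilityMeasure j
            exact hm.lintegral_prod_right'
          simp_rw [sq_eLpNorm_two]
          rw [← lintegral_congr fun x' => (hc.lintegral_eq_sum fun y => ‖K x' y‖ₑ ^ 2).symm,
            lintegral_finsetSum _ fun j _ => (hmj j).const_mul _]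
          exact Finset.sum_congr rfl fun j _ => (lintegral_const_mul _ (hmj j)).symm
      _ ≤ ∫⁻ _, (κ : ℝ≥0∞) ^ 2 ∂μ[|c i] := by
          refine lintegral_mono_ae ?_
          filter_upwards [hc.cond_le i hK.bounded] with x' hx'
          exact pow_le_pow_left' hx' 2
      _ = (κ : ℝ≥0∞) ^ 2 := by rw [lintegral_const, measure_univ, mul_one]

/-- The nonlocal operator on step functions. -/
lemma CellPartition.nonlocal_avgKernel_stepFun (K : Ω → Ω → ℝ) (Φ : ℝ → ℝ) (v : ι → ℝ) {i : ι}
    {x : Ω} (hx : x ∈ c i) : nonlocal μ (avgKernel μ c K) Φ (stepFun c v) x =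
      ∑ j, μ.real (c j) * cellAvg₂ μ c K i j * Φ (v j - v i) := by
  have e1 : (fun y => avgKernel μ c K x y * Φ (stepFun c v y - stepFun c v x)) =ᵐ[μ]
      stepFun c fun j => cellAvg₂ μ c K i j * Φ (v j - v i) := by
    filter_upwards [hc.cover] with y ⟨j, hy⟩
    rw [hc.avgKernel_eq K hx hy, hc.stepFun_eq _ hy, hc.stepFun_eq _ hx, hc.stepFun_eq _ hy]
  rw [nonlocal, integral_congr_ae e1]
  refine (hc.integral_stepFun_comp _ fun a => a).trans ?_
  exact Finset.sum_congr rfl fun j _ => by ring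

lemma CellPartition.memLp_stepFun (v : ι → ℝ) (q : ℝ≥0∞) : MemLp (stepFun c v) q μ := by
  refine MemLp.of_bound (hc.measurable_stepFun v).aestronglyMeasurable (∑ i, |v i|) ?_
  filter_upwards [hc.cover] with x ⟨i, hx⟩
  rw [hc.stepFun_eq _ hx]
  exact Finset.single_le_sum (f := fun i => |v i|) (fun j _ => abs_nonneg _) (Finset.mem_univ i)

end Cells

/-! ### Partitions of intervals and meshes -/

section Partitions

variable {a b : ℝ} {n : ℕ} (P : Partition a b n)

/-- The points of a partition, indexed by natural numbers. -/
def Partition.node (k : ℕ) : ℝ := P.pt ⟨min k n, by omega⟩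

lemma Partition.node_eq {k : ℕ} (hk : k ≤ n) : P.node k = P.pt ⟨k, by omega⟩ := by
  simp only [node, min_eq_left hk]

lemma Partition.node_zero : P.node 0 = a := by rw [P.node_eq (Nat.zero_le n)]; exact P.first

lemma Partition.node_last : P.node n = b := by rw [P.node_eq le_rfl]; exact P.last

lemma Partition.node_lt {j k : ℕ} (hjk : j < k) (hk : k ≤ n) : P.node j < P.node k := by
  rw [P.node_eq hk, P.node_eq (hjk.le.trans hk)]
  exact P.strictMono hjk

lemma Partition.node_le {j k : ℕ} (hjk : j ≤ k) : P.node j ≤ P.node k :=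
  P.strictMono.monotone (by simp only [Fin.mk_le_mk]; omega)

lemma Partition.node_mem (k : ℕ) : P.node k ∈ Icc a b := by
  refine ⟨?_, ?_⟩
  · exact P.node_zero.ge.trans (P.node_le (Nat.zero_le k))
  · refine le_trans ?_ P.node_last.le
    exact P.strictMono.monotone (by simp only [Fin.mk_le_mk]; omega)

lemma Partition.interval_eq (k : Fin n) : P.interval k = Ioc (P.node k) (P.node (k + 1)) := by
  rw [P.node_eq (show (k : ℕ) ≤ n by omega), P.node_eq (show (k : ℕ) + 1 ≤ n by omega)]
  rfl

lemma Partition.step_eq (k : Fin n) : P.step k = P.node (k + 1) - P.node k := by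
  rw [P.node_eq (show (k : ℕ) ≤ n by omega), P.node_eq (show (k : ℕ) + 1 ≤ n by omega)]
  rfl

lemma Partition.step_pos (k : Fin n) : 0 < P.step k :=
  sub_pos.2 (P.strictMono (Fin.castSucc_lt_succ (i := k)))

lemma Partition.step_le_size (k : Fin n) : P.step k ≤ P.size :=
  le_ciSup (Set.finite_range _).bddAbove k

lemma Partition.size_nonneg : 0 ≤ P.size := Real.iSup_nonneg fun k => (P.step_pos k).le

lemma Partition.step_le (k : Fin n) : P.step k ≤ b - a := by
  rw [P.step_eq]
  linarith [(P.node_mem k).1, (P.node_mem (k + 1)).2]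

lemma Partition.size_le (hab : a ≤ b) : P.size ≤ b - a := by
  rcases isEmpty_or_nonempty (Fin n) with h | h
  · rw [size, Real.iSup_of_isEmpty]; linarith
  · exact ciSup_le P.step_le

lemma Partition.interval_subset (k : Fin n) : P.interval k ⊆ Ioc a b := by
  rw [P.interval_eq]
  exact Ioc_subset_Ioc (P.node_mem _).1 (P.node_mem _).2

lemma Partition.measurableSet_interval (k : Fin n) : MeasurableSet (P.interval k) :=
  measurableSet_Ioc

lemma Partition.disjoint_interval {j k : Fin n} (h : j ≠ k) :
    Disjoint (P.interval j) (P.interval k) := by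
  rw [P.interval_eq, P.interval_eq, Set.disjoint_left]
  intro x hx hy
  rcases lt_or_gt_of_ne h with h | h
  · have := P.node_le (show (j : ℕ) + 1 ≤ k from h)
    linarith [hx.2, hy.1]
  · have := P.node_le (show (k : ℕ) + 1 ≤ j from h)
    linarith [hx.1, hy.2]

lemma Partition.exists_mem_interval {x : ℝ} (hx : x ∈ Ioc a b) : ∃ k, x ∈ P.interval k := by
  have key : ∀ m ≤ n, x ≤ P.node m → ∃ k, x ∈ P.interval k := by
    intro m
    induction m with
    | zero => intro _ h; rw [P.node_zero] at h; exact absurd hx.1 (not_lt.2 h)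
    | succ m ih =>
      intro hm h
      rcases le_or_gt x (P.node m) with h' | h'
      · exact ih (by omega) h'
      · exact ⟨⟨m, hm⟩, by rw [P.interval_eq]; exact ⟨h', h⟩⟩
  exact key n le_rfl (by rw [P.node_last]; exact hx.2)

lemma Partition.volume_interval (k : Fin n) : volume (P.interval k) = ENNReal.ofReal (P.step k) :=
  Real.volume_Ioc

lemma Partition.abs_sub_le_of_mem_interval {k : Fin n} {x y : ℝ} (hx : x ∈ P.interval k)
    (hy : y ∈ P.interval k) : |x - y| ≤ P.size := by
  refine le_trans ?_ (P.step_le_size k)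
  rw [P.interval_eq] at hx hy
  rw [P.step_eq, abs_le]
  constructor <;> linarith [hx.1, hx.2, hy.1, hy.2]

/-- The intervals of a partition as cells of `[a,b]`. -/
lemma Partition.cellPartition : CellPartition (volume.restrict (Icc a b)) P.interval := by
  refine ⟨P.measurableSet_interval, fun j k h => P.disjoint_interval h, fun k => ?_, ?_⟩
  · rw [Measure.restrict_apply (P.measurableSet_interval k), inter_eq_self_of_subset_left
      ((P.interval_subset k).trans Ioc_subset_Icc_self), P.volume_interval]
    exact (ENNReal.ofReal_pos.2 (P.step_pos k)).ne'
  · rw [← Measure.restrict_congr_set (Ioc_ae_eq_Icc (μ := volume))]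
    filter_upwards [ae_restrict_mem measurableSet_Ioc] with x hx using P.exists_mem_interval hx

end Partitions

section Meshes

variable {d n : ℕ} (m : Mesh d n)

lemma measurableSet_Om : MeasurableSet (Om d) := measurableSet_Icc

instance : IsProbabilityMeasure (mu d) := by
  refine ⟨?_⟩
  rw [mu, Measure.restrict_apply_univ, Om, Real.volume_Icc_pi]
  simp

lemma Mesh.measurableSet_cell (i : Idx d n) : MeasurableSet (m.cell i) :=
  MeasurableSet.univ_pi fun k => (m k).measurableSet_interval _

lemma Mesh.cell_subset (i : Idx d n) : m.cell i ⊆ Om d := fun x hx => by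
  rw [cell, mem_univ_pi] at hx
  have h : ∀ k, x k ∈ Ioc (0 : ℝ) 1 := fun k => (m k).interval_subset _ (hx k)
  exact ⟨fun k => (h k).1.le, fun k => (h k).2⟩

lemma Mesh.volume_cell (i : Idx d n) :
    volume (m.cell i) = ENNReal.ofReal (∏ k, (m k).step (i k)) := by
  rw [cell, volume_pi_pi, ENNReal.ofReal_prod_of_nonneg fun k _ => ((m k).step_pos _).le]
  exact Finset.prod_congr rfl fun k _ => (m k).volume_interval _

lemma Mesh.vol_pos (i : Idx d n) : 0 < m.vol i := by
  rw [vol, measureReal_def, m.volume_cell, ENNReal.toReal_ofReal]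
  · exact Finset.prod_pos fun k _ => (m k).step_pos _
  · exact Finset.prod_nonneg fun k _ => ((m k).step_pos _).le

lemma Mesh.mu_restrict_cell (i : Idx d n) :
    (mu d).restrict (m.cell i) = volume.restrict (m.cell i) := by
  rw [mu, Measure.restrict_restrict (m.measurableSet_cell i),
    inter_eq_self_of_subset_left (m.cell_subset i)]

lemma Mesh.mu_cell (i : Idx d n) : mu d (m.cell i) = volume (m.cell i) := by
  rw [mu, Measure.restrict_apply (m.measurableSet_cell i),
    inter_eq_self_of_subset_left (m.cell_subset i)]

lemma Mesh.mu_real_cell (i : Idx d n) : (mu d).real (m.cell i) = m.vol i := by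
  rw [measureReal_def, m.mu_cell]; rfl

lemma Mesh.cellPartition : CellPartition (mu d) m.cell := by
  refine ⟨m.measurableSet_cell, fun i j hij => ?_, fun i => ?_, ?_⟩
  · obtain ⟨k, hk⟩ := Function.ne_iff.1 hij
    rw [Set.disjoint_left]
    intro x hx hy
    rw [cell, mem_univ_pi] at hx hy
    exact Set.disjoint_left.1 ((m k).disjoint_interval hk) (hx k) (hy k)
  · rw [m.mu_cell, m.volume_cell]
    exact (ENNReal.ofReal_pos.2 (Finset.prod_pos fun k _ => (m k).step_pos _)).ne'
  -- The half-open cells cover ]0,1]^d; the missing faces of the cube are negligible.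
  · have h : (univ.pi fun _ : Fin d => Ioc (0 : ℝ) 1) =ᵐ[volume] Om d := by
      rw [volume_pi]
      exact Measure.univ_pi_Ioc_ae_eq_Icc (f := 0) (g := 1)
    rw [mu, ← Measure.restrict_congr_set h]
    filter_upwards [ae_restrict_mem (MeasurableSet.univ_pi fun _ => measurableSet_Ioc)] with x hx
    rw [mem_univ_pi] at hx
    choose i hi using fun k => (m k).exists_mem_interval (hx k)
    exact ⟨i, mem_univ_pi.2 hi⟩

lemma Mesh.size_nonneg : 0 ≤ m.size := Real.iSup_nonneg fun k => (m k).size_nonneg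

lemma Mesh.size_le_one : m.size ≤ 1 :=
  Real.iSup_le (fun k => ((m k).size_le zero_le_one).trans (by norm_num)) zero_le_one

/-- In dimension 0 the supremum over the empty set of directions would be 0. In positive dimension n
= 0 is impossible, since the endpoints 0 and 1 would coincide. -/
lemma Mesh.size_pos (hd : 1 ≤ d) : 0 < m.size := by
  have hn : 0 < n := by
    by_contra! h
    obtain rfl : n = 0 := by omega
    have h1 := (m ⟨0, hd⟩).first
    have h2 := (m ⟨0, hd⟩).last
    have : (Fin.last 0) = 0 := rfl
    rw [this, h1] at h2
    norm_num at h2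
  refine ((m ⟨0, hd⟩).step_pos ⟨0, hn⟩).trans_le (((m ⟨0, hd⟩).step_le_size _).trans ?_)
  exact le_ciSup (f := fun k => (m k).size) (Set.finite_range _).bddAbove _

lemma Mesh.abs_sub_le_of_mem_cell {i : Idx d n} {x y : Pt d} (hx : x ∈ m.cell i)
    (hy : y ∈ m.cell i) (k : Fin d) : |x k - y k| ≤ m.size := by
  rw [cell, mem_univ_pi] at hx hy
  exact ((m k).abs_sub_le_of_mem_interval (hx k) (hy k)).trans
    (le_ciSup (f := fun k => (m k).size) (Set.finite_range _).bddAbove k)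

lemma Mesh.inj_eq (v : Idx d n → ℝ) : m.inj v = stepFun m.cell v := rfl

lemma Mesh.proj_eq (w : Pt d → ℝ) : m.proj w = cellAvg (mu d) m.cell w := by
  ext i
  rw [m.cellPartition.cellAvg_eq, m.mu_restrict_cell, m.mu_real_cell, proj]

lemma Mesh.proj2_eq (F : Pt d → Pt d → ℝ) : m.proj2 F = cellAvg₂ (mu d) m.cell F := by
  ext i j
  rw [cellAvg₂, (m.cellPartition.prod m.cellPartition).cellAvg_eq, proj2, ← Measure.prod_restrict,
    m.mu_restrict_cell, m.mu_restrict_cell, Measure.prod_restrict, measureReal_def,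
    Measure.prod_prod, ENNReal.toReal_mul, ← measureReal_def, ← measureReal_def, m.mu_real_cell,
    m.mu_real_cell]
  rfl

lemma Mesh.inj2_eq (F : Pt d → Pt d → ℝ) : m.inj2 (m.proj2 F) = avgKernel (mu d) m.cell F := by
  ext x y
  rw [inj2, avgKernel, stepFun, Fintype.sum_prod_type]
  refine Finset.sum_congr rfl fun i _ => Finset.sum_congr rfl fun j _ => ?_
  rw [m.proj2_eq]
  by_cases hx : x ∈ m.cell i <;> by_cases hy : y ∈ m.cell j <;>
    simp [hx, hy, cellAvg₂]

lemma Mesh.cellAvg₂_congr {F G : Pt d → Pt d → ℝ} (h : ∀ x ∈ Om d, ∀ y ∈ Om d, F x y = G x y) :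
    cellAvg₂ (mu d) m.cell F = cellAvg₂ (mu d) m.cell G := by
  ext i j
  rw [m.cellPartition.cellAvg₂_eq_integral, m.cellPartition.cellAvg₂_eq_integral]
  have := m.cellPartition.isProbabilityMeasure i
  have := m.cellPartition.isProbabilityMeasure j
  refine integral_congr_ae ?_
  filter_upwards [Measure.quasiMeasurePreserving_fst.ae (m.cellPartition.ae_cond_mem i),
    Measure.quasiMeasurePreserving_snd.ae (m.cellPartition.ae_cond_mem j)] with z h1 h2
  exact h _ (m.cell_subset _ h1) _ (m.cell_subset _ h2)

end Meshes

/-! ### Kernels -/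

section KernelOnCube

variable {d n : ℕ} {K : Pt d → Pt d → ℝ} {p : ℝ}

open Classical in
/-- The kernel, extended by zero. -/
def cutKernel (K : Pt d → Pt d → ℝ) (x y : Pt d) : ℝ := if x ∈ Om d ∧ y ∈ Om d then K x y else 0

lemma cutKernel_eq {x y : Pt d} (hx : x ∈ Om d) (hy : y ∈ Om d) : cutKernel K x y = K x y :=
  if_pos ⟨hx, hy⟩

lemma ae_mem_Om : ∀ᵐ x ∂mu d, x ∈ Om d := ae_restrict_mem measurableSet_Om

lemma ae_mem_Om_prod : ∀ᵐ z ∂(mu d).prod (mu d), z.1 ∈ Om d ∧ z.2 ∈ Om d := by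
  filter_upwards [Measure.quasiMeasurePreserving_fst.ae ae_mem_Om,
    Measure.quasiMeasurePreserving_snd.ae ae_mem_Om] with z h1 h2 using ⟨h1, h2⟩

lemma IsKernel.ae_eLpNorm_le (hK : IsKernel K) :
    ∀ᵐ x ∂mu d, eLpNorm (K x) 2 (mu d) ≤ (supLqNorm 2 K).toNNReal := by
  rw [ENNReal.coe_toNNReal hK.bounded.ne]
  exact ENNReal.ae_le_essSup _

/-- Sign and symmetry are assumed on Ω only, whereas `SymmKernel` asks for them everywhere. Cutting
off outside Ω changes the kernel on a null set and leaves operator, domain and averages intact. -/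
lemma IsKernel.symmKernel (hK : IsKernel K) :
    SymmKernel (mu d) (cutKernel K) (supLqNorm 2 K).toNNReal := by
  refine ⟨?_, fun x y => ?_, fun x y => ?_, ?_⟩
  · exact Measurable.ite ((measurable_fst measurableSet_Om).inter (measurable_snd measurableSet_Om))
      hK.measurable measurable_const
  · rw [cutKernel]
    split_ifs with h
    · exact hK.nonneg x h.1 y h.2
    · exact le_rfl
  · rw [cutKernel, cutKernel]
    by_cases h : x ∈ Om d ∧ y ∈ Om d
    · rw [if_pos h, if_pos h.symm, hK.symm x h.1 y h.2]
    · rw [if_neg h, if_neg fun h' => h h'.symm]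
  · filter_upwards [hK.ae_eLpNorm_le, ae_mem_Om] with x hx hm
    refine le_trans (le_of_eq (eLpNorm_congr_ae ?_)) hx
    filter_upwards [ae_mem_Om] with y hy using cutKernel_eq hm hy

lemma plap_eq {w : Pt d → ℝ} {x : Pt d} (hx : x ∈ Om d) :
    -plap K p w x = nonlocal (mu d) (cutKernel K) (Psi p) w x := by
  rw [plap, neg_neg, nonlocal]
  refine integral_congr_ae ?_
  filter_upwards [ae_mem_Om] with y hy
  rw [cutKernel_eq hx hy]

lemma inDom_iff {w : Pt d → ℝ} : InDom K p w ↔ Integrable (fun z : Pt d × Pt d =>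
    cutKernel K z.1 z.2 * Psi p (w z.2 - w z.1)) ((mu d).prod (mu d)) := by
  refine integrable_congr ?_
  filter_upwards [ae_mem_Om_prod] with z hz
  rw [cutKernel_eq hz.1 hz.2]

end KernelOnCube

/-! ### Averaging as an operator on `L²` -/

section CellProj

variable {Ω ι : Type*} [MeasurableSpace Ω] [Fintype ι] {μ : Measure Ω} {c : ι → Set Ω}
  [IsFiniteMeasure μ]

/-- The orthogonal projection onto step functions. -/
def cellProj (μ : Measure Ω) [IsFiniteMeasure μ] (c : ι → Set Ω) (w : Lp ℝ 2 μ) : Lp ℝ 2 μ :=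
  toL2 μ (stepFun c (cellAvg μ c w))

variable (hc : CellPartition μ c)

include hc

lemma CellPartition.cellAvg_congr {w w' : Ω → ℝ} (h : w =ᵐ[μ] w') :
    cellAvg μ c w = cellAvg μ c w' := by
  ext i
  exact integral_congr_ae (hc.cond_le i h)

lemma CellPartition.toL2_stepFun_cellAvg {w : Ω → ℝ} (hw : MemLp w 2 μ) :
    toL2 μ (stepFun c (cellAvg μ c w)) = cellProj μ c (toL2 μ w) := by
  rw [cellProj, hc.cellAvg_congr (coeFn_toL2 hw)]

/-- The cell averages are continuous linear functionals. -/
lemma CellPartition.exists_clm_cellAvg (i : ι) :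
    ∃ φ : Lp ℝ 2 μ →L[ℝ] ℝ, ∀ w : Lp ℝ 2 μ, φ w = cellAvg μ c w i := by
  have hm : MemLp ((c i).indicator fun _ => (μ.real (c i))⁻¹) 2 μ :=
    (memLp_const _).indicator (hc.measurableSet i)
  refine ⟨innerSL ℝ (toL2 μ ((c i).indicator fun _ => (μ.real (c i))⁻¹)), fun w => ?_⟩
  rw [innerSL_apply_apply, inner_toL2_left hm, hc.cellAvg_eq, ← integral_const_mul,
    ← integral_indicator (hc.measurableSet i)]
  refine integral_congr_ae (Filter.Eventually.of_forall fun x => ?_)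
  by_cases hx : x ∈ c i <;> simp [hx]

lemma CellPartition.norm_cellProj_sub_le (w w' : Lp ℝ 2 μ) :
    ‖cellProj μ c w - cellProj μ c w'‖ ≤ ‖w - w'‖ := by
  have h1 : cellProj μ c w - cellProj μ c w' = cellProj μ c (w - w') := by
    rw [cellProj, cellProj, toL2_sub (hc.memLp_stepFun _ 2) (hc.memLp_stepFun _ 2), cellProj]
    refine toL2_congr ?_
    filter_upwards [hc.cover] with x ⟨i, hx⟩
    obtain ⟨φ, hφ⟩ := hc.exists_clm_cellAvg i
    rw [hc.stepFun_eq _ hx, hc.stepFun_eq _ hx, hc.stepFun_eq _ hx, ← hφ, ← hφ, ← hφ, map_sub]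
  rw [h1, cellProj, norm_toL2 (hc.memLp_stepFun _ 2), Lp.norm_def]
  exact ENNReal.toReal_mono (Lp.eLpNorm_ne_top _)
    (hc.eLpNorm_stepFun_cellAvg_le one_le_two (Lp.aestronglyMeasurable _))

lemma CellPartition.norm_cellProj_le (w : Lp ℝ 2 μ) : ‖cellProj μ c w‖ ≤ ‖w‖ := by
  have h0 : cellProj μ c 0 = 0 := by
    rw [cellProj, hc.cellAvg_congr (Lp.coeFn_zero ℝ 2 μ)]
    have : stepFun c (cellAvg μ c (0 : Ω → ℝ)) =ᵐ[μ] fun _ => 0 := by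
      filter_upwards [hc.cover] with x ⟨i, hx⟩
      rw [hc.stepFun_eq _ hx]
      simp [cellAvg]
    rw [toL2_congr this]
    apply Lp.ext
    filter_upwards [coeFn_toL2 (memLp_const (μ := μ) (p := 2) (0 : ℝ)), Lp.coeFn_zero ℝ 2 μ]
      with x h1 h2
    rw [h1, h2]; rfl
  simpa [h0] using hc.norm_cellProj_sub_le w 0

end CellProj

/-! ### Source terms as curves in `L²` -/

section Source

variable {d : ℕ} {q : ℝ≥0∞} {T : ℝ} {f : Pt d → ℝ → ℝ}

lemma eLpNorm_sub_le_variation {s t : ℝ} (hs : s ∈ Icc 0 T) (ht : t ∈ Icc 0 T) (hst : s ≤ t) :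
    eLpNorm (fun x => f x t - f x s) q (mu d) ≤ variation q T f := by
  -- The sequence s, t, t, … has the desired increment as its only summand when N = 1.
  have hm : Monotone fun k : ℕ => if k = 0 then s else t := by
    refine monotone_nat_of_le_succ fun k => ?_
    split_ifs <;> simp_all
  have := le_iSup_of_le (f := fun N => ⨆ (t : ℕ → ℝ) (_ : Monotone t) (_ : ∀ i, t i ∈ Icc 0 T),
    ∑ i ∈ Finset.range N, eLpNorm (fun x => f x (t (i + 1)) - f x (t i)) q (mu d)) 1
    (le_iSup_of_le (fun k : ℕ => if k = 0 then s else t) (le_iSup_of_le hm (le_iSup_of_le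
      (fun k => by dsimp only; split_ifs <;> assumption) le_rfl)))
  rw [variation]
  refine le_trans (le_of_eq ?_) this
  simp

variable (hf : IsSource q T f)

include hf

lemma IsSource.measurable_section (t : ℝ) : Measurable fun x => f x t :=
  hf.measurable.comp (measurable_id.prodMk measurable_const)

lemma IsSource.eLpNorm_le {t : ℝ} (ht : t ∈ Icc 0 T) :
    eLpNorm (fun x => f x t) 2 (mu d) ≤ bvNorm 2 T f := by
  have h0 : (0 : ℝ) ∈ Icc 0 T := ⟨le_rfl, ht.1.trans ht.2⟩
  have e : (fun x => f x t) = (fun x => f x 0) + fun x => f x t - f x 0 := by ext x; simp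
  rw [e]
  refine (eLpNorm_add_le (hf.measurable_section 0).aestronglyMeasurable
    ((hf.measurable_section t).sub (hf.measurable_section 0)).aestronglyMeasurable
    one_le_two).trans ?_
  exact add_le_add_right (eLpNorm_sub_le_variation h0 ht ht.1) _

lemma IsSource.memLp {t : ℝ} (ht : t ∈ Icc 0 T) : MemLp (fun x => f x t) 2 (mu d) :=
  ⟨(hf.measurable_section t).aestronglyMeasurable, (hf.eLpNorm_le ht).trans_lt hf.bv⟩

omit hf in
/-- The curve `t ↦ f(·,t)` in `L²(Ω)`, extended by zero outside `[0,T]`. -/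
def sourceCurve (T : ℝ) (f : Pt d → ℝ → ℝ) (t : ℝ) : Lp ℝ 2 (mu d) :=
  toL2 (mu d) fun x => (Icc 0 T).indicator (fun _ => (1 : ℝ)) t * f x t

omit hf in
lemma sourceCurve_eq {t : ℝ} (ht : t ∈ Icc 0 T) :
    sourceCurve T f t = toL2 (mu d) fun x => f x t := by
  simp only [sourceCurve, indicator_of_mem ht, one_mul]

lemma IsSource.coeFn_sourceCurve {t : ℝ} (ht : t ∈ Icc 0 T) :
    sourceCurve T f t =ᵐ[mu d] fun x => f x t := by
  rw [sourceCurve_eq ht]; exact coeFn_toL2 (hf.memLp ht)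

lemma IsSource.stronglyMeasurable_sourceCurve : StronglyMeasurable (sourceCurve T f) := by
  refine measurable_toL2_curve (μ := mu d) (f := fun x t => (Icc 0 T).indicator (fun _ => (1 : ℝ)) t * f x t)
    ?_ fun t => ?_
  · exact ((measurable_const.indicator measurableSet_Icc).comp measurable_snd).mul hf.measurable
  · by_cases ht : t ∈ Icc 0 T
    · simpa [indicator_of_mem ht] using hf.memLp ht
    · simp [indicator_of_notMem ht]

lemma IsSource.norm_sourceCurve_le (t : ℝ) : ‖sourceCurve T f t‖ ≤ (bvNorm 2 T f).toReal := by
  by_cases ht : t ∈ Icc 0 T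
  · rw [sourceCurve_eq ht, norm_toL2 (hf.memLp ht)]
    exact ENNReal.toReal_mono hf.bv.ne (hf.eLpNorm_le ht)
  · simp only [sourceCurve, indicator_of_notMem ht, zero_mul]
    rw [norm_toL2 (memLp_const 0)]
    simp

lemma IsSource.intervalIntegrable_comp {φ : ℝ → ℝ} (hφ : Measurable φ) (a b : ℝ) :
    IntervalIntegrable (fun t => sourceCurve T f (φ t)) volume a b :=
  (intervalIntegrable_const (c := (bvNorm 2 T f).toReal)).mono_fun
    (hf.stronglyMeasurable_sourceCurve.comp_measurable hφ).aestronglyMeasurable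
    (Filter.Eventually.of_forall fun _ => (hf.norm_sourceCurve_le _).trans (le_abs_self _))

lemma IsSource.intervalIntegrable (a b : ℝ) :
    IntervalIntegrable (sourceCurve T f) volume a b := hf.intervalIntegrable_comp measurable_id a b

lemma IsSource.norm_sourceCurve_sub {s t : ℝ} (hs : s ∈ Icc 0 T) (ht : t ∈ Icc 0 T) :
    ‖sourceCurve T f t - sourceCurve T f s‖ₑ =
      eLpNorm (fun x => f x t - f x s) 2 (mu d) := by
  rw [sourceCurve_eq hs, sourceCurve_eq ht, toL2_sub (hf.memLp ht) (hf.memLp hs)]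
  exact enorm_toL2 ((hf.memLp ht).sub (hf.memLp hs))

lemma IsSource.variation_ne_top : variation 2 T f ≠ ⊤ :=
  ((le_add_self : variation 2 T f ≤ bvNorm 2 T f).trans_lt hf.bv).ne

lemma IsSource.sum_norm_sub_le {t : ℕ → ℝ} (ht : Monotone t) (hT : ∀ k, t k ∈ Icc 0 T) (N : ℕ) :
    ∑ k ∈ Finset.range N, ‖sourceCurve T f (t (k + 1)) - sourceCurve T f (t k)‖ ≤
      (variation 2 T f).toReal := by
  rw [← ENNReal.ofReal_le_iff_le_toReal hf.variation_ne_top,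
    ENNReal.ofReal_sum_of_nonneg fun _ _ => norm_nonneg _]
  have := le_iSup_of_le (f := fun N => ⨆ (t : ℕ → ℝ) (_ : Monotone t) (_ : ∀ i, t i ∈ Icc 0 T),
    ∑ i ∈ Finset.range N, eLpNorm (fun x => f x (t (i + 1)) - f x (t i)) 2 (mu d)) N
    (le_iSup_of_le t (le_iSup_of_le ht (le_iSup_of_le hT le_rfl)))
  refine le_trans (le_of_eq (Finset.sum_congr rfl fun k _ => ?_)) this
  rw [ofReal_norm, hf.norm_sourceCurve_sub (hT k) (hT (k + 1))]

/-- The average of the source over the `k`-th time interval. -/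
lemma IsSource.average_eq {N : ℕ} (θ : Partition 0 T N) {k : ℕ} (hk : k < N) :
    (θ.node (k + 1) - θ.node k)⁻¹ • ∫ t in (θ.node k)..(θ.node (k + 1)), sourceCurve T f t =
      ∫ s in (0 : ℝ)..1, sourceCurve T f ((θ.node (k + 1) - θ.node k) * s + θ.node k) := by
  have h := sub_pos.2 (θ.node_lt (Nat.lt_succ_self k) hk)
  rw [intervalIntegral.integral_comp_mul_add _ h.ne']
  simp

lemma IsSource.norm_average_le {N : ℕ} (θ : Partition 0 T N) {k : ℕ} (hk : k < N) :
    ‖(θ.node (k + 1) - θ.node k)⁻¹ • ∫ t in (θ.node k)..(θ.node (k + 1)), sourceCurve T f t‖ ≤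
      (bvNorm 2 T f).toReal := by
  rw [hf.average_eq θ hk]
  have := intervalIntegral.norm_integral_le_of_norm_le_const (a := (0 : ℝ)) (b := 1)
    (C := (bvNorm 2 T f).toReal)
    (f := fun s => sourceCurve T f ((θ.node (k + 1) - θ.node k) * s + θ.node k))
    fun s _ => hf.norm_sourceCurve_le _
  simpa using this

/-- The variation of the averages is at most the variation of the source. -/
lemma IsSource.sum_norm_average_sub_le {N : ℕ} (θ : Partition 0 T N) :
    ∑ k ∈ Finset.range (N - 1),
      ‖((θ.node (k + 1 + 1) - θ.node (k + 1))⁻¹ •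
          ∫ t in (θ.node (k + 1))..(θ.node (k + 1 + 1)), sourceCurve T f t) -
        (θ.node (k + 1) - θ.node k)⁻¹ • ∫ t in (θ.node k)..(θ.node (k + 1)), sourceCurve T f t‖ ≤
      (variation 2 T f).toReal := by
  -- All time intervals are rescaled to [0,1]. For fixed s the points t k s form a nondecreasing
  -- sequence in [0,T], so the sum of the increments along it is at most the variation; integration
  -- over s keeps this bound.
  set t : ℕ → ℝ → ℝ := fun k s => (θ.node (k + 1) - θ.node k) * s + θ.node k with ht
  have hi : ∀ k, IntervalIntegrable (fun s => sourceCurve T f (t k s)) volume 0 1 := fun k =>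
    hf.intervalIntegrable_comp (by fun_prop) 0 1
  have hle : ∀ k ∈ Finset.range (N - 1), ‖((θ.node (k + 1 + 1) - θ.node (k + 1))⁻¹ •
          ∫ t in (θ.node (k + 1))..(θ.node (k + 1 + 1)), sourceCurve T f t) -
        (θ.node (k + 1) - θ.node k)⁻¹ • ∫ t in (θ.node k)..(θ.node (k + 1)), sourceCurve T f t‖ ≤
      ∫ s in (0 : ℝ)..1, ‖sourceCurve T f (t (k + 1) s) - sourceCurve T f (t k s)‖ := by
    intro k hk
    have hk' := Finset.mem_range.1 hk
    rw [hf.average_eq θ (by omega), hf.average_eq θ (by omega),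
      ← intervalIntegral.integral_sub (hi (k + 1)) (hi k)]
    exact intervalIntegral.norm_integral_le_integral_norm zero_le_one
  refine (Finset.sum_le_sum hle).trans ?_
  rw [← intervalIntegral.integral_finsetSum fun k _ => ((hi (k + 1)).sub (hi k)).norm]
  have hb : ∀ s ∈ Icc (0 : ℝ) 1, ∑ k ∈ Finset.range (N - 1),
      ‖sourceCurve T f (t (k + 1) s) - sourceCurve T f (t k s)‖ ≤ (variation 2 T f).toReal := by
    intro s hs
    have h1 : ∀ k, θ.node k ≤ t k s := fun k => by
      have := mul_nonneg (sub_nonneg.2 (θ.node_le (Nat.le_succ k))) hs.1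
      simp only [ht]; linarith
    have h2 : ∀ k, t k s ≤ θ.node (k + 1) := fun k => by
      have := mul_le_of_le_one_right (sub_nonneg.2 (θ.node_le (Nat.le_succ k))) hs.2
      simp only [ht]; linarith
    exact hf.sum_norm_sub_le (t := fun k => t k s)
      (monotone_nat_of_le_succ fun k => (h2 k).trans (h1 (k + 1)))
      (fun k => ⟨(θ.node_mem k).1.trans (h1 k), (h2 k).trans (θ.node_mem _).2⟩) _
  have hsum : IntervalIntegrable (fun s => ∑ k ∈ Finset.range (N - 1),
      ‖sourceCurve T f (t (k + 1) s) - sourceCurve T f (t k s)‖) volume 0 1 := by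
    have := IntervalIntegrable.sum (Finset.range (N - 1)) (f := fun k s =>
      ‖sourceCurve T f (t (k + 1) s) - sourceCurve T f (t k s)‖)
      fun k _ => ((hi (k + 1)).sub (hi k)).norm
    exact this.congr fun s _ => by simp
  refine (intervalIntegral.integral_mono_on zero_le_one hsum intervalIntegrable_const hb).trans ?_
  simp

end Source

section MeasurableNorm

variable {Ω : Type*} [MeasurableSpace Ω] {μ : Measure Ω} [SFinite μ]

/-- For finite q this is Tonelli's theorem. For q = ∞ the norm is at most c exactly when the set
{|f(·,t)| > c} has measure zero, and the measure of a section depends measurably on t. -/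
lemma measurable_eLpNorm_section {f : Ω → ℝ → ℝ} (hf : Measurable fun z : Ω × ℝ => f z.1 z.2)
    (q : ℝ≥0∞) : Measurable fun t => eLpNorm (fun x => f x t) q μ := by
  rcases eq_or_ne q 0 with rfl | hq0
  · simp only [eLpNorm_exponent_zero]; exact measurable_const
  rcases eq_or_ne q ⊤ with rfl | hqt
  · refine measurable_of_Iic fun c => ?_
    have e : (fun t => eLpNorm (fun x => f x t) ⊤ μ) ⁻¹' Iic c =
        (fun t => μ ((fun x => (x, t)) ⁻¹' {z | c < ‖f z.1 z.2‖ₑ})) ⁻¹' {0} := by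
      ext t
      simp only [mem_preimage, mem_Iic, mem_singleton_iff, eLpNorm_exponent_top, preimage_ofPred_eq]
      constructor
      · intro h
        have : ∀ᵐ x ∂μ, ‖f x t‖ₑ ≤ c := by
          filter_upwards [enorm_ae_le_eLpNormEssSup (fun x => f x t) μ] with x hx using hx.trans h
        simpa [ae_iff] using this
      · intro h
        refine essSup_le_of_ae_le _ ?_
        simpa [Filter.EventuallyLE, ae_iff] using h
    rw [e]
    exact measurable_measure_prodMk_right (measurableSet_lt measurable_const hf.enorm)
      (measurableSet_singleton 0)
  · simp_rw [eLpNorm_eq_lintegral_rpow_enorm_toReal hq0 hqt]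
    exact ((hf.enorm.pow_const q.toReal).lintegral_prod_left').pow_const _

end MeasurableNorm

/-! ### Existence and uniqueness for the evolution problem on the cube -/

section Solutions

variable {d : ℕ} {p T : ℝ} {q : ℝ≥0∞} {K : Pt d → Pt d → ℝ} {f : Pt d → ℝ → ℝ} {g : Pt d → ℝ}

lemma IsSource.measurable_eLpNorm (hf : IsSource q T f) (q' : ℝ≥0∞) :
    Measurable fun t => eLpNorm (fun x => f x t) q' (mu d) :=
  measurable_eLpNorm_section hf.measurable q'

lemma IsSource.ae_lt_top (hf : IsSource q T f) :
    ∀ᵐ t ∂volume.restrict (Icc 0 T), eLpNorm (fun x => f x t) q (mu d) < ⊤ :=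
  MeasureTheory.ae_lt_top (hf.measurable_eLpNorm q) hf.l1Lq.ne

/-- Existence of a solution which takes its values in `L²(Ω)` and is bounded in `L^q(Ω)`. -/
lemma exists_solution_curve (hp : 1 < p) (hK : IsKernel K) (hT : 0 ≤ T) (hf : IsSource q T f)
    (hg : MemLp g q (mu d)) (hq2 : 2 ≤ q) (hqp : 2 * ENNReal.ofReal (p - 1) ≤ q) :
    ∃ u : ℝ → Lp ℝ 2 (mu d), u 0 = toL2 (mu d) g ∧
      IsPrimitive u (fun t => toL2 (mu d) (nonlocal (mu d) (cutKernel K) (Psi p) (u t)) +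
        sourceCurve T f t) 0 T ∧
      ∀ t ∈ Icc 0 T, eLpNorm (u t) q (mu d) ≤ eLpNorm g q (mu d) + l1LqNorm q T f := by
  set ρ : ℝ → ℝ := fun t => (eLpNorm (fun x => f x t) q (mu d)).toReal with hρ
  have hg2 : MemLp g 2 (mu d) := hg.mono_exponent hq2
  have hfin : ∫⁻ t in Ioc 0 T, eLpNorm (fun x => f x t) q (mu d) = l1LqNorm q T f := by
    rw [l1LqNorm, restrict_Ioc_eq_restrict_Icc]
  have hρi : IntervalIntegrable ρ volume 0 T := by
    rw [intervalIntegrable_iff_integrableOn_Ioc_of_le hT]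
    exact integrable_toReal_of_lintegral_ne_top (hf.measurable_eLpNorm q).aemeasurable
      (by rw [hfin]; exact hf.l1Lq.ne)
  have hρint : ENNReal.ofReal (∫ t in (0 : ℝ)..T, ρ t) = l1LqNorm q T f := by
    rw [intervalIntegral.integral_of_le hT, integral_toReal, hfin,
      ENNReal.ofReal_toReal hf.l1Lq.ne]
    · exact (hf.measurable_eLpNorm q).aemeasurable
    · rw [restrict_Ioc_eq_restrict_Icc]; exact hf.ae_lt_top
  obtain ⟨u, h0, hu, hb⟩ := exists_solution (F := sourceCurve T f) (Q := q)
    (M₀ := (eLpNorm g q (mu d)).toNNReal) (ρ := ρ) hp hK.symmKernel hT (toL2 (mu d) g)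
    (hf.intervalIntegrable 0 T) hq2 hqp
    (by rw [ENNReal.coe_toNNReal hg.2.ne, eLpNorm_congr_ae (coeFn_toL2 hg2)]) hρi (by
      filter_upwards [ae_restrict_of_ae_restrict_of_subset Ioo_subset_Icc_self hf.ae_lt_top,
        ae_restrict_mem measurableSet_Ioo] with t ht hm
      refine ⟨ENNReal.toReal_nonneg, ?_⟩
      rw [ENNReal.ofReal_toReal ht.ne,
        eLpNorm_congr_ae (hf.coeFn_sourceCurve (Ioo_subset_Icc_self hm))])
  refine ⟨u, h0, hu, fun t ht => ?_⟩
  have := hb t ht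
  rwa [ENNReal.coe_toNNReal hg.2.ne, hρint] at this

lemma memLp_Psi_diff_of_curve (hp : 1 < p) (hf : IsSource q T f) (hg : MemLp g q (mu d))
    (hq2 : 2 ≤ q) (hqp : 2 * ENNReal.ofReal (p - 1) ≤ q) {w : Lp ℝ 2 (mu d)}
    (hw : eLpNorm w q (mu d) ≤ eLpNorm g q (mu d) + l1LqNorm q T f) :
    MemLp (fun z : Pt d × Pt d => Psi p (w z.2 - w z.1)) 2 ((mu d).prod (mu d)) :=
  memLp_Psi_diff hp (one_le_two.trans hq2) hqp ⟨Lp.aestronglyMeasurable w,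
    hw.trans_lt (ENNReal.add_lt_top.2 ⟨hg.2, hf.l1Lq⟩)⟩

lemma isSolution_of_curve (hp : 1 < p) (hK : IsKernel K) (hT : 0 ≤ T) (hf : IsSource q T f)
    (hg : MemLp g q (mu d)) (hq2 : 2 ≤ q) (hqp : 2 * ENNReal.ofReal (p - 1) ≤ q)
    {u : ℝ → Lp ℝ 2 (mu d)} (h0 : u 0 = toL2 (mu d) g)
    (hu : IsPrimitive u (fun t => toL2 (mu d) (nonlocal (mu d) (cutKernel K) (Psi p) (u t)) +
      sourceCurve T f t) 0 T)
    (hb : ∀ t ∈ Icc 0 T, eLpNorm (u t) q (mu d) ≤ eLpNorm g q (mu d) + l1LqNorm q T f) :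
    IsSolution K p T f g fun t => toL1 (mu d) (u t) := by
  have hu1 := hu.map (toL1 (mu d))
  refine ⟨hu1.continuousOn, ?_, _, ?_, hu1.eq, ?_⟩
  · rw [coeFn_toL1, h0]
    exact coeFn_toL2 (hg.mono_exponent hq2)
  · exact ((intervalIntegrable_iff_integrableOn_Ioc_of_le hT).1 hu1.integrable).mono_set
      Ioo_subset_Ioc_self
  · filter_upwards [ae_restrict_mem measurableSet_Ioo] with t ht
    have ht' := Ioo_subset_Icc_self ht
    have hG := memLp_Psi_diff_of_curve hp hf hg hq2 hqp (hb t ht')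
    refine ⟨?_, ?_⟩
    · rw [coeFn_toL1, inDom_iff]
      exact integrable_kernel_mul hK.symmKernel hG
    · rw [coeFn_toL1, coeFn_toL1]
      filter_upwards [Lp.coeFn_add (toL2 (mu d) (nonlocal (mu d) (cutKernel K) (Psi p) (u t)))
        (sourceCurve T f t), coeFn_toL2 (memLp_nonlocal hK.symmKernel hG),
        hf.coeFn_sourceCurve ht', ae_mem_Om] with x h1 h2 h3 h4
      rw [h1, Pi.add_apply, h2, h3, plap_eq h4]

lemma IsSolution.exists_isPrimitive {u : ℝ → Lp ℝ 1 (mu d)} (hT : 0 ≤ T)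
    (h : IsSolution K p T f g u) : ∃ v, IsPrimitive u v 0 T ∧
      ∀ᵐ t ∂volume.restrict (Ioo 0 T), Integrable (fun z : Pt d × Pt d =>
        cutKernel K z.1 z.2 * Psi p (u t z.2 - u t z.1)) ((mu d).prod (mu d)) ∧
        v t =ᵐ[mu d] fun x => nonlocal (mu d) (cutKernel K) (Psi p) (u t) x + f x t := by
  obtain ⟨v, hv, heq, hae⟩ := h.evolution
  refine ⟨v, ⟨?_, heq⟩, ?_⟩
  · rw [intervalIntegrable_iff_integrableOn_Ioc_of_le hT]
    exact hv.congr_set_ae Ioo_ae_eq_Ioc.symm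
  · filter_upwards [hae] with t ht
    refine ⟨inDom_iff.1 ht.1, ?_⟩
    filter_upwards [ht.2, ae_mem_Om] with x hx hm
    rw [hx, plap_eq hm]

/-- Uniqueness of solutions. -/
lemma IsSolution.eq (hp : 1 < p) (hK : IsKernel K) (hT : 0 ≤ T) {u v : ℝ → Lp ℝ 1 (mu d)}
    (hu : IsSolution K p T f g u) (hv : IsSolution K p T f g v) : ∀ t ∈ Icc 0 T, u t = v t := by
  obtain ⟨u', hu1, hu2⟩ := hu.exists_isPrimitive hT
  obtain ⟨v', hv1, hv2⟩ := hv.exists_isPrimitive hT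
  exact eq_of_isPrimitive_L1 hK.symmKernel (oddMono_Psi hp) hu1 hv1
    (Lp.ext (hu.initial.trans hv.initial.symm)) hu2 hv2

end Solutions

/-! ### The fully discrete scheme -/

section Scheme

variable {d n N : ℕ} {p T : ℝ} {q : ℝ≥0∞} {K : Pt d → Pt d → ℝ} {f : Pt d → ℝ → ℝ} {g : Pt d → ℝ}
  (m : Mesh d n) (θ : Partition 0 T N)

lemma Mesh.proj2_cutKernel (K : Pt d → Pt d → ℝ) :
    m.proj2 K = cellAvg₂ (mu d) m.cell (cutKernel K) := by
  rw [m.proj2_eq]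
  exact m.cellAvg₂_congr fun x hx y hy => (cutKernel_eq hx hy).symm

/-- One step of the scheme in implicit form. -/
lemma euler_step_iff (k : Fin N) (A : Idx d n → Idx d n → ℝ) (F v v' : Idx d n → ℝ) :
    (∀ i, (v' i - v i) / θ.step k = -m.discretePlap A p v' i + F i) ↔
      ∀ i, v' i - (v i + θ.step k * F i) =
        θ.step k * ∑ j, m.vol j * A i j * Psi p (v' j - v' i) := by
  have hs := θ.step_pos k
  refine forall_congr' fun i => ?_
  rw [Mesh.discretePlap, neg_neg, div_eq_iff hs.ne']
  constructor <;> intro h <;> linarith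

theorem existsUnique_isBackwardEuler (hp : 1 < p) (hK : IsKernel K) :
    ∃! U, IsBackwardEuler m θ K p f g U := by
  have hstep : ∀ (k : Fin N) (v : Idx d n → ℝ), ∃! v' : Idx d n → ℝ,
      ∀ i, (v' i - v i) / θ.step k =
        -m.discretePlap (m.proj2 K) p v' i + discreteSource m θ f k i := by
    intro k v
    simp_rw [euler_step_iff, m.proj2_cutKernel]
    exact existsUnique_discrete_step hp m.vol_pos
      (m.cellPartition.cellAvg₂_nonneg hK.symmKernel.nonneg)
      (m.cellPartition.cellAvg₂_symm hK.symmKernel.symm) (θ.step_pos k).le _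
  choose S hS hS' using hstep
  refine ⟨Fin.induction (motive := fun _ => Idx d n → ℝ) (m.proj g) fun k v => S k v,
    ⟨rfl, fun k i => ?_⟩, fun V hV => ?_⟩
  · rw [Fin.induction_succ]
    exact hS k _ i
  · funext k
    induction k using Fin.induction with
    | zero => exact hV.1
    | succ k ih =>
      rw [Fin.induction_succ]
      refine hS' k _ _ fun i => ?_
      rw [← ih]
      exact hV.2 k i

/-- The average of the source term over the `k`-th time interval. -/
def timeAvg (θ : Partition 0 T N) (f : Pt d → ℝ → ℝ) (k : ℕ) : Lp ℝ 2 (mu d) :=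
  (θ.node (k + 1) - θ.node k)⁻¹ • ∫ t in (θ.node k)..(θ.node (k + 1)), sourceCurve T f t

/-- Cell averages are continuous linear functionals on L², so they commute with the Bochner integral
in time. -/
lemma discreteSource_eq (hf : IsSource q T f) (k : Fin N) :
    discreteSource m θ f k = cellAvg (mu d) m.cell (timeAvg θ f k) := by
  ext i
  obtain ⟨φ, hφ⟩ := m.cellPartition.exists_clm_cellAvg i
  rw [← hφ, timeAvg, map_smul, ← φ.intervalIntegral_comp_comm (hf.intervalIntegrable _ _),
    smul_eq_mul, discreteSource, θ.step_eq, θ.interval_eq,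
    intervalIntegral.integral_of_le (θ.node_le (Nat.le_succ _))]
  congr 1
  refine setIntegral_congr_fun measurableSet_Ioc fun t ht => ?_
  have htT : t ∈ Icc 0 T := ⟨(θ.node_mem _).1.trans ht.1.le, ht.2.trans (θ.node_mem _).2⟩
  simp only [hφ]
  rw [m.proj_eq, m.cellPartition.cellAvg_congr (hf.coeFn_sourceCurve htT)]

/-- The discrete solution as a sequence in `L²(Ω)`. -/
def eulerSeq (m : Mesh d n) (U : Fin (N + 1) → Idx d n → ℝ) (k : ℕ) : Lp ℝ 2 (mu d) :=
  toL2 (mu d) (m.inj (U ⟨min k N, by omega⟩))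

/-- The discrete source terms as a sequence in `L²(Ω)`. -/
def eulerSource (m : Mesh d n) (θ : Partition 0 T N) (f : Pt d → ℝ → ℝ) (k : ℕ) : Lp ℝ 2 (mu d) :=
  cellProj (mu d) m.cell (timeAvg θ f k)

lemma eulerSeq_val (U : Fin (N + 1) → Idx d n → ℝ) (k : Fin (N + 1)) :
    eulerSeq m U k = toL2 (mu d) (m.inj (U k)) := by
  have : (⟨min (k : ℕ) N, by omega⟩ : Fin (N + 1)) = k := Fin.ext (min_eq_left (by omega))
  rw [eulerSeq, this]

lemma coeFn_eulerSeq (U : Fin (N + 1) → Idx d n → ℝ) (k : ℕ) :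
    eulerSeq m U k =ᵐ[mu d] stepFun m.cell (U ⟨min k N, by omega⟩) :=
  coeFn_toL2 (m.cellPartition.memLp_stepFun _ 2)

lemma memLp_Psi_diff_eulerSeq (hp : 1 < p) (U : Fin (N + 1) → Idx d n → ℝ) (k : ℕ) :
    MemLp (fun z : Pt d × Pt d => Psi p (eulerSeq m U k z.2 - eulerSeq m U k z.1)) 2
      ((mu d).prod (mu d)) :=
  memLp_Psi_diff (q := ⊤) hp le_top le_top
    ((m.cellPartition.memLp_stepFun _ ⊤).ae_eq (coeFn_eulerSeq m U k).symm)

lemma coeFn_eulerSource (hf : IsSource q T f) (k : Fin N) :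
    eulerSource m θ f k =ᵐ[mu d] stepFun m.cell (discreteSource m θ f k) := by
  rw [discreteSource_eq m θ hf]
  exact coeFn_toL2 (m.cellPartition.memLp_stepFun _ 2)

lemma norm_eulerSource_le (hf : IsSource q T f) {k : ℕ} (hk : k < N) :
    ‖eulerSource m θ f k‖ ≤ (bvNorm 2 T f).toReal :=
  (m.cellPartition.norm_cellProj_le _).trans (hf.norm_average_le θ hk)

lemma sum_norm_eulerSource_sub_le (hf : IsSource q T f) :
    ∑ k ∈ Finset.range N, ‖eulerSource m θ f k - eulerSource m θ f (k - 1)‖ ≤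
      (variation 2 T f).toReal := by
  rcases N.eq_zero_or_pos with rfl | hN
  · simp
  · obtain ⟨N', rfl⟩ : ∃ N', N = N' + 1 := ⟨N - 1, by omega⟩
    -- The summand k = 0 vanishes because 0 − 1 = 0 in ℕ; what remains are the increments of
    -- consecutive averages, which the projection does not enlarge.
    rw [Finset.sum_range_succ']
    simp only [Nat.add_sub_cancel, Nat.zero_sub, sub_self, norm_zero, add_zero]
    refine le_trans (Finset.sum_le_sum fun k _ => ?_) (hf.sum_norm_average_sub_le θ)
    exact m.cellPartition.norm_cellProj_sub_le _ _

/-- The scheme in `L²(Ω)`: an implicit Euler method for the operator with averaged kernel. -/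
lemma IsBackwardEuler.step {U : Fin (N + 1) → Idx d n → ℝ} (hp : 1 < p) (hK : IsKernel K)
    (hf : IsSource q T f) (h : IsBackwardEuler m θ K p f g U) {k : ℕ} (hk : k < N) :
    eulerSeq m U (k + 1) - eulerSeq m U k = (θ.node (k + 1) - θ.node k) •
      (toL2 (mu d) (nonlocal (mu d) (avgKernel (mu d) m.cell (cutKernel K)) (Psi p)
        (eulerSeq m U (k + 1))) + eulerSource m θ f k) := by
  have hc := m.cellPartition
  have hKn := hc.symmKernel_avgKernel hK.symmKernel
  obtain ⟨k, rfl⟩ : ∃ k' : Fin N, k = k' := ⟨⟨k, hk⟩, rfl⟩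
  have e1 : (⟨min ((k : ℕ) + 1) N, by omega⟩ : Fin (N + 1)) = k.succ :=
    Fin.ext (min_eq_left (by omega))
  have e0 : (⟨min (k : ℕ) N, by omega⟩ : Fin (N + 1)) = k.castSucc :=
    Fin.ext (min_eq_left (by omega))
  have c1 := coeFn_eulerSeq m U (k + 1)
  have c0 := coeFn_eulerSeq m U k
  rw [e1] at c1
  rw [e0] at c0
  apply Lp.ext
  set A := toL2 (mu d) (nonlocal (mu d) (avgKernel (mu d) m.cell (cutKernel K)) (Psi p)
    (eulerSeq m U (k + 1))) with hA
  filter_upwards [Lp.coeFn_sub (eulerSeq m U (k + 1)) (eulerSeq m U k),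
    Lp.coeFn_smul (θ.node (k + 1) - θ.node k) (A + eulerSource m θ f k),
    Lp.coeFn_add A (eulerSource m θ f k), c1, c0, coeFn_eulerSource m θ hf k,
    coeFn_toL2 (memLp_nonlocal hKn (memLp_Psi_diff_eulerSeq m hp U (k + 1))),
    nonlocal_congr_ae (K := avgKernel (mu d) m.cell (cutKernel K)) (Φ := Psi p) c1, hc.cover]
    with x h1 h2 h3 h4 h5 h6 h7 h8 ⟨i, hi⟩
  rw [h1, Pi.sub_apply, h4, h5, h2, Pi.smul_apply, h3, Pi.add_apply, h6, hA, h7, h8,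
    hc.nonlocal_avgKernel_stepFun _ _ _ hi, hc.stepFun_eq _ hi, hc.stepFun_eq _ hi,
    hc.stepFun_eq _ hi, smul_eq_mul, ← θ.step_eq]
  have := (euler_step_iff m θ k (m.proj2 K) (discreteSource m θ f k) (U k.castSucc)
    (U k.succ)).1 (h.2 k) i
  simp_rw [m.mu_real_cell]
  rw [m.proj2_cutKernel] at this
  linarith

lemma IsBackwardEuler.eulerSeq_zero {U : Fin (N + 1) → Idx d n → ℝ}
    (h : IsBackwardEuler m θ K p f g U) (hg : MemLp g 2 (mu d)) :
    eulerSeq m U 0 = cellProj (mu d) m.cell (toL2 (mu d) g) := by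
  have e0 : (⟨min 0 N, by omega⟩ : Fin (N + 1)) = 0 := Fin.ext (by simp)
  rw [eulerSeq, e0, h.1, m.proj_eq, m.inj_eq, m.cellPartition.toL2_stepFun_cellAvg hg]

/-- The scheme is stable in `L²(Ω)`. -/
lemma IsBackwardEuler.norm_le {U : Fin (N + 1) → Idx d n → ℝ} (hp : 1 < p) (hK : IsKernel K)
    (hf : IsSource q T f) (hg : MemLp g 2 (mu d)) (h : IsBackwardEuler m θ K p f g U) {k : ℕ}
    (hk : k ≤ N) :
    ‖eulerSeq m U k‖ ≤ ‖toL2 (mu d) g‖ + θ.node k * (bvNorm 2 T f).toReal := by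
  induction k with
  | zero =>
    rw [h.eulerSeq_zero m θ hg, θ.node_zero, zero_mul, add_zero]
    exact m.cellPartition.norm_cellProj_le _
  | succ k ih =>
    have hs := (sub_pos.2 (θ.node_lt (Nat.lt_succ_self k) hk)).le
    have h1 := norm_le_of_implicit_step (m.cellPartition.symmKernel_avgKernel hK.symmKernel)
      (oddMono_Psi hp) hs (memLp_Psi_diff_eulerSeq m hp U (k + 1)) (h.step m θ hp hK hf hk)
    have h2 := mul_le_mul_of_nonneg_left (norm_eulerSource_le m θ hf hk) hs
    have h3 := ih (by omega)
    simp only [Nat.succ_eq_add_one] at *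
    linarith

end Scheme

/-! ### The error of the fully discrete scheme -/

section Consistency

variable {Ω : Type*} [MeasurableSpace Ω] {μ : Measure Ω} [IsProbabilityMeasure μ]
  {K K' : Ω → Ω → ℝ} {κ κ' : ℝ≥0} {p : ℝ} {q : ℝ≥0∞} {w : Ω → ℝ}

lemma nonlocal_sub_ae_eq (hK : SymmKernel μ K κ) (hK' : SymmKernel μ K' κ') {Φ : ℝ → ℝ}
    (hG : MemLp (fun z : Ω × Ω => Φ (w z.2 - w z.1)) 2 (μ.prod μ)) :
    (fun x => nonlocal μ K Φ w x - nonlocal μ K' Φ w x) =ᵐ[μ]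
      fun x => ∫ y, (K x y - K' x y) * Φ (w y - w x) ∂μ := by
  filter_upwards [(integrable_kernel_mul hK hG).prod_right_ae,
    (integrable_kernel_mul hK' hG).prod_right_ae] with x h1 h2
  simp only [sub_mul]
  exact (integral_sub h1 h2).symm

/-- Dependence of the operator on the kernel, in the norm of `L^{∞,2}`. -/
lemma eLpNorm_nonlocal_sub_le (hK : SymmKernel μ K κ) (hK' : SymmKernel μ K' κ') (hp : 1 < p)
    (hq1 : 1 ≤ q) (hqp : 2 * ENNReal.ofReal (p - 1) ≤ q) (hw : MemLp w q μ) :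
    eLpNorm (fun x => nonlocal μ K (Psi p) w x - nonlocal μ K' (Psi p) w x) 2 μ ≤
      essSup (fun x => eLpNorm (fun y => K x y - K' x y) 2 μ) μ *
        (2 * eLpNorm w q μ) ^ (p - 1) := by
  have hG := memLp_Psi_diff hp hq1 hqp hw
  rw [eLpNorm_congr_ae (nonlocal_sub_ae_eq hK hK' hG)]
  refine (eLpNorm_integral_mul_le (F := fun z => K z.1 z.2 - K' z.1 z.2)
    (G := fun z => Psi p (w z.2 - w z.1)) (hK.aestronglyMeasurable.sub hK'.aestronglyMeasurable)
    hG.1 (ENNReal.ae_le_essSup _)).trans ?_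
  gcongr
  exact eLpNorm_Psi_diff_le hp hq1 hqp hw.1

/-- Dependence of the operator on the kernel, in the norm of `L²`. -/
lemma eLpNorm_nonlocal_sub_le_of_top (hK : SymmKernel μ K κ) (hK' : SymmKernel μ K' κ')
    (hp : 1 < p) (hw : MemLp w ⊤ μ) :
    eLpNorm (fun x => nonlocal μ K (Psi p) w x - nonlocal μ K' (Psi p) w x) 2 μ ≤
      eLpNorm (fun z : Ω × Ω => K z.1 z.2 - K' z.1 z.2) 2 (μ.prod μ) *
        (2 * eLpNorm w ⊤ μ) ^ (p - 1) := by
  have hG := memLp_Psi_diff hp le_top le_top hw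
  rw [eLpNorm_congr_ae (nonlocal_sub_ae_eq hK hK' hG), mul_comm]
  refine eLpNorm_integral_mul_le_of_bound (F := fun z => K z.1 z.2 - K' z.1 z.2)
    (G := fun z => Psi p (w z.2 - w z.1)) (hK.aestronglyMeasurable.sub hK'.aestronglyMeasurable) ?_
  have hb : ∀ᵐ x ∂μ, ‖w x‖ₑ ≤ eLpNorm w ⊤ μ := by
    rw [eLpNorm_exponent_top]; exact ae_le_eLpNormEssSup
  filter_upwards [Measure.quasiMeasurePreserving_fst.ae hb,
    Measure.quasiMeasurePreserving_snd.ae hb] with z h1 h2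
  rw [← ofReal_norm, Real.norm_eq_abs, abs_Psi hp,
    ← ENNReal.ofReal_rpow_of_nonneg (abs_nonneg _) (by linarith), ← Real.norm_eq_abs, ofReal_norm]
  refine ENNReal.rpow_le_rpow ((enorm_sub_le).trans ?_) (by linarith)
  rw [two_mul]
  exact add_le_add h2 h1

end Consistency

/-- The time step is small compared to the claimed rate. -/
lemma exists_le_sqrt_mul_rpow {T₀ r : ℝ} (hr : r ≤ 1) (h : 0 < T₀ ∨ r < 1) :
    ∃ C : ℝ, 0 ≤ C ∧ ∀ T : ℝ, 0 < T → T₀ ≤ T → ∃ τ₀ : ℝ, 0 < τ₀ ∧ τ₀ ≤ 1 ∧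
      ∀ τ : ℝ, 0 ≤ τ → τ ≤ τ₀ → τ ≤ C * √T * τ ^ r := by
  have hτr : ∀ τ : ℝ, 0 ≤ τ → τ ≤ 1 → τ ≤ τ ^ r := by
    intro τ h0 h1
    rcases h0.eq_or_lt with rfl | h0
    · positivity
    · simpa using Real.rpow_le_rpow_of_exponent_ge h0 h1 hr
  rcases h with h | h
  -- Here r = 1 is allowed; then T^(1/2) has to be bounded below, and the constant depends on T₀.
  · refine ⟨1 / √T₀, by positivity, fun T _ hT => ⟨1, one_pos, le_rfl, fun τ h0 h1 => ?_⟩⟩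
    refine (hτr τ h0 h1).trans (le_mul_of_one_le_left (by positivity) ?_)
    rw [div_mul_eq_mul_div, one_mul, one_le_div (Real.sqrt_pos.2 h)]
    exact Real.sqrt_le_sqrt hT
  -- For r < 1 the threshold is chosen so that τ^(1−r) ≤ √T. Smallness of T is paid for by the
  -- threshold and not by the constant.
  · refine ⟨1, zero_le_one, fun T hT _ => ⟨min 1 (√T ^ (1 / (1 - r))),
      lt_min one_pos (Real.rpow_pos_of_pos (Real.sqrt_pos.2 hT) _), min_le_left _ _,
      fun τ h0 h1 => ?_⟩⟩
    rcases h0.eq_or_lt with rfl | h0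
    · positivity
    · have h2 : τ = τ ^ (1 - r) * τ ^ r := by
        rw [← Real.rpow_add h0, sub_add_cancel, Real.rpow_one]
      have h3 : τ ^ (1 - r) ≤ √T := by
        have := Real.rpow_le_rpow h0.le (h1.trans (min_le_right _ _)) (sub_pos.2 h).le
        rwa [← Real.rpow_mul (Real.sqrt_nonneg T), one_div, inv_mul_cancel₀ (sub_pos.2 h).ne',
          Real.rpow_one] at this
      rw [one_mul]
      nth_rewrite 1 [h2]
      gcongr

/-- Since T + 1 ≤ e^T, the factor T coming from integrating the consistency error in time can be
traded for √T e^(T/2), so that no constant depends on T. -/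
lemma le_sqrt_mul_exp {T : ℝ} (hT : 0 ≤ T) : T ≤ √T * Real.exp (T / 2) := by
  have h1 : √T ≤ Real.exp (T / 2) := by
    rw [Real.sqrt_le_left (Real.exp_pos _).le, ← Real.exp_nat_mul]
    have := Real.add_one_le_exp T
    have e : ((2 : ℕ) : ℝ) * (T / 2) = T := by push_cast; ring
    rw [e]; linarith
  calc T = √T * √T := (Real.mul_self_sqrt hT).symm
    _ ≤ _ := by gcongr

section Error

variable {d n N : ℕ} {p T : ℝ} {q : ℝ≥0∞} {K : Pt d → Pt d → ℝ} {f : Pt d → ℝ → ℝ} {g : Pt d → ℝ}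
  (m : Mesh d n) (θ : Partition 0 T N)

lemma sourceExt_eq {k : Fin N} {t : ℝ} (ht : t ∈ θ.interval k) (x : Pt d) :
    sourceExt m θ f x t = m.inj (discreteSource m θ f k) x :=
  θ.cellPartition.stepFun_eq (fun k => m.inj (discreteSource m θ f k) x) ht

lemma measurable_sourceExt : Measurable fun z : Pt d × ℝ => sourceExt m θ f z.1 z.2 := by
  refine Finset.measurable_fun_sum _ fun k _ => ?_
  exact ((m.cellPartition.measurable_stepFun (discreteSource m θ f k)).comp
    measurable_fst).indicator (measurable_snd (θ.measurableSet_interval k))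

lemma IsSource.enorm_eulerSource_sub (hf : IsSource q T f) {k : Fin N} {t : ℝ}
    (ht : t ∈ θ.interval k) : ‖eulerSource m θ f k - sourceCurve T f t‖ₑ =
      eLpNorm (fun x => sourceExt m θ f x t - f x t) 2 (mu d) := by
  have htT := Ioc_subset_Icc_self (θ.interval_subset k ht)
  rw [Lp.enorm_def, eLpNorm_congr_ae (Lp.coeFn_sub _ _)]
  refine eLpNorm_congr_ae ?_
  filter_upwards [coeFn_eulerSource m θ hf k, hf.coeFn_sourceCurve htT] with x h1 h2
  rw [Pi.sub_apply, h1, h2, sourceExt_eq m θ ht, m.inj_eq]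

lemma l1LqNorm_sourceExt_sub_ne_top (hf : IsSource q T f) :
    l1LqNorm 2 T (fun x t => sourceExt m θ f x t - f x t) ≠ ⊤ := by
  have : ∀ᵐ t ∂volume.restrict (Icc 0 T), eLpNorm (fun x => sourceExt m θ f x t - f x t) 2 (mu d) ≤
      ENNReal.ofReal (2 * (bvNorm 2 T f).toReal) := by
    filter_upwards [θ.cellPartition.cover] with t ⟨k, hk⟩
    rw [← hf.enorm_eulerSource_sub m θ hk, ← ofReal_norm]
    refine ENNReal.ofReal_le_ofReal ((norm_sub_le _ _).trans ?_)
    have h1 := norm_eulerSource_le m θ hf k.2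
    have h2 := hf.norm_sourceCurve_le t
    linarith
  refine ((lintegral_mono_ae this).trans_lt ?_).ne
  rw [lintegral_const]
  exact ENNReal.mul_lt_top ENNReal.ofReal_lt_top (measure_lt_top _ _)

/-- The error estimate for a solution curve in `L²(Ω)`. -/
theorem enorm_eulerSeq_sub_le (hp : 1 < p) (hK : IsKernel K) (hT : 0 ≤ T) (hf : IsSource q T f)
    (hg : MemLp g q (mu d)) (hq2 : 2 ≤ q) (hqp : 2 * ENNReal.ofReal (p - 1) ≤ q)
    {u : ℝ → Lp ℝ 2 (mu d)} (h0 : u 0 = toL2 (mu d) g)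
    (hu : IsPrimitive u (fun t => toL2 (mu d) (nonlocal (mu d) (cutKernel K) (Psi p) (u t)) +
      sourceCurve T f t) 0 T)
    (hb : ∀ t ∈ Icc 0 T, eLpNorm (u t) q (mu d) ≤ eLpNorm g q (mu d) + l1LqNorm q T f)
    {U : Fin (N + 1) → Idx d n → ℝ} (hU : IsBackwardEuler m θ K p f g U) {ε : ℝ} (hε : 0 ≤ ε)
    (hA : ∀ t ∈ Icc 0 T, ‖toL2 (mu d) (nonlocal (mu d) (avgKernel (mu d) m.cell (cutKernel K))
      (Psi p) (u t)) - toL2 (mu d) (nonlocal (mu d) (cutKernel K) (Psi p) (u t))‖ ≤ ε)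
    (k : Fin N) {t : ℝ} (ht : t ∈ θ.interval k) :
    ‖eulerSeq m U (k + 1) - u t‖ₑ ≤
      eLpNorm (fun x => m.inj (m.proj g) x - g x) 2 (mu d) +
      l1LqNorm 2 T (fun x t => sourceExt m θ f x t - f x t) +
      ENNReal.ofReal (3 * θ.size * ((supLqNorm 2 K).toNNReal *
        (2 * (eLpNorm g q (mu d)).toReal) ^ (p - 1) + 2 * (bvNorm 2 T f).toReal) + T * ε) := by
  have hc := m.cellPartition
  have hKn := hc.symmKernel_avgKernel hK.symmKernel
  have hg2 : MemLp g 2 (mu d) := hg.mono_exponent hq2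
  set l₁ := l1LqNorm 2 T (fun x t => sourceExt m θ f x t - f x t) with hl
  have hlt : l₁ ≠ ⊤ := l1LqNorm_sourceExt_sub_ne_top m θ hf
  set η : ℝ → ℝ := fun s => (eLpNorm (fun x => sourceExt m θ f x s - f x s) 2 (mu d)).toReal with hη
  have hηm : Measurable fun s => eLpNorm (fun x => sourceExt m θ f x s - f x s) 2 (mu d) :=
    measurable_eLpNorm_section ((measurable_sourceExt m θ).sub hf.measurable) 2
  have hl' : ∫⁻ s in Ioc 0 T, eLpNorm (fun x => sourceExt m θ f x s - f x s) 2 (mu d) = l₁ := by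
    rw [hl, l1LqNorm, restrict_Ioc_eq_restrict_Icc]
  have hηi : IntervalIntegrable η volume 0 T := by
    rw [intervalIntegrable_iff_integrableOn_Ioc_of_le hT]
    exact integrable_toReal_of_lintegral_ne_top hηm.aemeasurable (by rwa [hl'])
  have hηint : ∫ s in (0 : ℝ)..T, η s = l₁.toReal := by
    rw [intervalIntegral.integral_of_le hT, integral_toReal hηm.aemeasurable, hl']
    exact ae_lt_top hηm (by rwa [hl'])
  -- Inserted into the discrete operator, the exact solution leaves a residual that splits into the
  -- kernel error, at most ε, and the approximation error η of the source.
  have key := norm_backwardEuler_sub_le (t := θ.node) (N := N) (τ := θ.size)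
    (w := eulerSeq m U) (F := eulerSource m θ f) (ψ := fun s => ε + η s) hKn (oddMono_Psi hp)
    (fun k hk => θ.node_lt (Nat.lt_succ_self k) hk)
    (fun k hk => by rw [← θ.step_eq ⟨k, hk⟩]; exact θ.step_le_size _)
    (by rw [θ.node_zero, θ.node_last]; exact hu) (fun k hk => hU.step m θ hp hK hf hk)
    (fun k _ => memLp_Psi_diff_eulerSeq m hp U k)
    (fun s hs => memLp_Psi_diff_of_curve hp hf hg hq2 hqp
      (hb s (by rwa [θ.node_zero, θ.node_last] at hs)))
    (by rw [θ.node_zero, θ.node_last]; exact intervalIntegrable_const.add hηi)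
    (fun s => add_nonneg hε ENNReal.toReal_nonneg) (fun k hk => by
      filter_upwards [ae_restrict_mem measurableSet_Ioo] with s hs
      have hs' : s ∈ θ.interval ⟨k, hk⟩ := by rw [θ.interval_eq]; exact Ioo_subset_Ioc_self hs
      have hsT := Ioc_subset_Icc_self (θ.interval_subset _ hs')
      have e1 : ∀ a b c e : Lp ℝ 2 (mu d), a + b - (c + e) = (a - c) + (b - e) :=
        fun a b c e => by abel
      rw [e1]
      refine (norm_add_le _ _).trans (add_le_add (hA s hsT) (le_of_eq ?_))
      rw [hη, ← toReal_enorm]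
      simp only
      rw [← hf.enorm_eulerSource_sub m θ hs']) k k.2 t (by
        rw [θ.interval_eq] at ht; exact Ioc_subset_Icc_self ht)
  rw [θ.node_zero, θ.node_last, h0] at key
  have e0 : ‖eulerSeq m U 0 - toL2 (mu d) g‖ₑ =
      eLpNorm (fun x => m.inj (m.proj g) x - g x) 2 (mu d) := by
    rw [hU.eulerSeq_zero m θ hg2, ← hc.toL2_stepFun_cellAvg hg2,
      toL2_sub (hc.memLp_stepFun _ 2) hg2]
    rw [enorm_toL2, m.proj_eq, m.inj_eq]
    exact (hc.memLp_stepFun _ 2).sub hg2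
  have e1 : ∫ s in (0 : ℝ)..T, (ε + η s) = T * ε + l₁.toReal := by
    rw [intervalIntegral.integral_add intervalIntegrable_const hηi, hηint]
    simp
  -- Averaging is a contraction in L^q, so the operator at the discrete initial value is controlled
  -- by ‖g‖_q, uniformly in the mesh.
  have e2 : ‖toL2 (mu d) (nonlocal (mu d) (avgKernel (mu d) m.cell (cutKernel K)) (Psi p)
      (eulerSeq m U 0))‖ ≤ (supLqNorm 2 K).toNNReal *
        (2 * (eLpNorm g q (mu d)).toReal) ^ (p - 1) := by
    refine norm_toL2_nonlocal_Psi_le hp hKn (one_le_two.trans hq2) hqp ENNReal.toReal_nonneg ?_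
    rw [ENNReal.ofReal_toReal hg.2.ne, hU.eulerSeq_zero m θ hg2, cellProj,
      eLpNorm_congr_ae (coeFn_toL2 (hc.memLp_stepFun _ 2)), hc.cellAvg_congr (coeFn_toL2 hg2)]
    exact hc.eLpNorm_stepFun_cellAvg_le (one_le_two.trans hq2) hg.1
  have hN : 0 < N := k.pos
  have e3 := norm_eulerSource_le m θ hf hN
  have e4 := sum_norm_eulerSource_sub_le m θ hf
  have e5 : (variation 2 T f).toReal ≤ (bvNorm 2 T f).toReal :=
    ENNReal.toReal_mono hf.bv.ne le_add_self
  have e6 := norm_add_le (toL2 (mu d) (nonlocal (mu d) (avgKernel (mu d) m.cell (cutKernel K))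
    (Psi p) (eulerSeq m U 0))) (eulerSource m θ f 0)
  rw [e1] at key
  have hL := mul_le_mul_of_nonneg_left (((add_le_add e6 e4).trans
    (add_le_add (add_le_add e2 e3) e5))) (mul_nonneg zero_le_three θ.size_nonneg)
  have hfin : ‖eulerSeq m U (k + 1) - u t‖ ≤ ‖eulerSeq m U 0 - toL2 (mu d) g‖ + l₁.toReal +
      (3 * θ.size * ((supLqNorm 2 K).toNNReal * (2 * (eLpNorm g q (mu d)).toReal) ^ (p - 1) +
        2 * (bvNorm 2 T f).toReal) + T * ε) := by
    refine key.trans ?_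
    linarith
  rw [← e0, ← ofReal_norm, ← ofReal_norm]
  conv_rhs => rw [← ENNReal.ofReal_toReal hlt]
  rw [← ENNReal.ofReal_add (norm_nonneg _) ENNReal.toReal_nonneg, ← ENNReal.ofReal_add
    (by positivity)]
  · exact ENNReal.ofReal_le_ofReal hfin
  · have := θ.size_nonneg
    positivity

end Error

/-! ### Exponents in the three integrability cases -/

section DataCases

variable {p : ℝ} {α : DataCase}

lemma DataCase.two_le_exponent (h : α.Admissible p) : 2 ≤ α.exponent p := by
  cases α with
  | a => exact le_rfl
  | b =>
    have h' : 2 ≤ p := h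
    rw [exponent, ← ENNReal.ofReal_ofNat]
    exact ENNReal.ofReal_le_ofReal (by linarith)
  | c => exact le_top

lemma DataCase.two_mul_le_exponent (h : α.Admissible p) :
    2 * ENNReal.ofReal (p - 1) ≤ α.exponent p := by
  cases α with
  | a =>
    have h' : p < 2 := h
    have : ENNReal.ofReal (p - 1) ≤ 1 := ENNReal.ofReal_le_one.2 (by linarith)
    calc 2 * ENNReal.ofReal (p - 1) ≤ 2 * 1 := by gcongr
      _ = 2 := mul_one _
  | b =>
    rw [exponent, ENNReal.ofReal_mul zero_le_two, ENNReal.ofReal_ofNat]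
  | c => exact le_top

lemma DataCase.rate_le_one (hp : 1 < p) (h : α.Admissible p) : α.rate p ≤ 1 := by
  cases α with
  | a =>
    have h' : p < 2 := h
    rw [rate, div_le_one (by linarith)]; linarith
  | b =>
    have h' : 2 ≤ p := h
    rw [rate, div_le_one (by linarith)]; linarith
  | c =>
    rw [rate]
    split_ifs with h'
    · rw [div_le_one (by linarith)]; linarith
    · exact le_rfl

end DataCases

/-! ### Well-posedness and the general error bound -/

section GeneralBound

variable {d n N : ℕ} {p T : ℝ} {q : ℝ≥0∞} {K : Pt d → Pt d → ℝ} {f : Pt d → ℝ → ℝ} {g : Pt d → ℝ}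
  {α : DataCase} (m : Mesh d n)

lemma Mesh.inj2_proj2_eq (K : Pt d → Pt d → ℝ) :
    m.inj2 (m.proj2 K) = avgKernel (mu d) m.cell (cutKernel K) := by
  have := m.inj2_eq (cutKernel K)
  rwa [m.proj2_eq (cutKernel K), ← m.proj2_cutKernel] at this

/-- In cases (a) and (b) the kernel error in L^{∞,2} is paired with Ψ(w(y) − w(x)) in L². In case
(c) the latter is bounded, which lets the former be measured in L²(Ω²) alone. -/
lemma kernelNorm_consistency (hp : 1 < p) (hK : IsKernel K) (hα : α.Admissible p) {w : Pt d → ℝ}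
    (hw : MemLp w (α.exponent p) (mu d)) :
    eLpNorm (fun x => nonlocal (mu d) (avgKernel (mu d) m.cell (cutKernel K)) (Psi p) w x -
      nonlocal (mu d) (cutKernel K) (Psi p) w x) 2 (mu d) ≤
      α.kernelNorm (fun x y => m.inj2 (m.proj2 K) x y - K x y) *
        (2 * eLpNorm w (α.exponent p) (mu d)) ^ (p - 1) := by
  have hKs := hK.symmKernel
  have hKn := m.cellPartition.symmKernel_avgKernel hKs
  rw [m.inj2_proj2_eq]
  have hsup : essSup (fun x => eLpNorm (fun y => avgKernel (mu d) m.cell (cutKernel K) x y -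
      cutKernel K x y) 2 (mu d)) (mu d) =
      supLqNorm 2 (fun x y => avgKernel (mu d) m.cell (cutKernel K) x y - K x y) := by
    refine essSup_congr_ae ?_
    filter_upwards [ae_mem_Om] with x hx
    refine eLpNorm_congr_ae ?_
    filter_upwards [ae_mem_Om] with y hy
    rw [cutKernel_eq hx hy]
  have hl2 : eLpNorm (fun z : Pt d × Pt d => avgKernel (mu d) m.cell (cutKernel K) z.1 z.2 -
      cutKernel K z.1 z.2) 2 ((mu d).prod (mu d)) =
      l2Norm2 (fun x y => avgKernel (mu d) m.cell (cutKernel K) x y - K x y) := by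
    refine eLpNorm_congr_ae ?_
    filter_upwards [ae_mem_Om_prod] with z hz
    rw [cutKernel_eq hz.1 hz.2]
  have hq := DataCase.two_le_exponent hα
  have hqp := DataCase.two_mul_le_exponent hα
  cases α with
  | a =>
    rw [DataCase.kernelNorm, ← hsup]
    exact eLpNorm_nonlocal_sub_le hKn hKs hp (one_le_two.trans hq) hqp hw
  | b =>
    rw [DataCase.kernelNorm, ← hsup]
    exact eLpNorm_nonlocal_sub_le hKn hKs hp (one_le_two.trans hq) hqp hw
  | c =>
    rw [DataCase.kernelNorm, ← hl2]
    exact eLpNorm_nonlocal_sub_le_of_top hKn hKs hp hw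

/-- Well-posedness of the continuous and of the discrete problem. -/
theorem wellPosed (hp : 1 < p) (hK : IsKernel K) (hα : α.Admissible p)
    (hg : MemLp g (α.exponent p) (mu d)) (hT : 0 < T) (hf : IsSource (α.exponent p) T f) :
    (∃ u, IsSolution K p T f g u ∧ ∀ v, IsSolution K p T f g v → ∀ t ∈ Icc 0 T, v t = u t) ∧
      ∃ B : ℝ, ∀ (n : ℕ) (m : Mesh d n) (N : ℕ) (θ : Partition 0 T N),
        (∃! U, IsBackwardEuler m θ K p f g U) ∧
        ∀ U, IsBackwardEuler m θ K p f g U → ∀ k,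
          eLpNorm (m.inj (U k)) 2 (mu d) ≤ ENNReal.ofReal B := by
  have hq := DataCase.two_le_exponent hα
  have hqp := DataCase.two_mul_le_exponent hα
  constructor
  · obtain ⟨u, h0, hu, hb⟩ := exists_solution_curve hp hK hT.le hf hg hq hqp
    have hs := isSolution_of_curve hp hK hT.le hf hg hq hqp h0 hu hb
    exact ⟨_, hs, fun v hv => hv.eq hp hK hT.le hs⟩
  · refine ⟨‖toL2 (mu d) g‖ + T * (bvNorm 2 T f).toReal, fun n m N θ =>
      ⟨existsUnique_isBackwardEuler m θ hp hK, fun U hU k => ?_⟩⟩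
    have h1 := hU.norm_le m θ hp hK hf (hg.mono_exponent hq) (k := k) (by omega)
    rw [eulerSeq_val] at h1
    refine (enorm_toL2 (m.cellPartition.memLp_stepFun (U k) 2)).symm.le.trans ?_
    rw [← ofReal_norm]
    refine ENNReal.ofReal_le_ofReal (h1.trans ?_)
    gcongr
    exact (θ.node_mem k).2

/-- Brings the estimate into the claimed form: the factor T in front of the kernel error becomes √T
e^(T/2), and the other terms are enlarged by e^(T/2) ≥ 1. -/
lemma le_of_generalBound {E₀ E₁ X : ℝ≥0∞} {C Tk τr : ℝ} {E : ℝ≥0∞} {B Q : ℝ} (hE : E ≠ ⊤)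
    (hT : 0 ≤ T) (hB : 0 ≤ B) (hQ : 0 ≤ Q) (hτ : 0 ≤ τr) (hC : Q + B ≤ C) (hTk : Tk ≤ Q * √T * τr)
    (h : X ≤ E₀ + E₁ + ENNReal.ofReal (Tk + T * (E.toReal * B))) :
    X ≤ ENNReal.ofReal (Real.exp (T / 2)) *
      (E₀ + E₁ + ENNReal.ofReal (C * √T) * (ENNReal.ofReal τr + E)) := by
  refine h.trans ?_
  rw [mul_add (ENNReal.ofReal (Real.exp (T / 2)))]
  have h1 : (1 : ℝ≥0∞) ≤ ENNReal.ofReal (Real.exp (T / 2)) :=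
    ENNReal.one_le_ofReal.2 (Real.one_le_exp (by positivity))
  refine add_le_add (le_mul_of_one_le_left zero_le h1) ?_
  have hC0 : 0 ≤ C := by linarith
  conv_rhs => rw [← ENNReal.ofReal_toReal hE]
  rw [← ENNReal.ofReal_add hτ ENNReal.toReal_nonneg, ← ENNReal.ofReal_mul (by positivity),
    ← ENNReal.ofReal_mul (by positivity)]
  refine ENNReal.ofReal_le_ofReal ?_
  have h2 := le_sqrt_mul_exp hT
  have h3 : T * (E.toReal * B) ≤ Real.exp (T / 2) * (C * √T * E.toReal) := by
    calc T * (E.toReal * B) ≤ (√T * Real.exp (T / 2)) * (E.toReal * C) := by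
          have : B ≤ C := by linarith
          gcongr
      _ = _ := by ring
  have h4 : Tk ≤ Real.exp (T / 2) * (C * √T * τr) := by
    have h5 : 1 ≤ Real.exp (T / 2) := Real.one_le_exp (by positivity)
    refine hTk.trans ?_
    have : Q ≤ C := by linarith
    calc Q * √T * τr ≤ C * √T * τr := by gcongr
      _ ≤ _ := le_mul_of_one_le_left (by positivity) h5
  linarith

/-- The general error bound. -/
theorem generalErrorBound (hp : 1 < p) (hK : IsKernel K) (hα : α.Admissible p)
    (hg : MemLp g (α.exponent p) (mu d)) (M : ℝ≥0) {T₀ r : ℝ} (hr : r ≤ 1)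
    (hr' : 0 < T₀ ∨ r < 1) :
    ∃ C : ℝ, 0 < C ∧ ∀ T : ℝ, 0 < T → T₀ ≤ T → ∃ τ₀ : ℝ, 0 < τ₀ ∧ τ₀ ≤ 1 ∧
      ∀ f : Pt d → ℝ → ℝ, IsSource (α.exponent p) T f → l1LqNorm (α.exponent p) T f ≤ M →
      bvNorm 2 T f ≤ M → ∀ u, IsSolution K p T f g u →
        ∀ (n : ℕ) (m : Mesh d n) (N : ℕ) (θ : Partition 0 T N), θ.size ≤ τ₀ →
        ∀ U, IsBackwardEuler m θ K p f g U →
          ErrorLE m θ U u (ENNReal.ofReal (Real.exp (T / 2)) *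
            (eLpNorm (fun x => m.inj (m.proj g) x - g x) 2 (mu d) +
              l1LqNorm 2 T (fun x t => sourceExt m θ f x t - f x t) +
              ENNReal.ofReal (C * √T) * (ENNReal.ofReal (θ.size ^ r) +
                α.kernelNorm (fun x y => m.inj2 (m.proj2 K) x y - K x y)))) := by
  have hq := DataCase.two_le_exponent hα
  have hqp := DataCase.two_mul_le_exponent hα
  obtain ⟨c, hc0, hc⟩ := exists_le_sqrt_mul_rpow hr hr'
  set G : ℝ := (eLpNorm g (α.exponent p) (mu d)).toReal with hG
  have hG0 : 0 ≤ G := ENNReal.toReal_nonneg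
  set L : ℝ := (supLqNorm 2 K).toNNReal * (2 * G) ^ (p - 1) + 2 * M with hL
  -- The solution satisfies ‖u(t)‖_q ≤ G + M, so B bounds the factor multiplying the kernel error.
  set B : ℝ := (2 * (G + M)) ^ (p - 1) with hB
  have hL0 : 0 ≤ L := by positivity
  have hB0 : 0 ≤ B := by positivity
  refine ⟨3 * L * c + B + 1, by positivity, fun T hT hTT => ?_⟩
  obtain ⟨τ₀, hτ0, hτ1, hτ⟩ := hc T hT hTT
  refine ⟨τ₀, hτ0, hτ1, fun f hf hfM hbM u hu n m N θ hθ U hU k t ht => ?_⟩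
  have htT := Ioc_subset_Icc_self (θ.interval_subset k ht)
  -- The estimate is proved for the constructed curve in L²; by uniqueness every solution coincides
  -- with it on [0,T].
  obtain ⟨v, h0, hv, hb⟩ := exists_solution_curve hp hK hT.le hf hg hq hqp
  have hs := isSolution_of_curve hp hK hT.le hf hg hq hqp h0 hv hb
  set E := α.kernelNorm (fun x y => m.inj2 (m.proj2 K) x y - K x y) with hE
  rcases eq_or_ne E ⊤ with hEt | hEt
  -- An infinite kernel error makes the bound trivial, as T > 0 excludes the product 0 · ∞.
  · rw [hEt, add_top, ENNReal.mul_top, add_top, ENNReal.mul_top]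
    · exact le_top
    · exact (ENNReal.ofReal_pos.2 (Real.exp_pos _)).ne'
    · have := Real.sqrt_pos.2 hT
      exact (ENNReal.ofReal_pos.2 (by positivity)).ne'
  have hlhs : eLpNorm (fun x => m.inj (U k.succ) x - u t x) 2 (mu d) =
      ‖eulerSeq m U (k + 1) - v t‖ₑ := by
    rw [Lp.enorm_def, eLpNorm_congr_ae (Lp.coeFn_sub _ _)]
    refine eLpNorm_congr_ae ?_
    have e1 := eulerSeq_val m U k.succ
    rw [Fin.val_succ] at e1
    have e2 : u t = toL1 (mu d) (v t) := hu.eq hp hK hT.le hs t htT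
    rw [e1, e2, coeFn_toL1]
    filter_upwards [coeFn_toL2 (m.cellPartition.memLp_stepFun (U k.succ) 2)] with x hx
    rw [Pi.sub_apply, m.inj_eq, hx]
  rw [hlhs]
  have hbound : ∀ s ∈ Icc 0 T, eLpNorm (v s) (α.exponent p) (mu d) ≤ ENNReal.ofReal (G + M) := by
    intro s hs
    refine (hb s hs).trans ?_
    rw [ENNReal.ofReal_add hG0 M.coe_nonneg, hG, ENNReal.ofReal_toReal hg.2.ne,
      ENNReal.ofReal_coe_nnreal]
    gcongr
  have hA : ∀ s ∈ Icc 0 T, ‖toL2 (mu d) (nonlocal (mu d) (avgKernel (mu d) m.cell (cutKernel K))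
      (Psi p) (v s)) - toL2 (mu d) (nonlocal (mu d) (cutKernel K) (Psi p) (v s))‖ ≤
      E.toReal * B := by
    intro s hs
    have hm : MemLp (v s) (α.exponent p) (mu d) :=
      ⟨Lp.aestronglyMeasurable _, (hbound s hs).trans_lt ENNReal.ofReal_lt_top⟩
    have hPsi := memLp_Psi_diff hp (one_le_two.trans hq) hqp hm
    have m1 := memLp_nonlocal (m.cellPartition.symmKernel_avgKernel hK.symmKernel) hPsi
    have m2 := memLp_nonlocal hK.symmKernel hPsi
    rw [toL2_sub m1 m2]
    refine (norm_toL2 (m1.sub m2)).le.trans ?_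
    refine ENNReal.toReal_le_of_le_ofReal (by positivity) ?_
    refine (kernelNorm_consistency m hp hK hα hm).trans ?_
    rw [ENNReal.ofReal_mul ENNReal.toReal_nonneg, ENNReal.ofReal_toReal hEt, hB,
      ← ENNReal.ofReal_rpow_of_nonneg (by positivity) (by linarith),
      ENNReal.ofReal_mul zero_le_two, ENNReal.ofReal_ofNat]
    gcongr
    exact hbound s hs
  have key := enorm_eulerSeq_sub_le m θ hp hK hT.le hf hg hq hqp h0 hv hb hU
    (ε := E.toReal * B) (by positivity) hA k ht
  have hsz := θ.size_nonneg
  have hbv : (bvNorm 2 T f).toReal ≤ M := by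
    have := ENNReal.toReal_mono ENNReal.coe_ne_top hbM
    simpa using this
  refine le_of_generalBound (Tk := 3 * θ.size * L) (Q := 3 * L * c) (B := B) hEt hT.le hB0
    (by positivity) (by positivity) (by linarith) ?_ (key.trans ?_)
  · have := mul_le_mul_of_nonneg_left (hτ θ.size hsz hθ) (show 0 ≤ 3 * L by positivity)
    linarith
  · gcongr
    rw [hL]
    gcongr

end GeneralBound

/-! ### Approximation by averages under `L²` regularity -/

lemma enorm_sub_sq_le (a b c : ℝ) : ‖a - b‖ₑ ^ 2 ≤ 2 * (‖c - b‖ₑ ^ 2 + ‖c - a‖ₑ ^ 2) := by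
  have e : ∀ x : ℝ, ‖x‖ₑ ^ 2 = ENNReal.ofReal (x ^ 2) := fun x => by
    rw [Real.enorm_eq_ofReal_abs, ← ENNReal.ofReal_pow (abs_nonneg _), sq_abs]
  rw [e, e, e, ← ENNReal.ofReal_add (sq_nonneg _) (sq_nonneg _), ← ENNReal.ofReal_ofNat,
    ← ENNReal.ofReal_mul (by norm_num)]
  exact ENNReal.ofReal_le_ofReal (by nlinarith [sq_nonneg ((c - b) + (c - a))])

section Windows

variable {V ι : Type*} [AddCommGroup V] [MeasureSpace V] [MeasurableAdd₂ V] [MeasurableNeg V]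
  [SFinite (volume : Measure V)] [(volume : Measure V).IsAddLeftInvariant] [Fintype ι]
  {S : Set V} {w : V → ℝ}

/-- The integral of the squared differences over a window. -/
lemma lintegral_window_le (hS : MeasurableSet S) (hw : Measurable w) {W : Set V}
    (hW : MeasurableSet W) {R : ℝ≥0∞}
    (hR : ∀ z ∈ W, eLpNorm (fun x => w (x + z) - w x) 2
      (volume.restrict {x | x ∈ S ∧ x + z ∈ S}) ≤ R) :
    ∫⁻ x in S, ∫⁻ ξ in S, W.indicator (fun _ => ‖w ξ - w x‖ₑ ^ 2) (ξ - x) ≤ volume W * R ^ 2 := by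
  set Φ : V × V → ℝ≥0∞ := fun v =>
    {v : V × V | v.1 ∈ S ∧ v.1 + v.2 ∈ S ∧ v.2 ∈ W}.indicator
      (fun v => ‖w (v.1 + v.2) - w v.1‖ₑ ^ 2) v with hΦ
  have hset : MeasurableSet {v : V × V | v.1 ∈ S ∧ v.1 + v.2 ∈ S ∧ v.2 ∈ W} :=
    (measurable_fst hS).inter (((measurable_fst.add measurable_snd) hS).inter (measurable_snd hW))
  have hΦm : Measurable Φ :=
    (((hw.comp (measurable_fst.add measurable_snd)).sub (hw.comp measurable_fst)).enorm.pow_const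
      2).indicator hset
  have h1 : ∀ x ∈ S, ∫⁻ ξ in S, W.indicator (fun _ => ‖w ξ - w x‖ₑ ^ 2) (ξ - x) =
      ∫⁻ z, Φ (x, z) := by
    intro x hx
    rw [← lintegral_indicator hS, ← lintegral_add_left_eq_self _ x]
    refine lintegral_congr fun z => ?_
    by_cases h1 : x + z ∈ S <;> by_cases h2 : z ∈ W <;> simp [hΦ, hx, h1, h2]
  rw [setLIntegral_congr_fun hS h1]
  -- After the substitution ξ = x + z and Tonelli's theorem, the inner integral at fixed z is a
  -- squared L² norm of a translation difference over the points for which x and x + z both lie in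
  -- S.
  calc ∫⁻ x in S, ∫⁻ z, Φ (x, z) ≤ ∫⁻ x, ∫⁻ z, Φ (x, z) := setLIntegral_le_lintegral _ _
    _ = ∫⁻ z, ∫⁻ x, Φ (x, z) := lintegral_lintegral_swap hΦm.aemeasurable
    _ ≤ ∫⁻ z, W.indicator (fun _ => R ^ 2) z := by
        refine lintegral_mono fun z => ?_
        by_cases hz : z ∈ W
        · have hSz : MeasurableSet {x | x ∈ S ∧ x + z ∈ S} :=
            hS.inter ((measurable_id.add_const z) hS)
          rw [indicator_of_mem hz]
          refine le_trans (le_of_eq ?_) (pow_le_pow_left' (hR z hz) 2)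
          rw [sq_eLpNorm_two, ← lintegral_indicator hSz]
          refine lintegral_congr fun x => ?_
          by_cases h1 : x ∈ S <;> by_cases h2 : x + z ∈ S <;> simp [hΦ, hz, h1, h2]
        · simp [hΦ, hz]
    _ = volume W * R ^ 2 := by rw [lintegral_indicator hW, setLIntegral_const, mul_comm]

/-- Averages over cells approximate functions with `L²` regularity. -/
theorem CellPartition.sq_eLpNorm_sub_le_of_window {c : ι → Set V}
    [IsFiniteMeasure ((volume : Measure V).restrict S)] (hc : CellPartition (volume.restrict S) c)
    (hS : MeasurableSet S) (hcS : ∀ i, c i ⊆ S) (hw : Measurable w)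
    (hw2 : MemLp w 2 (volume.restrict S)) {W₀ W : Set V} (hW₀ : MeasurableSet W₀)
    (hW : MeasurableSet W)
    (hcell : ∀ i, ∀ x ∈ c i, ∀ y ∈ c i, ∀ ξ, ξ - x ∈ W₀ → ξ - x ∈ W ∧ ξ - y ∈ W)
    {M R : ℝ≥0∞} (hM0 : M ≠ 0) (hM : M ≠ ⊤)
    (hmass : ∀ x ∈ S, M ≤ volume {ξ | ξ ∈ S ∧ ξ - x ∈ W₀})
    (hR : ∀ z ∈ W, eLpNorm (fun x => w (x + z) - w x) 2
      (volume.restrict {x | x ∈ S ∧ x + z ∈ S}) ≤ R) :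
    eLpNorm (fun x => stepFun c (cellAvg (volume.restrict S) c w) x - w x) 2 (volume.restrict S) ^ 2
      ≤ 4 * (volume W / M) * R ^ 2 := by
  set μ : Measure V := volume.restrict S with hμ
  set H : V → ℝ≥0∞ := fun x => ∫⁻ ξ in S, W.indicator (fun _ => ‖w ξ - w x‖ₑ ^ 2) (ξ - x) with hH
  have hm2 : Measurable fun v : V × V => W.indicator (fun _ => ‖w v.2 - w v.1‖ₑ ^ 2) (v.2 - v.1) := by
    have : Measurable fun v : V × V => {v : V × V | v.2 - v.1 ∈ W}.indicator
        (fun v => ‖w v.2 - w v.1‖ₑ ^ 2) v :=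
      (((hw.comp measurable_snd).sub (hw.comp measurable_fst)).enorm.pow_const 2).indicator
        ((measurable_snd.sub measurable_fst) hW)
    exact this
  have hHm : Measurable H := hm2.lintegral_prod_right'
  -- The points x and y are compared through all ξ ∈ S with ξ − x ∈ W₀, a set of measure at least M.
  -- Only translations in W occur, and W ignores the shape of the cells, so strongly graded meshes
  -- are allowed.
  have hpair : ∀ i, ∀ x ∈ c i, ∀ y ∈ c i, M * ‖w y - w x‖ₑ ^ 2 ≤ 2 * (H x + H y) := by
    intro i x hx y hy
    have hA : MeasurableSet {ξ | ξ - x ∈ W₀} := (measurable_id.sub_const x) hW₀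
    have hmx : Measurable fun ξ => W.indicator (fun _ => ‖w ξ - w x‖ₑ ^ 2) (ξ - x) :=
      hm2.comp (measurable_const.prodMk measurable_id)
    have hmy : Measurable fun ξ => W.indicator (fun _ => ‖w ξ - w y‖ₑ ^ 2) (ξ - y) :=
      hm2.comp (measurable_const.prodMk measurable_id)
    calc M * ‖w y - w x‖ₑ ^ 2 ≤ volume {ξ | ξ ∈ S ∧ ξ - x ∈ W₀} * ‖w y - w x‖ₑ ^ 2 := by
          gcongr
          exact hmass x (hcS i hx)
      _ = ∫⁻ ξ in S, {ξ | ξ - x ∈ W₀}.indicator (fun _ => ‖w y - w x‖ₑ ^ 2) ξ := by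
          rw [lintegral_indicator hA, setLIntegral_const, Measure.restrict_apply hA, mul_comm]
          congr 2
          ext ξ; exact and_comm
      _ ≤ ∫⁻ ξ in S, 2 * (W.indicator (fun _ => ‖w ξ - w x‖ₑ ^ 2) (ξ - x) +
            W.indicator (fun _ => ‖w ξ - w y‖ₑ ^ 2) (ξ - y)) := by
          refine lintegral_mono fun ξ => ?_
          by_cases hξ : ξ - x ∈ W₀
          · obtain ⟨h1, h2⟩ := hcell i x hx y hy ξ hξ
            rw [indicator_of_mem (show ξ ∈ {ξ | ξ - x ∈ W₀} from hξ), indicator_of_mem h1,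
              indicator_of_mem h2]
            exact enorm_sub_sq_le _ _ _
          · rw [indicator_of_notMem (show ξ ∉ {ξ | ξ - x ∈ W₀} from hξ)]
            exact zero_le
      _ = 2 * (H x + H y) := by
          have hmxy : Measurable fun ξ => W.indicator (fun _ => ‖w ξ - w x‖ₑ ^ 2) (ξ - x) +
            W.indicator (fun _ => ‖w ξ - w y‖ₑ ^ 2) (ξ - y) := hmx.add hmy
          rw [lintegral_const_mul _ hmxy, lintegral_add_left hmx]
  have hsum : M * eLpNorm (fun x => stepFun c (cellAvg μ c w) x - w x) 2 μ ^ 2 ≤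
      4 * ∫⁻ x, H x ∂μ := by
    calc M * eLpNorm (fun x => stepFun c (cellAvg μ c w) x - w x) 2 μ ^ 2
        ≤ M * ∑ i, μ (c i) * ∫⁻ x, ∫⁻ y, ‖w y - w x‖ₑ ^ 2 ∂ProbabilityTheory.cond μ (c i)
            ∂ProbabilityTheory.cond μ (c i) := by
          gcongr
          exact hc.sq_eLpNorm_stepFun_cellAvg_sub_le hw2
      _ ≤ ∑ i, μ (c i) * (4 * ∫⁻ x, H x ∂ProbabilityTheory.cond μ (c i)) := by
          rw [Finset.mul_sum]
          refine Finset.sum_le_sum fun i _ => ?_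
          rw [mul_left_comm]
          refine mul_le_mul_right ?_ _
          have := hc.isProbabilityMeasure i
          have hmw : Measurable fun v : V × V => ‖w v.2 - w v.1‖ₑ ^ 2 :=
            ((hw.comp measurable_snd).sub (hw.comp measurable_fst)).enorm.pow_const 2
          rw [← lintegral_const_mul _ hmw.lintegral_prod_right']
          calc ∫⁻ x, M * ∫⁻ y, ‖w y - w x‖ₑ ^ 2 ∂ProbabilityTheory.cond μ (c i)
                ∂ProbabilityTheory.cond μ (c i)
              ≤ ∫⁻ x, 2 * (H x + ∫⁻ y, H y ∂ProbabilityTheory.cond μ (c i))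
                ∂ProbabilityTheory.cond μ (c i) := by
                refine lintegral_mono_ae ?_
                filter_upwards [hc.ae_cond_mem i] with x hx
                have hmwx : Measurable fun y => ‖w y - w x‖ₑ ^ 2 :=
                  hmw.comp (measurable_const.prodMk measurable_id)
                have hHx : Measurable fun y => H x + H y := measurable_const.add hHm
                rw [← lintegral_const_mul _ hmwx]
                calc ∫⁻ y, M * ‖w y - w x‖ₑ ^ 2 ∂ProbabilityTheory.cond μ (c i)
                    ≤ ∫⁻ y, 2 * (H x + H y) ∂ProbabilityTheory.cond μ (c i) := by
                      refine lintegral_mono_ae ?_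
                      filter_upwards [hc.ae_cond_mem i] with y hy using hpair i x hx y hy
                  _ = _ := by
                      rw [lintegral_const_mul _ hHx,
                        lintegral_add_left measurable_const, lintegral_const, measure_univ, mul_one]
            _ = 4 * ∫⁻ x, H x ∂ProbabilityTheory.cond μ (c i) := by
                have hHc : Measurable fun x => H x + ∫⁻ y, H y ∂ProbabilityTheory.cond μ (c i) :=
                  hHm.add measurable_const
                rw [lintegral_const_mul _ hHc, lintegral_add_left hHm,
                  lintegral_const, measure_univ, mul_one, ← two_mul, ← mul_assoc]
                norm_num
      _ = 4 * ∫⁻ x, H x ∂μ := by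
          rw [hc.lintegral_eq_sum, Finset.mul_sum]
          exact Finset.sum_congr rfl fun i _ => by rw [mul_left_comm]
  have hfin := hsum.trans (mul_le_mul_right (lintegral_window_le hS hw hW hR) 4)
  rw [mul_comm] at hfin
  have := (ENNReal.le_div_iff_mul_le (Or.inl hM0) (Or.inl hM)).2 hfin
  refine this.trans (le_of_eq ?_)
  simp only [div_eq_mul_inv]
  ring

end Windows

/-! ### Translations and the Lipschitz seminorm -/

section Translation

variable {V : Type*} [AddCommGroup V] [MeasureSpace V] [MeasurableAdd₂ V]
  [(volume : Measure V).IsAddLeftInvariant] {S : Set V}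

/-- Translations preserve null sets, so translation differences do not depend on the representative;
this permits replacing a square integrable function by a measurable one. -/
lemma eLpNorm_translate_sub_congr {q : ℝ≥0∞} {w w' : V → ℝ} (hS : MeasurableSet S)
    (h : w =ᵐ[volume.restrict S] w') (z : V) :
    eLpNorm (fun x => w (x + z) - w x) q (volume.restrict {x | x ∈ S ∧ x + z ∈ S}) =
      eLpNorm (fun x => w' (x + z) - w' x) q (volume.restrict {x | x ∈ S ∧ x + z ∈ S}) := by
  have hSz : MeasurableSet {x | x ∈ S ∧ x + z ∈ S} := hS.inter ((measurable_id.add_const z) hS)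
  have h1 := (ae_restrict_iff' hS).1 h
  have h2 : ∀ᵐ x, x + z ∈ S → w (x + z) = w' (x + z) := by
    have := (measurePreserving_add_left (volume : Measure V) z).quasiMeasurePreserving.ae h1
    filter_upwards [this] with x hx
    rwa [add_comm z x] at hx
  refine eLpNorm_congr_ae ((ae_restrict_iff' hSz).2 ?_)
  filter_upwards [h1, h2] with x hx1 hx2 hx
  rw [hx1 hx.1, hx2 hx.2]

lemma eLpNorm_translate_sub_le {ν : V → ℝ} {s h : ℝ} {q : ℝ≥0∞} {F : V → ℝ} (hh : 0 < h) {z : V}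
    (hz : ν z < h) :
    eLpNorm (fun x => F (x + z) - F x) q (volume.restrict {x | x ∈ S ∧ x + z ∈ S}) ≤
      ENNReal.ofReal (h ^ s) * lipNorm ν s q S F := by
  set E := eLpNorm (fun x => F (x + z) - F x) q (volume.restrict {x | x ∈ S ∧ x + z ∈ S})
  have h1 : E ≤ modulus ν q S F h := le_iSup₂_of_le (f := fun z (_ : ν z < h) =>
    eLpNorm (fun x => F (x + z) - F x) q (volume.restrict {x | x ∈ S ∧ x + z ∈ S})) z hz le_rfl
  have h2 : ENNReal.ofReal (h ^ (-s)) * modulus ν q S F h ≤ lipNorm ν s q S F :=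
    le_add_left (le_iSup₂_of_le (f := fun h (_ : 0 < h) =>
      ENNReal.ofReal (h ^ (-s)) * modulus ν q S F h) h hh le_rfl)
  calc E = ENNReal.ofReal (h ^ s) * (ENNReal.ofReal (h ^ (-s)) * E) := by
        rw [← mul_assoc, ← ENNReal.ofReal_mul (by positivity), ← Real.rpow_add hh, add_neg_cancel,
          Real.rpow_zero, ENNReal.ofReal_one, one_mul]
    _ ≤ _ := by
        gcongr
        exact le_trans (by gcongr) h2

end Translation

/-! ### Cubic windows: approximation of functions and kernels -/

section Boxes

variable {V ι : Type*} [AddCommGroup V] [MeasureSpace V] [MeasurableAdd₂ V] [MeasurableNeg V]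
  [SFinite (volume : Measure V)] [(volume : Measure V).IsAddLeftInvariant] [Fintype ι]
  {S : Set V} {w : V → ℝ}

/-- Averages over cells approximate functions with `L²` regularity: version for windows of
comparable measures. -/
theorem CellPartition.eLpNorm_sub_le_of_window {c : ι → Set V}
    [IsFiniteMeasure ((volume : Measure V).restrict S)] (hc : CellPartition (volume.restrict S) c)
    (hS : MeasurableSet S) (hcS : ∀ i, c i ⊆ S) (hw : MemLp w 2 (volume.restrict S))
    {W₀ W : Set V} (hW₀ : MeasurableSet W₀) (hW : MeasurableSet W)
    (hcell : ∀ i, ∀ x ∈ c i, ∀ y ∈ c i, ∀ ξ, ξ - x ∈ W₀ → ξ - x ∈ W ∧ ξ - y ∈ W)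
    {M R : ℝ≥0∞} {D : ℕ} (hM0 : M ≠ 0) (hM : M ≠ ⊤) (hWM : volume W ≤ 4 ^ D * M)
    (hmass : ∀ x ∈ S, M ≤ volume {ξ | ξ ∈ S ∧ ξ - x ∈ W₀})
    (hR : ∀ z ∈ W, eLpNorm (fun x => w (x + z) - w x) 2
      (volume.restrict {x | x ∈ S ∧ x + z ∈ S}) ≤ R) :
    eLpNorm (fun x => stepFun c (cellAvg (volume.restrict S) c w) x - w x) 2 (volume.restrict S)
      ≤ 2 ^ (D + 1) * R := by
  obtain ⟨w', hw'm, hw'⟩ := hw.1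
  have h1 := hc.sq_eLpNorm_sub_le_of_window hS hcS hw'm.measurable
    ((memLp_congr_ae hw').1 hw) hW₀ hW hcell hM0 hM hmass (R := R) fun z hz => by
      rw [← eLpNorm_translate_sub_congr hS hw']
      exact hR z hz
  have h2 : eLpNorm (fun x => stepFun c (cellAvg (volume.restrict S) c w) x - w x) 2
      (volume.restrict S) = eLpNorm (fun x => stepFun c (cellAvg (volume.restrict S) c w') x - w' x)
      2 (volume.restrict S) := by
    rw [hc.cellAvg_congr hw']
    refine eLpNorm_congr_ae ?_
    filter_upwards [hw'] with x hx
    rw [hx]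
  rw [h2]
  refine pow_two_le_imp (h1.trans ?_)
  have h3 : volume W / M ≤ 4 ^ D := ENNReal.div_le_of_le_mul hWM
  -- The constant is exact: 4 · 4^D = (2^(D+1))².
  calc 4 * (volume W / M) * R ^ 2 ≤ 4 * 4 ^ D * R ^ 2 := by gcongr
    _ = (2 ^ (D + 1) * R) ^ 2 := by
        rw [mul_pow, ← pow_succ', ← pow_mul, mul_comm (D + 1) 2, pow_mul]
        norm_num

/-- If [x − δ, x + δ] is cut at one end only, the half of length δ on the other side of x remains;
if it is cut at both ends, all of [a,b] remains. Compared with the length 4δ of the doubled window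
this produces the ratio 4 per dimension. -/
lemma ofReal_le_volume_window {a b δ x : ℝ} (hδ : 0 ≤ δ) (hab : δ ≤ b - a) (hx : x ∈ Icc a b) :
    ENNReal.ofReal δ ≤ volume {ξ | ξ ∈ Icc a b ∧ ξ - x ∈ Icc (-δ) δ} := by
  have : Icc (max a (x - δ)) (min b (x + δ)) ⊆ {ξ | ξ ∈ Icc a b ∧ ξ - x ∈ Icc (-δ) δ} := by
    rintro ξ ⟨h1, h2⟩
    rw [max_le_iff] at h1
    rw [le_min_iff] at h2
    exact ⟨⟨h1.1, h2.1⟩, by linarith, by linarith⟩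
  refine le_trans ?_ (measure_mono this)
  rw [Real.volume_Icc]
  refine ENNReal.ofReal_le_ofReal ?_
  obtain ⟨h1, h2⟩ := hx
  rcases max_cases a (x - δ) with ⟨h, -⟩ | ⟨h, -⟩ <;>
    rcases min_cases b (x + δ) with ⟨h', -⟩ | ⟨h', -⟩ <;> rw [h, h'] <;> linarith

variable {d : ℕ}

/-- The cube of the points of maximum norm at most `δ`. -/
def box (d : ℕ) (δ : ℝ) : Set (Pt d) := univ.pi fun _ => Icc (-δ) δ

lemma mem_box {δ : ℝ} {z : Pt d} : z ∈ box d δ ↔ ∀ k, |z k| ≤ δ := by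
  simp only [box, mem_univ_pi, mem_Icc, abs_le]

lemma measurableSet_box {δ : ℝ} : MeasurableSet (box d δ) :=
  MeasurableSet.univ_pi fun _ => measurableSet_Icc

lemma volume_box (δ : ℝ) : volume (box d δ) = ENNReal.ofReal (2 * δ) ^ d := by
  rw [box, volume_pi_pi]
  simp only [Real.volume_Icc, Finset.prod_const, Finset.card_univ, Fintype.card_fin]
  congr 2; ring

lemma ofReal_pow_le_volume_window {δ : ℝ} (hδ : 0 ≤ δ) (hδ1 : δ ≤ 1) {x : Pt d} (hx : x ∈ Om d) :
    ENNReal.ofReal δ ^ d ≤ volume {ξ | ξ ∈ Om d ∧ ξ - x ∈ box d δ} := by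
  have : {ξ | ξ ∈ Om d ∧ ξ - x ∈ box d δ} =
      univ.pi fun k => {t : ℝ | t ∈ Icc (0 : ℝ) 1 ∧ t - x k ∈ Icc (-δ) δ} := by
    ext ξ
    simp only [Om, box, mem_ofPred_eq, mem_univ_pi, mem_Icc, Pi.le_def, Pi.sub_apply, Pi.zero_apply,
      Pi.one_apply]
    exact ⟨fun h k => ⟨⟨h.1.1 k, h.1.2 k⟩, h.2 k⟩,
      fun h => ⟨⟨fun k => (h k).1.1, fun k => (h k).1.2⟩, fun k => (h k).2⟩⟩
  rw [this, volume_pi_pi]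
  calc ENNReal.ofReal δ ^ d = ∏ _k : Fin d, ENNReal.ofReal δ := by simp
    _ ≤ _ := Finset.prod_le_prod' fun k _ =>
        ofReal_le_volume_window hδ (by simpa using hδ1) ⟨hx.1 k, hx.2 k⟩

lemma sum_sq_le_of_mem_box {δ : ℝ} {z : Pt d} (hz : z ∈ box d δ) : ∑ i, z i ^ 2 ≤ d * δ ^ 2 := by
  calc ∑ i, z i ^ 2 ≤ ∑ _i : Fin d, δ ^ 2 :=
        Finset.sum_le_sum fun i _ => sq_le_sq' (by linarith [abs_le.1 (mem_box.1 hz i)])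
          (abs_le.1 (mem_box.1 hz i)).2
    _ = d * δ ^ 2 := by simp

lemma box_mono {δ δ' : ℝ} (h : δ ≤ δ') : box d δ ⊆ box d δ' := fun _ hz =>
  mem_box.2 fun k => (mem_box.1 hz k).trans h

lemma add_mem_box {δ δ' : ℝ} {z z' : Pt d} (h : z ∈ box d δ) (h' : z' ∈ box d δ') :
    z + z' ∈ box d (δ + δ') := mem_box.2 fun k =>
  (abs_add_le _ _).trans (add_le_add (mem_box.1 h k) (mem_box.1 h' k))

variable {n : ℕ} (m : Mesh d n)

lemma Mesh.sub_mem_box {i : Idx d n} {x y : Pt d} (hx : x ∈ m.cell i) (hy : y ∈ m.cell i) :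
    x - y ∈ box d m.size := mem_box.2 fun k => m.abs_sub_le_of_mem_cell hx hy k

lemma Mesh.window {i : Idx d n} {x y ξ : Pt d} (hx : x ∈ m.cell i) (hy : y ∈ m.cell i)
    (hξ : ξ - x ∈ box d m.size) : ξ - x ∈ box d (2 * m.size) ∧ ξ - y ∈ box d (2 * m.size) := by
  refine ⟨box_mono (by linarith [m.size_nonneg]) hξ, ?_⟩
  have := add_mem_box hξ (m.sub_mem_box hx hy)
  rwa [sub_add_sub_cancel, ← two_mul] at this

lemma volume_box_eq {δ : ℝ} : volume (box d (2 * δ)) = 4 ^ d * ENNReal.ofReal δ ^ d := by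
  rw [volume_box, ← mul_pow, ← ENNReal.ofReal_ofNat, ← ENNReal.ofReal_mul (by norm_num)]
  congr 2; ring

/-- Approximation in space. -/
theorem Mesh.eLpNorm_inj_proj_sub_le (hd : 1 ≤ d) {w : Pt d → ℝ} (hw : MemLp w 2 (mu d)) {R : ℝ≥0∞}
    (hR : ∀ z : Pt d, √(∑ i, z i ^ 2) < 3 * (d + 1) * m.size →
      eLpNorm (fun x => w (x + z) - w x) 2 (volume.restrict {x | x ∈ Om d ∧ x + z ∈ Om d}) ≤ R) :
    eLpNorm (fun x => m.inj (m.proj w) x - w x) 2 (mu d) ≤ 2 ^ (d + 1) * R := by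
  have hδ := m.size_pos hd
  rw [m.proj_eq, m.inj_eq]
  have : IsFiniteMeasure ((volume : Measure (Pt d)).restrict (Om d)) :=
    inferInstanceAs (IsFiniteMeasure (mu d))
  refine m.cellPartition.eLpNorm_sub_le_of_window (S := Om d) measurableSet_Om m.cell_subset hw
    (measurableSet_box (δ := m.size)) (measurableSet_box (δ := 2 * m.size))
    (fun i x hx y hy ξ hξ => m.window hx hy hξ) (M := ENNReal.ofReal m.size ^ d) ?_ ?_
    volume_box_eq.le (fun x hx => ofReal_pow_le_volume_window hδ.le m.size_le_one hx)
    fun z hz => hR z ?_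
  · exact pow_ne_zero _ (ENNReal.ofReal_pos.2 hδ).ne'
  · exact ENNReal.pow_ne_top ENNReal.ofReal_ne_top
  -- A point of the doubled window has squared Euclidean length at most 4dδ². The generous radius
  -- 3(d+1)δ gives the strict inequality demanded by the modulus and is at least 1 times δ.
  · rw [Real.sqrt_lt' (by positivity)]
    have h1 := sum_sq_le_of_mem_box hz
    have : (0 : ℝ) ≤ d := Nat.cast_nonneg d
    have h2 : (0 : ℝ) < m.size ^ 2 := by positivity
    nlinarith

lemma volume_restrict_prod {V' : Type*} [MeasureSpace V'] [SFinite (volume : Measure V')]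
    (S : Set V) (S' : Set V') : ((volume : Measure V).restrict S).prod (volume.restrict S') =
      (volume : Measure (V × V')).restrict (S ×ˢ S') := Measure.prod_restrict S S'

lemma pow_mul_le_volume_prod {V' : Type*} [MeasureSpace V'] [SFinite (volume : Measure V')]
    {A B : ℝ≥0∞} {s : Set V} {s' : Set V'} (h : A ≤ volume s) (h' : B ≤ volume s') :
    A * B ≤ volume (s ×ˢ s') := by
  rw [Measure.volume_eq_prod, Measure.prod_prod]
  exact mul_le_mul' h h'

instance isAddLeftInvariant_volume_space_space :
    (volume : Measure (Pt d × Pt d)).IsAddLeftInvariant :=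
  inferInstanceAs ((volume : Measure (Pt d)).prod (volume : Measure (Pt d))).IsAddLeftInvariant

instance isAddLeftInvariant_volume_space_time :
    (volume : Measure (Pt d × ℝ)).IsAddLeftInvariant :=
  inferInstanceAs ((volume : Measure (Pt d)).prod (volume : Measure ℝ)).IsAddLeftInvariant

/-- Approximation of kernels. -/
theorem Mesh.l2Norm2_inj2_proj2_sub_le (hd : 1 ≤ d) {K : Pt d → Pt d → ℝ}
    (hK : MemLp (fun z : Pt d × Pt d => K z.1 z.2) 2 ((mu d).prod (mu d))) {R : ℝ≥0∞}
    (hR : ∀ z : Pt d × Pt d, √((∑ i, z.1 i ^ 2) + ∑ i, z.2 i ^ 2) < 3 * (d + 1) * m.size →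
      eLpNorm (fun x => (fun z : Pt d × Pt d => K z.1 z.2) (x + z) -
        (fun z : Pt d × Pt d => K z.1 z.2) x) 2
        (volume.restrict {x | x ∈ Om d ×ˢ Om d ∧ x + z ∈ Om d ×ˢ Om d}) ≤ R) :
    l2Norm2 (fun x y => m.inj2 (m.proj2 K) x y - K x y) ≤ 2 ^ (2 * d + 1) * R := by
  have hδ := m.size_pos hd
  have hprod := m.cellPartition.prod m.cellPartition
  rw [m.inj2_eq, l2Norm2]
  simp only [avgKernel]
  have hmu : (mu d).prod (mu d) = volume.restrict (Om d ×ˢ Om d) := volume_restrict_prod _ _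
  rw [hmu] at hprod hK ⊢
  have : IsFiniteMeasure ((volume : Measure (Pt d × Pt d)).restrict (Om d ×ˢ Om d)) := by
    rw [← hmu]; infer_instance
  refine hprod.eLpNorm_sub_le_of_window (measurableSet_Om.prod measurableSet_Om)
    (fun k => prod_mono (m.cell_subset _) (m.cell_subset _)) hK
    ((measurableSet_box (δ := m.size)).prod (measurableSet_box (δ := m.size)))
    ((measurableSet_box (δ := 2 * m.size)).prod (measurableSet_box (δ := 2 * m.size)))
    (fun i x hx y hy ξ hξ => ?_) (M := ENNReal.ofReal m.size ^ d * ENNReal.ofReal m.size ^ d) ?_ ?_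
    ?_ (fun x hx => ?_) fun z hz => hR z ?_
  · have h1 := m.window hx.1 hy.1 hξ.1
    have h2 := m.window hx.2 hy.2 hξ.2
    exact ⟨⟨h1.1, h2.1⟩, h1.2, h2.2⟩
  · rw [← pow_add]
    exact pow_ne_zero _ (ENNReal.ofReal_pos.2 hδ).ne'
  · rw [← pow_add]
    exact ENNReal.pow_ne_top ENNReal.ofReal_ne_top
  · rw [Measure.volume_eq_prod, Measure.prod_prod, volume_box_eq, two_mul, pow_add]
    exact le_of_eq (by ring)
  · refine (pow_mul_le_volume_prod (ofReal_pow_le_volume_window hδ.le m.size_le_one hx.1)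
      (ofReal_pow_le_volume_window hδ.le m.size_le_one hx.2)).trans (measure_mono ?_)
    rintro ξ ⟨h1, h2⟩
    exact ⟨⟨h1.1, h2.1⟩, h1.2, h2.2⟩
  · rw [Real.sqrt_lt' (by positivity)]
    have h1 := sum_sq_le_of_mem_box hz.1
    have h2 := sum_sq_le_of_mem_box hz.2
    have : (0 : ℝ) ≤ d := Nat.cast_nonneg d
    have h2 : (0 : ℝ) < m.size ^ 2 := by positivity
    nlinarith

end Boxes

/-! ### Approximation of source terms in space and time -/

section SourceApproximation

variable {d n N : ℕ} {T : ℝ} {f : Pt d → ℝ → ℝ} (m : Mesh d n) (θ : Partition 0 T N)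

/-- By Fubini's theorem the time average of the spatial averages is the average over the space-time
cell, so the discrete source is an instance of the general cell averages. -/
lemma cellAvg_prod_eq (hf : Integrable (fun z : Pt d × ℝ => f z.1 z.2)
    ((mu d).prod (volume.restrict (Icc 0 T)))) (i : Idx d n) (k : Fin N) :
    cellAvg ((mu d).prod (volume.restrict (Icc 0 T)))
      (fun j : Idx d n × Fin N => m.cell j.1 ×ˢ θ.interval j.2) (fun z => f z.1 z.2) (i, k) =
      discreteSource m θ f k i := by
  have hm := m.cellPartition
  have hθ := θ.cellPartition
  have := hm.isProbabilityMeasure i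
  have := hθ.isProbabilityMeasure k
  have hi : Integrable (fun z : Pt d × ℝ => f z.1 z.2)
      ((ProbabilityTheory.cond (mu d) (m.cell i)).prod
        (ProbabilityTheory.cond (volume.restrict (Icc 0 T)) (θ.interval k))) := by
    rw [← cond_prod_cond (hm.pos i) (hθ.pos k)]
    exact (hf.mono_measure Measure.restrict_le_self).smul_measure
      (ENNReal.inv_ne_top.2 ((hm.prod hθ).pos (i, k)))
  rw [cellAvg, cond_prod_cond (hm.pos i) (hθ.pos k), integral_prod_symm _ hi]
  have h1 := hθ.cellAvg_eq (fun t => m.proj (fun x => f x t) i) k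
  rw [measureReal_restrict_apply (θ.measurableSet_interval k), inter_eq_self_of_subset_left
    ((θ.interval_subset k).trans Ioc_subset_Icc_self), Measure.restrict_restrict
    (θ.measurableSet_interval k), inter_eq_self_of_subset_left
    ((θ.interval_subset k).trans Ioc_subset_Icc_self), measureReal_def, θ.volume_interval,
    ENNReal.toReal_ofReal (θ.step_pos k).le] at h1
  rw [discreteSource, ← h1, cellAvg]
  simp only [m.proj_eq, cellAvg]

lemma window_interval {k : Fin N} {x y ξ : ℝ} (hx : x ∈ θ.interval k) (hy : y ∈ θ.interval k)
    (hξ : ξ - x ∈ Icc (-θ.size) θ.size) : ξ - x ∈ Icc (-(2 * θ.size)) (2 * θ.size) ∧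
      ξ - y ∈ Icc (-(2 * θ.size)) (2 * θ.size) := by
  have h := abs_le.1 (θ.abs_sub_le_of_mem_interval hx hy)
  obtain ⟨h1, h2⟩ := hξ
  refine ⟨⟨?_, ?_⟩, ?_, ?_⟩ <;> linarith [h.1, h.2]

/-- Approximation of source terms. -/
theorem eLpNorm_sourceExt_sub_le (hd : 1 ≤ d) (hT : 0 ≤ T) (k₀ : Fin N)
    (hf : MemLp (fun z : Pt d × ℝ => f z.1 z.2) 2 ((mu d).prod (volume.restrict (Icc 0 T))))
    {R : ℝ≥0∞}
    (hR : ∀ z : Pt d × ℝ, √((∑ i, z.1 i ^ 2) + z.2 ^ 2) < 3 * (d + 1) * (m.size + θ.size) →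
      eLpNorm (fun x => (fun z : Pt d × ℝ => f z.1 z.2) (x + z) -
        (fun z : Pt d × ℝ => f z.1 z.2) x) 2
        (volume.restrict {x | x ∈ Om d ×ˢ Icc 0 T ∧ x + z ∈ Om d ×ˢ Icc 0 T}) ≤ R) :
    eLpNorm (fun z : Pt d × ℝ => sourceExt m θ f z.1 z.2 - f z.1 z.2) 2
      ((mu d).prod (volume.restrict (Icc 0 T))) ≤ 2 ^ (d + 1 + 1) * R := by
  have hδ := m.size_pos hd
  have hτ : 0 < θ.size := (θ.step_pos k₀).trans_le (θ.step_le_size k₀)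
  have hprod := m.cellPartition.prod θ.cellPartition
  have hae : (fun z : Pt d × ℝ => sourceExt m θ f z.1 z.2 - f z.1 z.2)
      =ᵐ[(mu d).prod (volume.restrict (Icc 0 T))] fun z =>
      stepFun (fun j : Idx d n × Fin N => m.cell j.1 ×ˢ θ.interval j.2)
        (cellAvg ((mu d).prod (volume.restrict (Icc 0 T)))
          (fun j : Idx d n × Fin N => m.cell j.1 ×ˢ θ.interval j.2) fun z => f z.1 z.2) z -
        f z.1 z.2 := by
    filter_upwards [hprod.cover] with z ⟨⟨i, k⟩, hz⟩
    rw [hprod.stepFun_eq _ hz, sourceExt_eq m θ hz.2, m.inj_eq, m.cellPartition.stepFun_eq _ hz.1,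
      cellAvg_prod_eq m θ (hf.integrable one_le_two)]
  rw [eLpNorm_congr_ae hae]
  have hmu : (mu d).prod (volume.restrict (Icc 0 T)) = volume.restrict (Om d ×ˢ Icc 0 T) :=
    volume_restrict_prod _ _
  rw [hmu] at hprod hf ⊢
  have : IsFiniteMeasure ((volume : Measure (Pt d × ℝ)).restrict (Om d ×ˢ Icc 0 T)) := by
    rw [← hmu]; infer_instance
  refine hprod.eLpNorm_sub_le_of_window (measurableSet_Om.prod measurableSet_Icc)
    (fun k => prod_mono (m.cell_subset _) ((θ.interval_subset _).trans Ioc_subset_Icc_self)) hf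
    ((measurableSet_box (δ := m.size)).prod (measurableSet_Icc (a := -θ.size) (b := θ.size)))
    ((measurableSet_box (δ := 2 * m.size)).prod
      (measurableSet_Icc (a := -(2 * θ.size)) (b := 2 * θ.size)))
    (fun i x hx y hy ξ hξ => ?_) (M := ENNReal.ofReal m.size ^ d * ENNReal.ofReal θ.size) ?_ ?_
    ?_ (fun x hx => ?_) fun z hz => hR z ?_
  · have h1 := m.window hx.1 hy.1 hξ.1
    have h2 := window_interval θ hx.2 hy.2 hξ.2
    exact ⟨⟨h1.1, h2.1⟩, h1.2, h2.2⟩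
  · exact mul_ne_zero (pow_ne_zero _ (ENNReal.ofReal_pos.2 hδ).ne') (ENNReal.ofReal_pos.2 hτ).ne'
  · exact ENNReal.mul_ne_top (ENNReal.pow_ne_top ENNReal.ofReal_ne_top) ENNReal.ofReal_ne_top
  · rw [Measure.volume_eq_prod, Measure.prod_prod, volume_box_eq, Real.volume_Icc,
      show 2 * θ.size - -(2 * θ.size) = 4 * θ.size by ring, ENNReal.ofReal_mul (by norm_num),
      ENNReal.ofReal_ofNat, pow_succ]
    exact le_of_eq (by ring)
  · refine (pow_mul_le_volume_prod (ofReal_pow_le_volume_window hδ.le m.size_le_one hx.1)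
      (ofReal_le_volume_window hτ.le (θ.size_le hT) hx.2)).trans (measure_mono ?_)
    rintro ξ ⟨h1, h2⟩
    exact ⟨⟨h1.1, h2.1⟩, h1.2, h2.2⟩
  · rw [Real.sqrt_lt' (by positivity)]
    have h1 := sum_sq_le_of_mem_box hz.1
    have h2 : z.2 ^ 2 ≤ (2 * θ.size) ^ 2 := sq_le_sq' hz.2.1 hz.2.2
    have : (0 : ℝ) ≤ d := Nat.cast_nonneg d
    have h3 : (0 : ℝ) < m.size ^ 2 := by positivity
    have h4 : (0 : ℝ) < θ.size ^ 2 := by positivity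
    have h5 : (0 : ℝ) < m.size * θ.size := by positivity
    have h6 : (m.size ^ 2 + θ.size ^ 2) * (9 * (d + 1) ^ 2) ≤
        (3 * (d + 1) * (m.size + θ.size)) ^ 2 := by nlinarith
    have h7 : 4 * d + 5 ≤ 9 * ((d : ℝ) + 1) ^ 2 := by nlinarith
    have h8 := mul_le_mul_of_nonneg_left h7 (add_pos h3 h4).le
    nlinarith [mul_nonneg this h4.le]

lemma l1LqNorm_le_sqrt_mul (hT : 0 ≤ T) (F : Pt d → ℝ → ℝ) (hF : Measurable fun z : Pt d × ℝ => F z.1 z.2) :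
    l1LqNorm 2 T F ≤ ENNReal.ofReal √T *
      eLpNorm (fun z : Pt d × ℝ => F z.1 z.2) 2 ((mu d).prod (volume.restrict (Icc 0 T))) := by
  have hm := measurable_eLpNorm_section (μ := mu d) hF 2
  have h1 := ENNReal.lintegral_mul_le_Lp_mul_Lq (volume.restrict (Icc 0 T))
    Real.HolderConjugate.two_two (aemeasurable_const (b := (1 : ℝ≥0∞))) hm.aemeasurable
  simp only [Pi.mul_apply, one_mul, ENNReal.one_rpow, lintegral_const, Measure.restrict_apply,
    MeasurableSet.univ, univ_inter, Real.volume_Icc, sub_zero] at h1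
  rw [l1LqNorm]
  refine h1.trans (le_of_eq ?_)
  congr 1
  · rw [Real.sqrt_eq_rpow, ENNReal.ofReal_rpow_of_nonneg hT (by norm_num)]
  · have : ∫⁻ t in Icc 0 T, eLpNorm (fun x => F x t) 2 (mu d) ^ (2 : ℝ) =
        eLpNorm (fun z : Pt d × ℝ => F z.1 z.2) 2 ((mu d).prod (volume.restrict (Icc 0 T))) ^ 2 := by
      rw [sq_eLpNorm_two, lintegral_prod_symm _ (hF.enorm.pow_const 2).aemeasurable]
      refine lintegral_congr fun t => ?_
      rw [ENNReal.rpow_ofNat, sq_eLpNorm_two]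
    rw [this, ← ENNReal.rpow_natCast, ← ENNReal.rpow_mul]
    norm_num

/-- The discretization error of time-independent source terms. -/
lemma l1LqNorm_sourceExt_sub_of_const (hf : ∀ t ∈ Icc 0 T, ∀ᵐ x ∂(mu d), f x t = f x 0) :
    l1LqNorm 2 T (fun x t => sourceExt m θ f x t - f x t) ≤
      ENNReal.ofReal T * eLpNorm (fun x => m.inj (m.proj fun x => f x 0) x - f x 0) 2 (mu d) := by
  have hproj : ∀ t ∈ Icc 0 T, m.proj (fun x => f x t) = m.proj fun x => f x 0 := fun t ht => by
    rw [m.proj_eq, m.proj_eq, m.cellPartition.cellAvg_congr (hf t ht)]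
  have hsrc : ∀ k, discreteSource m θ f k = m.proj fun x => f x 0 := fun k => by
    ext i
    have : ∀ t ∈ θ.interval k, m.proj (fun x => f x t) i = m.proj (fun x => f x 0) i :=
      fun t ht => by rw [hproj t (Ioc_subset_Icc_self (θ.interval_subset k ht))]
    rw [discreteSource, setIntegral_congr_fun (θ.measurableSet_interval k) this, setIntegral_const,
      measureReal_def, θ.volume_interval, ENNReal.toReal_ofReal (θ.step_pos k).le, smul_eq_mul,
      inv_mul_cancel_left₀ (θ.step_pos k).ne']
  have hle : ∀ᵐ t ∂volume.restrict (Icc 0 T),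
      eLpNorm (fun x => sourceExt m θ f x t - f x t) 2 (mu d) ≤
        eLpNorm (fun x => m.inj (m.proj fun x => f x 0) x - f x 0) 2 (mu d) := by
    filter_upwards [θ.cellPartition.cover] with t ⟨k, hk⟩
    refine (eLpNorm_congr_ae ?_).le
    filter_upwards [hf t (Ioc_subset_Icc_self (θ.interval_subset k hk))] with x hx
    rw [sourceExt_eq m θ hk, hsrc, hx]
  refine (lintegral_mono_ae hle).trans (le_of_eq ?_)
  rw [lintegral_const, Measure.restrict_apply MeasurableSet.univ, univ_inter, Real.volume_Icc,
    sub_zero, mul_comm]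

/-- The regularity in space of time-independent source terms. -/
lemma eLpNorm_translate_sub_of_const {s h : ℝ} (hh : 0 < h) (hT : 0 ≤ T)
    (hfm : Measurable fun z : Pt d × ℝ => f z.1 z.2)
    (hf : ∀ t ∈ Icc 0 T, ∀ᵐ x ∂(mu d), f x t = f x 0) {z : Pt d} (hz : √(∑ i, z i ^ 2) < h) :
    ENNReal.ofReal √T * eLpNorm (fun x => f (x + z) 0 - f x 0) 2
      (volume.restrict {x | x ∈ Om d ∧ x + z ∈ Om d}) ≤
      ENNReal.ofReal (h ^ s) * lipNormTime s T f := by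
  set A : Set (Pt d) := {x | x ∈ Om d ∧ x + z ∈ Om d} with hA
  -- Translation by (z, 0) leaves the time variable alone. For a source constant in time the squared
  -- space-time norm is T times the spatial one, whence the factor √T.
  have h1 := eLpNorm_translate_sub_le (V := Pt d × ℝ) (S := Om d ×ˢ Icc 0 T)
    (ν := fun z : Pt d × ℝ => √((∑ i, z.1 i ^ 2) + z.2 ^ 2)) (s := s) (q := 2)
    (F := fun z => f z.1 z.2) hh (z := (z, 0)) (by simpa using hz)
  refine le_trans ?_ h1
  have hset : {x : Pt d × ℝ | x ∈ Om d ×ˢ Icc 0 T ∧ x + (z, 0) ∈ Om d ×ˢ Icc 0 T} =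
      A ×ˢ Icc 0 T := by
    ext x
    simp only [hA, mem_prod, mem_ofPred_eq, Prod.fst_add, Prod.snd_add, add_zero]
    tauto
  have hG : Measurable fun x : Pt d × ℝ => f (x.1 + z) x.2 - f x.1 x.2 :=
    (hfm.comp ((measurable_fst.add_const z).prodMk measurable_snd)).sub hfm
  have hsq : ∫⁻ x in A ×ˢ Icc 0 T, ‖f (x.1 + z) x.2 - f x.1 x.2‖ₑ ^ 2 =
      ENNReal.ofReal T * eLpNorm (fun x => f (x + z) 0 - f x 0) 2 (volume.restrict A) ^ 2 := by
    rw [← volume_restrict_prod, lintegral_prod_symm _ (hG.enorm.pow_const 2).aemeasurable]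
    have : ∀ t ∈ Icc 0 T, ∫⁻ x in A, ‖f (x + z) t - f x t‖ₑ ^ 2 =
        eLpNorm (fun x => f (x + z) 0 - f x 0) 2 (volume.restrict A) ^ 2 := fun t ht => by
      rw [← sq_eLpNorm_two, eLpNorm_translate_sub_congr (w := fun x => f x t)
        (w' := fun x => f x 0) measurableSet_Om (hf t ht) z]
    rw [setLIntegral_congr_fun measurableSet_Icc this, setLIntegral_const, Real.volume_Icc, sub_zero,
      mul_comm]
  refine pow_two_le_imp (le_of_eq ?_)
  rw [sq_eLpNorm_two, hset]
  simp only [Prod.fst_add, Prod.snd_add, add_zero]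
  rw [hsq, mul_pow, ← ENNReal.ofReal_pow (Real.sqrt_nonneg _), Real.sq_sqrt hT]

end SourceApproximation

/-! ### Error bounds under Lipschitz regularity -/

section LipBound

variable {d n N : ℕ} {p s T : ℝ} {K : Pt d → Pt d → ℝ} {g : Pt d → ℝ} {f : Pt d → ℝ → ℝ}

/-- As a ≥ 1 and s ≤ 1, (a h)^s ≤ a h^s, so the geometric factor of the windows goes into a constant
independent of s. -/
lemma lipNorm_estimate {a h s : ℝ} (ha : 1 ≤ a) (hh : 0 ≤ h) (hs : s ≤ 1) (D : ℕ) {L : ℝ≥0∞}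
    (hL : L ≠ ⊤) :
    2 ^ D * (ENNReal.ofReal ((a * h) ^ s) * L) ≤ ENNReal.ofReal (2 ^ D * a * L.toReal * h ^ s) := by
  have h1 : (a * h) ^ s ≤ a * h ^ s := by
    rw [Real.mul_rpow (by linarith) hh]
    gcongr
    calc a ^ s ≤ a ^ (1 : ℝ) := Real.rpow_le_rpow_of_exponent_le ha hs
      _ = a := Real.rpow_one a
  have h2 : 0 ≤ h ^ s := Real.rpow_nonneg hh s
  calc 2 ^ D * (ENNReal.ofReal ((a * h) ^ s) * L)
      ≤ 2 ^ D * (ENNReal.ofReal (a * h ^ s) * ENNReal.ofReal L.toReal) := by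
        rw [ENNReal.ofReal_toReal hL]
        gcongr
    _ = ENNReal.ofReal (2 ^ D * a * L.toReal * h ^ s) := by
        rw [← ENNReal.ofReal_mul (by positivity), ← ENNReal.ofReal_ofNat (n := 2),
          ← ENNReal.ofReal_pow zero_le_two, ← ENNReal.ofReal_mul (by positivity)]
        congr 1; ring

lemma one_le_three_mul (d : ℕ) : (1 : ℝ) ≤ 3 * (d + 1) := by
  have : (0 : ℝ) ≤ d := Nat.cast_nonneg d
  linarith

lemma eLpNorm_inj_proj_sub_le_of_lip (m : Mesh d n) (hd : 1 ≤ d) (hs : s ≤ 1)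
    (hg : MemLp g 2 (mu d)) (hgs : lipNormSpace s g < ⊤) :
    eLpNorm (fun x => m.inj (m.proj g) x - g x) 2 (mu d) ≤
      ENNReal.ofReal (2 ^ (d + 1) * (3 * (d + 1)) * (lipNormSpace s g).toReal * m.size ^ s) := by
  have hδ := m.size_pos hd
  have ha := one_le_three_mul d
  have h1 := m.eLpNorm_inj_proj_sub_le hd hg
    (R := ENNReal.ofReal ((3 * (d + 1) * m.size) ^ s) * lipNormSpace s g) fun z hz =>
      eLpNorm_translate_sub_le (ν := fun z : Pt d => √(∑ i, z i ^ 2)) (by positivity) hz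
  exact h1.trans (lipNorm_estimate ha hδ.le hs (d + 1) hgs.ne)

lemma l2Norm2_sub_le_of_lip (m : Mesh d n) (hd : 1 ≤ d) (hs : s ≤ 1) (hK : IsKernel K)
    (hKs : lipNormKernel s K < ⊤) :
    l2Norm2 (fun x y => m.inj2 (m.proj2 K) x y - K x y) ≤
      ENNReal.ofReal (2 ^ (2 * d + 1) * (3 * (d + 1)) * (lipNormKernel s K).toReal * m.size ^ s) := by
  have hδ := m.size_pos hd
  have ha := one_le_three_mul d
  have hK2 : MemLp (fun z : Pt d × Pt d => K z.1 z.2) 2 ((mu d).prod (mu d)) := by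
    refine ⟨hK.measurable.aestronglyMeasurable, lt_of_le_of_lt ?_ hKs⟩
    have hmu : (mu d).prod (mu d) = volume.restrict (Om d ×ˢ Om d) := volume_restrict_prod _ _
    rw [hmu, lipNormKernel, lipNorm]
    exact self_le_add_right _ _
  have h1 := m.l2Norm2_inj2_proj2_sub_le hd hK2
    (R := ENNReal.ofReal ((3 * (d + 1) * m.size) ^ s) * lipNormKernel s K) fun z hz =>
      eLpNorm_translate_sub_le (V := Pt d × Pt d) (S := Om d ×ˢ Om d) (s := s) (q := 2)
        (ν := fun z : Pt d × Pt d => √((∑ i, z.1 i ^ 2) + ∑ i, z.2 i ^ 2))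
        (F := fun z => K z.1 z.2) (by positivity) hz
  exact h1.trans (lipNorm_estimate ha hδ.le hs (2 * d + 1) hKs.ne)

/-- Cauchy–Schwarz in time produces √T, and subadditivity of x ↦ x^s separates the space and time
steps. The index k witnesses that the time partition is nonempty. -/
lemma l1LqNorm_sourceExt_sub_le_of_lip (m : Mesh d n) (θ : Partition 0 T N) (hd : 1 ≤ d) (hT : 0 ≤ T)
    (hs0 : 0 < s) (hs : s ≤ 1) (k : Fin N) (hf : Measurable fun z : Pt d × ℝ => f z.1 z.2) {M : ℝ≥0}
    (hfs : lipNormTime s T f ≤ M) :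
    l1LqNorm 2 T (fun x t => sourceExt m θ f x t - f x t) ≤
      ENNReal.ofReal (√T * (2 ^ (d + 1 + 1) * (3 * (d + 1)) * M * (m.size ^ s + θ.size ^ s))) := by
  have hδ := m.size_pos hd
  have hτ := θ.size_nonneg
  have ha := one_le_three_mul d
  have hf2 : MemLp (fun z : Pt d × ℝ => f z.1 z.2) 2 ((mu d).prod (volume.restrict (Icc 0 T))) := by
    refine ⟨hf.aestronglyMeasurable, lt_of_le_of_lt ?_ (hfs.trans_lt ENNReal.coe_lt_top)⟩
    have hmu : (mu d).prod (volume.restrict (Icc 0 T)) = volume.restrict (Om d ×ˢ Icc 0 T) :=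
      volume_restrict_prod _ _
    rw [hmu, lipNormTime, lipNorm]
    exact self_le_add_right _ _
  have h1 := (eLpNorm_sourceExt_sub_le m θ hd hT k hf2 fun z hz =>
    (eLpNorm_translate_sub_le (V := Pt d × ℝ) (S := Om d ×ˢ Icc 0 T) (s := s) (q := 2)
      (ν := fun z : Pt d × ℝ => √((∑ i, z.1 i ^ 2) + z.2 ^ 2)) (F := fun z => f z.1 z.2)
      (by positivity) hz).trans
      (mul_le_mul_right hfs _)).trans
    (lipNorm_estimate ha (by positivity) hs (d + 1 + 1) ENNReal.coe_ne_top)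
  refine (l1LqNorm_le_sqrt_mul hT _ ((measurable_sourceExt m θ).sub hf)).trans ?_
  rw [ENNReal.ofReal_mul (Real.sqrt_nonneg T)]
  refine mul_le_mul_right (h1.trans (ENNReal.ofReal_le_ofReal ?_)) _
  rw [ENNReal.coe_toReal]
  gcongr
  exact Real.rpow_add_le_add_rpow hδ.le hτ hs0.le hs

/-- The spatial modulus of a source constant in time is its space-time modulus divided by √T.
Integration over [0,T] multiplies the error by T, so √T M remains and no time step appears. -/
lemma l1LqNorm_sourceExt_sub_le_of_lip_of_const (m : Mesh d n) (θ : Partition 0 T N) (hd : 1 ≤ d)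
    (hT : 0 < T) (hs : s ≤ 1) {q : ℝ≥0∞} (hf : IsSource q T f) {M : ℝ≥0}
    (hfs : lipNormTime s T f ≤ M) (hfc : ∀ t ∈ Icc 0 T, ∀ᵐ x ∂(mu d), f x t = f x 0) :
    l1LqNorm 2 T (fun x t => sourceExt m θ f x t - f x t) ≤
      ENNReal.ofReal (√T * (2 ^ (d + 1) * (3 * (d + 1)) * M * m.size ^ s)) := by
  have hδ := m.size_pos hd
  have ha := one_le_three_mul d
  have hsT : ENNReal.ofReal √T ≠ 0 := (ENNReal.ofReal_pos.2 (Real.sqrt_pos.2 hT)).ne'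
  have h1 := m.eLpNorm_inj_proj_sub_le hd (hf.memLp (left_mem_Icc.2 hT.le))
    (R := ENNReal.ofReal ((3 * (d + 1) * m.size) ^ s) * M / ENNReal.ofReal √T) fun z hz => by
      rw [ENNReal.le_div_iff_mul_le (Or.inl hsT) (Or.inl ENNReal.ofReal_ne_top), mul_comm]
      exact (eLpNorm_translate_sub_of_const (s := s) (by positivity) hT.le hf.measurable hfc hz).trans
        (mul_le_mul_right hfs _)
  refine (l1LqNorm_sourceExt_sub_of_const m θ hfc).trans ?_
  have hTT : ENNReal.ofReal T = ENNReal.ofReal √T * ENNReal.ofReal √T := by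
    rw [← ENNReal.ofReal_mul (Real.sqrt_nonneg T), Real.mul_self_sqrt hT.le]
  rw [hTT, ENNReal.ofReal_mul (Real.sqrt_nonneg T), mul_assoc]
  refine mul_le_mul_right ((mul_le_mul_right h1 _).trans ?_) _
  refine le_trans (le_of_eq ?_) (lipNorm_estimate ha hδ.le hs (d + 1) (ENNReal.coe_ne_top (r := M)))
  rw [mul_left_comm, ENNReal.mul_div_cancel hsT ENNReal.ofReal_ne_top]

/-- The error bound under Lipschitz regularity of the initial datum and of the kernel. -/
theorem lipErrorBound (hd : 1 ≤ d) (hp : 1 < p) (hK : IsKernel K) (hs : s ≤ 1)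
    (hg : MemLp g ⊤ (mu d)) (hgs : lipNormSpace s g < ⊤) (hKs : lipNormKernel s K < ⊤) (M : ℝ≥0)
    {T₀ r : ℝ} (hr : r ≤ 1) (hr' : 0 < T₀ ∨ r < 1) {Cf : ℝ} (hCf : 0 ≤ Cf) :
    ∃ C : ℝ, 0 < C ∧ ∀ T : ℝ, 0 < T → T₀ ≤ T → ∃ τ₀ : ℝ, 0 < τ₀ ∧ τ₀ ≤ 1 ∧
      ∀ f : Pt d → ℝ → ℝ, IsSource ⊤ T f → l1LqNorm ⊤ T f ≤ M → bvNorm 2 T f ≤ M →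
      ∀ u, IsSolution K p T f g u →
        ∀ (n : ℕ) (m : Mesh d n) (N : ℕ) (θ : Partition 0 T N), θ.size ≤ τ₀ →
        (Fin N → l1LqNorm 2 T (fun x t => sourceExt m θ f x t - f x t) ≤
          ENNReal.ofReal (√T * (Cf * (m.size ^ s + θ.size ^ r)))) →
        ∀ U, IsBackwardEuler m θ K p f g U → ErrorLE m θ U u (lipBound s r C m θ) := by
  obtain ⟨C, hC, hbound⟩ := generalErrorBound (α := .c) hp hK trivial hg M hr hr'
  set Cg : ℝ := 2 ^ (d + 1) * (3 * (d + 1)) * (lipNormSpace s g).toReal with hCg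
  set Ck : ℝ := 2 ^ (2 * d + 1) * (3 * (d + 1)) * (lipNormKernel s K).toReal with hCk
  have hCg0 : 0 ≤ Cg := by positivity
  have hCk0 : 0 ≤ Ck := by positivity
  refine ⟨Cg + Cf + C + C * Ck, by positivity, fun T hT hTT => ?_⟩
  obtain ⟨τ₀, hτ0, hτ1, h⟩ := hbound T hT hTT
  refine ⟨τ₀, hτ0, hτ1, fun f hf hfM hbM u hu n m N θ hθ hsrc U hU k t ht => ?_⟩
  refine (h f hf hfM hbM u hu n m N θ hθ U hU k t ht).trans ?_
  have hx : 0 ≤ m.size ^ s := Real.rpow_nonneg m.size_nonneg s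
  have hy : 0 ≤ θ.size ^ r := Real.rpow_nonneg θ.size_nonneg r
  have hsT := Real.sqrt_nonneg T
  have h1 := eLpNorm_inj_proj_sub_le_of_lip m hd hs (hg.mono_exponent le_top) hgs
  have h2 := l2Norm2_sub_le_of_lip m hd hs hK hKs
  rw [← hCg] at h1
  rw [← hCk] at h2
  clear_value Cg Ck
  rw [DataCase.kernelNorm]
  set x := m.size ^ s
  set y := θ.size ^ r
  have h3 : 0 ≤ √T * x := by positivity
  have h4 : 0 ≤ √T * y := by positivity
  calc _ ≤ ENNReal.ofReal (Real.exp (T / 2)) * (ENNReal.ofReal (Cg * x) +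
        ENNReal.ofReal (√T * (Cf * (x + y))) + ENNReal.ofReal (C * √T) *
          (ENNReal.ofReal y + ENNReal.ofReal (Ck * x))) := by
        gcongr
        exact hsrc k
    _ = ENNReal.ofReal (Real.exp (T / 2) *
          (Cg * x + √T * (Cf * (x + y)) + C * √T * (y + Ck * x))) := by
        rw [← ENNReal.ofReal_add hy (by positivity), ← ENNReal.ofReal_mul (by positivity),
          ← ENNReal.ofReal_add (by positivity) (by positivity),
          ← ENNReal.ofReal_add (by positivity) (by positivity),
          ← ENNReal.ofReal_mul (by positivity)]
    _ ≤ _ := by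
        refine ENNReal.ofReal_le_ofReal ?_
        rw [mul_comm _ (Real.exp _), mul_assoc (Real.exp _)]
        refine mul_le_mul_of_nonneg_left ?_ (Real.exp_pos _).le
        -- These three nonnegative quantities add up to the difference of the two sides.
        have e1 : 0 ≤ (Cf + C + C * Ck) * x := by positivity
        have e2 : 0 ≤ (Cg + C) * (√T * x) := by positivity
        have e3 : 0 ≤ (Cg + C * Ck) * (√T * y) := by positivity
        nlinarith

lemma lipRate_le (s p : ℝ) : lipRate s p ≤ s := by
  rw [lipRate]
  split_ifs
  · exact min_le_left _ _
  · exact le_rfl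

end LipBound

end NonlocalPLap

end

/-- With T₀ = 0, allowed when the exponent of τ is less than 1, the constant is independent of T.
When the exponent equals 1, T₀ is the positive lower bound on which C may depend. -/
theorem mainTheorem3 (d : ℕ) (hd : 1 ≤ d) (p : ℝ) (hp : 1 < p)
    (K : NonlocalPLap.Pt d → NonlocalPLap.Pt d → ℝ) (hK : NonlocalPLap.IsKernel K)
    (g : NonlocalPLap.Pt d → ℝ) :
    -- (i) well-posedness and uniform boundedness
    (∀ α : NonlocalPLap.DataCase, α.Admissible p → MemLp g (α.exponent p) (NonlocalPLap.mu d) →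
      ∀ T : ℝ, 0 < T → ∀ f : NonlocalPLap.Pt d → ℝ → ℝ,
      NonlocalPLap.IsSource (α.exponent p) T f →
        (∃ u, NonlocalPLap.IsSolution K p T f g u ∧
          ∀ v, NonlocalPLap.IsSolution K p T f g v → ∀ t ∈ Set.Icc 0 T, v t = u t) ∧
        ∃ B : ℝ, ∀ (n : ℕ) (m : NonlocalPLap.Mesh d n)
          (N : ℕ) (θ : NonlocalPLap.Partition 0 T N),
          (∃! U, NonlocalPLap.IsBackwardEuler m θ K p f g U) ∧
          ∀ U, NonlocalPLap.IsBackwardEuler m θ K p f g U → ∀ k,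
            eLpNorm (NonlocalPLap.Mesh.inj m (U k)) 2 (NonlocalPLap.mu d) ≤ ENNReal.ofReal B) ∧
    -- (ii) the general error bound
    (∀ α : NonlocalPLap.DataCase, α.Admissible p → MemLp g (α.exponent p) (NonlocalPLap.mu d) →
      ∀ (M : ℝ≥0) (T₀ : ℝ), 0 ≤ T₀ → (0 < T₀ ∨ α.rate p < 1) →
      ∃ C : ℝ, 0 < C ∧ ∀ T : ℝ, 0 < T → T₀ ≤ T → ∀ f : NonlocalPLap.Pt d → ℝ → ℝ,
      NonlocalPLap.IsSource (α.exponent p) T f →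
      NonlocalPLap.l1LqNorm (α.exponent p) T f ≤ M → NonlocalPLap.bvNorm 2 T f ≤ M →
      ∃ τ₀ : ℝ, 0 < τ₀ ∧ ∀ u, NonlocalPLap.IsSolution K p T f g u →
        ∀ (n : ℕ) (m : NonlocalPLap.Mesh d n) (N : ℕ) (θ : NonlocalPLap.Partition 0 T N),
        θ.size ≤ τ₀ → ∀ U, NonlocalPLap.IsBackwardEuler m θ K p f g U →
          NonlocalPLap.ErrorLE m θ U u (NonlocalPLap.generalBound α p C m θ K f g)) ∧
    -- (iii) the error bound under Lipschitz regularity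
    (∀ s : ℝ, 0 < s → s ≤ 1 → MemLp g ⊤ (NonlocalPLap.mu d) →
      NonlocalPLap.lipNormSpace s g < ⊤ → NonlocalPLap.lipNormKernel s K < ⊤ →
      ∀ (M : ℝ≥0) (T₀ : ℝ), 0 ≤ T₀ →
      ((0 < T₀ ∨ NonlocalPLap.lipRate s p < 1) →
        ∃ C : ℝ, 0 < C ∧ ∀ T : ℝ, 0 < T → T₀ ≤ T → ∀ f : NonlocalPLap.Pt d → ℝ → ℝ,
        NonlocalPLap.IsSource ⊤ T f → NonlocalPLap.l1LqNorm ⊤ T f ≤ M →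
        NonlocalPLap.bvNorm 2 T f ≤ M → NonlocalPLap.lipNormTime s T f ≤ M →
        ∃ τ₀ : ℝ, 0 < τ₀ ∧ ∀ u, NonlocalPLap.IsSolution K p T f g u →
          ∀ (n : ℕ) (m : NonlocalPLap.Mesh d n) (N : ℕ) (θ : NonlocalPLap.Partition 0 T N),
          θ.size ≤ τ₀ → ∀ U, NonlocalPLap.IsBackwardEuler m θ K p f g U →
            NonlocalPLap.ErrorLE m θ U u
              (NonlocalPLap.lipBound s (NonlocalPLap.lipRate s p) C m θ)) ∧
      -- time-independent source terms: no `τ ^ s`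
      ((0 < T₀ ∨ NonlocalPLap.DataCase.c.rate p < 1) →
        ∃ C : ℝ, 0 < C ∧ ∀ T : ℝ, 0 < T → T₀ ≤ T → ∀ f : NonlocalPLap.Pt d → ℝ → ℝ,
        NonlocalPLap.IsSource ⊤ T f → NonlocalPLap.l1LqNorm ⊤ T f ≤ M →
        NonlocalPLap.bvNorm 2 T f ≤ M → NonlocalPLap.lipNormTime s T f ≤ M →
        (∀ t ∈ Set.Icc 0 T, ∀ᵐ x ∂(NonlocalPLap.mu d), f x t = f x 0) →
        ∃ τ₀ : ℝ, 0 < τ₀ ∧ ∀ u, NonlocalPLap.IsSolution K p T f g u →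
          ∀ (n : ℕ) (m : NonlocalPLap.Mesh d n) (N : ℕ) (θ : NonlocalPLap.Partition 0 T N),
          θ.size ≤ τ₀ → ∀ U, NonlocalPLap.IsBackwardEuler m θ K p f g U →
            NonlocalPLap.ErrorLE m θ U u
              (NonlocalPLap.lipBound s (NonlocalPLap.DataCase.c.rate p) C m θ)))
    := by
  open NonlocalPLap in
  refine ⟨fun α hα hg T hT f hf => wellPosed hp hK hα hg hT hf, fun α hα hg M T₀ _ hr => ?_,
    fun s hs0 hs hg hgs hKs M T₀ _ => ⟨fun hr => ?_, fun hr => ?_⟩⟩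
  · obtain ⟨C, hC, h⟩ := generalErrorBound hp hK hα hg M (DataCase.rate_le_one hp hα) hr
    refine ⟨C, hC, fun T hT hTT f hf hfM hbM => ?_⟩
    obtain ⟨τ₀, hτ0, -, h⟩ := h T hT hTT
    exact ⟨τ₀, hτ0, h f hf hfM hbM⟩
  · obtain ⟨C, hC, h⟩ := lipErrorBound hd hp hK hs hg hgs hKs M
      ((lipRate_le s p).trans hs) hr (Cf := 2 ^ (d + 1 + 1) * (3 * (d + 1)) * M) (by positivity)
    refine ⟨C, hC, fun T hT hTT f hf hfM hbM hfs => ?_⟩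
    obtain ⟨τ₀, hτ0, hτ1, h⟩ := h T hT hTT
    refine ⟨τ₀, hτ0, fun u hu n m N θ hθ => h f hf hfM hbM u hu n m N θ hθ fun k => ?_⟩
    refine (l1LqNorm_sourceExt_sub_le_of_lip m θ hd hT.le hs0 hs k hf.measurable hfs).trans
      (ENNReal.ofReal_le_ofReal ?_)
    gcongr √T * (_ * (_ + ?_))
    -- The source contributes τ^s, which is at most τ to the power `lipRate s p` because τ ≤ 1; for
    -- this the threshold is kept at most 1.
    exact Real.rpow_le_rpow_of_exponent_ge ((θ.step_pos k).trans_le (θ.step_le_size k))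
      (hθ.trans hτ1) (lipRate_le s p)
  · obtain ⟨C, hC, h⟩ := lipErrorBound hd hp hK hs hg hgs hKs M
      (DataCase.rate_le_one (α := .c) hp trivial) hr
      (Cf := 2 ^ (d + 1) * (3 * (d + 1)) * M) (by positivity)
    refine ⟨C, hC, fun T hT hTT f hf hfM hbM hfs hfc => ?_⟩
    obtain ⟨τ₀, hτ0, -, h⟩ := h T hT hTT
    refine ⟨τ₀, hτ0, fun u hu n m N θ hθ => h f hf hfM hbM u hu n m N θ hθ fun k => ?_⟩
    refine (l1LqNorm_sourceExt_sub_le_of_lip_of_const m θ hd hT hs hf hfs hfc).trans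
      (ENNReal.ofReal_le_ofReal ?_)
    gcongr
    -- The source contributes no power of τ here, so the exponent of case (c) stays free of s; a
    -- nonnegative term is added merely to match the form of `lipErrorBound`.
    exact le_add_of_nonneg_right (Real.rpow_nonneg θ.size_nonneg _)
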